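/- Let $\alpha\in(\tfrac12,1)$ and $0<T<\infty$. Consider on $(0,T)\times\mathbb R^2$ the system $$u_t+u\cdot\nabla u+\Lambda^{2\alpha}u=\nabla p+\theta e_2,\qquad \nabla\cdot u=0,\qquad \theta_t+u\cdot\nabla\theta=0,\qquad u|_{t=0}=u_0,\quad \theta|_{t=0}=\theta_0,$$ where $e_2=(0,1)$, $\widehat{\Lambda^{2\alpha}f}(\xi)=|2\pi\xi|^{2\alpha}\hat f(\xi)$, and $u_0:\mathbb R^2\to\mathbb R^2$ (divergence free) and $\theta_0:\mathbb R^2\to\mathbb R$ are locally integrable. A pair $(u,\theta)\in L^2_{\rm loc}([0,T)\times\mathbb R^2;\mathbb R^2)\times L^2_{\rm loc}([0,T)\times\mathbb R^2)$ with $\nabla\cdot u=0$ in the sense of distributions is a weak solution with data $(u_0,\theta_0)$ if, for every $\phi\in C^\infty_c([0,T)\times\mathbb R^2;\mathbb R^2)$ with $\nabla\cdot\phi=0$ and every $\psi\in C_c^\infty([0,T)\times\mathbb R^2)$, the following integrals converge absolutely and $$\int_0^T\!\!\int_{\mathbb R^2}\big(u\cdot\phi_t+u\otimes u:\nabla\phi-u\cdot\Lambda^{2\alpha}\phi+\theta\,\phi\cdot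 e_2\big)\,dx\,dt+\int_{\mathbb R^2}u_0\cdot\phi(0,x)\,dx=0,$$ $$\int_0^T\!\!\int_{\mathbb R^2}\big(\theta\psi_t+\theta\,u\cdot\nabla\psi\big)\,dx\,dt+\int_{\mathbb R^2}\theta_0\,\psi(0,x)\,dx=0.$$ Fix a dyadic partition of unity, that is, smooth compactly supported radial functions $\chi,\varphi\ge 0$ on $\mathbb R^2$ with $0\notin\operatorname{supp}\varphi$, $\chi+\sum_{q\ge0}\varphi(2^{-q}\cdot)=1$, $\operatorname{supp}\chi\cap\operatorname{supp}\varphi(2^{-q}\cdot)=\emptyset$ for $q\ge1$, and $\operatorname{supp}\varphi(2^{-j}\cdot)\cap\operatorname{supp}\varphi(2^{-k}\cdot)=\emptyset$ for $|j-k|\ge2$. Put $\Delta_{-1}=\chi(D)$, $\Delta_q=\varphi(2^{-q}D)$ for $q\ge0$, $\|f\|_{B^s_{p,r}}=\big\|\,(2^{qs}\|\Delta_qf\|_{L^p})_{q\ge-1}\big\|_{\ell^r}$ for tempered distributions $f$ on $\mathbb R^2$, $H^1=B^1_{2,2}$, and $\|f\|_{L^\rho_tX}=\big\|\,\|f(t)\|_X\big\|_{L^\rho(0,T)}$.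 Then, for given data $(u_0,\theta_0)$, there is at most one weak solution $(u,\theta)$ (up to equality almost everywhere on $(0,T)\times\mathbb R^2$) in the space $$\big(L^1_tB^1_{\infty,1}\cap L^\infty_tH^1\big)\times\big(L^\infty_tB^{-1}_{2,\infty}\cap L^1_tL^\infty\big).$$ -/

import Mathlib

open MeasureTheory Set Filter Topology TemperedDistribution
open scoped ENNReal SchwartzMap FourierTransform ContDiff

noncomputable section

namespace Boussinesq

/-- The plane `ℝ²` with its Euclidean norm. -/
abbrev Plane : Type := EuclideanSpace ℝ (Fin 2)

/-! ## Littlewood-Paley decomposition and Besov norms -/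

/-- The dyadic dilation `ξ ↦ φ (2^{-q} ξ)`. -/
def dilate (φ : Plane → ℝ) (q : ℕ) : Plane → ℝ := fun ξ => φ (((2 : ℝ) ^ q)⁻¹ • ξ)

/-- The pair `(χ, φ)` is a dyadic partition of unity on the frequency space: both functions are
smooth, compactly supported, radial and non-negative, `φ` is supported away from the origin,
`χ + ∑_{q ≥ 0} φ (2^{-q} ·) = 1`, and the supports satisfy the usual separation conditions. -/
structure IsDyadicPartition (χ φ : Plane → ℝ) : Prop where
  smooth_low : ContDiff ℝ ∞ χ
  smooth_annulus : ContDiff ℝ ∞ φ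
  compact_low : HasCompactSupport χ
  compact_annulus : HasCompactSupport φ
  zero_notMem : (0 : Plane) ∉ tsupport φ
  nonneg_low : ∀ ξ, 0 ≤ χ ξ
  nonneg_annulus : ∀ ξ, 0 ≤ φ ξ
  radial_low : ∀ ξ η : Plane, ‖ξ‖ = ‖η‖ → χ ξ = χ η
  radial_annulus : ∀ ξ η : Plane, ‖ξ‖ = ‖η‖ → φ ξ = φ η
  partition : ∀ ξ, HasSum (fun q : ℕ => dilate φ q ξ) (1 - χ ξ)
  disjoint_low : ∀ q : ℕ, 1 ≤ q → Disjoint (tsupport χ) (tsupport (dilate φ q))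
  disjoint_annulus : ∀ j k : ℕ, j + 2 ≤ k →
    Disjoint (tsupport (dilate φ j)) (tsupport (dilate φ k))

/-- The locally integrable function `g` and the tempered distribution `v` are the same
distribution. -/
def Represents (g : Plane → ℂ) (v : 𝓢'(Plane, ℂ)) : Prop :=
  LocallyIntegrable g ∧
    ∀ f : 𝓢(Plane, ℂ), HasCompactSupport (f : Plane → ℂ) → v f = ∫ x, f x * g x

/-- The `L^p` norm of a tempered distribution (infinite if it is not an `L^p` function). -/
def distLpNorm (p : ℝ≥0∞) (v : 𝓢'(Plane, ℂ)) : ℝ≥0∞ :=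
  ⨅ (g : Plane → ℂ) (_ : Represents g v), eLpNorm g p volume

/-- The symbols of the dyadic blocks: `χ` for `k = 0` and `φ (2^{-q} ·)` for `k = q + 1`. -/
def blockSymbol (χ φ : Plane → ℝ) : ℕ → Plane → ℝ
  | 0 => χ
  | q + 1 => dilate φ q

/-- The dyadic block `Δ_{k-1} v`, a Fourier multiplier applied to a tempered distribution. -/
def dyadicBlock (χ φ : Plane → ℝ) (k : ℕ) (v : 𝓢'(Plane, ℂ)) : 𝓢'(Plane, ℂ) :=
  fourierMultiplierCLM ℂ (fun ξ => (blockSymbol χ φ k ξ : ℂ)) v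

/-- The Besov norm `‖ 2^{q s} ‖Δ_q v‖_{L^p} ‖_{ℓ^r (q ≥ -1)}` of a tempered distribution; the
summation index is `k = q + 1`. -/
def besovNormDist (χ φ : Plane → ℝ) (s : ℝ) (p r : ℝ≥0∞) (v : 𝓢'(Plane, ℂ)) : ℝ≥0∞ :=
  eLpNorm (fun k : ℕ => ENNReal.ofReal ((2 : ℝ) ^ (((k : ℝ) - 1) * s)) *
    distLpNorm p (dyadicBlock χ φ k v)) r Measure.count

/-- The Besov norm of a real function, through the (unique) tempered distribution that it
represents; infinite if there is none. -/
def besovNorm (χ φ : Plane → ℝ) (s : ℝ) (p r : ℝ≥0∞) (f : Plane → ℝ) : ℝ≥0∞ :=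
  ⨅ (v : 𝓢'(Plane, ℂ)) (_ : Represents (fun x => (f x : ℂ)) v), besovNormDist χ φ s p r v

/-- The norm of `L^ρ(0, T; B^s_{p,r})` of a real function on space-time. -/
def timeBesovNorm (χ φ : Plane → ℝ) (T : ℝ) (ρ : ℝ≥0∞) (s : ℝ) (p r : ℝ≥0∞)
    (f : ℝ × Plane → ℝ) : ℝ≥0∞ :=
  eLpNorm (fun t : ℝ => besovNorm χ φ s p r (fun x => f (t, x))) ρ (volume.restrict (Ioo 0 T))

/-- The uniqueness class on `(0, T)`:
`u ∈ L¹_t B¹_{∞,1} ∩ L^∞_t H¹` and `θ ∈ L^∞_t B^{-1}_{2,∞} ∩ L¹_t L^∞`, where `H¹ = B¹_{2,2}`. -/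
structure InUniquenessClass (χ φ : Plane → ℝ) (T : ℝ)
    (u : ℝ × Plane → Plane) (θ : ℝ × Plane → ℝ) : Prop where
  velocity_besov : ∀ i : Fin 2, timeBesovNorm χ φ T 1 1 ⊤ 1 (fun z => u z i) < ⊤
  velocity_sobolev : ∀ i : Fin 2, timeBesovNorm χ φ T ⊤ 1 2 2 (fun z => u z i) < ⊤
  temperature_besov : timeBesovNorm χ φ T ⊤ (-1) 2 ⊤ θ < ⊤
  temperature_bounded :
    eLpNorm (fun t : ℝ => eLpNorm (fun x => θ (t, x)) ⊤ volume) 1 (volume.restrict (Ioo 0 T)) < ⊤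

/-! ## Weak solutions -/

/-- The space-time slab `(0, T) × ℝ²`. -/
def slab (T : ℝ) : Set (ℝ × Plane) := Ioo 0 T ×ˢ univ

/-- `Λ^β f = (-Δ)^{β/2} f`, the Fourier multiplier with symbol `|2πξ|^β`, for a test function
`f`. -/
def fracLaplacian (β : ℝ) (f : Plane → ℝ) (x : Plane) : ℝ :=
  (𝓕⁻ (fun ξ : Plane => (((2 * Real.pi * ‖ξ‖) ^ β : ℝ) : ℂ) * 𝓕 (fun y => (f y : ℂ)) ξ) x).re

section derivatives

variable {F : Type*} [NormedAddCommGroup F] [NormedSpace ℝ F]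

/-- The time derivative of a function on space-time. -/
def timeDeriv (f : ℝ × Plane → F) (z : ℝ × Plane) : F := fderiv ℝ f z (1, 0)

/-- The spatial derivative `(w · ∇) f` of a function on space-time. -/
def spaceDeriv (f : ℝ × Plane → F) (z : ℝ × Plane) (w : Plane) : F := fderiv ℝ f z (0, w)

/-- `f` is a test function on `I × ℝ²`: smooth with compact support contained in `I × ℝ²`. -/
def IsTestOn (I : Set ℝ) (f : ℝ × Plane → F) : Prop :=
  ContDiff ℝ ∞ f ∧ HasCompactSupport f ∧ tsupport f ⊆ I ×ˢ univ

end derivatives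

/-- The spatial divergence vanishes at each time. -/
def IsDivFree (Φ : ℝ × Plane → Plane) : Prop :=
  ∀ z, ∑ i : Fin 2, spaceDeriv Φ z (EuclideanSpace.single i 1) i = 0

/-- Square integrability on the compact subsets of `[0, T) × ℝ²`. -/
def LocallySquareIntegrable {F : Type*} [NormedAddCommGroup F] (T : ℝ)
    (f : ℝ × Plane → F) : Prop :=
  ∀ K : Set (ℝ × Plane), IsCompact K → K ⊆ Ico 0 T ×ˢ univ → MemLp f 2 (volume.restrict K)

/-- The integrand `u · Φ_t + u ⊗ u : ∇Φ - u · Λ^{2α} Φ + θ Φ · e₂` of the momentum equation. -/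
def momentumIntegrand (α : ℝ) (u : ℝ × Plane → Plane) (θ : ℝ × Plane → ℝ)
    (Φ : ℝ × Plane → Plane) (z : ℝ × Plane) : ℝ :=
  inner ℝ (u z) (timeDeriv Φ z) + inner ℝ (u z) (spaceDeriv Φ z (u z))
    - ∑ i : Fin 2, u z i * fracLaplacian (2 * α) (fun y => Φ (z.1, y) i) z.2
    + θ z * Φ z 1

/-- The integrand `θ ψ_t + θ u · ∇ψ` of the temperature equation. -/
def temperatureIntegrand (u : ℝ × Plane → Plane) (θ : ℝ × Plane → ℝ)
    (ψ : ℝ × Plane → ℝ) (z : ℝ × Plane) : ℝ :=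
  θ z * timeDeriv ψ z + θ z * spaceDeriv ψ z (u z)

/-- `(u, θ)` is a weak solution on `(0, T)` of
`u_t + u · ∇u + Λ^{2α} u = ∇p + θ e₂`, `∇ · u = 0`, `θ_t + u · ∇θ = 0`
with initial data `(u₀, θ₀)`. The test functions are supported in `[0, T) × ℝ²` and may be
non-zero at `t = 0`, which is how the initial data enter. -/
structure IsWeakSolution (α T : ℝ) (u₀ : Plane → Plane) (θ₀ : Plane → ℝ)
    (u : ℝ × Plane → Plane) (θ : ℝ × Plane → ℝ) : Prop where
  velocity_data : LocallyIntegrable u₀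
  velocity_data_divFree : ∀ ψ : Plane → ℝ, ContDiff ℝ ∞ ψ → HasCompactSupport ψ →
    ∫ x, fderiv ℝ ψ x (u₀ x) = 0
  temperature_data : LocallyIntegrable θ₀
  velocity_sq : LocallySquareIntegrable T u
  temperature_sq : LocallySquareIntegrable T θ
  divFree : ∀ ψ : ℝ × Plane → ℝ, IsTestOn (Ioo 0 T) ψ →
    ∫ z in slab T, spaceDeriv ψ z (u z) = 0
  momentum : ∀ Φ : ℝ × Plane → Plane, IsTestOn (Iio T) Φ → IsDivFree Φ →
    IntegrableOn (momentumIntegrand α u θ Φ) (slab T) ∧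
    (∫ z in slab T, momentumIntegrand α u θ Φ z) + ∫ x, inner ℝ (u₀ x) (Φ (0, x)) = 0
  temperature : ∀ ψ : ℝ × Plane → ℝ, IsTestOn (Iio T) ψ →
    IntegrableOn (temperatureIntegrand u θ ψ) (slab T) ∧
    (∫ z in slab T, temperatureIntegrand u θ ψ z) + ∫ x, θ₀ x * ψ (0, x) = 0

/-! ## Existence of a dyadic partition of unity -/

/-- A smooth radial cutoff, equal to `1` for `‖ξ‖² ≤ 1` and to `0` for `‖ξ‖² ≥ 2`. -/
def cutoff (ξ : Plane) : ℝ := Real.smoothTransition (2 - ‖ξ‖ ^ 2)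

lemma cutoff_eq_one {ξ : Plane} (h : ‖ξ‖ ^ 2 ≤ 1) : cutoff ξ = 1 :=
  Real.smoothTransition.one_of_one_le (by linarith)

lemma cutoff_eq_zero {ξ : Plane} (h : 2 ≤ ‖ξ‖ ^ 2) : cutoff ξ = 0 :=
  Real.smoothTransition.zero_of_nonpos (by linarith)

lemma cutoff_contDiff : ContDiff ℝ ∞ cutoff :=
  Real.smoothTransition.contDiff.comp (contDiff_const.sub (contDiff_norm_sq ℝ))

lemma tsupport_cutoff : tsupport cutoff ⊆ {ξ | ‖ξ‖ ^ 2 ≤ 2} := by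
  refine closure_minimal (fun ξ hξ => ?_) (isClosed_le (by fun_prop) (by fun_prop))
  by_contra h
  exact hξ (cutoff_eq_zero (not_le.1 h).le)

/-- The annular function `ξ ↦ cutoff (ξ / 2) - cutoff ξ`. -/
def annulus (ξ : Plane) : ℝ := cutoff ((2 : ℝ)⁻¹ • ξ) - cutoff ξ

lemma norm_sq_smul (c : ℝ) (ξ : Plane) : ‖c • ξ‖ ^ 2 = c ^ 2 * ‖ξ‖ ^ 2 := by
  rw [norm_smul, mul_pow, Real.norm_eq_abs, sq_abs]

lemma tsupport_dilate_annulus (q : ℕ) :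
    tsupport (dilate annulus q) ⊆ {ξ | 4 ^ q ≤ ‖ξ‖ ^ 2 ∧ ‖ξ‖ ^ 2 ≤ 8 * 4 ^ q} := by
  have hc : (((2 : ℝ) ^ q)⁻¹) ^ 2 = ((4 : ℝ) ^ q)⁻¹ := by
    rw [inv_pow, ← pow_mul, mul_comm, pow_mul]; norm_num
  have hpos : (0 : ℝ) < 4 ^ q := by positivity
  have hcl : IsClosed {ξ : Plane | (4 : ℝ) ^ q ≤ ‖ξ‖ ^ 2 ∧ ‖ξ‖ ^ 2 ≤ 8 * 4 ^ q} :=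
    (isClosed_le (f := fun _ : Plane => (4 : ℝ) ^ q) (by fun_prop) (by fun_prop)).and
      (isClosed_le (g := fun _ : Plane => 8 * (4 : ℝ) ^ q) (by fun_prop) (by fun_prop))
  refine closure_minimal (fun ξ hξ => ?_) hcl
  by_contra h
  apply hξ
  simp only [mem_ofPred_eq, not_and_or, not_le] at h
  have key : ‖((2 : ℝ) ^ q)⁻¹ • ξ‖ ^ 2 = ‖ξ‖ ^ 2 / 4 ^ q := by
    rw [norm_sq_smul, hc]; ring
  unfold dilate annulus
  rcases h with h | h
  · have h1 : ‖ξ‖ ^ 2 / 4 ^ q ≤ 1 := by rw [div_le_one hpos]; exact h.le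
    rw [cutoff_eq_one (by rw [norm_sq_smul, key]; linarith), cutoff_eq_one (by rw [key]; exact h1),
      sub_self]
  · have h1 : 8 ≤ ‖ξ‖ ^ 2 / 4 ^ q := by rw [le_div_iff₀ hpos]; exact h.le
    rw [cutoff_eq_zero (by rw [norm_sq_smul, key]; linarith), cutoff_eq_zero (by rw [key]; linarith),
      sub_self]

lemma isCompact_norm_sq_le (c : ℝ) : IsCompact {ξ : Plane | ‖ξ‖ ^ 2 ≤ c} := by
  refine Metric.isCompact_of_isClosed_isBounded (isClosed_le (by fun_prop) (by fun_prop)) ?_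
  refine (Metric.isBounded_closedBall (x := (0 : Plane)) (r := |c| + 1)).subset fun ξ hξ => ?_
  rw [mem_closedBall_zero_iff]
  have h1 : ‖ξ‖ ^ 2 ≤ c := hξ
  nlinarith [le_abs_self c, abs_nonneg c, norm_nonneg ξ]

lemma dilate_zero (φ : Plane → ℝ) : dilate φ 0 = φ := by
  funext ξ; simp [dilate]

lemma annulus_nonneg (ξ : Plane) : 0 ≤ annulus ξ := by
  refine sub_nonneg.2 (Real.smoothTransition.monotone ?_)
  rw [norm_sq_smul]
  nlinarith [sq_nonneg ‖ξ‖]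

lemma sum_annulus (ξ : Plane) (n : ℕ) :
    ∑ q ∈ Finset.range n, dilate annulus q ξ = cutoff (((2 : ℝ) ^ n)⁻¹ • ξ) - cutoff ξ := by
  induction n with
  | zero => simp
  | succ n ih =>
    rw [Finset.sum_range_succ, ih, dilate, annulus, smul_smul, pow_succ, mul_inv_rev]
    ring

/-- Dyadic partitions of unity exist. -/
theorem exists_isDyadicPartition : ∃ χ φ : Plane → ℝ, IsDyadicPartition χ φ := by
  have hsupp : tsupport annulus ⊆ {ξ | 1 ≤ ‖ξ‖ ^ 2 ∧ ‖ξ‖ ^ 2 ≤ 8} := by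
    have h := tsupport_dilate_annulus 0
    rw [dilate_zero] at h
    simpa using h
  refine ⟨cutoff, annulus, cutoff_contDiff, ?_, ?_, ?_, ?_, ?_, annulus_nonneg, ?_, ?_, ?_, ?_, ?_⟩
  · exact (cutoff_contDiff.comp (contDiff_const_smul _)).sub cutoff_contDiff
  · exact (isCompact_norm_sq_le 2).of_isClosed_subset (isClosed_tsupport _) tsupport_cutoff
  · exact (isCompact_norm_sq_le 8).of_isClosed_subset (isClosed_tsupport _)
      (hsupp.trans fun ξ h => h.2)
  · intro h
    have h1 := (hsupp h).1
    norm_num at h1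
  · exact fun ξ => Real.smoothTransition.nonneg _
  · intro ξ η h
    simp only [cutoff, h]
  · intro ξ η h
    simp only [annulus, cutoff, norm_smul, h]
  · intro ξ
    rw [hasSum_iff_tendsto_nat_of_nonneg (f := fun q : ℕ => dilate annulus q ξ)
      (fun q => annulus_nonneg _)]
    simp_rw [sum_annulus]
    refine Tendsto.sub_const ?_ _
    have h0 : Tendsto (fun n : ℕ => ((2 : ℝ) ^ n)⁻¹ • ξ) atTop (𝓝 ((0 : ℝ) • ξ)) :=
      (tendsto_inv_atTop_zero.comp
        (tendsto_pow_atTop_atTop_of_one_lt (by norm_num : (1 : ℝ) < 2))).smul_const ξ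
    have h1 := (cutoff_contDiff.continuous.tendsto _).comp h0
    rwa [zero_smul, cutoff_eq_one (by simp)] at h1
  · intro q hq
    rw [Set.disjoint_left]
    intro ξ h1 h2
    have h3 : ‖ξ‖ ^ 2 ≤ 2 := tsupport_cutoff h1
    have h4 := (tsupport_dilate_annulus q h2).1
    have h5 : (4 : ℝ) ^ 1 ≤ 4 ^ q := pow_le_pow_right₀ (by norm_num) hq
    linarith
  · intro j k hjk
    rw [Set.disjoint_left]
    intro ξ h1 h2
    have h3 := (tsupport_dilate_annulus j h1).2
    have h4 := (tsupport_dilate_annulus k h2).1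
    have h5 : (4 : ℝ) ^ (j + 2) ≤ 4 ^ k := pow_le_pow_right₀ (by norm_num) hjk
    have h6 : (0 : ℝ) < 4 ^ j := by positivity
    rw [pow_add] at h5
    linarith

end Boussinesq

end

open MeasureTheory Set Filter Topology TemperedDistribution
open scoped ENNReal SchwartzMap FourierTransform ContDiff

noncomputable section

namespace Boussinesq

/-! ## Density of compactly supported functions in the Schwartz space -/

section SchwartzDensity

variable {E F : Type*} [NormedAddCommGroup E] [NormedSpace ℝ E] [FiniteDimensional ℝ E]
  [NormedAddCommGroup F] [NormedSpace ℝ F]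

/-! Put w = u₁ - u₂ and η = θ₁ - θ₂. Because the data coincide, η_t + u₁·∇η + ∇·(θ₂ w) = 0 and w_t +
Λ^{2α} w + ∇·(w ⊗ u₁ + u₂ ⊗ w) = ∇p + η e₂, both from zero. The temperature difference is measured
one derivative below the velocity difference: w in L² and η in the dual of V ↦ ‖∇V‖_{L²}. In the
momentum equation every source then loses one derivative, and the dissipation gives one derivative
back at the price (t - s)^{-1/(2α)}, which is integrable since 2α > 1.

Regularity of u. Bernstein's inequality and the H¹ bound make the sup norms of the dyadic blocks
uniformly bounded, while the B¹_{∞,1} bound makes the sum of 2^k times these norms integrable in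
time. Hence u has a representative with a spatial Lipschitz constant L in L¹(0, T), and
interpolation puts its sup norm A in every L^p(0, T) with p finite
(`exists_lipschitz_representative`).

Temperature. If V is carried backward along u₁, the L² norm of its gradient grows at most by exp(3 ∫
L). Pairing the transported function with η leaves only the source, so η(t) is bounded in the dual
norm by exp(3 ∫ L) ∫₀ᵗ ‖θ₂‖_∞ ‖w‖₂ ds (`transport_estimate`). The backward transport is only
approximate: the velocity is truncated in time, and an Euler scheme with a vanishing step produces
Lipschitz test functions (`exists_approx_transport`). They are admissible because a weak
conservation law extends from smooth to Lipschitz test functions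
(`integral_fderiv_lipschitz_eq_zero`).

Velocity. Test functions ∇^⊥ρ remove the pressure, and Duhamel's formula asks for e^{-(t-s)Λ^{2α}}
∇^⊥ρ. With the frequencies of ρ in a compact set away from the origin, the exponential can be
replaced by its Taylor polynomial in s - t: a finite sum of products of functions of s and Schwartz
functions of x, whose remainder tends to zero with the degree. Since η is only locally integrable in
space, the balance passes from compactly supported to Schwartz ρ as an inequality whose right-hand
side involves ρ only through the L² norms of its second derivatives. The inequality |ξ|
e^{-τ|ξ|^{2α}} ≤ τ^{-1/(2α)} yields the smoothing estimate for pairings of w with ∇^⊥ρ. Pairings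
with ∇ρ vanish, so both components of w are controlled, and duality gives ‖w(t)‖₂ ≤ 8 ∫₀ᵗ (t -
s)^{-1/(2α)} (2 A ‖w‖₂ + 2 E) ds, where E bounds η (`IsPerturbation.ae_eLpNorm_le`).

Conclusion. E is itself an integral of ‖θ₂‖_∞ ‖w‖₂ over the past, the kernel lies in L^q(0, T) for
some q > 1, and A lies in the dual L^p. A Gronwall argument with an exponential weight forces w = 0
(`ae_eq_zero_of_singular_gronwall`); the temperature estimate then has no source, and η = 0. -/

lemma exists_bound_iteratedFDeriv_one_sub_bump (b : ContDiffBump (0 : E)) (i : ℕ) :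
    ∃ B, 0 ≤ B ∧ ∀ x, ‖iteratedFDeriv ℝ i (fun x => 1 - b x) x‖ ≤ B := by
  have hb : ContDiff ℝ ∞ (b : E → ℝ) := b.contDiff
  obtain ⟨B, hB⟩ := (hb.continuous_iteratedFDeriv (m := i)
    (mod_cast le_top)).bounded_above_of_compact_support (b.hasCompactSupport.iteratedFDeriv i)
  refine ⟨1 + B, by linarith [norm_nonneg (iteratedFDeriv ℝ i (b : E → ℝ) 0), hB 0], fun x => ?_⟩
  rw [fun_iteratedFDeriv_sub_apply contDiffAt_const (hb.contDiffAt.of_le (mod_cast le_top))]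
  refine (norm_sub_le _ _).trans (add_le_add ?_ (hB x))
  rcases Nat.eq_zero_or_pos i with rfl | hi
  · simp
  · rw [iteratedFDeriv_const_of_ne hi.ne']
    simp

/-- Compactly supported functions are sequentially dense in the Schwartz space. -/
theorem exists_seq_hasCompactSupport_tendsto (f : 𝓢(E, F)) :
    ∃ g : ℕ → 𝓢(E, F), (∀ n, HasCompactSupport (g n : E → F)) ∧ Tendsto g atTop (𝓝 f) := by
  let b : ContDiffBump (0 : E) := ⟨1, 2, one_pos, one_lt_two⟩
  let c : ℕ → ℝ := fun n => ((n : ℝ) + 1)⁻¹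
  have hc0 : ∀ n, 0 < c n := fun n => by positivity
  have hc1 : ∀ n, c n ≤ 1 := fun n => inv_le_one_of_one_le₀ (by linarith [n.cast_nonneg (α := ℝ)])
  have hcl : Tendsto c atTop (𝓝 0) := tendsto_inv_atTop_zero.comp
    (tendsto_atTop_add_const_right _ _ tendsto_natCast_atTop_atTop)
  have hbs : ContDiff ℝ ∞ (b : E → ℝ) := b.contDiff
  have hbc : ∀ n, HasCompactSupport fun x : E => b (c n • x) := fun n =>
    b.hasCompactSupport.comp_homeomorph (Homeomorph.smulOfNeZero (c n) (hc0 n).ne')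
  have hs : ∀ n, ContDiff ℝ ∞ fun x : E => b (c n • x) := fun n =>
    hbs.comp (contDiff_const_smul (c n))
  have hgc : ∀ n, HasCompactSupport fun x : E => b (c n • x) • f x := fun n => (hbc n).smul_right
  have hgs : ∀ n, ContDiff ℝ ∞ fun x : E => b (c n • x) • f x := fun n => (hs n).smul (f.smooth ⊤)
  refine ⟨fun n => (hgc n).toSchwartzMap (hgs n), hgc, ?_⟩
  rw [(schwartz_withSeminorms ℝ E F).tendsto_nhds]
  rintro ⟨k, m⟩ ε hε
  choose B hB0 hB using exists_bound_iteratedFDeriv_one_sub_bump b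
  set C : ℝ := ∑ i ∈ Finset.range (m + 1),
    (m.choose i : ℝ) * B i * SchwartzMap.seminorm ℝ (k + 1) (m - i) f with hC
  have hCn : 0 ≤ C := Finset.sum_nonneg fun i _ => by have := hB0 i; positivity
  have key : ∀ n, SchwartzMap.seminorm ℝ k m ((hgc n).toSchwartzMap (hgs n) - f) ≤ c n * C := by
    intro n
    refine SchwartzMap.seminorm_le_bound ℝ k m _ (mul_nonneg (hc0 n).le hCn) fun x => ?_
    have hfun : (((hgc n).toSchwartzMap (hgs n) - f : 𝓢(E, F)) : E → F)
        = fun x => -((1 - b (c n • x)) • f x) := by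
      funext y
      simp [sub_smul]
    rw [hfun]
    have hneg : iteratedFDeriv ℝ m (fun x => -((1 - b (c n • x)) • f x)) x
        = - iteratedFDeriv ℝ m (fun x => (1 - b (c n • x)) • f x) x := by
      rw [← iteratedFDeriv_neg_apply]; rfl
    rw [hneg, norm_neg]
    by_cases hx : c n * ‖x‖ < 1
    · have h0 : (fun x => (1 - b (c n • x)) • f x) =ᶠ[𝓝 x] fun _ => 0 := by
        have ho : IsOpen {y : E | c n * ‖y‖ < 1} := isOpen_lt (by fun_prop) (by fun_prop)
        filter_upwards [ho.mem_nhds hx] with y hy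
        have : b (c n • y) = 1 := b.one_of_mem_closedBall (by
          rw [mem_closedBall_zero_iff, norm_smul, Real.norm_of_nonneg (hc0 n).le]
          exact (le_of_lt hy))
        simp [this]
      rw [(h0.iteratedFDeriv ℝ m).eq_of_nhds]
      simp only [iteratedFDeriv_fun_zero, Pi.zero_apply, norm_zero, mul_zero]
      exact mul_nonneg (hc0 n).le hCn
    -- Where the difference does not vanish locally, 1 ≤ `c n * ‖x‖`. Inserting this factor trades
    -- one more power of the weight for the small factor `c n`.
    · push Not at hx
      have hd : ∀ i, ‖iteratedFDeriv ℝ i (fun x => 1 - b (c n • x)) x‖ ≤ B i := by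
        intro i
        have h1 := congrFun (iteratedFDeriv_comp_const_smul (i := i) (c n)
          ((contDiff_const (c := (1:ℝ))).sub (hbs.of_le (mod_cast le_top) : ContDiff ℝ i (b : E → ℝ)))) x
        rw [h1, norm_smul, norm_pow, Real.norm_of_nonneg (hc0 n).le]
        calc c n ^ i * _ ≤ 1 * B i :=
              mul_le_mul (pow_le_one₀ (hc0 n).le (hc1 n)) (hB i _) (norm_nonneg _) zero_le_one
          _ = B i := one_mul _
      have hle := norm_iteratedFDeriv_smul_le (𝕜 := ℝ) (N := ∞) (n := m) (contDiff_const.sub (hs n))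
        (f.smooth ⊤) x (mod_cast le_top) (f := fun x => 1 - b (c n • x))
      calc ‖x‖ ^ k * ‖iteratedFDeriv ℝ m (fun x => (1 - b (c n • x)) • f x) x‖
          ≤ ‖x‖ ^ k * ∑ i ∈ Finset.range (m + 1), (m.choose i : ℝ) *
            ‖iteratedFDeriv ℝ i (fun x => 1 - b (c n • x)) x‖ *
              ‖iteratedFDeriv ℝ (m - i) f x‖ := by gcongr
        _ ≤ (c n * ‖x‖) * (‖x‖ ^ k * ∑ i ∈ Finset.range (m + 1), (m.choose i : ℝ) * B i *
              ‖iteratedFDeriv ℝ (m - i) f x‖) := by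
            refine le_trans ?_ (le_mul_of_one_le_left (mul_nonneg (by positivity)
              (Finset.sum_nonneg fun i _ => by have := hB0 i; positivity)) hx)
            gcongr with i hi
            exact hd i
        _ = c n * ∑ i ∈ Finset.range (m + 1), (m.choose i : ℝ) * B i *
              (‖x‖ ^ (k + 1) * ‖iteratedFDeriv ℝ (m - i) f x‖) := by
            rw [Finset.mul_sum, Finset.mul_sum, Finset.mul_sum]
            exact Finset.sum_congr rfl fun i _ => by ring
        _ ≤ c n * C := by
            refine mul_le_mul_of_nonneg_left (Finset.sum_le_sum fun i _ => ?_) (hc0 n).le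
            exact mul_le_mul_of_nonneg_left (SchwartzMap.le_seminorm ℝ _ _ f x)
              (mul_nonneg (by positivity) (hB0 i))
  have hlim : Tendsto (fun n => c n * C) atTop (𝓝 0) := by simpa using hcl.mul_const C
  filter_upwards [hlim.eventually_lt_const hε] with n hn
  exact (key n).trans_lt hn

end SchwartzDensity

/-- Tempered distributions that agree on compactly supported functions are equal. -/
theorem distribution_ext {v w : 𝓢'(Plane, ℂ)}
    (h : ∀ f : 𝓢(Plane, ℂ), HasCompactSupport (f : Plane → ℂ) → v f = w f) : v = w := by
  ext f
  obtain ⟨g, hg, hlim⟩ := exists_seq_hasCompactSupport_tendsto f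
  refine tendsto_nhds_unique (((map_continuous v).tendsto f).comp hlim) ?_
  refine (((map_continuous w).tendsto f).comp hlim).congr fun n => ?_
  exact (h _ (hg n)).symm

/-- Tempered distributions that agree on the Fourier transforms of compactly supported functions
are equal. -/
theorem distribution_ext_fourier {v w : 𝓢'(Plane, ℂ)}
    (h : ∀ f : 𝓢(Plane, ℂ), HasCompactSupport (f : Plane → ℂ) → v (𝓕 f) = w (𝓕 f)) : v = w := by
  have h1 : 𝓕 v = 𝓕 w := distribution_ext fun f hf => by
    rw [TemperedDistribution.fourier_apply, TemperedDistribution.fourier_apply, h f hf]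
  ext f
  have h2 := congrArg (fun z : 𝓢'(Plane, ℂ) => z (𝓕⁻ f)) h1
  simpa [TemperedDistribution.fourier_apply] using h2

/-! ## Convolution of a square integrable function with a Schwartz kernel -/

/-- The convolution of a function with a Schwartz kernel. -/
def kernelConv (h : 𝓢(Plane, ℂ)) (F : Plane → ℂ) (x : Plane) : ℂ := ∫ y, h (x - y) * F y

/-- This is the transpose of the multiplier, the form in which it acts on test functions of a
distribution. The transform of a product is a convolution, and 𝓕 and 𝓕⁻ differ by a reflection;
hence the kernel is evaluated at `z - x`, not at `x - z`. -/
lemma fourier_mul_fourierInv_apply (m f : 𝓢(Plane, ℂ)) (x : Plane) :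
    (𝓕 (SchwartzMap.smulLeftCLM ℂ (m : Plane → ℂ) (𝓕⁻ f))) x = ∫ z, (𝓕⁻ m) (z - x) * f z := by
  have hneg : ∀ (g : 𝓢(Plane, ℂ)) (y : Plane), (𝓕⁻ g) y = (𝓕 g) (-y) := fun g y => by
    rw [SchwartzMap.fourierInv_coe, SchwartzMap.fourier_coe, Real.fourierInv_eq_fourier_neg]
  have hp : SchwartzMap.smulLeftCLM ℂ (m : Plane → ℂ) (𝓕⁻ f)
      = SchwartzMap.pairing (ContinuousLinearMap.mul ℂ ℂ) (𝓕 (𝓕⁻ m)) (𝓕 (𝓕⁻ (𝓕⁻ f))) := by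
    ext y
    rw [SchwartzMap.smulLeftCLM_apply_apply m.hasTemperateGrowth, SchwartzMap.pairing_apply_apply]
    simp
  have h1 : (𝓕 (SchwartzMap.smulLeftCLM ℂ (m : Plane → ℂ) (𝓕⁻ f))) x
      = SchwartzMap.convolution (ContinuousLinearMap.mul ℂ ℂ) (𝓕⁻ m) (𝓕⁻ (𝓕⁻ f)) (-x) := by
    rw [hp, ← SchwartzMap.fourier_convolution, ← neg_neg x, ← hneg]
    simp
  rw [h1, SchwartzMap.convolution_apply, MeasureTheory.convolution]
  rw [← integral_sub_right_eq_self _ x]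
  refine integral_congr_ae (Eventually.of_forall fun z => ?_)
  simp only [ContinuousLinearMap.mul_apply']
  rw [hneg (𝓕⁻ f)]
  congr 1
  simp

lemma eLpNorm_comp_sub_left (h : Plane → ℂ) (hh : AEStronglyMeasurable h volume) (x : Plane)
    (p : ℝ≥0∞) :
    eLpNorm (fun y => h (x - y)) p volume = eLpNorm h p volume :=
  eLpNorm_comp_measurePreserving hh (Measure.measurePreserving_sub_left volume x)

lemma memLp_comp_sub_left (h : 𝓢(Plane, ℂ)) (x : Plane) (p : ℝ≥0∞) :
    MemLp (fun y => h (x - y)) p volume :=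
  (h.memLp p volume).comp_measurePreserving (Measure.measurePreserving_sub_left volume x)

lemma lintegral_mul_le_eLpNorm_two {X : Type*} [MeasurableSpace X] {μ : Measure X}
    {f g : X → ℝ≥0∞} (hf : AEMeasurable f μ)
    (hg : AEMeasurable g μ) :
    ∫⁻ x, f x * g x ∂μ ≤ eLpNorm f 2 μ * eLpNorm g 2 μ := by
  have := ENNReal.lintegral_mul_le_Lp_mul_Lq μ Real.HolderConjugate.two_two hf hg
  simpa [eLpNorm_eq_lintegral_rpow_enorm_toReal] using this

lemma eLpNorm_enorm' {X E : Type*} [MeasurableSpace X] {μ : Measure X} [NormedAddCommGroup E]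
    (f : X → E) (p : ℝ≥0∞) : eLpNorm (fun x => ‖f x‖ₑ) p μ = eLpNorm f p μ :=
  eLpNorm_congr_enorm_ae (by simp)

lemma enorm_integral_mul_le {X : Type*} [MeasurableSpace X] {μ : Measure X} {f g : X → ℂ}
    (hf : AEStronglyMeasurable f μ) (hg : AEStronglyMeasurable g μ) :
    ‖∫ x, f x * g x ∂μ‖ₑ ≤ eLpNorm f 2 μ * eLpNorm g 2 μ := by
  refine (enorm_integral_le_lintegral_enorm _).trans ?_
  simp only [enorm_mul]
  refine (lintegral_mul_le_eLpNorm_two hf.enorm hg.enorm).trans ?_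
  rw [eLpNorm_enorm', eLpNorm_enorm']

lemma enorm_kernelConv_le (h : 𝓢(Plane, ℂ)) {F : Plane → ℂ} (hF : AEStronglyMeasurable F volume)
    (x : Plane) : ‖kernelConv h F x‖ₑ ≤ eLpNorm h 2 volume * eLpNorm F 2 volume := by
  refine (enorm_integral_mul_le (memLp_comp_sub_left h x 2).1 hF).trans ?_
  rw [eLpNorm_comp_sub_left _ h.continuous.aestronglyMeasurable]

lemma integrable_kernelConv (h : 𝓢(Plane, ℂ)) {F : Plane → ℂ} (hF : MemLp F 2 volume)
    (x : Plane) : Integrable (fun y => h (x - y) * F y) := by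
  simpa [Pi.mul_def] using (memLp_comp_sub_left h x 2).integrable_mul hF

lemma kernelConv_sub (h : 𝓢(Plane, ℂ)) {F G : Plane → ℂ} (hF : MemLp F 2 volume)
    (hG : MemLp G 2 volume) (x : Plane) :
    kernelConv h (F - G) x = kernelConv h F x - kernelConv h G x := by
  rw [kernelConv, kernelConv, kernelConv, ← integral_sub (integrable_kernelConv h hF x)
    (integrable_kernelConv h hG x)]
  simp only [Pi.sub_apply, mul_sub]

/-- The convolution of a square integrable function with a Schwartz kernel is continuous. -/
theorem continuous_kernelConv (h : 𝓢(Plane, ℂ)) {F : Plane → ℂ} (hF : MemLp F 2 volume) :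
    Continuous (kernelConv h F) := by
  have hd := SchwartzMap.denseRange_toLpCLM (E := Plane) (F := ℂ) (p := 2)
    (μ := volume) ENNReal.ofNat_ne_top
  obtain ⟨s, hs, hlim⟩ := mem_closure_iff_seq_limit.1 (hd (hF.toLp F))
  choose f hf using hs
  have hlim' : Tendsto (fun n => eLpNorm (fun x => f n x - F x) 2 volume) atTop (𝓝 0) := by
    have h1 := tendsto_iff_edist_tendsto_0.1 hlim
    refine h1.congr fun n => ?_
    rw [← hf n, Lp.edist_def]
    refine eLpNorm_congr_ae ?_
    filter_upwards [hF.coeFn_toLp, (f n).coeFn_toLp 2 volume] with x hx hx'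
    simp [hx, hx']
  have hcont : ∀ n, Continuous (kernelConv h (f n)) := by
    intro n
    have : kernelConv h (f n) = SchwartzMap.convolution (ContinuousLinearMap.mul ℂ ℂ) (f n) h := by
      funext x
      rw [SchwartzMap.convolution_apply, MeasureTheory.convolution, kernelConv]
      simp [mul_comm]
    rw [this]
    exact SchwartzMap.continuous _
  -- The Cauchy-Schwarz bound does not depend on x, so L² approximation of F by Schwartz functions
  -- gives uniform convergence of the convolutions.
  have hunif : TendstoUniformly (fun n => kernelConv h (f n)) (kernelConv h F) atTop := by
    rw [EMetric.tendstoUniformly_iff]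
    intro ε hε
    have h2 : Tendsto (fun n => eLpNorm h 2 volume * eLpNorm (fun x => f n x - F x) 2 volume)
        atTop (𝓝 0) := by
      simpa using ENNReal.Tendsto.const_mul hlim' (Or.inr (h.memLp 2 volume).2.ne)
    filter_upwards [h2.eventually_lt_const hε] with n hn x
    refine lt_of_le_of_lt ?_ hn
    rw [edist_comm, edist_eq_enorm_sub, ← kernelConv_sub h ((f n).memLp 2 volume) hF]
    exact enorm_kernelConv_le h (((f n).memLp 2 volume).sub hF).1 x
  exact hunif.continuous (Frequently.of_forall hcont)

/-- A Fourier multiplier with Schwartz symbol acts on a square integrable function by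
convolution. -/
theorem integral_multiplier_eq (m f : 𝓢(Plane, ℂ)) {F : Plane → ℂ} (hF : MemLp F 2 volume) :
    ∫ x, (𝓕 (SchwartzMap.smulLeftCLM ℂ (m : Plane → ℂ) (𝓕⁻ f))) x * F x
      = ∫ x, f x * kernelConv (𝓕⁻ m) F x := by
  set h : 𝓢(Plane, ℂ) := 𝓕⁻ m
  simp only [fourier_mul_fourierInv_apply, kernelConv, ← integral_mul_const,
    ← integral_const_mul]
  rw [integral_integral_swap]
  · refine integral_congr_ae (Eventually.of_forall fun z => ?_)
    refine integral_congr_ae (Eventually.of_forall fun x => ?_)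
    ring
  · have hm : AEStronglyMeasurable (Function.uncurry fun x y => h (y - x) * f y * F x)
        (volume.prod volume) := by
      refine (AEStronglyMeasurable.mul ?_ ?_).mul ?_
      · exact (h.continuous.comp (continuous_snd.sub continuous_fst)).aestronglyMeasurable
      · exact (f.continuous.comp continuous_snd).aestronglyMeasurable
      · exact hF.1.comp_fst
    refine (integrable_prod_iff' hm).2 ⟨Eventually.of_forall fun y => ?_, ?_⟩
    · refine ((integrable_kernelConv h hF y).mul_const (f y)).congr
        (Eventually.of_forall fun x => ?_)
      simp only [Function.uncurry]
      ring
    · set C : ℝ := (eLpNorm h 2 volume * eLpNorm F 2 volume).toReal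
      refine (f.integrable.norm.mul_const C).mono' ?_ (Eventually.of_forall fun y => ?_)
      · exact hm.norm.prod_swap.integral_prod_right'
      · rw [Real.norm_of_nonneg (integral_nonneg fun _ => norm_nonneg _)]
        have h1 : ∀ x, ‖Function.uncurry (fun x y => h (y - x) * f y * F x) (x, y)‖
            = ‖f y‖ * (‖h (y - x)‖ * ‖F x‖) := fun x => by
          simp only [Function.uncurry, norm_mul]
          ring
        simp only [h1, integral_const_mul]
        refine mul_le_mul_of_nonneg_left ?_ (norm_nonneg _)
        rw [← ENNReal.ofReal_le_iff_le_toReal (ENNReal.mul_ne_top (h.memLp 2 volume).2.ne hF.2.ne),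
          ofReal_integral_eq_lintegral_ofReal]
        · simp only [ENNReal.ofReal_mul (norm_nonneg _), ofReal_norm]
          refine (lintegral_mul_le_eLpNorm_two (memLp_comp_sub_left h y 2).1.enorm
            hF.1.enorm).trans ?_
          rw [eLpNorm_enorm', eLpNorm_enorm',
            eLpNorm_comp_sub_left _ h.continuous.aestronglyMeasurable]
        · simpa only [norm_mul] using (integrable_kernelConv h hF y).norm
        · exact Eventually.of_forall fun _ => by positivity

/-- A square integrable function as a tempered distribution. -/
def ofMemLp {F : Plane → ℂ} (hF : MemLp F 2 volume) : 𝓢'(Plane, ℂ) :=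
  Lp.toTemperedDistributionCLM ℂ volume 2 (hF.toLp F)

lemma ofMemLp_apply {F : Plane → ℂ} (hF : MemLp F 2 volume) (f : 𝓢(Plane, ℂ)) :
    ofMemLp hF f = ∫ x, f x * F x := by
  rw [ofMemLp, Lp.toTemperedDistributionCLM_apply, Lp.toTemperedDistribution_apply]
  refine integral_congr_ae ?_
  filter_upwards [hF.coeFn_toLp] with x hx
  rw [hx, smul_eq_mul]

lemma locallyIntegrable_of_memLp_two {F : Plane → ℂ} (hF : MemLp F 2 volume) :
    LocallyIntegrable F :=
  hF.locallyIntegrable one_le_two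

lemma represents_ofMemLp {F : Plane → ℂ} (hF : MemLp F 2 volume) : Represents F (ofMemLp hF) :=
  ⟨locallyIntegrable_of_memLp_two hF, fun f _ => ofMemLp_apply hF f⟩

lemma Represents.ae_eq {g₁ g₂ : Plane → ℂ} {v : 𝓢'(Plane, ℂ)} (h₁ : Represents g₁ v)
    (h₂ : Represents g₂ v) : g₁ =ᵐ[volume] g₂ := by
  refine ae_eq_of_integral_contDiff_smul_eq h₁.1 h₂.1 fun g hg hgc => ?_
  have hc : HasCompactSupport (fun x => (g x : ℂ)) := hgc.comp_left Complex.ofReal_zero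
  have hs : ContDiff ℝ ∞ (fun x => (g x : ℂ)) := Complex.ofRealCLM.contDiff.comp hg
  have h := (h₁.2 (hc.toSchwartzMap hs) hc).symm.trans (h₂.2 (hc.toSchwartzMap hs) hc)
  simpa only [HasCompactSupport.toSchwartzMap_toFun, Complex.real_smul] using! h

lemma Represents.eq_ofMemLp {g : Plane → ℂ} {v : 𝓢'(Plane, ℂ)} (h : Represents g v)
    (hg : MemLp g 2 volume) : v = ofMemLp hg :=
  distribution_ext fun f hf => by rw [h.2 f hf, ofMemLp_apply]

lemma Represents.congr {g g' : Plane → ℂ} {v : 𝓢'(Plane, ℂ)} (h : Represents g v)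
    (hg : g =ᵐ[volume] g') : Represents g' v :=
  ⟨h.1.congr hg, fun f hf => by
    rw [h.2 f hf]
    refine integral_congr_ae ?_
    filter_upwards [hg] with x hx
    rw [hx]⟩

/-! ## Littlewood-Paley decomposition of a Sobolev function -/

lemma schwartzMap_sum_apply {ι : Type*} (s : Finset ι) (f : ι → 𝓢(Plane, ℂ)) (x : Plane) :
    (∑ i ∈ s, f i) x = ∑ i ∈ s, f i x :=
  map_sum (AddMonoidHom.mk' (fun g : 𝓢(Plane, ℂ) => g x) fun _ _ => rfl) f s

section LittlewoodPaley

variable {χ φ : Plane → ℝ}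

lemma IsDyadicPartition.contDiff_blockSymbol (h : IsDyadicPartition χ φ) (k : ℕ) :
    ContDiff ℝ ∞ (fun ξ => (blockSymbol χ φ k ξ : ℂ)) := by
  refine Complex.ofRealCLM.contDiff.comp ?_
  cases k with
  | zero => exact h.smooth_low
  | succ q => exact h.smooth_annulus.comp (contDiff_const_smul _)

lemma IsDyadicPartition.hasCompactSupport_blockSymbol (h : IsDyadicPartition χ φ) (k : ℕ) :
    HasCompactSupport (fun ξ => (blockSymbol χ φ k ξ : ℂ)) := by
  refine HasCompactSupport.comp_left (g := fun r : ℝ => (r : ℂ)) ?_ Complex.ofReal_zero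
  cases k with
  | zero => exact h.compact_low
  | succ q =>
    have hq : ((2 : ℝ) ^ q)⁻¹ ≠ 0 := by positivity
    exact h.compact_annulus.comp_homeomorph (Homeomorph.smulOfNeZero (((2 : ℝ) ^ q)⁻¹) hq)

/-- The symbol of a dyadic block as a Schwartz function. -/
def schwartzSymbol (h : IsDyadicPartition χ φ) (k : ℕ) : 𝓢(Plane, ℂ) :=
  (h.hasCompactSupport_blockSymbol k).toSchwartzMap (h.contDiff_blockSymbol k)

/-- The convolution kernel of a dyadic block. -/
def blockKernel (h : IsDyadicPartition χ φ) (k : ℕ) : 𝓢(Plane, ℂ) := 𝓕⁻ (schwartzSymbol h k)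

lemma dyadicBlock_apply (h : IsDyadicPartition χ φ) (k : ℕ) (v : 𝓢'(Plane, ℂ))
    (f : 𝓢(Plane, ℂ)) : dyadicBlock χ φ k v f
      = v (𝓕 (SchwartzMap.smulLeftCLM ℂ (schwartzSymbol h k : Plane → ℂ) (𝓕⁻ f))) := rfl

lemma represents_dyadicBlock (h : IsDyadicPartition χ φ) (k : ℕ) {F : Plane → ℂ}
    (hF : MemLp F 2 volume) :
    Represents (kernelConv (blockKernel h k) F) (dyadicBlock χ φ k (ofMemLp hF)) := by
  refine ⟨(continuous_kernelConv _ hF).locallyIntegrable, fun f _ => ?_⟩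
  rw [dyadicBlock_apply h, ofMemLp_apply, integral_multiplier_eq _ _ hF]
  rfl

/-- On a ball only finitely many symbols do not vanish, and they add up to `1`. -/
lemma IsDyadicPartition.exists_sum_eq_one (h : IsDyadicPartition χ φ) (r : ℝ) :
    ∃ n₀ : ℕ, ∀ n ≥ n₀, ∀ ξ : Plane, ‖ξ‖ ≤ r →
      ∑ k ∈ Finset.range n, blockSymbol χ φ k ξ = 1 := by
  have h0 : ∀ᶠ ξ : Plane in 𝓝 0, φ ξ = 0 := by
    filter_upwards [(isClosed_tsupport φ).isOpen_compl.mem_nhds h.zero_notMem] with ξ hξ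
    exact image_eq_zero_of_notMem_tsupport hξ
  obtain ⟨δ, hδ, hb⟩ := Metric.eventually_nhds_iff.1 h0
  obtain ⟨N, hN⟩ := pow_unbounded_of_one_lt (r / δ) (one_lt_two (α := ℝ))
  have hz : ∀ q ≥ N, ∀ ξ : Plane, ‖ξ‖ ≤ r → dilate φ q ξ = 0 := by
    intro q hq ξ hξ
    refine hb ?_
    rw [dist_zero_right, norm_smul, norm_inv, norm_pow, Real.norm_ofNat, inv_mul_lt_iff₀ (by positivity)]
    rw [div_lt_iff₀ hδ] at hN
    calc ‖ξ‖ ≤ r := hξ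
      _ < 2 ^ N * δ := hN
      _ ≤ 2 ^ q * δ := by gcongr; norm_num
  refine ⟨N + 1, fun n hn ξ hξ => ?_⟩
  obtain ⟨m, rfl⟩ : ∃ m, n = m + 1 := ⟨n - 1, by omega⟩
  rw [Finset.sum_range_succ']
  have h1 : HasSum (fun q => dilate φ q ξ) (∑ q ∈ Finset.range m, dilate φ q ξ) :=
    hasSum_sum_of_ne_finset_zero fun q hq => hz q (by simp at hq; omega) ξ hξ
  have h2 := h1.unique (h.partition ξ)
  simp only [blockSymbol]
  rw [h2]
  ring

/-- A tempered distribution whose dyadic blocks are absolutely summable in `L²` is their sum. -/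
theorem eq_tsum_of_dyadicBlock (h : IsDyadicPartition χ φ) {v : 𝓢'(Plane, ℂ)}
    {G : ℕ → Lp ℂ 2 (volume : Measure Plane)}
    (hv : ∀ k, dyadicBlock χ φ k v = Lp.toTemperedDistributionCLM ℂ volume 2 (G k))
    (hs : Summable G) :
    v = Lp.toTemperedDistributionCLM ℂ volume 2 (∑' k, G k) := by
  refine distribution_ext_fourier fun f hf => ?_
  obtain ⟨r, hr⟩ := hf.isBounded.subset_closedBall 0
  obtain ⟨n₀, hn₀⟩ := h.exists_sum_eq_one r
  -- On the compact support of f the partial sums of the symbols are eventually 1, so finitely many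
  -- blocks already reproduce the value of v on 𝓕 f; no convergence for v itself is needed.
  have hsum : ∀ n ≥ n₀, ∑ k ∈ Finset.range n,
      SchwartzMap.smulLeftCLM ℂ (schwartzSymbol h k : Plane → ℂ) f = f := by
    intro n hn
    ext ξ
    rw [schwartzMap_sum_apply]
    simp_rw [SchwartzMap.smulLeftCLM_apply_apply (schwartzSymbol h _).hasTemperateGrowth,
      ← Finset.sum_smul]
    by_cases hξ : ξ ∈ tsupport f
    · have h1 := hn₀ n hn ξ (by simpa using hr hξ)
      have h2 : ∑ k ∈ Finset.range n, (schwartzSymbol h k) ξ = 1 := by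
        rw [← Complex.ofReal_one, ← h1, Complex.ofReal_sum]
        rfl
      rw [h2, one_smul]
    · rw [image_eq_zero_of_notMem_tsupport hξ, smul_zero]
  have hL : Tendsto (fun n => (Lp.toTemperedDistributionCLM ℂ volume 2
      (∑ k ∈ Finset.range n, G k)) (𝓕 f)) atTop
      (𝓝 ((Lp.toTemperedDistributionCLM ℂ volume 2 (∑' k, G k)) (𝓕 f))) := by
    have h1 := ((Lp.toTemperedDistributionCLM ℂ (volume : Measure Plane) 2).continuous.tendsto
      (∑' k, G k)).comp hs.hasSum.tendsto_sum_nat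
    exact PointwiseConvergenceCLM.tendsto_iff_forall_tendsto.1 h1 (𝓕 f)
  refine tendsto_nhds_unique (tendsto_const_nhds.congr' ?_) hL
  filter_upwards [eventually_ge_atTop n₀] with n hn
  rw [map_sum]
  simp_rw [← hv]
  have h3 : (∑ k ∈ Finset.range n, dyadicBlock χ φ k v) (𝓕 f)
      = ∑ k ∈ Finset.range n, dyadicBlock χ φ k v (𝓕 f) := by
    simp
  rw [h3]
  simp_rw [dyadicBlock_apply h, FourierTransform.fourierInv_fourier_eq]
  rw [← map_sum, ← FourierTransform.fourier_sum, hsum n hn]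

end LittlewoodPaley

/-! ## Bernstein inequalities for the dyadic blocks -/

section Bernstein

variable {χ φ : Plane → ℝ}

lemma enorm_ofReal_of_nonneg {r : ℝ} (hr : 0 ≤ r) : ‖(r : ℂ)‖ₑ = ENNReal.ofReal r := by
  rw [← ofReal_norm, Complex.norm_real, Real.norm_of_nonneg hr]

lemma fourierInv_comp_inv_smul (m m' : 𝓢(Plane, ℂ)) {c : ℝ} (hc : 0 < c)
    (hm : ∀ ξ, m' ξ = m (c⁻¹ • ξ)) (x : Plane) :
    (𝓕⁻ m') x = (c : ℂ) ^ 2 * (𝓕⁻ m) (c • x) := by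
  rw [SchwartzMap.fourierInv_coe, SchwartzMap.fourierInv_coe, Real.fourierInv_eq,
    Real.fourierInv_eq]
  have h := Measure.integral_comp_inv_smul_of_nonneg (volume : Measure Plane)
    (fun v => Real.fourierChar (inner ℝ v (c • x)) • m v) (R := c) hc.le
  simp only [finrank_euclideanSpace, Fintype.card_fin] at h
  have h2 : ((c : ℂ) ^ 2) * ∫ v, Real.fourierChar (inner ℝ v (c • x)) • m v
      = (c ^ 2 : ℝ) • ∫ v, Real.fourierChar (inner ℝ v (c • x)) • m v := by
    rw [Complex.real_smul]
    push_cast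
    rfl
  rw [h2, ← h]
  refine integral_congr_ae (Eventually.of_forall fun v => ?_)
  simp only [hm]
  congr 2
  rw [inner_smul_left, inner_smul_right]
  simp [hc.ne']

/-- The `L¹` modulus of continuity of a Schwartz function. -/
lemma lintegral_sub_translate_le (h : 𝓢(Plane, ℂ)) :
    ∃ C : ℝ, 0 ≤ C ∧ ∀ x y : Plane,
      ∫⁻ z, ‖h (x - z) - h (y - z)‖ₑ ≤ ENNReal.ofReal (C * ‖x - y‖) := by
  have hi : Integrable (fun z => fderiv ℝ h z) := (SchwartzMap.fderivCLM ℝ Plane ℂ h).integrable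
  refine ⟨∫ z, ‖fderiv ℝ h z‖, integral_nonneg fun _ => norm_nonneg _, fun x y => ?_⟩
  have hcont : Continuous fun z => fderiv ℝ h z :=
    (SchwartzMap.fderivCLM ℝ Plane ℂ h).continuous
  -- The difference is the integral of the gradient along the segment; after Tonelli, translation
  -- invariance makes the z-integral independent of the point on the segment.
  have h1 : ∀ z, ‖h (x - z) - h (y - z)‖ₑ
      ≤ ∫⁻ t in Icc (0 : ℝ) 1, ‖fderiv ℝ h (y - z + t • (x - y))‖ₑ * ‖x - y‖ₑ := by
    intro z
    have h2 : ∀ t : ℝ, HasDerivAt (fun t : ℝ => h (y - z + t • (x - y)))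
        (fderiv ℝ h (y - z + t • (x - y)) (x - y)) t := by
      intro t
      have h3 : HasDerivAt (fun t : ℝ => y - z + t • (x - y)) (x - y) t := by
        simpa using ((hasDerivAt_id t).smul_const (x - y)).const_add (y - z)
      exact (h.differentiableAt.hasFDerivAt.comp_hasDerivAt t h3)
    have hc2 : Continuous fun t : ℝ => fderiv ℝ h (y - z + t • (x - y)) (x - y) :=
      (hcont.comp (by fun_prop)).clm_apply continuous_const
    have h4 := intervalIntegral.integral_eq_sub_of_hasDerivAt (a := 0) (b := 1)
      (fun t _ => h2 t) (hc2.intervalIntegrable 0 1)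
    have h5 : h (x - z) - h (y - z)
        = ∫ t in (0 : ℝ)..1, fderiv ℝ h (y - z + t • (x - y)) (x - y) := by
      rw [h4]
      congr 2 <;> simp
    rw [h5, intervalIntegral.integral_of_le zero_le_one, ← integral_Icc_eq_integral_Ioc]
    refine (enorm_integral_le_lintegral_enorm _).trans (lintegral_mono fun t => ?_)
    exact ContinuousLinearMap.le_opENorm _ _
  refine (lintegral_mono h1).trans ?_
  have hmeas : Measurable (Function.uncurry fun (z : Plane) (t : ℝ) =>
      ‖fderiv ℝ h (y - z + t • (x - y))‖ₑ * ‖x - y‖ₑ) := by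
    refine Measurable.mul_const (Continuous.measurable ?_) _
    exact (hcont.comp (by fun_prop)).enorm
  rw [lintegral_lintegral_swap hmeas.aemeasurable]
  have h6 : ∀ t : ℝ, ∫⁻ z, ‖fderiv ℝ h (y - z + t • (x - y))‖ₑ * ‖x - y‖ₑ
      = ENNReal.ofReal ((∫ z, ‖fderiv ℝ h z‖) * ‖x - y‖) := by
    intro t
    rw [lintegral_mul_const' _ _ enorm_ne_top, ENNReal.ofReal_mul (integral_nonneg fun _ => norm_nonneg _),
      ofReal_norm, ofReal_integral_norm_eq_lintegral_enorm hi]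
    congr 1
    have h7 : ∀ z : Plane, y - z + t • (x - y) = (y + t • (x - y)) - z := fun z => by abel
    simp only [h7]
    exact lintegral_sub_left_eq_self (fun z => ‖fderiv ℝ h z‖ₑ) _
  simp only [h6]
  simp

lemma lintegral_comp_smul_plane (f : Plane → ℝ≥0∞) (hf : Measurable f) {c : ℝ} (hc : 0 < c) :
    ∫⁻ x, f (c • x) = ENNReal.ofReal ((c ^ 2)⁻¹) * ∫⁻ x, f x := by
  have h := Measure.map_addHaar_smul (volume : Measure Plane) hc.ne'
  rw [← lintegral_map (g := fun x : Plane => c • x) hf (measurable_const_smul c), h,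
    lintegral_smul_measure]
  simp [abs_of_pos (pow_pos hc 2)]

/-- Every dyadic block at frequency `2^k` is reproduced by a kernel obeying the scaling bounds. -/
theorem exists_reproducing_kernel (h : IsDyadicPartition χ φ) :
    ∃ C : ℝ, 0 ≤ C ∧ ∀ k : ℕ, ∃ H : 𝓢(Plane, ℂ),
      (∀ F : Plane → ℂ, MemLp F 2 volume → MemLp (kernelConv (blockKernel h k) F) 2 volume →
        kernelConv H (kernelConv (blockKernel h k) F) = kernelConv (blockKernel h k) F) ∧
      eLpNorm H 2 volume ≤ ENNReal.ofReal (C * 2 ^ k) ∧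
      ∀ x y, ∫⁻ z, ‖H (x - z) - H (y - z)‖ₑ ≤ ENNReal.ofReal (C * 2 ^ k * ‖x - y‖) := by
  obtain ⟨r₁, hr₁⟩ := h.compact_low.isBounded.subset_closedBall (0 : Plane)
  obtain ⟨r₂, hr₂⟩ := h.compact_annulus.isBounded.subset_closedBall (0 : Plane)
  -- A ball of radius r contains the supports of both χ and φ, so a bump equal to 1 there, dilated
  -- by 2^k, is 1 on the support of the symbol number k. The symbol with k = q + 1 is dilated only
  -- by 2^q, which is harmless.
  set r : ℝ := max 1 (max r₁ r₂) with hr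
  have hr0 : 0 < r := lt_of_lt_of_le one_pos (le_max_left _ _)
  let b : ContDiffBump (0 : Plane) := ⟨r, r + 1, hr0, by linarith⟩
  have hmc : ∀ k : ℕ, HasCompactSupport fun ξ : Plane => ((b (((2 : ℝ) ^ k)⁻¹ • ξ) : ℝ) : ℂ) :=
    fun k => by
      have hk : ((2 : ℝ) ^ k)⁻¹ ≠ 0 := by positivity
      exact (b.hasCompactSupport.comp_homeomorph (Homeomorph.smulOfNeZero _ hk)).comp_left
        (g := fun r : ℝ => (r : ℂ)) Complex.ofReal_zero
  have hms : ∀ k : ℕ, ContDiff ℝ ∞ fun ξ : Plane => ((b (((2 : ℝ) ^ k)⁻¹ • ξ) : ℝ) : ℂ) :=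
    fun k => Complex.ofRealCLM.contDiff.comp (b.contDiff.comp (contDiff_const_smul _))
  let m : ℕ → 𝓢(Plane, ℂ) := fun k => (hmc k).toSchwartzMap (hms k)
  obtain ⟨N, hN⟩ : ∃ N : ℕ → 𝓢(Plane, ℂ), ∀ k, N k = 𝓕⁻ (m k) := ⟨_, fun _ => rfl⟩
  obtain ⟨H, hH⟩ : ∃ H : 𝓢(Plane, ℂ), H = N 0 := ⟨_, rfl⟩
  -- All kernels are dilations of one function, with amplitude (2^k)² in dimension two; this gives
  -- the L² norm a factor 2^k and leaves the L¹ norm invariant.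
  have hscale : ∀ k x, N k x = (((2 : ℝ) ^ k : ℝ) : ℂ) ^ 2 * H ((2 : ℝ) ^ k • x) := fun k x => by
    rw [hH, hN, hN]
    exact fourierInv_comp_inv_smul (m 0) (m k) (by positivity) (fun ξ => by simp [m]) x
  obtain ⟨C₁, hC₁, hL⟩ := lintegral_sub_translate_le H
  set C₂ : ℝ := (eLpNorm H 2 volume).toReal with hC₂
  have hC₂0 : 0 ≤ C₂ := ENNReal.toReal_nonneg
  refine ⟨C₁ + C₂, by positivity, fun k => ⟨N k, ?_, ?_, ?_⟩⟩
  · intro F hF hG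
    have hone : ∀ ξ, blockSymbol χ φ k ξ ≠ 0 → b (((2 : ℝ) ^ k)⁻¹ • ξ) = 1 := by
      intro ξ hξ
      refine b.one_of_mem_closedBall ?_
      rw [mem_closedBall_zero_iff]
      show _ ≤ r
      cases k with
      | zero =>
        have h1 : ξ ∈ tsupport χ := subset_tsupport _ hξ
        have h2 := mem_closedBall_zero_iff.1 (hr₁ h1)
        have h3 : r₁ ≤ r := (le_max_left _ _).trans (le_max_right _ _)
        simpa using h2.trans h3
      | succ q =>
        have h1 : ((2 : ℝ) ^ q)⁻¹ • ξ ∈ tsupport φ := subset_tsupport _ hξ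
        have h2 := mem_closedBall_zero_iff.1 (hr₂ h1)
        have h3 : r₂ ≤ r := (le_max_right _ _).trans (le_max_right _ _)
        rw [norm_smul, Real.norm_of_nonneg (by positivity)] at h2 ⊢
        refine le_trans ?_ (h2.trans h3)
        gcongr <;> norm_num
    refine (Continuous.ae_eq_iff_eq volume (continuous_kernelConv _ hG)
      (continuous_kernelConv _ hF)).1 ?_
    -- Multiplying the block symbol by the bump does not change it, so the block and its convolution
    -- with `N k` represent the same distribution; both are continuous, hence equal everywhere.
    have hrep := represents_dyadicBlock h k hF
    have heq := hrep.eq_ofMemLp hG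
    refine Represents.ae_eq (v := dyadicBlock χ φ k (ofMemLp hF)) ⟨(continuous_kernelConv _ hG).locallyIntegrable, fun f hf => ?_⟩ hrep
    rw [hN, ← integral_multiplier_eq _ _ hG, ← ofMemLp_apply hG, ← heq, dyadicBlock_apply h,
      dyadicBlock_apply h, FourierTransform.fourierInv_fourier_eq]
    congr 2
    ext ξ
    rw [SchwartzMap.smulLeftCLM_apply_apply (schwartzSymbol h k).hasTemperateGrowth,
      SchwartzMap.smulLeftCLM_apply_apply (schwartzSymbol h k).hasTemperateGrowth,
      SchwartzMap.smulLeftCLM_apply_apply (m k).hasTemperateGrowth]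
    by_cases h0 : blockSymbol χ φ k ξ = 0
    · have h1 : schwartzSymbol h k ξ = 0 := by
        show ((blockSymbol χ φ k ξ : ℝ) : ℂ) = 0
        simp [h0]
      simp [h1]
    · have h1 : m k ξ = 1 := by
        show ((b (((2 : ℝ) ^ k)⁻¹ • ξ) : ℝ) : ℂ) = 1
        simp [hone ξ h0]
      rw [h1, one_smul]
  · have h2 : eLpNorm (N k) 2 volume ≤ ENNReal.ofReal (2 ^ k) * eLpNorm H 2 volume := by
      rw [eLpNorm_eq_lintegral_rpow_enorm_toReal two_ne_zero ENNReal.ofNat_ne_top,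
        eLpNorm_eq_lintegral_rpow_enorm_toReal two_ne_zero ENNReal.ofNat_ne_top]
      have hpow : (0 : ℝ) < 2 ^ k := by positivity
      have h3 : ∀ x, ‖(N k) x‖ₑ ^ (2 : ℝ≥0∞).toReal
          = ENNReal.ofReal ((2 ^ k) ^ 4) * ‖H ((2 : ℝ) ^ k • x)‖ₑ ^ (2 : ℝ≥0∞).toReal := by
        intro x
        rw [hscale, enorm_mul, ENNReal.mul_rpow_of_nonneg _ _ (by simp)]
        congr 1
        rw [enorm_pow, enorm_ofReal_of_nonneg hpow.le, ENNReal.toReal_ofNat, ENNReal.rpow_two,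
          ← ENNReal.ofReal_pow hpow.le, ← ENNReal.ofReal_pow (by positivity)]
        congr 1
        ring
      simp only [h3]
      rw [lintegral_const_mul' _ _ ENNReal.ofReal_ne_top, lintegral_comp_smul_plane
        (fun x => ‖H x‖ₑ ^ (2 : ℝ≥0∞).toReal)
        ((H.continuous.enorm.measurable).pow_const _) hpow, ← mul_assoc,
        ← ENNReal.ofReal_mul (by positivity), ENNReal.mul_rpow_of_nonneg _ _ (by simp)]
      gcongr
      rw [ENNReal.ofReal_rpow_of_nonneg (by positivity) (by simp)]
      refine ENNReal.ofReal_le_ofReal (le_of_eq ?_)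
      have h4 : ((2 : ℝ) ^ k) ^ 4 * (((2 : ℝ) ^ k) ^ 2)⁻¹ = (2 ^ k) ^ 2 := by
        field_simp
      rw [h4, ENNReal.toReal_ofNat, ← Real.sqrt_eq_rpow, Real.sqrt_sq hpow.le]
    refine h2.trans ?_
    rw [← ENNReal.ofReal_toReal (H.memLp 2 volume).2.ne, ← hC₂,
      ← ENNReal.ofReal_mul (by positivity)]
    refine ENNReal.ofReal_le_ofReal ?_
    nlinarith [pow_pos (zero_lt_two (α := ℝ)) k]
  · intro x y
    have hpow : (0 : ℝ) < 2 ^ k := by positivity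
    have h3 : ∀ z, ‖(N k) (x - z) - (N k) (y - z)‖ₑ
        = ENNReal.ofReal ((2 ^ k) ^ 2) * ‖H ((2 : ℝ) ^ k • x - (2 : ℝ) ^ k • z)
          - H ((2 : ℝ) ^ k • y - (2 : ℝ) ^ k • z)‖ₑ := by
      intro z
      rw [hscale, hscale, ← mul_sub, enorm_mul, smul_sub, smul_sub, enorm_pow, enorm_ofReal_of_nonneg hpow.le, ← ENNReal.ofReal_pow hpow.le]
    simp only [h3]
    rw [lintegral_const_mul' _ _ ENNReal.ofReal_ne_top, lintegral_comp_smul_plane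
      (fun z => ‖H ((2 : ℝ) ^ k • x - z) - H ((2 : ℝ) ^ k • y - z)‖ₑ)
      (by
        refine Continuous.measurable (Continuous.enorm ?_)
        exact (H.continuous.comp (by fun_prop)).sub
          (H.continuous.comp (by fun_prop))) hpow,
      ← mul_assoc, ← ENNReal.ofReal_mul (by positivity), mul_inv_cancel₀ (by positivity),
      ENNReal.ofReal_one, one_mul]
    refine (hL _ _).trans (ENNReal.ofReal_le_ofReal ?_)
    rw [← smul_sub, norm_smul, Real.norm_of_nonneg hpow.le]
    nlinarith [mul_nonneg hpow.le (norm_nonneg (x - y)), mul_nonneg hC₂0 (mul_nonneg hpow.le (norm_nonneg (x - y)))]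

end Bernstein

/-! ## Regularity of a function at a fixed time -/

section Slices

variable {χ φ : Plane → ℝ}

/-- The dyadic block of a real function as a convolution. -/
def blockConv (h : IsDyadicPartition χ φ) (k : ℕ) (f : Plane → ℝ) : Plane → ℂ :=
  kernelConv (blockKernel h k) (fun x => (f x : ℂ))

lemma besovNorm_congr {s : ℝ} {p r : ℝ≥0∞} {f g : Plane → ℝ} (hfg : f =ᵐ[volume] g) :
    besovNorm χ φ s p r f = besovNorm χ φ s p r g := by
  have hc : (fun x => (f x : ℂ)) =ᵐ[volume] fun x => (g x : ℂ) := by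
    filter_upwards [hfg] with x hx
    rw [hx]
  unfold besovNorm
  exact iInf_congr fun v => iInf_congr_Prop ⟨fun h => h.congr hc, fun h => h.congr hc.symm⟩
    fun _ => rfl

/-- The index k stands for q = k - 1, so the weight of H¹ is 2^{k-1} and its inverse is 2 · 2^{-k}.
-/
lemma ofReal_weight_mul (k : ℕ) :
    ENNReal.ofReal ((2 : ℝ) ^ (((k : ℝ) - 1) * 1)) * ENNReal.ofReal (2 * (1 / 2) ^ k) = 1 := by
  rw [← ENNReal.ofReal_mul (by positivity), mul_one, Real.rpow_sub two_pos, Real.rpow_natCast,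
    Real.rpow_one]
  rw [← ENNReal.ofReal_one]
  congr 1
  rw [one_div, inv_pow]
  field_simp

/-- A function in `H¹` is square integrable, and it is the sum of its dyadic blocks. -/
theorem sobolev_slice (h : IsDyadicPartition χ φ) {f : Plane → ℝ} {M : ℝ≥0∞} (hMt : M ≠ ⊤)
    (hM : besovNorm χ φ 1 2 2 f < M) :
    MemLp (fun x => (f x : ℂ)) 2 volume ∧ eLpNorm (fun x => (f x : ℂ)) 2 volume ≤ 4 * M ∧
      (∀ k, MemLp (blockConv h k f) 2 volume) ∧
      (∀ k, eLpNorm (blockConv h k f) 2 volume ≤ ENNReal.ofReal (2 * (1 / 2) ^ k) * M) ∧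
      Tendsto (fun n => eLpNorm (fun x => ∑ k ∈ Finset.range n, blockConv h k f x - f x) 2 volume)
        atTop (𝓝 0) := by
  -- The norms are infima, so the strict inequality is what provides an actual distribution here and
  -- actual L² functions for the blocks below.
  obtain ⟨v, hv⟩ := iInf_lt_iff.1 hM
  obtain ⟨hrep, hlt⟩ := iInf_lt_iff.1 hv
  have hd : ∀ k, distLpNorm 2 (dyadicBlock χ φ k v) < ENNReal.ofReal (2 * (1 / 2) ^ k) * M := by
    intro k
    have h1 := (enorm_le_eLpNorm_count (fun k : ℕ => ENNReal.ofReal ((2 : ℝ) ^ (((k : ℝ) - 1) * 1)) *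
      distLpNorm 2 (dyadicBlock χ φ k v)) k (p := 2) two_ne_zero).trans_lt hlt
    rw [enorm_eq_self] at h1
    have hw : ENNReal.ofReal (2 * (1 / 2) ^ k) ≠ 0 := by
      rw [Ne, ENNReal.ofReal_eq_zero, not_le]; positivity
    have h2 := ENNReal.mul_lt_mul_right hw ENNReal.ofReal_ne_top h1
    rwa [← mul_assoc, mul_comm (ENNReal.ofReal (2 * (1 / 2) ^ k)) (ENNReal.ofReal _),
      ofReal_weight_mul, one_mul] at h2
  have hg : ∀ k, ∃ g : Plane → ℂ, Represents g (dyadicBlock χ φ k v) ∧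
      eLpNorm g 2 volume < ENNReal.ofReal (2 * (1 / 2) ^ k) * M := by
    intro k
    obtain ⟨g, hg⟩ := iInf_lt_iff.1 (hd k)
    obtain ⟨hg1, hg2⟩ := iInf_lt_iff.1 hg
    exact ⟨g, hg1, hg2⟩
  choose g hg1 hg2 using hg
  have hgm : ∀ k, MemLp (g k) 2 volume := fun k =>
    ⟨(hg1 k).1.aestronglyMeasurable, (hg2 k).trans_le le_top⟩
  let G : ℕ → Lp ℂ 2 (volume : Measure Plane) := fun k => (hgm k).toLp (g k)
  have hGn : ∀ k, ‖G k‖ ≤ 2 * (1 / 2) ^ k * M.toReal := by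
    intro k
    rw [Lp.norm_toLp]
    refine (ENNReal.toReal_mono (ENNReal.mul_ne_top ENNReal.ofReal_ne_top hMt) (hg2 k).le).trans ?_
    rw [ENNReal.toReal_mul, ENNReal.toReal_ofReal (by positivity)]
  -- The constant 4 of the L² bound is the sum of the inverse weights 2 · 2^{-k}.
  have hsb : HasSum (fun k : ℕ => 2 * (1 / 2 : ℝ) ^ k * M.toReal) (4 * M.toReal) := by
    have := (hasSum_geometric_two.mul_left 2).mul_right M.toReal
    norm_num at this ⊢
    exact this
  have hGs : Summable G := Summable.of_norm_bounded hsb.summable hGn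
  have hvS : v = Lp.toTemperedDistributionCLM ℂ volume 2 (∑' k, G k) :=
    eq_tsum_of_dyadicBlock h (fun k => (hg1 k).eq_ofMemLp (hgm k)) hGs
  set S : Lp ℂ 2 (volume : Measure Plane) := ∑' k, G k with hS
  have hSv : v = ofMemLp (Lp.memLp S) := by rw [hvS, ofMemLp, Lp.toLp_coeFn]
  have hfS : (fun x => (f x : ℂ)) =ᵐ[volume] S := hrep.ae_eq (hSv ▸ represents_ofMemLp (Lp.memLp S))
  have hF : MemLp (fun x => (f x : ℂ)) 2 volume := (Lp.memLp S).ae_eq hfS.symm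
  have hvF : v = ofMemLp hF := hrep.eq_ofMemLp hF
  have hbg : ∀ k, blockConv h k f =ᵐ[volume] g k := fun k =>
    (represents_dyadicBlock h k hF).ae_eq (hvF ▸ hg1 k)
  refine ⟨hF, ?_, fun k => (hgm k).ae_eq (hbg k).symm, fun k => ?_, ?_⟩
  · rw [eLpNorm_congr_ae hfS]
    have h1 : ‖S‖ ≤ 4 * M.toReal := tsum_of_norm_bounded hsb hGn
    have h2 : eLpNorm S 2 volume = ENNReal.ofReal ‖S‖ := by
      rw [Lp.norm_def, ENNReal.ofReal_toReal (Lp.eLpNorm_ne_top S)]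
    rw [h2]
    refine (ENNReal.ofReal_le_ofReal h1).trans ?_
    rw [ENNReal.ofReal_mul (by norm_num), ENNReal.ofReal_toReal hMt]
    norm_num
  · rw [eLpNorm_congr_ae (hbg k)]
    exact (hg2 k).le
  · have h1 := tendsto_iff_edist_tendsto_0.1 hGs.hasSum.tendsto_sum_nat
    refine h1.congr fun n => ?_
    rw [Lp.edist_def]
    refine eLpNorm_congr_ae ?_
    have h2 : ∀ᵐ x, ∀ k, G k x = blockConv h k f x := ae_all_iff.2 fun k => by
      filter_upwards [(hgm k).coeFn_toLp, hbg k] with x hx hx'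
      rw [hx', hx]
    filter_upwards [h2, hfS, Lp.coeFn_finsetSum (Finset.range n) G] with x hx hx' hx''
    simp only [Pi.sub_apply]
    rw [hx'', hx', Finset.sum_apply]
    simp only [hx]
    rfl

/-- The `B¹_{∞,1}` norm controls the sum of the dyadic blocks. -/
theorem tsum_blockConv_le (h : IsDyadicPartition χ φ) {f : Plane → ℝ}
    (hF : MemLp (fun x => (f x : ℂ)) 2 volume) :
    ∑' k : ℕ, ENNReal.ofReal (2 ^ k) * eLpNorm (blockConv h k f) ⊤ volume
      ≤ 2 * besovNorm χ φ 1 ⊤ 1 f := by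
  -- The factor 2 is the shift k = q + 1 between the summation index and the dyadic frequency.
  have h1 : ∑' k : ℕ, ENNReal.ofReal (2 ^ k) * eLpNorm (blockConv h k f) ⊤ volume
      = 2 * ∑' k : ℕ, ENNReal.ofReal ((2 : ℝ) ^ (((k : ℝ) - 1) * 1)) *
        eLpNorm (blockConv h k f) ⊤ volume := by
    rw [← ENNReal.tsum_mul_left]
    refine tsum_congr fun k => ?_
    rw [← mul_assoc]
    congr 1
    rw [← ENNReal.ofReal_ofNat, ← ENNReal.ofReal_mul (by norm_num), mul_one, Real.rpow_sub two_pos,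
      Real.rpow_natCast, Real.rpow_one]
    congr 1
    field_simp
  rw [h1]
  refine mul_le_mul_right ?_ _
  refine le_iInf₂ fun v hv => ?_
  rw [besovNormDist, eLpNorm_one_eq_lintegral_enorm, lintegral_count]
  refine ENNReal.tsum_le_tsum fun k => ?_
  rw [enorm_eq_self]
  refine mul_le_mul_right ?_ _
  refine le_iInf₂ fun g hg => ?_
  have hvF := hv.eq_ofMemLp hF
  subst hvF
  exact (eLpNorm_congr_ae ((represents_dyadicBlock h k hF).ae_eq hg)).le

/-- Bernstein inequalities for the dyadic blocks. -/
theorem exists_bernstein (h : IsDyadicPartition χ φ) :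
    ∃ C : ℝ, 0 ≤ C ∧ ∀ (k : ℕ) (f : Plane → ℝ), MemLp (fun x => (f x : ℂ)) 2 volume →
      MemLp (blockConv h k f) 2 volume →
      eLpNorm (blockConv h k f) ⊤ volume
        ≤ ENNReal.ofReal (C * 2 ^ k) * eLpNorm (blockConv h k f) 2 volume ∧
      ∀ x y, ‖blockConv h k f x - blockConv h k f y‖ₑ
        ≤ ENNReal.ofReal (C * 2 ^ k * ‖x - y‖) * eLpNorm (blockConv h k f) ⊤ volume := by
  obtain ⟨C, hC, hH⟩ := exists_reproducing_kernel h
  refine ⟨C, hC, fun k f hF hG => ?_⟩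
  obtain ⟨H, hH1, hH2, hH3⟩ := hH k
  have hrep : kernelConv H (blockConv h k f) = blockConv h k f := hH1 _ hF hG
  refine ⟨?_, fun x y => ?_⟩
  · rw [eLpNorm_exponent_top]
    refine essSup_le_of_ae_le _ (Eventually.of_forall fun x => ?_)
    have h1 := enorm_kernelConv_le H hG.1 x
    rw [hrep] at h1
    exact h1.trans (mul_le_mul_left hH2 _)
  · have h1 : blockConv h k f x - blockConv h k f y
        = ∫ z, (H (x - z) - H (y - z)) * blockConv h k f z := by
      conv_lhs => rw [← hrep]
      simp only [kernelConv, sub_mul]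
      rw [← integral_sub (integrable_kernelConv H hG x) (integrable_kernelConv H hG y)]
    rw [h1]
    refine (enorm_integral_le_lintegral_enorm _).trans ?_
    have h2 : ∀ᵐ z, ‖(H (x - z) - H (y - z)) * blockConv h k f z‖ₑ
        ≤ ‖H (x - z) - H (y - z)‖ₑ * eLpNorm (blockConv h k f) ⊤ volume := by
      filter_upwards [enorm_ae_le_eLpNormEssSup (blockConv h k f) volume] with z hz
      rw [enorm_mul, eLpNorm_exponent_top]
      exact mul_le_mul_right hz _
    refine (lintegral_mono_ae h2).trans ?_
    rw [lintegral_mul_const _ (by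
      refine Continuous.measurable (Continuous.enorm ?_)
      exact (H.continuous.comp (by fun_prop)).sub (H.continuous.comp (by fun_prop)))]
    exact mul_le_mul_left (hH3 x y) _

/-- The essential supremum of a slice exceeds c exactly when the corresponding section of the set
where ‖f‖ > c has positive measure, and the measure of a section is measurable in t. -/
lemma measurable_eLpNorm_top_slice {E : Type*} [NormedAddCommGroup E] [MeasurableSpace E]
    [OpensMeasurableSpace E] {f : ℝ × Plane → E} (hf : Measurable f) :
    Measurable fun t => eLpNorm (fun x => f (t, x)) ⊤ volume := by
  refine measurable_of_Ioi fun c => ?_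
  have hset : (fun t => eLpNorm (fun x => f (t, x)) ⊤ volume) ⁻¹' Ioi c
      = {t | volume (Prod.mk t ⁻¹' {z : ℝ × Plane | c < ‖f z‖ₑ}) ≠ 0} := by
    ext t
    simp only [mem_preimage, mem_Ioi, mem_ofPred_eq, eLpNorm_exponent_top]
    constructor
    · intro hlt h0
      refine absurd hlt (not_lt.2 (essSup_le_of_ae_le c ?_))
      rw [Filter.EventuallyLE, ae_iff]
      simpa using h0
    · intro h0
      by_contra hle
      refine h0 ?_
      have := ae_le_essSup (f := fun x => ‖f (t, x)‖ₑ) (μ := (volume : Measure Plane))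
      have h2 : ∀ᵐ x, ‖f (t, x)‖ₑ ≤ c := by
        filter_upwards [this] with x hx
        exact hx.trans (not_lt.1 hle)
      rw [ae_iff] at h2
      simpa using h2
  rw [hset]
  exact (measurable_measure_prodMk_left (measurableSet_lt measurable_const hf.enorm))
    (measurableSet_singleton 0).compl

lemma enorm_le_eLpNorm_top_of_continuous {E : Type*} [NormedAddCommGroup E] {f : Plane → E}
    (hf : Continuous f) (x : Plane) : ‖f x‖ₑ ≤ eLpNorm f ⊤ volume := by
  by_contra hlt
  push Not at hlt
  have ho : IsOpen {y | eLpNorm f ⊤ volume < ‖f y‖ₑ} := isOpen_lt continuous_const hf.enorm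
  have hpos := ho.measure_pos volume ⟨x, hlt⟩
  have h0 : volume {y | eLpNorm f ⊤ volume < ‖f y‖ₑ} = 0 := by
    have := enorm_ae_le_eLpNormEssSup f (volume : Measure Plane)
    rw [ae_iff] at this
    simpa [eLpNorm_exponent_top] using this
  exact hpos.ne' h0

end Slices

/-! ## The Lipschitz representative of a function on space-time -/

section Representative

variable {χ φ : Plane → ℝ}

lemma volume_restrict_slab (T : ℝ) : (volume : Measure (ℝ × Plane)).restrict (slab T)
    = ((volume : Measure ℝ).restrict (Ioo 0 T)).prod (volume : Measure Plane) := by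
  rw [slab, Measure.volume_eq_prod, ← Measure.prod_restrict, Measure.restrict_univ]

/-- The sum of the block norms is controlled by an interpolation inequality. -/
lemma tsum_rpow_le {a : ℕ → ℝ≥0∞} {S N : ℝ≥0∞} (hS : ∑' k : ℕ, ENNReal.ofReal (2 ^ k) * a k ≤ S)
    (hN : ∀ k, a k ≤ N) {p : ℝ} (hp : 1 ≤ p) :
    (∑' k, a k) ^ p ≤ S * (N ^ (1 - 1 / p) * ∑' k : ℕ, ENNReal.ofReal ((2 ^ (-(1 / p))) ^ k)) ^ p := by
  have hp0 : 0 < p := by linarith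
  have hp1 : 0 ≤ 1 - 1 / p := by
    rw [sub_nonneg, div_le_one hp0]; exact hp
  -- Write a_k = (2^k a_k)^{1/p} · a_k^{1-1/p} · 2^{-k/p}. The first factor is at most S^{1/p}, the
  -- second at most N^{1-1/p}, and the third is a summable geometric sequence.
  have hk : ∀ k, a k ≤ S ^ (1 / p) * (N ^ (1 - 1 / p) * ENNReal.ofReal ((2 ^ (-(1 / p))) ^ k)) := by
    intro k
    have h1 : ENNReal.ofReal (2 ^ k) * a k ≤ S := (ENNReal.le_tsum k).trans hS
    have h2 : a k = (ENNReal.ofReal (2 ^ k) * a k) ^ (1 / p) *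
        (a k ^ (1 - 1 / p) * ENNReal.ofReal ((2 ^ (-(1 / p))) ^ k)) := by
      rw [ENNReal.mul_rpow_of_nonneg _ _ (by positivity)]
      have h3 : ENNReal.ofReal (2 ^ k) ^ (1 / p) * ENNReal.ofReal ((2 ^ (-(1 / p))) ^ k) = 1 := by
        rw [ENNReal.ofReal_rpow_of_nonneg (by positivity) (by positivity),
          ← ENNReal.ofReal_mul (by positivity), ← ENNReal.ofReal_one]
        congr 1
        rw [← Real.rpow_natCast, ← Real.rpow_natCast, ← Real.rpow_mul (by norm_num),
          ← Real.rpow_mul (by norm_num), ← Real.rpow_add two_pos]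
        ring_nf
        simp
      have h4 : a k ^ (1 / p) * a k ^ (1 - 1 / p) = a k := by
        rw [← ENNReal.rpow_add_of_nonneg _ _ (by positivity) hp1]
        simp
      calc a k = (ENNReal.ofReal (2 ^ k) ^ (1 / p) * ENNReal.ofReal ((2 ^ (-(1 / p))) ^ k)) *
            (a k ^ (1 / p) * a k ^ (1 - 1 / p)) := by rw [h3, h4, one_mul]
        _ = _ := by ring
    calc a k = _ := h2
      _ ≤ _ := by gcongr; exact hN k
  calc (∑' k, a k) ^ p
      ≤ (∑' k : ℕ, S ^ (1 / p) * (N ^ (1 - 1 / p) * ENNReal.ofReal ((2 ^ (-(1 / p))) ^ k))) ^ p := by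
        gcongr with k
        exact hk k
    _ = _ := by
        rw [ENNReal.tsum_mul_left, ENNReal.tsum_mul_left, ENNReal.mul_rpow_of_nonneg _ _ hp0.le,
          ← ENNReal.rpow_mul, one_div_mul_cancel hp0.ne', ENNReal.rpow_one]

lemma measurable_blockConv_slice (h : IsDyadicPartition χ φ) (k : ℕ) {f : ℝ × Plane → ℝ}
    (hf : Measurable f) :
    Measurable fun z : ℝ × Plane => blockConv h k (fun x => f (z.1, x)) z.2 := by
  have hm : Measurable fun p : (ℝ × Plane) × Plane =>
      blockKernel h k (p.1.2 - p.2) * (f (p.1.1, p.2) : ℂ) := by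
    refine Measurable.mul ?_ ?_
    · have h1 : Continuous fun p : (ℝ × Plane) × Plane => p.1.2 - p.2 := by fun_prop
      exact ((blockKernel h k).continuous.comp h1).measurable
    · have h1 : Measurable fun p : (ℝ × Plane) × Plane => (p.1.1, p.2) := by fun_prop
      exact Complex.measurable_ofReal.comp (hf.comp h1)
  exact (hm.stronglyMeasurable.integral_prod_right (ν := (volume : Measure Plane))).measurable

lemma ae_slice_of_ae_slab {T : ℝ} {E : Type*} {f g : ℝ × Plane → E}
    (hfg : f =ᵐ[volume.restrict (slab T)] g) :
    ∀ᵐ t ∂(volume.restrict (Ioo 0 T)), (fun x => f (t, x)) =ᵐ[volume] fun x => g (t, x) := by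
  rw [volume_restrict_slab] at hfg
  exact Measure.ae_ae_of_ae_prod hfg

/-- The block norms of almost every time slice. -/
lemma ae_slice_bounds (h : IsDyadicPartition χ φ) {T : ℝ} {f f₀ : ℝ × Plane → ℝ}
    (hff₀ : f =ᵐ[volume.restrict (slab T)] f₀) {M : ℝ≥0∞} (hMt : M ≠ ⊤)
    (h2 : timeBesovNorm χ φ T ⊤ 1 2 2 f < M) :
    ∀ᵐ t ∂(volume.restrict (Ioo 0 T)), besovNorm χ φ 1 2 2 (fun x => f₀ (t, x)) < M ∧
      ∑' k : ℕ, ENNReal.ofReal (2 ^ k) * eLpNorm (blockConv h k fun x => f₀ (t, x)) ⊤ volume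
        ≤ 2 * besovNorm χ φ 1 ⊤ 1 (fun x => f (t, x)) := by
  have h3 := ae_le_eLpNormEssSup (f := fun t : ℝ => besovNorm χ φ 1 2 2 (fun x => f (t, x)))
    (μ := volume.restrict (Ioo 0 T))
  have h4 : eLpNormEssSup (fun t : ℝ => besovNorm χ φ 1 2 2 (fun x => f (t, x)))
      (volume.restrict (Ioo 0 T)) < M := by
    rw [← eLpNorm_exponent_top]
    exact h2
  filter_upwards [ae_slice_of_ae_slab hff₀, h3] with t ht ht'
  have h5 : besovNorm χ φ 1 2 2 (fun x => f₀ (t, x)) < M := by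
    rw [← besovNorm_congr ht]
    exact ht'.trans_lt h4
  refine ⟨h5, ?_⟩
  rw [besovNorm_congr ht]
  exact tsum_blockConv_le h (sobolev_slice h hMt h5).1

/-- A function in `L¹(0, T; B¹_{∞,1}) ∩ L^∞(0, T; H¹)` has a representative that is Lipschitz
continuous in space, with integrable Lipschitz constant, and bounded in space, with a bound in all
`L^p(0, T)`. -/
theorem exists_lipschitz_representative (h : IsDyadicPartition χ φ) {T : ℝ}
    {f : ℝ × Plane → ℝ} (hf : AEStronglyMeasurable f (volume.restrict (slab T)))
    (h1 : timeBesovNorm χ φ T 1 1 ⊤ 1 f < ⊤) (h2 : timeBesovNorm χ φ T ⊤ 1 2 2 f < ⊤) :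
    ∃ (g : ℝ × Plane → ℝ) (L A : ℝ → ℝ≥0∞) (M : ℝ≥0∞), Measurable g ∧ Measurable L ∧
      Measurable A ∧ M < ⊤ ∧ g =ᵐ[volume.restrict (slab T)] f ∧
      (∀ t ∉ Ioo 0 T, L t = 0 ∧ A t = 0) ∧
      (∀ t x y, ‖g (t, x) - g (t, y)‖ₑ ≤ L t * ‖x - y‖ₑ) ∧ (∀ t x, ‖g (t, x)‖ₑ ≤ A t) ∧
      (∀ t, L t < ⊤ ∧ A t < ⊤) ∧ (∀ t, eLpNorm (fun x => g (t, x)) 2 volume ≤ M) ∧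
      ∫⁻ t, L t < ⊤ ∧ ∀ p : ℝ, 1 ≤ p → ∫⁻ t, A t ^ p < ⊤ := by
  obtain ⟨C, hC0, hC⟩ := exists_bernstein h
  obtain ⟨f₀, hf₀⟩ : ∃ f₀, f₀ = hf.mk f := ⟨_, rfl⟩
  have hf₀m : Measurable f₀ := hf₀ ▸ hf.stronglyMeasurable_mk.measurable
  have hff₀ : f =ᵐ[volume.restrict (slab T)] f₀ := hf₀ ▸ hf.ae_eq_mk
  obtain ⟨M, hM, hMt'⟩ := exists_between h2
  have hMt : M ≠ ⊤ := hMt'.ne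
  obtain ⟨B, hB⟩ : ∃ B : ℕ → ℝ × Plane → ℂ,
      ∀ k z, B k z = blockConv h k (fun x => f₀ (z.1, x)) z.2 := ⟨_, fun _ _ => rfl⟩
  have hBf : ∀ k t, (fun x => B k (t, x)) = blockConv h k (fun x => f₀ (t, x)) :=
    fun k t => funext fun x => hB k (t, x)
  have hBm : ∀ k, Measurable (B k) := fun k => by
    rw [funext (hB k)]
    exact measurable_blockConv_slice h k hf₀m
  obtain ⟨a, ha⟩ : ∃ a : ℕ → ℝ → ℝ≥0∞, ∀ k t, a k t = eLpNorm (fun x => B k (t, x)) ⊤ volume :=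
    ⟨_, fun _ _ => rfl⟩
  have ham : ∀ k, Measurable (a k) := fun k => by
    rw [funext (ha k)]
    exact measurable_eLpNorm_top_slice (hBm k)
  obtain ⟨S, hS⟩ : ∃ S : ℝ → ℝ≥0∞, ∀ t, S t = ∑' k : ℕ, ENNReal.ofReal (2 ^ k) * a k t :=
    ⟨_, fun _ => rfl⟩
  have hSm : Measurable S := by
    rw [funext hS]
    exact Measurable.tsum fun k => (ham k).const_mul _
  -- Bernstein costs C 2^k and the H¹ bound on the block number k is 2 · 2^{-k} M, so the sup norms
  -- of all blocks are at most 2 C M, uniformly in time.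
  obtain ⟨N, hN⟩ : ∃ N : ℝ≥0∞, N = ENNReal.ofReal (2 * C) * M := ⟨_, rfl⟩
  have hNt : N ≠ ⊤ := hN ▸ ENNReal.mul_ne_top ENNReal.ofReal_ne_top hMt
  have hsb : ∀ᵐ t ∂(volume.restrict (Ioo 0 T)), besovNorm χ φ 1 2 2 (fun x => f₀ (t, x)) < M ∧
      S t ≤ 2 * besovNorm χ φ 1 ⊤ 1 (fun x => f (t, x)) := by
    filter_upwards [ae_slice_bounds h hff₀ hMt hM] with t ht
    refine ⟨ht.1, ?_⟩
    simp only [hS, ha, hBf]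
    exact ht.2
  have hSint : ∫⁻ t in Ioo 0 T, S t < ⊤ := by
    refine (lintegral_mono_ae (hsb.mono fun t ht => ht.2)).trans_lt ?_
    rw [lintegral_const_mul' _ _ ENNReal.ofNat_ne_top]
    refine ENNReal.mul_lt_top ENNReal.ofNat_lt_top ?_
    have := h1
    rwa [timeBesovNorm, eLpNorm_one_eq_lintegral_enorm] at this
  have hgood : ∀ᵐ t ∂(volume.restrict (Ioo 0 T)),
      besovNorm χ φ 1 2 2 (fun x => f₀ (t, x)) < M ∧ S t < ⊤ := by
    filter_upwards [hsb, ae_lt_top hSm hSint.ne] with t h3 h4 using ⟨h3.1, h4⟩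
  -- No measurability in time of the Besov norms is assumed; the exceptional times are therefore
  -- enclosed in a measurable null set, on which the representative is set to zero.
  set Z : Set ℝ := toMeasurable (volume.restrict (Ioo 0 T))
    {t | ¬(besovNorm χ φ 1 2 2 (fun x => f₀ (t, x)) < M ∧ S t < ⊤)} with hZ
  have hZ0 : volume.restrict (Ioo 0 T) Z = 0 := by
    rw [hZ, measure_toMeasurable]
    exact hgood
  have hZm : MeasurableSet Z := measurableSet_toMeasurable _ _
  set D : Set ℝ := Ioo 0 T \ Z with hD
  have hDm : MeasurableSet D := measurableSet_Ioo.diff hZm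
  have hDp : ∀ t ∈ D, besovNorm χ φ 1 2 2 (fun x => f₀ (t, x)) < M ∧ S t < ⊤ := by
    intro t ht
    by_contra hc
    exact ht.2 (subset_toMeasurable _ _ hc)
  have hDae : ∀ᵐ t ∂(volume.restrict (Ioo 0 T)), t ∈ D := by
    filter_upwards [ae_restrict_mem measurableSet_Ioo, measure_eq_zero_iff_ae_notMem.1 hZ0]
      with t h3 h4 using ⟨h3, h4⟩
  have hslice := fun t ht => sobolev_slice h hMt (hDp t ht).1
  have hcont : ∀ t ∈ D, ∀ k, Continuous fun x => B k (t, x) := fun t ht k =>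
    by
    rw [hBf]
    exact continuous_kernelConv _ (hslice t ht).1
  have hBa : ∀ t ∈ D, ∀ k x, ‖B k (t, x)‖ₑ ≤ a k t := fun t ht k x =>
    (enorm_le_eLpNorm_top_of_continuous (hcont t ht k) x).trans (ha k t).ge
  have haN : ∀ t ∈ D, ∀ k, a k t ≤ N := by
    intro t ht k
    rw [ha, hBf]
    refine (hC k _ (hslice t ht).1 ((hslice t ht).2.2.1 k)).1.trans ?_
    refine (mul_le_mul_right ((hslice t ht).2.2.2.1 k) _).trans ?_
    rw [← mul_assoc, ← ENNReal.ofReal_mul (by positivity), hN]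
    refine mul_le_mul_left (ENNReal.ofReal_le_ofReal (le_of_eq ?_)) _
    rw [one_div, inv_pow]
    field_simp
  have haS : ∀ t, ∑' k, a k t ≤ S t := fun t => (ENNReal.tsum_le_tsum fun k => by
    refine le_mul_of_one_le_left zero_le ?_
    rw [ENNReal.one_le_ofReal]
    exact one_le_pow₀ one_le_two : _ ≤ ∑' k : ℕ, ENNReal.ofReal (2 ^ k) * a k t).trans (hS t).ge
  have hsumm : ∀ t ∈ D, ∀ x, Summable fun k => B k (t, x) := by
    intro t ht x
    refine Summable.of_enorm (ne_of_lt ?_)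
    exact ((ENNReal.tsum_le_tsum fun k => hBa t ht k x).trans (haS t)).trans_lt (hDp t ht).2
  -- Summing the continuous blocks pointwise, rather than keeping f₀, makes the Lipschitz and sup
  -- bounds hold at every point instead of almost everywhere.
  obtain ⟨g, hg⟩ : ∃ g : ℝ × Plane → ℝ,
      ∀ z, g z = D.indicator (fun t => (∑' k, B k (t, z.2)).re) z.1 := ⟨_, fun _ => rfl⟩
  have hgD : ∀ t ∈ D, ∀ x, g (t, x) = (∑' k, B k (t, x)).re := fun t ht x => by
    simp [hg, indicator_of_mem ht]
  have hgDc : ∀ t ∉ D, ∀ x, g (t, x) = 0 := fun t ht x => by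
    simp [hg, indicator_of_notMem ht]
  have hgm : Measurable g := by
    refine measurable_of_tendsto_metrizable (f := fun (n : ℕ) (z : ℝ × Plane) =>
      D.indicator (fun t => (∑ k ∈ Finset.range n, B k (t, z.2)).re) z.1) (fun n => ?_) ?_
    · have h3 : (fun z : ℝ × Plane => D.indicator
          (fun t => (∑ k ∈ Finset.range n, B k (t, z.2)).re) z.1)
          = (Prod.fst ⁻¹' D).indicator fun z => (∑ k ∈ Finset.range n, B k z).re := by
        funext z
        by_cases hz : z.1 ∈ D <;> simp [indicator, hz]
      rw [h3]
      exact (Complex.measurable_re.comp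
        (Finset.measurable_fun_sum _ fun k _ => hBm k)).indicator (measurable_fst hDm)
    · rw [tendsto_pi_nhds]
      rintro ⟨t, x⟩
      by_cases ht : t ∈ D
      · rw [hgD t ht x]
        simp only [indicator_of_mem ht]
        exact (Complex.continuous_re.tendsto _).comp (hsumm t ht x).hasSum.tendsto_sum_nat
      · rw [hgDc t ht x]
        simp [indicator_of_notMem ht]
  have hgf₀ : ∀ t ∈ D, (fun x => g (t, x)) =ᵐ[volume] fun x => f₀ (t, x) := by
    intro t ht
    obtain ⟨hF, -, hb, -, hlim⟩ := hslice t ht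
    -- The partial sums converge to f₀ in L², hence almost everywhere along a subsequence; this
    -- identifies the pointwise sum.
    have h3 := tendstoInMeasure_of_tendsto_eLpNorm (μ := (volume : Measure Plane)) (l := atTop)
      (f := fun n x => ∑ k ∈ Finset.range n, blockConv h k (fun x => f₀ (t, x)) x)
      (g := fun x => ((f₀ (t, x) : ℝ) : ℂ)) (p := 2) two_ne_zero (fun n => by
        exact (memLp_finsetSum _ fun k _ => hb k).1) hF.1 hlim
    obtain ⟨ns, hns, hae⟩ := h3.exists_seq_tendsto_ae
    filter_upwards [hae] with x hx
    have h4 := (hsumm t ht x).hasSum.tendsto_sum_nat.comp hns.tendsto_atTop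
    have h5 : ∑' k, B k (t, x) = ((f₀ (t, x) : ℝ) : ℂ) := by
      refine tendsto_nhds_unique h4 ?_
      simpa only [hB, Function.comp_def] using hx
    rw [hgD t ht x, h5, Complex.ofReal_re]
  refine ⟨g, D.indicator fun t => ENNReal.ofReal C * S t, D.indicator fun t => ∑' k, a k t,
    4 * M, hgm, (hSm.const_mul _).indicator hDm, (Measurable.tsum ham).indicator hDm,
    ENNReal.mul_lt_top ENNReal.ofNat_lt_top hMt.lt_top, ?_, ?_, ?_, ?_, ?_, ?_, ?_, ?_⟩
  · refine EventuallyEq.trans ?_ hff₀.symm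
    rw [volume_restrict_slab]
    have h3 : MeasurableSet {z | g z = f₀ z} := measurableSet_eq_fun hgm hf₀m
    refine (Measure.ae_prod_iff_ae_ae h3).2 ?_
    filter_upwards [hDae] with t ht using hgf₀ t ht
  · intro t ht
    have : t ∉ D := fun h => ht h.1
    simp [this]
  · intro t x y
    by_cases ht : t ∈ D
    · rw [indicator_of_mem ht, hgD t ht, hgD t ht, ← Complex.sub_re,
        ← (hsumm t ht x).tsum_sub (hsumm t ht y)]
      have h3 : ∀ z : ℂ, ‖z.re‖ₑ ≤ ‖z‖ₑ := fun z => by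
        rw [← ofReal_norm, ← ofReal_norm]
        exact ENNReal.ofReal_le_ofReal (Complex.abs_re_le_norm z)
      refine (h3 _).trans (enorm_tsum_le_tsum_enorm.trans ?_)
      rw [hS, mul_assoc, ← ENNReal.tsum_mul_right, ← ENNReal.tsum_mul_left]
      refine ENNReal.tsum_le_tsum fun k => ?_
      have h4 := (hC k _ (hslice t ht).1 ((hslice t ht).2.2.1 k)).2 x y
      rw [ENNReal.ofReal_mul (by positivity), ENNReal.ofReal_mul hC0, ofReal_norm] at h4
      rw [ha, hBf, hB, hB]
      refine h4.trans (le_of_eq ?_)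
      ring
    · simp [hgDc t ht]
  · intro t x
    by_cases ht : t ∈ D
    · rw [indicator_of_mem ht, hgD t ht]
      have h3 : ∀ z : ℂ, ‖z.re‖ₑ ≤ ‖z‖ₑ := fun z => by
        rw [← ofReal_norm, ← ofReal_norm]
        exact ENNReal.ofReal_le_ofReal (Complex.abs_re_le_norm z)
      refine (h3 _).trans (enorm_tsum_le_tsum_enorm.trans ?_)
      exact ENNReal.tsum_le_tsum fun k => hBa t ht k x
    · simp [hgDc t ht]
  · intro t
    by_cases ht : t ∈ D
    · rw [indicator_of_mem ht, indicator_of_mem ht]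
      exact ⟨ENNReal.mul_lt_top ENNReal.ofReal_lt_top (hDp t ht).2,
        (haS t).trans_lt (hDp t ht).2⟩
    · simp [ht]
  · intro t
    by_cases ht : t ∈ D
    · rw [eLpNorm_congr_ae (hgf₀ t ht)]
      refine le_trans (le_of_eq ?_) (hslice t ht).2.1
      refine eLpNorm_congr_norm_ae (Eventually.of_forall fun x => ?_)
      simp
    · simp [hgDc t ht]
  · rw [lintegral_indicator hDm, lintegral_const_mul' _ _ ENNReal.ofReal_ne_top]
    refine ENNReal.mul_lt_top ENNReal.ofReal_lt_top ?_
    exact (lintegral_mono_set sdiff_subset).trans_lt hSint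
  · intro p hp
    have hp0 : 0 < p := by linarith
    set K : ℝ≥0∞ := (N ^ (1 - 1 / p) * ∑' k : ℕ, ENNReal.ofReal ((2 ^ (-(1 / p))) ^ k)) ^ p with hK
    have hKt : K ≠ ⊤ := by
      refine ENNReal.rpow_ne_top_of_nonneg hp0.le (ENNReal.mul_ne_top ?_ ?_)
      · refine ENNReal.rpow_ne_top_of_nonneg ?_ hNt
        rw [sub_nonneg, div_le_one hp0]; exact hp
      · have h3 : (2 : ℝ) ^ (-(1 / p)) < 1 :=
          Real.rpow_lt_one_of_one_lt_of_neg one_lt_two (by simpa using hp0)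
        have h4 := summable_geometric_of_lt_one (by positivity) h3
        rw [← ENNReal.ofReal_tsum_of_nonneg (fun k => by positivity) h4]
        exact ENNReal.ofReal_ne_top
    have hle : ∀ t, (D.indicator (fun t => ∑' k, a k t) t) ^ p ≤ D.indicator (fun t => S t * K) t := by
      intro t
      by_cases ht : t ∈ D
      · rw [indicator_of_mem ht, indicator_of_mem ht]
        exact tsum_rpow_le (hS t).ge (haN t ht) hp
      · simp [ht, hp0]
    refine (lintegral_mono hle).trans_lt ?_
    rw [lintegral_indicator hDm, lintegral_mul_const' _ _ hKt]
    exact ENNReal.mul_lt_top ((lintegral_mono_set sdiff_subset).trans_lt hSint) hKt.lt_top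

end Representative

/-! ## Lipschitz test functions -/

instance : (volume : Measure (ℝ × Plane)).IsAddHaarMeasure := by
  rw [Measure.volume_eq_prod]; infer_instance

/-- The derivative falls on ψ and not on the kernel: by Rademacher's theorem ψ is differentiable at
z - t for almost every t, and its Lipschitz constant dominates the difference quotients. -/
lemma fderiv_convolution_lipschitz {ρ : ℝ × Plane → ℝ} (hρ : Continuous ρ)
    (hρc : HasCompactSupport ρ) {ψ : ℝ × Plane → ℝ} {C : NNReal} (hψ : LipschitzWith C ψ)
    (z : ℝ × Plane) :
    HasFDerivAt (convolution ρ ψ (ContinuousLinearMap.lsmul ℝ ℝ) volume)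
      (convolution ρ (fderiv ℝ ψ) (ContinuousLinearMap.lsmul ℝ ℝ) volume z) z := by
  have hm : ∀ z : ℝ × Plane, Continuous fun t => ρ t • ψ (z - t) := fun z =>
    hρ.smul (hψ.continuous.comp (by fun_prop))
  have hρi : Integrable ρ := hρ.integrable_of_hasCompactSupport hρc
  refine (hasFDerivAt_integral_of_dominated_loc_of_lip (bound := fun t => |ρ t| * C)
    (F := fun z t => ρ t • ψ (z - t)) (F' := fun t => ρ t • fderiv ℝ ψ (z - t)) univ_mem
    (Eventually.of_forall fun z => (hm z).aestronglyMeasurable)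
    ((hm z).integrable_of_hasCompactSupport hρc.smul_right) ?_ ?_ ?_ ?_).2
  · refine hρ.aestronglyMeasurable.smul ?_
    have h1 : Measurable (fderiv ℝ ψ) := measurable_fderiv ℝ ψ
    exact (h1.comp (measurable_const.sub measurable_id)).aestronglyMeasurable
  · refine Eventually.of_forall fun t => LipschitzOnWith.of_dist_le_mul fun x _ y _ => ?_
    have h1 := hψ.dist_le_mul (x - t) (y - t)
    rw [dist_sub_right] at h1
    rw [dist_smul₀, Real.coe_nnabs, abs_of_nonneg (a := |ρ t| * C) (by positivity), mul_assoc,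
      Real.norm_eq_abs]
    exact mul_le_mul_of_nonneg_left h1 (abs_nonneg _)
  · exact hρi.abs.mul_const _
  · have h1 : ∀ᵐ t : ℝ × Plane, DifferentiableAt ℝ ψ (z - t) :=
      (Measure.measurePreserving_sub_left volume z).quasiMeasurePreserving.ae
        hψ.ae_differentiableAt
    filter_upwards [h1] with t ht
    have h2 : HasFDerivAt (fun x => ψ (x - t)) (fderiv ℝ ψ (z - t)) z := by
      simpa using! ht.hasFDerivAt.comp z ((hasFDerivAt_id z).sub_const t)
    exact h2.const_smul (ρ t)

/-- A weak conservation law that holds for smooth compactly supported test functions holds for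
Lipschitz continuous ones. -/
theorem integral_fderiv_lipschitz_eq_zero {Ω : Set (ℝ × Plane)} (hΩ : IsOpen Ω)
    {a : ℝ × Plane → ℝ × Plane} (ha : ∀ K, IsCompact K → K ⊆ Ω → IntegrableOn a K)
    (hw : ∀ ψ : ℝ × Plane → ℝ, ContDiff ℝ ∞ ψ → HasCompactSupport ψ → tsupport ψ ⊆ Ω →
      ∫ z, fderiv ℝ ψ z (a z) = 0)
    {ψ : ℝ × Plane → ℝ} {C : NNReal} (hψ : LipschitzWith C ψ) (hc : HasCompactSupport ψ)
    (hs : tsupport ψ ⊆ Ω) : ∫ z, fderiv ℝ ψ z (a z) = 0 := by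
  -- The margin δ keeps the supports of all fine enough mollifications inside one compact subset of
  -- Ω, where the field a is integrable.
  obtain ⟨δ, hδ, hδΩ⟩ := hc.isCompact.exists_cthickening_subset_open hΩ hs
  set K := Metric.cthickening δ (tsupport ψ) with hK
  have hKc : IsCompact K := hc.isCompact.cthickening
  have hψK : tsupport ψ ⊆ K := Metric.self_subset_cthickening _
  let b : ℕ → ContDiffBump (0 : ℝ × Plane) := fun n =>
    ⟨((n : ℝ) + 1)⁻¹ / 2, ((n : ℝ) + 1)⁻¹, by positivity, half_lt_self (by positivity)⟩
  have hbl : Tendsto (fun n => (b n).rOut) atTop (𝓝 0) := tendsto_inv_atTop_zero.comp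
    (tendsto_atTop_add_const_right _ _ tendsto_natCast_atTop_atTop)
  let ψn : ℕ → ℝ × Plane → ℝ := fun n =>
    convolution ((b n).normed volume) ψ (ContinuousLinearMap.lsmul ℝ ℝ) volume
  have hder : ∀ n z, fderiv ℝ (ψn n) z
      = convolution ((b n).normed volume) (fderiv ℝ ψ) (ContinuousLinearMap.lsmul ℝ ℝ) volume z :=
    fun n z => (fderiv_convolution_lipschitz (b n).continuous_normed
      (b n).hasCompactSupport_normed hψ z).fderiv
  have hsupp : ∀ᶠ n in atTop, tsupport (ψn n) ⊆ K := by
    filter_upwards [hbl.eventually_le_const hδ] with n hn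
    refine closure_minimal ?_ Metric.isClosed_cthickening
    refine (support_convolution_subset (ContinuousLinearMap.lsmul ℝ ℝ)).trans ?_
    rintro _ ⟨x, hx, y, hy, rfl⟩
    rw [(b n).support_normed_eq, mem_ball_zero_iff] at hx
    refine Metric.mem_cthickening_of_dist_le (x + y) y δ _ (subset_tsupport _ hy) ?_
    rw [dist_eq_norm, add_sub_cancel_right]
    exact hx.le.trans hn
  have hzero : ∀ᶠ n in atTop, ∫ z in K, fderiv ℝ (ψn n) z (a z) = 0 := by
    filter_upwards [hsupp] with n hn
    rw [setIntegral_eq_integral_of_forall_compl_eq_zero]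
    · refine hw _ ?_ (hKc.of_isClosed_subset (isClosed_tsupport _) hn) (hn.trans hδΩ)
      exact (b n).hasCompactSupport_normed.contDiff_convolution_left _ (b n).contDiff_normed
        (hψ.continuous.locallyIntegrable)
    · intro z hz
      have h1 : z ∉ tsupport (fderiv ℝ (ψn n)) := fun h => hz (hn (tsupport_fderiv_subset ℝ h))
      rw [image_eq_zero_of_notMem_tsupport h1]
      rfl
  have hbd : ∀ z, ‖fderiv ℝ ψ z‖ ≤ C := fun z => norm_fderiv_le_of_lipschitz ℝ hψ
  have hloc : LocallyIntegrable (fderiv ℝ ψ) (volume : Measure (ℝ × Plane)) := by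
    have : MemLp (fderiv ℝ ψ) ⊤ (volume : Measure (ℝ × Plane)) :=
      memLp_top_of_bound (measurable_fderiv ℝ ψ).aestronglyMeasurable C (Eventually.of_forall hbd)
    exact this.locallyIntegrable le_top
  have hlim : Tendsto (fun n => ∫ z in K, fderiv ℝ (ψn n) z (a z)) atTop
      (𝓝 (∫ z in K, fderiv ℝ ψ z (a z))) := by
    have haK := ha K hKc hδΩ
    refine tendsto_integral_of_dominated_convergence (fun z => C * ‖a z‖) (fun n => ?_)
      (haK.norm.const_mul _) (fun n => Eventually.of_forall fun z => ?_) ?_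
    · exact (ContinuousLinearMap.apply ℝ ℝ).aestronglyMeasurable_comp₂ haK.1
        (measurable_fderiv ℝ _).aestronglyMeasurable
    · refine (ContinuousLinearMap.le_opNorm _ _).trans ?_
      refine mul_le_mul_of_nonneg_right ?_ (norm_nonneg _)
      rw [hder]
      refine (norm_integral_le_of_norm_le (g := fun t => (b n).normed volume t * C)
        ((b n).integrable_normed.mul_const _) (Eventually.of_forall fun t => ?_)).trans ?_
      · simp only [ContinuousLinearMap.lsmul_apply]
        rw [norm_smul, Real.norm_of_nonneg ((b n).nonneg_normed t)]
        exact mul_le_mul_of_nonneg_left (hbd _) ((b n).nonneg_normed t)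
      · rw [integral_mul_const, (b n).integral_normed, one_mul]
    -- The gradients of the mollifications are averages of the bounded gradient of ψ, so they
    -- converge at almost every point and C bounds them all.
    · refine ae_restrict_of_ae ?_
      have h1 := ContDiffBump.ae_convolution_tendsto_right_of_locallyIntegrable (φ := b) (K := 2)
        (μ := (volume : Measure (ℝ × Plane))) hbl
        (Eventually.of_forall fun n => by simp only [b]; linarith) hloc
      filter_upwards [h1] with z hz
      simp only [hder]
      exact ((ContinuousLinearMap.apply ℝ ℝ (a z)).continuous.tendsto _).comp hz
  rw [← setIntegral_eq_integral_of_forall_compl_eq_zero (s := K)]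
  · exact tendsto_nhds_unique hlim (tendsto_const_nhds.congr' (hzero.mono fun n hn => hn.symm))
  · intro z hz
    have h1 : z ∉ tsupport (fderiv ℝ ψ) := fun h => hz (hψK (tsupport_fderiv_subset ℝ h))
    rw [image_eq_zero_of_notMem_tsupport h1]
    rfl

/-! ## The effect of a change of variables on gradients -/

/-- Area is a multiple of the two-dimensional Hausdorff measure, and S has a K-Lipschitz inverse on
its range; the exponent 2 is the dimension. -/
lemma volume_preimage_le_of_antilipschitz {S : Plane → Plane} {K : NNReal}
    (hS : AntilipschitzWith K S) (A : Set Plane) :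
    volume (S ⁻¹' A) ≤ (K : ℝ≥0∞) ^ 2 * volume A := by
  have h1 := hS.hausdorffMeasure_preimage_le (d := 2) (by norm_num) A
  rw [← EuclideanSpace.euclideanHausdorffMeasure_eq_volume,
    Measure.euclideanHausdorffMeasure_def]
  simp only [Measure.smul_apply, Nat.cast_ofNat, smul_eq_mul, ENNReal.smul_def]
  rw [mul_left_comm]
  refine mul_le_mul_right (h1.trans_eq ?_) _
  norm_num

lemma map_le_of_antilipschitz {S : Plane → Plane} {K : NNReal} (hS : AntilipschitzWith K S)
    (hm : Measurable S) :
    (volume : Measure Plane).map S ≤ ((K : ℝ≥0∞) ^ 2) • (volume : Measure Plane) := by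
  refine Measure.le_iff.2 fun A hA => ?_
  rw [Measure.map_apply hm hA, Measure.smul_apply, smul_eq_mul]
  exact volume_preimage_le_of_antilipschitz hS A

lemma ae_comp_of_antilipschitz {S : Plane → Plane} {K : NNReal} (hS : AntilipschitzWith K S)
    (hm : Measurable S) {p : Plane → Prop} (hp : ∀ᵐ x, p x) : ∀ᵐ x, p (S x) := by
  refine ae_of_ae_map hm.aemeasurable ?_
  refine (Measure.absolutelyContinuous_of_le (map_le_of_antilipschitz hS hm)).ae_le ?_
  exact Measure.ae_smul_measure hp _

/-- The `L²` norm of the gradient of a Lipschitz function, composed with a bi-Lipschitz map. -/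
lemma eLpNorm_fderiv_comp_le {W : Plane → ℝ} {C K₁ K₂ : NNReal} {S : Plane → Plane}
    (hW : LipschitzWith C W) (hS : LipschitzWith K₁ S) (hS' : AntilipschitzWith K₂ S) :
    eLpNorm (fderiv ℝ (W ∘ S)) 2 volume ≤ K₁ * K₂ * eLpNorm (fderiv ℝ W) 2 volume := by
  have hm : Measurable S := hS.continuous.measurable
  have h1 : ∀ᵐ x, ‖fderiv ℝ (W ∘ S) x‖ ≤ K₁ * ‖fderiv ℝ W (S x)‖ := by
    filter_upwards [ae_comp_of_antilipschitz hS' hm hW.ae_differentiableAt,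
      hS.ae_differentiableAt] with x hx hx'
    rw [fderiv_comp x hx hx', mul_comm]
    exact (ContinuousLinearMap.opNorm_comp_le _ _).trans
      (mul_le_mul_of_nonneg_left (norm_fderiv_le_of_lipschitz ℝ hS) (norm_nonneg _))
  have hg : AEStronglyMeasurable (fderiv ℝ W) ((volume : Measure Plane).map S) :=
    (measurable_fderiv ℝ W).aestronglyMeasurable
  calc eLpNorm (fderiv ℝ (W ∘ S)) 2 volume
      ≤ ENNReal.ofReal K₁ * eLpNorm (fderiv ℝ W ∘ S) 2 volume :=
        eLpNorm_le_mul_eLpNorm_of_ae_le_mul h1 2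
    _ ≤ ENNReal.ofReal K₁ * (K₂ * eLpNorm (fderiv ℝ W) 2 volume) := by
        refine mul_le_mul_right ?_ _
        rw [← eLpNorm_map_measure hg hm.aemeasurable]
        refine (eLpNorm_mono_measure _ (map_le_of_antilipschitz hS' hm)).trans ?_
        -- The square root in the L² norm turns the area factor K₂² into K₂.
        rw [eLpNorm_smul_measure_of_ne_top (by norm_num)]
        refine le_of_eq ?_
        rw [smul_eq_mul, ← ENNReal.rpow_natCast, ← ENNReal.rpow_mul]
        norm_num
    _ = _ := by rw [ENNReal.ofReal_coe_nnreal, mul_assoc]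

lemma id_add_lipschitz {U : Plane → Plane} {m : NNReal} (hU : LipschitzWith m U) :
    LipschitzWith (1 + m) fun x => x + U x := LipschitzWith.id.add hU

/-- The inverse has Lipschitz constant 1 / (1 - m) ≤ 1 + 2m ≤ e^{2m} for 0 ≤ m ≤ 1/2. The
exponential form lets the constants of successive time steps multiply to the exponential of an
integral. -/
lemma id_add_antilipschitz {U : Plane → Plane} {m : ℝ} (hm : m ≤ 1 / 2)
    (hU : ∀ x y, ‖U x - U y‖ ≤ m * ‖x - y‖) :
    AntilipschitzWith (Real.exp (2 * m)).toNNReal fun x => x + U x := by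
  by_cases h0 : m < 0
  · refine AntilipschitzWith.of_le_mul_dist fun x y => ?_
    have h1 := hU x y
    have h2 : dist x y ≤ 0 := by
      rw [dist_eq_norm]; nlinarith [norm_nonneg (U x - U y), norm_nonneg (x - y)]
    exact h2.trans (by positivity)
  push Not at h0
  refine AntilipschitzWith.of_le_mul_dist fun x y => ?_
  have h1 : 1 + 2 * m ≤ Real.exp (2 * m) := by linarith [Real.add_one_le_exp (2 * m)]
  rw [Real.coe_toNNReal _ (Real.exp_pos _).le, dist_eq_norm, dist_eq_norm]
  have h2 : ‖x - y‖ - ‖U x - U y‖ ≤ ‖x + U x - (y + U y)‖ := by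
    have := norm_sub_norm_le (x - y) (-(U x - U y))
    rw [norm_neg] at this
    refine this.trans_eq ?_
    congr 1; abel
  have h3 := hU x y
  have h4 : (1 - m) * ‖x - y‖ ≤ ‖x + U x - (y + U y)‖ := by linarith
  calc ‖x - y‖ ≤ (1 + 2 * m) * ((1 - m) * ‖x - y‖) := by
        have : 0 ≤ m * (1 - 2 * m) * ‖x - y‖ :=
          mul_nonneg (mul_nonneg h0 (by linarith)) (norm_nonneg _)
        nlinarith
    _ ≤ _ := mul_le_mul h1 h4 (mul_nonneg (by linarith) (norm_nonneg _)) (Real.exp_pos _).le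

/-- The derivative of a Lipschitz function of a differentiable map. -/
lemma norm_fderiv_lipschitz_comp_le {E F : Type*} [NormedAddCommGroup E] [NormedSpace ℝ E]
    [NormedAddCommGroup F] [NormedSpace ℝ F] {W : F → ℝ} {C : NNReal} (hW : LipschitzWith C W)
    {S : E → F} {z : E} (hS : DifferentiableAt ℝ S z) (e : E) :
    ‖fderiv ℝ (W ∘ S) z e‖ ≤ C * ‖fderiv ℝ S z e‖ := by
  by_cases h : DifferentiableAt ℝ (W ∘ S) z
  swap
  · rw [fderiv_zero_of_not_differentiableAt h]
    simp only [zero_apply, norm_zero]; positivity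
  have hl : HasDerivAt (fun ε : ℝ => z + ε • e) e 0 := by
    simpa using ((hasDerivAt_id (0 : ℝ)).smul_const e).const_add z
  have h1 : HasDerivAt (fun ε : ℝ => (W ∘ S) (z + ε • e)) (fderiv ℝ (W ∘ S) z e) 0 :=
    HasFDerivAt.comp_hasDerivAt (x := (0 : ℝ)) (l := W ∘ S) (f := fun ε : ℝ => z + ε • e)
      (by simpa using h.hasFDerivAt) hl
  have h2 : HasDerivAt (fun ε : ℝ => S (z + ε • e)) (fderiv ℝ S z e) 0 :=
    HasFDerivAt.comp_hasDerivAt (x := (0 : ℝ)) (l := S) (f := fun ε : ℝ => z + ε • e)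
      (by simpa using hS.hasFDerivAt) hl
  -- W need not be differentiable at S z, so the chain rule is replaced by a comparison of
  -- difference quotients.
  refine le_of_tendsto_of_tendsto h1.tendsto_slope_zero.norm
    (h2.tendsto_slope_zero.norm.const_mul (C : ℝ)) (Eventually.of_forall fun ε => ?_)
  simp only [norm_smul, zero_add, Function.comp_apply]
  rw [mul_left_comm]
  refine mul_le_mul_of_nonneg_left ?_ (norm_nonneg _)
  have := hW.dist_le_mul (S (z + ε • e)) (S (z + (0 : ℝ) • e))
  simpa only [dist_eq_norm] using this

/-! ## Approximate transport of a function by a rough velocity field -/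

/-- A bounded measurable velocity field that is Lipschitz continuous in space. -/
structure VelocityBounds (v : ℝ × Plane → Plane) (a l : ℝ → ℝ) (R : ℝ) : Prop where
  meas : Measurable v
  meas_speed : Measurable a
  meas_lip : Measurable l
  norm_le : ∀ s x, ‖v (s, x)‖ ≤ a s
  lip : ∀ s x y, ‖v (s, x) - v (s, y)‖ ≤ l s * ‖x - y‖
  speed_le : ∀ s, a s ≤ R
  lip_le : ∀ s, l s ≤ R
  lip_nonneg : ∀ s, 0 ≤ l s

namespace VelocityBounds

variable {v : ℝ × Plane → Plane} {a l : ℝ → ℝ} {R : ℝ}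

lemma speed_nonneg (hv : VelocityBounds v a l R) (s : ℝ) : 0 ≤ a s :=
  (norm_nonneg _).trans (hv.norm_le s 0)

lemma bound_nonneg (hv : VelocityBounds v a l R) : 0 ≤ R := (hv.speed_nonneg 0).trans (hv.speed_le 0)

lemma locallyIntegrable (hv : VelocityBounds v a l R) (x : Plane) :
    LocallyIntegrable (fun r => v (r, x)) := by
  have : MemLp (fun r => v (r, x)) ⊤ (volume : Measure ℝ) :=
    memLp_top_of_bound (hv.meas.comp (measurable_id.prodMk measurable_const)).aestronglyMeasurable R
      (Eventually.of_forall fun r => (hv.norm_le r x).trans (hv.speed_le r))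
  exact this.locallyIntegrable le_top

lemma intervalIntegrable (hv : VelocityBounds v a l R) (x : Plane) (p q : ℝ) :
    IntervalIntegrable (fun r => v (r, x)) volume p q :=
  intervalIntegrable_iff.2 (((hv.locallyIntegrable x).integrableOn_isCompact
    isCompact_uIcc).mono_set uIoc_subset_uIcc)

lemma intervalIntegrable_speed (hv : VelocityBounds v a l R) (p q : ℝ) :
    IntervalIntegrable a volume p q := by
  have : MemLp a ⊤ (volume : Measure ℝ) :=
    memLp_top_of_bound hv.meas_speed.aestronglyMeasurable R
      (Eventually.of_forall fun r => by
        rw [Real.norm_of_nonneg (hv.speed_nonneg r)]; exact hv.speed_le r)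
  exact intervalIntegrable_iff.2 (((this.locallyIntegrable le_top).integrableOn_isCompact
    isCompact_uIcc).mono_set uIoc_subset_uIcc)

lemma intervalIntegrable_lip (hv : VelocityBounds v a l R) (p q : ℝ) :
    IntervalIntegrable l volume p q := by
  have : MemLp l ⊤ (volume : Measure ℝ) :=
    memLp_top_of_bound hv.meas_lip.aestronglyMeasurable R
      (Eventually.of_forall fun r => by
        rw [Real.norm_of_nonneg (hv.lip_nonneg r)]; exact hv.lip_le r)
  exact intervalIntegrable_iff.2 (((this.locallyIntegrable le_top).integrableOn_isCompact
    isCompact_uIcc).mono_set uIoc_subset_uIcc)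

lemma integral_lip_le (hv : VelocityBounds v a l R) {p q : ℝ} (h : p ≤ q) :
    ∫ r in p..q, l r ≤ (q - p) * R := by
  have := intervalIntegral.integral_mono_on h (hv.intervalIntegrable_lip p q)
    (intervalIntegrable_const (c := R)) fun r _ => hv.lip_le r
  simpa using this

end VelocityBounds

/-- Truncation of a time to the interval `[p, q]`. -/
def clampTime (p q s : ℝ) : ℝ := max p (min s q)

lemma dist_clampTime (p q s s' : ℝ) : |clampTime p q s - clampTime p q s'| ≤ |s - s'| := by
  unfold clampTime
  refine (abs_max_sub_max_le_max _ _ _ _).trans ?_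
  refine max_le (by simp) ((abs_min_sub_min_le_max _ _ _ _).trans (by simp))

lemma le_clampTime (p q s : ℝ) : p ≤ clampTime p q s := le_max_left _ _

lemma clampTime_le {p q : ℝ} (h : p ≤ q) (s : ℝ) : clampTime p q s ≤ q :=
  max_le h (min_le_right _ _)

/-- The displacement of a particle during the part of `[p, q]` after the time `z.1`. -/
def displacement (v : ℝ × Plane → Plane) (p q : ℝ) (z : ℝ × Plane) : Plane :=
  ∫ r in (clampTime p q z.1)..q, v (r, z.2)

section

variable {v : ℝ × Plane → Plane} {a l : ℝ → ℝ} {R p q : ℝ}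

lemma displacement_of_ge (hpq : p ≤ q) {s : ℝ} (hs : q ≤ s) (x : Plane) :
    displacement v p q (s, x) = 0 := by
  simp [displacement, clampTime, min_eq_right hs, max_eq_right hpq]

lemma displacement_of_le (hpq : p ≤ q) {s : ℝ} (hs : s ≤ p) (x : Plane) :
    displacement v p q (s, x) = displacement v p q (p, x) := by
  simp [displacement, clampTime, min_eq_left hpq, min_eq_left (hs.trans hpq), hs]

lemma norm_displacement_le (hv : VelocityBounds v a l R) (hpq : p ≤ q) (z : ℝ × Plane) :
    ‖displacement v p q z‖ ≤ ∫ r in p..q, a r := by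
  refine (intervalIntegral.norm_integral_le_of_norm_le (clampTime_le hpq _)
    (Eventually.of_forall fun r _ => hv.norm_le r z.2) (hv.intervalIntegrable_speed _ _)).trans ?_
  rw [← intervalIntegral.integral_add_adjacent_intervals (hv.intervalIntegrable_speed p
    (clampTime p q z.1)) (hv.intervalIntegrable_speed _ q)]
  refine le_add_of_nonneg_left ?_
  exact intervalIntegral.integral_nonneg (le_clampTime _ _ _) fun r _ => hv.speed_nonneg r

lemma norm_displacement_sub_space_le (hv : VelocityBounds v a l R) (hpq : p ≤ q) (s : ℝ)
    (x y : Plane) :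
    ‖displacement v p q (s, x) - displacement v p q (s, y)‖ ≤ (∫ r in p..q, l r) * ‖x - y‖ := by
  unfold displacement
  rw [← intervalIntegral.integral_sub (hv.intervalIntegrable _ _ _) (hv.intervalIntegrable _ _ _)]
  refine (intervalIntegral.norm_integral_le_of_norm_le (clampTime_le hpq _)
    (Eventually.of_forall fun r _ => hv.lip r x y)
    ((hv.intervalIntegrable_lip _ _).mul_const _)).trans ?_
  rw [intervalIntegral.integral_mul_const]
  refine mul_le_mul_of_nonneg_right ?_ (norm_nonneg _)
  rw [← intervalIntegral.integral_add_adjacent_intervals (hv.intervalIntegrable_lip p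
    (clampTime p q s)) (hv.intervalIntegrable_lip _ q)]
  refine le_add_of_nonneg_left ?_
  exact intervalIntegral.integral_nonneg (le_clampTime _ _ _) fun r _ => hv.lip_nonneg r

lemma norm_displacement_sub_time_le (hv : VelocityBounds v a l R) (s s' : ℝ) (x : Plane) :
    ‖displacement v p q (s, x) - displacement v p q (s', x)‖ ≤ R * |s - s'| := by
  unfold displacement
  rw [intervalIntegral.integral_interval_sub_interval_comm' (hv.intervalIntegrable _ _ _)
    (hv.intervalIntegrable _ _ _) (hv.intervalIntegrable _ _ _)]
  simp only [intervalIntegral.integral_same, zero_sub, norm_neg]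
  refine (intervalIntegral.norm_integral_le_of_norm_le_const (C := R)
    fun r _ => (hv.norm_le r x).trans (hv.speed_le r)).trans ?_
  refine mul_le_mul_of_nonneg_left ?_ hv.bound_nonneg
  exact dist_clampTime p q s s'

lemma integral_lip_nonneg (hv : VelocityBounds v a l R) (hpq : p ≤ q) : 0 ≤ ∫ r in p..q, l r :=
  intervalIntegral.integral_nonneg hpq fun r _ => hv.lip_nonneg r

lemma displacement_lipschitz (hv : VelocityBounds v a l R) (hpq : p ≤ q) :
    LipschitzWith (R + ∫ r in p..q, l r).toNNReal (displacement v p q) := by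
  have hm := integral_lip_nonneg hv hpq
  refine LipschitzWith.of_dist_le_mul fun z z' => ?_
  obtain ⟨s, x⟩ := z
  obtain ⟨s', x'⟩ := z'
  rw [Real.coe_toNNReal _ (add_nonneg hv.bound_nonneg hm), dist_eq_norm]
  have h1 : |s - s'| ≤ dist (s, x) (s', x') := le_max_left _ _
  have h2 : ‖x - x'‖ ≤ dist (s, x) (s', x') := by
    rw [← dist_eq_norm]; exact le_max_right _ _
  calc ‖displacement v p q (s, x) - displacement v p q (s', x')‖
      ≤ ‖displacement v p q (s, x) - displacement v p q (s', x)‖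
        + ‖displacement v p q (s', x) - displacement v p q (s', x')‖ :=
        norm_sub_le_norm_sub_add_norm_sub _ _ _
    _ ≤ R * |s - s'| + (∫ r in p..q, l r) * ‖x - x'‖ :=
        add_le_add (norm_displacement_sub_time_le hv _ _ _)
          (norm_displacement_sub_space_le hv hpq _ _ _)
    _ ≤ _ := by
        rw [add_mul]
        exact add_le_add (mul_le_mul_of_nonneg_left h1 hv.bound_nonneg)
          (mul_le_mul_of_nonneg_left h2 hm)

/-- Almost everywhere the displacement is transported up to a small error. -/
lemma ae_norm_fderiv_displacement_le (hv : VelocityBounds v a l R) (hpq : p ≤ q) :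
    ∀ᵐ z : ℝ × Plane, z.1 ∈ Ioo p q → DifferentiableAt ℝ (displacement v p q) z ∧
      ‖v z + fderiv ℝ (displacement v p q) z (1, v z)‖ ≤ (q - p) * R * R := by
  have hU := displacement_lipschitz hv hpq
  -- For fixed x, Lebesgue differentiation gives this at almost every time, the sign coming from the
  -- lower limit of the integral. Fubini turns this into almost every point of space-time.
  have hd : ∀ᵐ z : ℝ × Plane, z.1 ∈ Ioo p q → DifferentiableAt ℝ (displacement v p q) z →
      fderiv ℝ (displacement v p q) z (1, 0) = - v z := by
    have hms : MeasurableSet {z : ℝ × Plane | z.1 ∈ Ioo p q →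
        DifferentiableAt ℝ (displacement v p q) z →
        fderiv ℝ (displacement v p q) z (1, 0) = - v z} := by
      have h1 : MeasurableSet {z : ℝ × Plane | z.1 ∈ Ioo p q} := measurable_fst measurableSet_Ioo
      have h2 := measurableSet_of_differentiableAt ℝ (displacement v p q)
      have h3 : MeasurableSet {z | fderiv ℝ (displacement v p q) z (1, 0) = - v z} :=
        measurableSet_eq_fun (measurable_fderiv_apply_const ℝ _ _) hv.meas.neg
      exact h1.imp (h2.imp h3)
    rw [Measure.volume_eq_prod, Measure.ae_prod_iff_ae_ae hms]
    refine (Measure.ae_ae_comm (p := fun s x => s ∈ Ioo p q →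
        DifferentiableAt ℝ (displacement v p q) (s, x) →
        fderiv ℝ (displacement v p q) (s, x) (1, 0) = - v (s, x)) hms).2 ?_
    refine Eventually.of_forall fun x => ?_
    filter_upwards [LocallyIntegrable.ae_hasDerivAt_integral (hv.locallyIntegrable x)] with s hs hsI hdiff
    have h1 : HasDerivAt (fun r => displacement v p q (r, x))
        (fderiv ℝ (displacement v p q) (s, x) (1, 0)) s :=
      HasFDerivAt.comp_hasDerivAt (x := s) (l := displacement v p q)
        (f := fun r : ℝ => ((r, x) : ℝ × Plane)) hdiff.hasFDerivAt
        ((hasDerivAt_id s).prodMk (hasDerivAt_const s x))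
    have h2 : HasDerivAt (fun r => displacement v p q (r, x)) (- v (s, x)) s := by
      refine (hs q).neg.congr_of_eventuallyEq ?_
      filter_upwards [isOpen_Ioo.mem_nhds hsI] with r hr
      simp only [displacement, clampTime, Pi.neg_apply]
      rw [min_eq_left hr.2.le, max_eq_right hr.1.le, intervalIntegral.integral_symm]
    exact h1.unique h2
  filter_upwards [hd, hU.ae_differentiableAt] with z hz hdiff hI
  refine ⟨hdiff, ?_⟩
  -- The time derivative cancels v. What is left is the derivative of the displacement along v, at
  -- most its spatial Lipschitz constant (q - p) R times the speed R: quadratic in R but small with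
  -- the step.
  have h1 : ((1 : ℝ), v z) = (1, 0) + (0, v z) := by simp
  rw [h1, map_add, hz hI hdiff, add_neg_cancel_left]
  have h2 : HasDerivAt (fun ε : ℝ => displacement v p q (z + ε • (0, v z)))
      (fderiv ℝ (displacement v p q) z (0, v z)) 0 := by
    refine HasFDerivAt.comp_hasDerivAt (x := (0 : ℝ)) (l := displacement v p q)
      (f := fun ε : ℝ => z + ε • ((0 : ℝ), v z)) (by simpa using hdiff.hasFDerivAt) ?_
    simpa using ((hasDerivAt_id (0 : ℝ)).smul_const ((0 : ℝ), v z)).const_add z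
  refine (le_of_tendsto (b := (∫ r in p..q, l r) * ‖v z‖) h2.tendsto_slope_zero.norm ?_).trans ?_
  · filter_upwards [self_mem_nhdsWithin] with ε hε
    rw [norm_smul, zero_add]
    have h3 := norm_displacement_sub_space_le hv hpq z.1 (z.2 + ε • v z) z.2
    have h4 : z + ε • ((0 : ℝ), v z) = (z.1, z.2 + ε • v z) := by ext <;> simp
    have h5 : z + (0 : ℝ) • ((0 : ℝ), v z) = (z.1, z.2) := by simp
    rw [h4, h5, norm_inv]
    rw [add_sub_cancel_left, norm_smul] at h3
    have h6 : 0 < ‖ε‖ := norm_pos_iff.2 hε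
    rw [inv_mul_le_iff₀ h6]
    linarith
  · refine mul_le_mul (hv.integral_lip_le hpq) ?_ (norm_nonneg _)
      (mul_nonneg (by linarith) hv.bound_nonneg)
    exact (hv.norm_le z.1 z.2).trans (hv.speed_le _)

end

/-- Approximate solutions of the backward transport equation, by an Euler scheme with time
step `h`. -/
theorem exists_approx_transport {v : ℝ × Plane → Plane} {a l : ℝ → ℝ} {R : ℝ}
    (hv : VelocityBounds v a l R) {V : Plane → ℝ} {C : ℝ} (hC : 0 ≤ C)
    (hV : LipschitzWith C.toNNReal V) {ρ : ℝ} (hρ : ∀ x, ρ < ‖x‖ → V x = 0) (t : ℝ) {h : ℝ}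
    (h0 : 0 ≤ h) (hR : h * R ≤ 1 / 2) (j : ℕ) :
    ∃ ψ : ℝ × Plane → ℝ, (∃ D, LipschitzWith D ψ) ∧ (∀ s x, t ≤ s → ψ (s, x) = V x) ∧
      (∀ s x, s ≤ t - j * h → ψ (s, x) = ψ (t - j * h, x)) ∧
      (∀ s, LipschitzWith (C * Real.exp (∫ r in (t - j * h)..t, l r)).toNNReal
        fun x => ψ (s, x)) ∧
      (∀ s x, (ρ + ∫ r in (t - j * h)..t, a r) < ‖x‖ → ψ (s, x) = 0) ∧
      (∀ s, eLpNorm (fderiv ℝ fun x => ψ (s, x)) 2 volume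
        ≤ ENNReal.ofReal (Real.exp (3 * ∫ r in (t - j * h)..t, l r))
          * eLpNorm (fderiv ℝ V) 2 volume) ∧
      ∀ᵐ z : ℝ × Plane, z.1 ∈ Ioo (t - j * h) t → ‖fderiv ℝ ψ z (1, v z)‖
        ≤ C * Real.exp (∫ r in (t - j * h)..t, l r) * (h * R * R) := by
  -- Each step extends the approximate solution backward over one more time interval of length h, by
  -- moving particles along straight displacements with frozen space variable.
  induction j with
  | zero =>
    refine ⟨fun z => V z.2, ⟨_, hV.comp LipschitzWith.prod_snd⟩, fun _ _ _ => rfl, fun _ _ _ => rfl,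
      ?_, ?_, ?_, ?_⟩
    · simpa using hV
    · simpa using hρ
    · simp
    · refine Eventually.of_forall fun z hz => ?_
      simp only [Nat.cast_zero, zero_mul, sub_zero, Ioo_self, mem_empty_iff_false] at hz
  | succ j ih =>
    obtain ⟨ψ, ⟨D, hD⟩, h1, h2, h3, h4, h5, h6⟩ := ih
    obtain ⟨q, hq⟩ : ∃ q, q = t - j * h := ⟨_, rfl⟩
    obtain ⟨p, hp⟩ : ∃ p, p = t - (j + 1 : ℕ) * h := ⟨_, rfl⟩
    have hqp : q - p = h := by rw [hq, hp]; push_cast; ring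
    have hpq : p ≤ q := by linarith
    have hqt : q ≤ t := by rw [hq]; have : 0 ≤ (j : ℝ) * h := by positivity
                           linarith
    rw [← hp]
    rw [← hq] at h2 h3 h4 h5 h6
    have hla : (∫ r in p..t, l r) = (∫ r in p..q, l r) + ∫ r in q..t, l r :=
      (intervalIntegral.integral_add_adjacent_intervals (hv.intervalIntegrable_lip _ _)
        (hv.intervalIntegrable_lip _ _)).symm
    have haa : (∫ r in p..t, a r) = (∫ r in p..q, a r) + ∫ r in q..t, a r :=
      (intervalIntegral.integral_add_adjacent_intervals (hv.intervalIntegrable_speed _ _)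
        (hv.intervalIntegrable_speed _ _)).symm
    have hm0 : 0 ≤ ∫ r in p..q, l r := integral_lip_nonneg hv hpq
    have hm1 : ∫ r in p..q, l r ≤ 1 / 2 := (hv.integral_lip_le hpq).trans (by rwa [hqp])
    obtain ⟨m, hm⟩ : ∃ m, m = ∫ r in p..q, l r := ⟨_, rfl⟩
    rw [← hm] at hm0 hm1 hla
    have hUx : ∀ s x y, ‖displacement v p q (s, x) - displacement v p q (s, y)‖ ≤ m * ‖x - y‖ :=
      fun s x y => by rw [hm]; exact norm_displacement_sub_space_le hv hpq s x y
    have hSl : ∀ s, LipschitzWith (1 + m.toNNReal) fun x => x + displacement v p q (s, x) := by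
      refine fun s => id_add_lipschitz (LipschitzWith.of_dist_le_mul fun x y => ?_)
      rw [dist_eq_norm, dist_eq_norm, Real.coe_toNNReal _ hm0]
      exact hUx s x y
    have hSa : ∀ s, AntilipschitzWith (Real.exp (2 * m)).toNNReal
        fun x => x + displacement v p q (s, x) := fun s => id_add_antilipschitz hm1 (hUx s)
    have hem : 1 + m ≤ Real.exp m := by linarith [Real.add_one_le_exp m]
    have hW : ∀ s x, s ≤ q → ψ (s, x + displacement v p q (s, x))
        = ψ (q, x + displacement v p q (s, x)) := fun s x hs => h2 _ _ hs
    -- Before time q the old ψ is frozen, so there the new function is ψ(q, ·) composed with x ↦ x +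
    -- displacement. After q the displacement is zero and nothing changes.
    refine ⟨fun z => ψ (z.1, z.2 + displacement v p q z), ⟨_, hD.comp
      (LipschitzWith.prod_fst.prodMk (LipschitzWith.prod_snd.add
        (displacement_lipschitz hv hpq)))⟩, ?_, ?_, ?_, ?_, ?_, ?_⟩
    · intro s x hs
      simp only
      rw [displacement_of_ge hpq (hqt.trans hs), add_zero, h1 _ _ hs]
    · intro s x hs
      simp only
      rw [displacement_of_le hpq hs, h2 s _ (hs.trans hpq), h2 p _ hpq]
    · intro s
      refine ((h3 s).comp (hSl s)).weaken ?_
      rw [hla, ← NNReal.coe_le_coe, NNReal.coe_mul, NNReal.coe_add, NNReal.coe_one,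
        Real.coe_toNNReal _ hm0, Real.coe_toNNReal _ (by positivity),
        Real.coe_toNNReal _ (by positivity), Real.exp_add, mul_assoc]
      refine mul_le_mul_of_nonneg_left ?_ hC
      rw [mul_comm]
      exact mul_le_mul_of_nonneg_right hem (Real.exp_pos _).le
    · intro s x hx
      refine h4 s _ ?_
      have h7 := norm_displacement_le hv hpq (s, x)
      have h8 := norm_sub_le_norm_add x (displacement v p q (s, x))
      rw [haa] at hx
      linarith
    · intro s
      -- One step costs the Lipschitz constant 1 + m ≤ e^m of the map times the constant e^{2m} of
      -- its inverse; this is the origin of the 3 in the exponent.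
      refine (eLpNorm_fderiv_comp_le (h3 s) (hSl s) (hSa s)).trans ?_
      refine (mul_le_mul_right (h5 s) _).trans ?_
      rw [← mul_assoc]
      refine mul_le_mul_left ?_ _
      rw [← ENNReal.coe_mul, ← ENNReal.ofReal_coe_nnreal, ← ENNReal.ofReal_mul (by positivity)]
      refine ENNReal.ofReal_le_ofReal ?_
      rw [NNReal.coe_mul, NNReal.coe_add, NNReal.coe_one, Real.coe_toNNReal _ hm0,
        Real.coe_toNNReal _ (Real.exp_pos _).le, hla]
      have : Real.exp (3 * (m + ∫ r in q..t, l r))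
          = Real.exp m * Real.exp (2 * m) * Real.exp (3 * ∫ r in q..t, l r) := by
        rw [← Real.exp_add, ← Real.exp_add]; congr 1; ring
      rw [this]
      gcongr
    -- The two formulas for the new function meet at time q, a null set, which can be discarded.
    · have hne : ∀ᵐ z : ℝ × Plane, z.1 ≠ q := by
        have : ∀ᵐ s : ℝ, s ≠ q := by simp [ae_iff]
        rw [Measure.volume_eq_prod]
        exact Measure.quasiMeasurePreserving_fst.ae this
      have hexp : Real.exp (∫ r in q..t, l r) ≤ Real.exp (∫ r in p..t, l r) := by
        rw [hla]; exact Real.exp_le_exp.2 (by linarith)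
      have hR0 := hv.bound_nonneg
      filter_upwards [h6, ae_norm_fderiv_displacement_le hv hpq, hne] with z hz1 hz2 hne hz
      rcases lt_or_gt_of_ne hne with hlt | hgt
      · obtain ⟨hd, hle⟩ := hz2 ⟨hz.1, hlt⟩
        have heq : (fun z : ℝ × Plane => ψ (z.1, z.2 + displacement v p q z)) =ᶠ[𝓝 z]
            (fun x => ψ (q, x)) ∘ fun z => z.2 + displacement v p q z := by
          filter_upwards [(isOpen_Iio.preimage continuous_fst).mem_nhds
            (show z ∈ Prod.fst ⁻¹' Iio q from hlt)] with y hy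
          exact h2 _ _ (le_of_lt hy)
        rw [heq.fderiv_eq]
        have hS : HasFDerivAt (fun z : ℝ × Plane => z.2 + displacement v p q z)
          (ContinuousLinearMap.snd ℝ ℝ Plane + fderiv ℝ (displacement v p q) z) z :=
          hasFDerivAt_snd.add hd.hasFDerivAt
        refine (norm_fderiv_lipschitz_comp_le (h3 q) hS.differentiableAt _).trans ?_
        rw [hS.fderiv, Real.coe_toNNReal _ (by positivity)]
        rw [hqp] at hle
        refine mul_le_mul (mul_le_mul_of_nonneg_left hexp hC) ?_ (norm_nonneg _) (by positivity)
        simpa using hle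
      · have heq : (fun z : ℝ × Plane => ψ (z.1, z.2 + displacement v p q z)) =ᶠ[𝓝 z] ψ := by
          filter_upwards [(isOpen_Ioi.preimage continuous_fst).mem_nhds
            (show z ∈ Prod.fst ⁻¹' Ioi q from hgt)] with y hy
          rw [show y = (y.1, y.2) from rfl, displacement_of_ge hpq (le_of_lt hy), add_zero]
        rw [heq.fderiv_eq]
        refine (hz1 ⟨hgt, hz.2⟩).trans ?_
        gcongr

/-! ## Weak conservation laws tested with a ramp in time -/

/-- A piecewise linear function of time which is `1` on `[-1, t - δ]` and vanishes outside
`[-2, t]`. -/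
def ramp (t δ s : ℝ) : ℝ := max 0 (min 1 (min (δ⁻¹ * (t - s)) (s + 2)))

lemma ramp_nonneg (t δ s : ℝ) : 0 ≤ ramp t δ s := le_max_left _ _

lemma ramp_le_one (t δ s : ℝ) : ramp t δ s ≤ 1 := max_le zero_le_one (min_le_left _ _)

lemma ramp_of_ge {t δ s : ℝ} (hδ : 0 < δ) (h : t ≤ s) : ramp t δ s = 0 := by
  refine max_eq_left ((min_le_right _ _).trans ((min_le_left _ _).trans ?_))
  exact mul_nonpos_of_nonneg_of_nonpos (by positivity) (by linarith)

lemma ramp_of_le {t δ s : ℝ} (h : s ≤ -2) : ramp t δ s = 0 :=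
  max_eq_left ((min_le_right _ _).trans ((min_le_right _ _).trans (by linarith)))

lemma ramp_eq_one {t δ s : ℝ} (hδ : 0 < δ) (h : -1 ≤ s) (h' : s ≤ t - δ) : ramp t δ s = 1 := by
  have h1 : 1 ≤ δ⁻¹ * (t - s) := by
    rw [le_inv_mul_iff₀ hδ]; linarith
  unfold ramp
  rw [min_eq_left (le_min h1 (by linarith)), max_eq_right zero_le_one]

lemma ramp_eq {t δ s : ℝ} (hδ : 0 < δ) (h : -1 ≤ s) (h1 : t - δ ≤ s) (h2 : s ≤ t) :
    ramp t δ s = δ⁻¹ * (t - s) := by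
  have h3 : δ⁻¹ * (t - s) ≤ 1 := by
    rw [inv_mul_le_iff₀ hδ]; linarith
  have h4 : 0 ≤ δ⁻¹ * (t - s) := mul_nonneg (by positivity) (by linarith)
  unfold ramp
  rw [min_eq_left (h3.trans (by linarith)), min_eq_right h3, max_eq_right h4]

lemma abs_ramp_sub_le {t δ : ℝ} (hδ : 0 < δ) (s s' : ℝ) :
    |ramp t δ s - ramp t δ s'| ≤ (δ⁻¹ + 1) * |s - s'| := by
  have hδ' : 0 < δ⁻¹ := by positivity
  unfold ramp
  refine (abs_max_sub_max_le_max _ _ _ _).trans (max_le (by simp; positivity) ?_)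
  refine (abs_min_sub_min_le_max _ _ _ _).trans (max_le (by simp; positivity) ?_)
  refine (abs_min_sub_min_le_max _ _ _ _).trans (max_le ?_ ?_)
  · rw [← mul_sub, abs_mul, abs_of_pos hδ', abs_sub_comm, show t - s' - (t - s) = s - s' by ring]
    exact mul_le_mul_of_nonneg_right (by linarith) (abs_nonneg _)
  · rw [show s + 2 - (s' + 2) = s - s' by ring]
    exact le_mul_of_one_le_left (abs_nonneg _) (by linarith)

/-- Compare with the value 0 at a point of norm |r| + 1 at the same time. -/
lemma abs_le_of_lipschitz_of_support {ψ : ℝ × Plane → ℝ} {D : NNReal} (hψ : LipschitzWith D ψ)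
    {r : ℝ} (hr : ∀ s x, r < ‖x‖ → ψ (s, x) = 0) (z : ℝ × Plane) :
    |ψ z| ≤ D * (2 * |r| + 1) := by
  obtain ⟨s, x⟩ := z
  by_cases hx : r < ‖x‖
  · rw [hr s x hx, abs_zero]; positivity
  push Not at hx
  have hy : ‖(EuclideanSpace.single 0 (|r| + 1) : Plane)‖ = |r| + 1 := by
    rw [PiLp.norm_single, Real.norm_of_nonneg (by positivity)]
  have h0 : ψ (s, EuclideanSpace.single 0 (|r| + 1)) = 0 :=
    hr s _ (by rw [hy]; linarith [le_abs_self r])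
  have h1 := hψ.dist_le_mul (s, x) (s, EuclideanSpace.single 0 (|r| + 1))
  rw [h0, dist_zero_right, Real.norm_eq_abs] at h1
  refine h1.trans (mul_le_mul_of_nonneg_left ?_ D.coe_nonneg)
  rw [Prod.dist_eq, dist_self, max_eq_right dist_nonneg, dist_eq_norm]
  refine (norm_sub_le _ _).trans ?_
  rw [hy]
  linarith [le_abs_self r]

lemma fderiv_eq_zero_of_support {ψ : ℝ × Plane → ℝ} {r : ℝ}
    (hr : ∀ s x, r < ‖x‖ → ψ (s, x) = 0) {z : ℝ × Plane} (hz : r < ‖z.2‖) : fderiv ℝ ψ z = 0 := by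
  have : ψ =ᶠ[𝓝 z] fun _ => 0 := by
    have ho : IsOpen {z : ℝ × Plane | r < ‖z.2‖} := isOpen_lt continuous_const (by fun_prop)
    filter_upwards [ho.mem_nhds hz] with y hy
    exact hr y.1 y.2 hy
  rw [this.fderiv_eq]; simp

lemma integrable_of_norm_le_of_integrableOn {E F : Type*} [NormedAddCommGroup E]
    [NormedAddCommGroup F] {a : ℝ × Plane → E}
    {f : ℝ × Plane → F} {K : Set (ℝ × Plane)} (ha : IntegrableOn a K)
    (hf : AEStronglyMeasurable f (volume.restrict K)) (h0 : ∀ z ∉ K, f z = 0) {c : ℝ}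
    (hc : ∀ z, ‖f z‖ ≤ c * ‖a z‖) : Integrable f := by
  rw [← integrableOn_iff_integrable_of_support_subset (s := K)]
  · exact (ha.norm.const_mul c).mono' hf (Eventually.of_forall hc)
  · intro z hz
    by_contra h
    exact hz (h0 z h)

/-- The balance law between two times, up to averaging over a short time interval. -/
theorem enorm_average_le_of_weak {T : ℝ} {a : ℝ × Plane → ℝ × Plane}
    (ha : ∀ K, IsCompact K → K ⊆ Iio T ×ˢ univ → IntegrableOn a K) (ha0 : ∀ z, z.1 ≤ 0 → a z = 0)
    (hw : ∀ ψ : ℝ × Plane → ℝ, ContDiff ℝ ∞ ψ → HasCompactSupport ψ → tsupport ψ ⊆ Iio T ×ˢ univ →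
      ∫ z, fderiv ℝ ψ z (a z) = 0)
    {ψ : ℝ × Plane → ℝ} {D : NNReal} (hψ : LipschitzWith D ψ) {r : ℝ}
    (hr : ∀ s x, r < ‖x‖ → ψ (s, x) = 0) {t δ : ℝ} (hδ : 0 < δ) (hδt : δ < t) (htT : t < T) :
    ‖δ⁻¹ * ∫ z in Ioo (t - δ) t ×ˢ univ, ψ z * (a z).1‖ₑ
      ≤ ∫⁻ z in Ioo 0 t ×ˢ univ, ‖fderiv ℝ ψ z (a z)‖ₑ := by
  have hδ' : 0 < δ⁻¹ := by positivity
  -- The times below 0 serve only to make the cutoff compactly supported: the field a vanishes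
  -- there, so the lower end of the ramp contributes nothing and no initial term appears.
  obtain ⟨K, hK⟩ : ∃ K : Set (ℝ × Plane), K = Icc (-2) t ×ˢ Metric.closedBall 0 r := ⟨_, rfl⟩
  have hKc : IsCompact K := hK ▸ isCompact_Icc.prod (isCompact_closedBall _ _)
  have hKm : MeasurableSet K := hKc.measurableSet
  have hKT : K ⊆ Iio T ×ˢ univ := by
    rw [hK]; rintro z ⟨h1, -⟩; exact ⟨h1.2.trans_lt htT, mem_univ _⟩
  have haK := ha K hKc hKT
  obtain ⟨Ψ, hΨ⟩ : ∃ Ψ : ℝ × Plane → ℝ, Ψ = fun z => ramp t δ z.1 * ψ z := ⟨_, rfl⟩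
  have hbd := abs_le_of_lipschitz_of_support hψ hr
  have hΨl : LipschitzWith (Real.toNNReal ((δ⁻¹ + 1) * (D * (2 * |r| + 1)) + D)) Ψ := by
    refine LipschitzWith.of_dist_le_mul fun z z' => ?_
    rw [Real.coe_toNNReal _ (by positivity), hΨ, Real.dist_eq]
    have h1 : |ψ z - ψ z'| ≤ D * dist z z' := by
      simpa [Real.dist_eq] using hψ.dist_le_mul z z'
    have h2 : |z.1 - z'.1| ≤ dist z z' := by rw [← Real.dist_eq]; exact le_max_left _ _
    calc |ramp t δ z.1 * ψ z - ramp t δ z'.1 * ψ z'|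
        = |(ramp t δ z.1 - ramp t δ z'.1) * ψ z + ramp t δ z'.1 * (ψ z - ψ z')| := by
          congr 1; ring
      _ ≤ |ramp t δ z.1 - ramp t δ z'.1| * |ψ z| + |ramp t δ z'.1| * |ψ z - ψ z'| := by
          rw [← abs_mul, ← abs_mul]; exact abs_add_le _ _
      _ ≤ ((δ⁻¹ + 1) * dist z z') * (D * (2 * |r| + 1)) + 1 * (D * dist z z') := by
          refine add_le_add (mul_le_mul ((abs_ramp_sub_le hδ _ _).trans
            (mul_le_mul_of_nonneg_left h2 (by positivity))) (hbd z) (abs_nonneg _) (by positivity))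
            (mul_le_mul ?_ h1 (abs_nonneg _) zero_le_one)
          rw [abs_of_nonneg (ramp_nonneg _ _ _)]; exact ramp_le_one _ _ _
      _ = _ := by ring
  have hsupp : Function.support Ψ ⊆ K := by
    intro z hz
    rw [hK]
    rw [hΨ] at hz
    refine ⟨⟨?_, ?_⟩, ?_⟩
    · by_contra h
      exact hz (by simp [ramp_of_le (not_le.1 h).le])
    · by_contra h
      exact hz (by simp [ramp_of_ge hδ (not_le.1 h).le])
    · by_contra h
      refine hz ?_
      rw [mem_closedBall_zero_iff, not_le] at h
      simp [show ψ z = 0 from hr z.1 z.2 h]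
  have htsupp : tsupport Ψ ⊆ K := closure_minimal hsupp hKc.isClosed
  have hzero := integral_fderiv_lipschitz_eq_zero (isOpen_Iio.prod isOpen_univ) ha hw hΨl
    (hKc.of_isClosed_subset (isClosed_tsupport _) htsupp) (htsupp.trans hKT)
  obtain ⟨X, hX⟩ : ∃ X : ℝ × Plane → ℝ, X = (Ioo (t - δ) t ×ˢ univ).indicator
    fun z => ψ z * (a z).1 := ⟨_, rfl⟩
  obtain ⟨Y, hY⟩ : ∃ Y : ℝ × Plane → ℝ, Y = fun z => ramp t δ z.1 * fderiv ℝ ψ z (a z) :=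
    ⟨_, rfl⟩
  have hI : MeasurableSet (Ioo (t - δ) t ×ˢ (univ : Set Plane)) :=
    measurableSet_Ioo.prod MeasurableSet.univ
  -- The product rule: the slope -1/δ of the ramp on (t - δ, t) gives the time average, and the
  -- other term is the defect of ψ as a solution of the adjoint equation.
  have hae : (fun z => fderiv ℝ Ψ z (a z)) =ᵐ[volume] fun z => -(δ⁻¹ * X z) + Y z := by
    have hne : ∀ᵐ z : ℝ × Plane, z.1 ≠ t ∧ z.1 ≠ t - δ := by
      have h1 : ∀ᵐ s : ℝ, s ≠ t ∧ s ≠ t - δ := by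
        have h2 : ∀ c : ℝ, ∀ᵐ s : ℝ, s ≠ c := fun c => by simp [ae_iff]
        filter_upwards [h2 t, h2 (t - δ)] with s h3 h4 using ⟨h3, h4⟩
      rw [Measure.volume_eq_prod]
      exact Measure.quasiMeasurePreserving_fst.ae h1
    filter_upwards [hne, hψ.ae_differentiableAt] with z hz hd
    simp only [hX, hY]
    by_cases h0 : z.1 ≤ 0
    · simp only [ha0 z h0, map_zero, indicator]
      split_ifs <;> simp
    push Not at h0
    rcases lt_or_gt_of_ne hz.1 with h1 | h1
    swap
    · have : Ψ =ᶠ[𝓝 z] fun _ => 0 := by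
        filter_upwards [(isOpen_Ioi.preimage continuous_fst).mem_nhds
          (show z ∈ Prod.fst ⁻¹' Ioi t from h1)] with y hy
        rw [hΨ]; simp [ramp_of_ge hδ (le_of_lt hy)]
      rw [this.fderiv_eq, indicator_of_notMem (fun h => lt_asymm h1 h.1.2),
        ramp_of_ge hδ h1.le]
      simp
    rcases lt_or_gt_of_ne hz.2 with h2 | h2
    · have : Ψ =ᶠ[𝓝 z] ψ := by
        filter_upwards [((isOpen_Ioo (a := (0 : ℝ)) (b := t - δ)).preimage continuous_fst).mem_nhds
          (show z ∈ Prod.fst ⁻¹' Ioo 0 (t - δ) from ⟨h0, h2⟩)] with y hy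
        rw [hΨ]
        simp [ramp_eq_one (t := t) hδ (by linarith [hy.1] : -1 ≤ y.1) (le_of_lt hy.2)]
      rw [this.fderiv_eq, indicator_of_notMem (fun h => lt_asymm h2 h.1.1),
        ramp_eq_one hδ (by linarith) h2.le]
      simp
    · have : Ψ =ᶠ[𝓝 z] fun y => (δ⁻¹ * (t - y.1)) * ψ y := by
        filter_upwards [((isOpen_Ioo (a := t - δ) (b := t)).preimage continuous_fst).mem_nhds
          (show z ∈ Prod.fst ⁻¹' Ioo (t - δ) t from ⟨h2, h1⟩)] with y hy
        rw [hΨ]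
        simp only
        rw [ramp_eq hδ (by linarith [hy.1]) hy.1.le hy.2.le]
      have hd1 : HasFDerivAt (fun y : ℝ × Plane => δ⁻¹ * (t - y.1))
          (δ⁻¹ • -ContinuousLinearMap.fst ℝ ℝ Plane) z :=
        ((hasFDerivAt_fst.const_sub t).const_mul δ⁻¹)
      have hd2 : HasFDerivAt (fun y : ℝ × Plane => (δ⁻¹ * (t - y.1)) * ψ y) _ z :=
        hd1.mul hd.hasFDerivAt
      rw [this.fderiv_eq, hd2.fderiv,
        indicator_of_mem (show z ∈ Ioo (t - δ) t ×ˢ univ from ⟨⟨h2, h1⟩, mem_univ _⟩),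
        ramp_eq hδ (by linarith) h2.le h1.le]
      simp
      ring
  have hm : AEStronglyMeasurable (fun z => fderiv ℝ ψ z (a z)) (volume.restrict K) :=
    (ContinuousLinearMap.apply ℝ ℝ).aestronglyMeasurable_comp₂ haK.1
      (measurable_fderiv ℝ _).aestronglyMeasurable
  have hrc : Continuous (ramp t δ) := by unfold ramp; fun_prop
  have hXi : Integrable X := by
    refine integrable_of_norm_le_of_integrableOn haK ?_ ?_ (c := D * (2 * |r| + 1)) ?_
    · rw [hX]
      exact ((hψ.continuous.aestronglyMeasurable).mul haK.1.fst).indicator hI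
    · intro z hz
      rw [hX]
      by_cases h1 : z ∈ Ioo (t - δ) t ×ˢ (univ : Set Plane)
      · rw [indicator_of_mem h1]
        have h2 : r < ‖z.2‖ := by
          by_contra h
          refine hz ?_
          rw [hK]
          exact ⟨⟨by linarith [h1.1.1], h1.1.2.le⟩, by simpa using h⟩
        simp [show ψ z = 0 from hr z.1 z.2 h2]
      · rw [indicator_of_notMem h1]
    · intro z
      rw [hX]
      refine (norm_indicator_le_norm_self _ _).trans ?_
      rw [norm_mul]
      exact mul_le_mul (hbd z) (norm_fst_le _) (norm_nonneg _) (by positivity)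
  have hYi : Integrable Y := by
    refine integrable_of_norm_le_of_integrableOn haK ?_ ?_ (c := D) ?_
    · rw [hY]
      exact ((hrc.comp continuous_fst).aestronglyMeasurable).mul hm
    · intro z hz
      rw [hY]
      simp only
      rw [hK, mem_prod, not_and_or] at hz
      rcases hz with hz | hz
      · rw [mem_Icc, not_and_or] at hz
        rcases hz with hz | hz
        · rw [ramp_of_le (not_le.1 hz).le, zero_mul]
        · rw [ramp_of_ge hδ (not_le.1 hz).le, zero_mul]
      · rw [fderiv_eq_zero_of_support hr (by simpa using hz)]
        simp
    · intro z
      rw [hY]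
      simp only
      rw [norm_mul, Real.norm_of_nonneg (ramp_nonneg _ _ _)]
      refine (mul_le_of_le_one_left (norm_nonneg _) (ramp_le_one _ _ _)).trans ?_
      refine (ContinuousLinearMap.le_opNorm _ _).trans ?_
      exact mul_le_mul_of_nonneg_right (norm_fderiv_le_of_lipschitz ℝ hψ) (norm_nonneg _)
  rw [integral_congr_ae hae, integral_add (f := fun z => -(δ⁻¹ * X z)) (hXi.const_mul _).neg hYi, integral_neg,
    integral_const_mul, neg_add_eq_zero] at hzero
  rw [hX, integral_indicator hI] at hzero
  rw [hzero]
  refine (enorm_integral_le_lintegral_enorm _).trans ?_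
  rw [← lintegral_indicator (measurableSet_Ioo.prod MeasurableSet.univ)]
  refine lintegral_mono fun z => ?_
  by_cases h1 : z ∈ Ioo 0 t ×ˢ (univ : Set Plane)
  · rw [indicator_of_mem h1, hY]
    simp only
    rw [enorm_mul]
    refine mul_le_of_le_one_left' ?_
    rw [Real.enorm_of_nonneg (ramp_nonneg _ _ _)]
    exact ENNReal.ofReal_le_one.2 (ramp_le_one _ _ _)
  · have : Y z = 0 := by
      rw [hY]
      by_cases h2 : z.1 ≤ 0
      · simp [ha0 z h2]
      · have h3 : t ≤ z.1 := by
          by_contra h3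
          exact h1 ⟨⟨not_le.1 h2, not_le.1 h3⟩, mem_univ _⟩
        simp [ramp_of_ge hδ h3]
    rw [this]; simp

lemma setIntegral_prod_univ {f : ℝ × Plane → ℝ} (hf : Integrable f) {p q : ℝ} (h : p ≤ q) :
    ∫ z in Ioo p q ×ˢ univ, f z = ∫ s in p..q, ∫ x, f (s, x) := by
  rw [intervalIntegral.integral_of_le h, Measure.volume_eq_prod,
    setIntegral_prod _ (by rw [← Measure.volume_eq_prod]; exact hf.integrableOn)]
  simp only [Measure.restrict_univ]
  rw [integral_Ioc_eq_integral_Ioo]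

/-- Averages over short time intervals converge at Lebesgue points. -/
lemma tendsto_average_of_lipschitz {ψ : ℝ × Plane → ℝ} {D : NNReal} (hψ : LipschitzWith D ψ)
    {r : ℝ} (hr : ∀ s x, r < ‖x‖ → ψ (s, x) = 0) {V : Plane → ℝ} {t : ℝ}
    (hV : ∀ x, ψ (t, x) = V x)
    {η : ℝ × Plane → ℝ} (hη : IntegrableOn η (univ ×ˢ Metric.closedBall 0 r))
    (ht : HasDerivAt (fun s => ∫ q in (t - 1)..s, ∫ x, V x * η (q, x)) (∫ x, V x * η (t, x)) t) :
    Tendsto (fun δ => δ⁻¹ * ∫ z in Ioo (t - δ) t ×ˢ univ, ψ z * η z) (𝓝[>] 0)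
      (𝓝 (∫ x, V x * η (t, x))) := by
  obtain ⟨B, hB⟩ : ∃ B : Set (ℝ × Plane), B = univ ×ˢ Metric.closedBall 0 r := ⟨_, rfl⟩
  rw [← hB] at hη
  have hBm : MeasurableSet B := hB ▸ MeasurableSet.univ.prod Metric.isClosed_closedBall.measurableSet
  have hBn : ∀ z ∉ B, r < ‖z.2‖ := fun z hz => by
    rw [hB] at hz; simpa using hz
  have hV0 : ∀ x, r < ‖x‖ → V x = 0 := fun x hx => by rw [← hV, hr t x hx]
  have hVc : Continuous V := by
    have : V = fun x => ψ (t, x) := funext fun x => (hV x).symm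
    rw [this]; exact hψ.continuous.comp (by fun_prop)
  have hbd := abs_le_of_lipschitz_of_support hψ hr
  have h1 : Integrable fun z : ℝ × Plane => V z.2 * η z := by
    refine integrable_of_norm_le_of_integrableOn hη
      ((hVc.comp continuous_snd).aestronglyMeasurable.mul hη.1) (fun z hz => ?_)
      (c := D * (2 * |r| + 1)) fun z => ?_
    · rw [hV0 _ (hBn z hz), zero_mul]
    · rw [norm_mul, ← hV]
      exact mul_le_mul_of_nonneg_right (hbd _) (norm_nonneg _)
  have h2 : Integrable fun z : ℝ × Plane => ψ z * η z := by
    refine integrable_of_norm_le_of_integrableOn hη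
      (hψ.continuous.aestronglyMeasurable.mul hη.1) (fun z hz => ?_)
      (c := D * (2 * |r| + 1)) fun z => ?_
    · rw [show ψ z = 0 from hr z.1 z.2 (hBn z hz), zero_mul]
    · rw [norm_mul]
      exact mul_le_mul_of_nonneg_right (hbd _) (norm_nonneg _)
  have h3 : Integrable (B.indicator fun z => |η z|) := (integrable_indicator_iff hBm).2 hη.abs
  have h3s : Integrable (fun s => ∫ x, B.indicator (fun z => |η z|) (s, x)) := by
    rw [Measure.volume_eq_prod] at h3
    exact h3.integral_prod_left
  -- With ψ replaced by its value V at time t, the average is a backward difference quotient of the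
  -- primitive, which is differentiable at t.
  have hlim1 : Tendsto (fun δ => δ⁻¹ * ∫ z in Ioo (t - δ) t ×ˢ univ, V z.2 * η z) (𝓝[>] 0)
      (𝓝 (∫ x, V x * η (t, x))) := by
    have hneg : Tendsto (fun δ : ℝ => -δ) (𝓝[>] 0) (𝓝[≠] 0) := by
      refine tendsto_nhdsWithin_iff.2 ⟨?_, ?_⟩
      · exact (by simpa using (continuous_neg (G := ℝ)).tendsto 0 :
          Tendsto (fun δ : ℝ => -δ) (𝓝 0) (𝓝 0)).mono_left nhdsWithin_le_nhds
      · filter_upwards [self_mem_nhdsWithin] with δ hδ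
        simpa using (ne_of_gt hδ)
    have h4 := ht.tendsto_slope_zero.comp hneg
    refine h4.congr' ?_
    filter_upwards [self_mem_nhdsWithin] with δ hδ
    have hs : Integrable fun s => ∫ x, V x * η (s, x) := by
      rw [Measure.volume_eq_prod] at h1
      exact h1.integral_prod_left
    have hi : ∀ p q, IntervalIntegrable (fun s => ∫ x, V x * η (s, x)) volume p q :=
      fun p q => hs.intervalIntegrable
    rw [setIntegral_prod_univ h1 (by linarith [show (0 : ℝ) < δ from hδ])]
    simp only [Function.comp_apply, smul_eq_mul]
    rw [intervalIntegral.integral_interval_sub_left (hi _ _) (hi _ _),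
      intervalIntegral.integral_symm, inv_neg, neg_mul_neg, ← sub_eq_add_neg]
  -- On the strip |ψ - V| ≤ D δ, which cancels 1/δ; the remaining integral of |η| over the shrinking
  -- strip tends to 0.
  have hlim2 : Tendsto (fun δ => δ⁻¹ * ∫ z in Ioo (t - δ) t ×ˢ univ, (ψ z - V z.2) * η z)
      (𝓝[>] 0) (𝓝 0) := by
    have hcont : Tendsto (fun δ => D * ∫ s in (t - δ)..t, ∫ x, B.indicator (fun z => |η z|) (s, x))
        (𝓝[>] 0) (𝓝 0) := by
      have h5 : Continuous fun p => ∫ s in t..p, ∫ x, B.indicator (fun z => |η z|) (s, x) :=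
        intervalIntegral.continuous_primitive (fun p q => h3s.intervalIntegrable) t
      have h6 : Continuous fun δ => D * ∫ s in (t - δ)..t, ∫ x, B.indicator (fun z => |η z|) (s, x) := by
        simp_rw [fun δ => intervalIntegral.integral_symm (μ := volume)
          (f := fun s => ∫ x, B.indicator (fun z => |η z|) (s, x)) t (t - δ)]
        exact continuous_const.mul ((h5.comp (by fun_prop : Continuous fun δ : ℝ => t - δ)).neg)
      have h7 := (h6.tendsto 0).mono_left (nhdsWithin_le_nhds (s := Ioi 0))
      simpa using h7
    refine squeeze_zero_norm' ?_ hcont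
    filter_upwards [self_mem_nhdsWithin] with δ hδ
    have hδ0 : (0 : ℝ) < δ := hδ
    rw [← setIntegral_prod_univ h3 (by linarith), norm_mul, norm_inv, Real.norm_of_nonneg hδ0.le,
      inv_mul_le_iff₀ hδ0, ← mul_assoc, ← integral_const_mul]
    refine norm_integral_le_of_norm_le (h3.integrableOn.const_mul _) ?_
    refine (ae_restrict_iff' (measurableSet_Ioo.prod MeasurableSet.univ)).2
      (Eventually.of_forall fun z hz => ?_)
    by_cases hzB : z ∈ B
    · rw [indicator_of_mem hzB, norm_mul, ← hV]
      refine mul_le_mul_of_nonneg_right ?_ (abs_nonneg _)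
      have h8 := hψ.dist_le_mul z (t, z.2)
      rw [Real.dist_eq] at h8
      refine h8.trans ?_
      rw [mul_comm]
      refine mul_le_mul_of_nonneg_right ?_ D.coe_nonneg
      rw [Prod.dist_eq, dist_self, max_eq_left dist_nonneg, Real.dist_eq, abs_le]
      constructor <;> linarith [hz.1.1, hz.1.2]
    · rw [indicator_of_notMem hzB, show ψ z = 0 from hr z.1 z.2 (hBn z hzB), hV0 _ (hBn z hzB)]
      simp
  have := hlim1.add hlim2
  rw [add_zero] at this
  refine this.congr fun δ => ?_
  rw [← mul_add, ← integral_add h1.integrableOn]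
  · congr 2
    ext z; ring
  · refine ((h2.sub h1).congr (Eventually.of_forall fun z => ?_)).integrableOn
    simp only [Pi.sub_apply]; ring

/-! ## Duality estimate for the transport equation -/

/-- The truncation removes whole time slices, so the Lipschitz bound in space survives and the
integrals of the bounds over time stay below those of A and L, uniformly in n. Only the error of the
Euler scheme sees n. -/
lemma velocityBounds_truncate {u : ℝ × Plane → Plane} (hu : Measurable u) {A L : ℝ → ℝ≥0∞}
    (hA : Measurable A) (hL : Measurable L) (hA' : ∀ t, A t < ⊤) (hL' : ∀ t, L t < ⊤)
    (huA : ∀ t x, ‖u (t, x)‖ₑ ≤ A t) (huL : ∀ t x y, ‖u (t, x) - u (t, y)‖ₑ ≤ L t * ‖x - y‖ₑ)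
    (n : ℕ) :
    VelocityBounds ({z : ℝ × Plane | A z.1 ≤ n ∧ L z.1 ≤ n}.indicator u)
      ({s | A s ≤ n ∧ L s ≤ n}.indicator fun s => (A s).toReal)
      ({s | A s ≤ n ∧ L s ≤ n}.indicator fun s => (L s).toReal) n := by
  have hm : MeasurableSet {s | A s ≤ n ∧ L s ≤ n} :=
    (measurableSet_le hA measurable_const).inter (measurableSet_le hL measurable_const)
  refine ⟨hu.indicator (measurable_fst hm), hA.ennreal_toReal.indicator hm,
    hL.ennreal_toReal.indicator hm, fun s x => ?_, fun s x y => ?_, fun s => ?_, fun s => ?_,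
    fun s => ?_⟩
  · by_cases h : A s ≤ n ∧ L s ≤ n
    · rw [indicator_of_mem (show (s, x) ∈ {z : ℝ × Plane | A z.1 ≤ n ∧ L z.1 ≤ n} from h),
        indicator_of_mem (show s ∈ {s | A s ≤ n ∧ L s ≤ n} from h), ← toReal_enorm]
      exact ENNReal.toReal_mono (hA' s).ne (huA s x)
    · rw [indicator_of_notMem (show (s, x) ∉ {z : ℝ × Plane | A z.1 ≤ n ∧ L z.1 ≤ n} from h),
        indicator_of_notMem (show s ∉ {s | A s ≤ n ∧ L s ≤ n} from h), norm_zero]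
  · by_cases h : A s ≤ n ∧ L s ≤ n
    · rw [indicator_of_mem (show (s, x) ∈ {z : ℝ × Plane | A z.1 ≤ n ∧ L z.1 ≤ n} from h),
        indicator_of_mem (show (s, y) ∈ {z : ℝ × Plane | A z.1 ≤ n ∧ L z.1 ≤ n} from h),
        indicator_of_mem (show s ∈ {s | A s ≤ n ∧ L s ≤ n} from h), ← toReal_enorm,
        ← toReal_enorm (x - y), ← ENNReal.toReal_mul]
      exact ENNReal.toReal_mono (ENNReal.mul_ne_top (hL' s).ne enorm_ne_top) (huL s x y)
    · rw [indicator_of_notMem (show (s, x) ∉ {z : ℝ × Plane | A z.1 ≤ n ∧ L z.1 ≤ n} from h),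
        indicator_of_notMem (show (s, y) ∉ {z : ℝ × Plane | A z.1 ≤ n ∧ L z.1 ≤ n} from h),
        indicator_of_notMem (show s ∉ {s | A s ≤ n ∧ L s ≤ n} from h)]
      simp
  · refine indicator_apply_le' (fun h => ?_) fun _ => n.cast_nonneg
    simpa using ENNReal.toReal_mono (ENNReal.natCast_ne_top n) h.1
  · refine indicator_apply_le' (fun h => ?_) fun _ => n.cast_nonneg
    simpa using ENNReal.toReal_mono (ENNReal.natCast_ne_top n) h.2
  · exact indicator_nonneg (fun _ _ => ENNReal.toReal_nonneg) s

lemma intervalIntegral_indicator_toReal_le {A : ℝ → ℝ≥0∞} (hA : Measurable A)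
    (hi : ∫⁻ t, A t < ⊤) {S : Set ℝ} (hS : MeasurableSet S) {p q : ℝ} (h : p ≤ q) :
    ∫ s in p..q, S.indicator (fun s => (A s).toReal) s ≤ (∫⁻ t, A t).toReal := by
  rw [intervalIntegral.integral_of_le h, integral_eq_lintegral_of_nonneg_ae
    (Eventually.of_forall fun s => indicator_nonneg (fun _ _ => ENNReal.toReal_nonneg) s)
    (hA.ennreal_toReal.indicator hS).aestronglyMeasurable]
  refine ENNReal.toReal_mono hi.ne ((setLIntegral_le_lintegral _ _).trans (lintegral_mono fun s => ?_))
  by_cases hs : s ∈ S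
  · rw [indicator_of_mem hs]; exact ENNReal.ofReal_toReal_le
  · rw [indicator_of_notMem hs]; simp

/-- Split (η, η u + G) = η (1, v) + η (0, u - v) + (0, G): the three parts are the error of the
Euler scheme, the error of the truncation, and the source. -/
lemma enorm_fderiv_transport_le {ψ : ℝ × Plane → ℝ} {z : ℝ × Plane}
    (hd : DifferentiableAt ℝ ψ z) {c r ε : ℝ} (hc : 0 ≤ c)
    (hl : LipschitzWith c.toNNReal fun x => ψ (z.1, x)) (hr : ∀ s x, r < ‖x‖ → ψ (s, x) = 0)
    {v u G : Plane} (η : ℝ) (hv : ‖fderiv ℝ ψ z (1, v)‖ ≤ ε) :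
    ‖fderiv ℝ ψ z (η, η • u + G)‖ₑ ≤
      (univ ×ˢ Metric.closedBall 0 r : Set (ℝ × Plane)).indicator
        (fun _ => ‖η‖ₑ * ENNReal.ofReal ε + ENNReal.ofReal c * (‖η‖ₑ * ‖u - v‖ₑ)) z
      + ‖fderiv ℝ (fun x => ψ (z.1, x)) z.2‖ₑ * ‖G‖ₑ := by
  have h1 : ∀ w, fderiv ℝ ψ z (0, w) = fderiv ℝ (fun x => ψ (z.1, x)) z.2 w := by
    intro w
    have h2 : HasFDerivAt (fun x => ψ (z.1, x))
        ((fderiv ℝ ψ z).comp (ContinuousLinearMap.inr ℝ ℝ Plane)) z.2 :=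
      HasFDerivAt.comp z.2 (f := fun x => (z.1, x)) (g := ψ) hd.hasFDerivAt
        (hasFDerivAt_prodMk_right z.1 z.2)
    rw [h2.fderiv]; simp
  have hG : ‖fderiv ℝ ψ z (0, G)‖ₑ ≤ ‖fderiv ℝ (fun x => ψ (z.1, x)) z.2‖ₑ * ‖G‖ₑ := by
    rw [h1]; exact ContinuousLinearMap.le_opENorm _ _
  have hsplit : (η, η • u + G) = η • ((1 : ℝ), v) + η • ((0 : ℝ), u - v) + ((0 : ℝ), G) := by
    ext1 <;> simp [smul_sub]
  by_cases hz : r < ‖z.2‖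
  · have h0 := fderiv_eq_zero_of_support hr hz
    rw [h0]; simp
  · rw [indicator_of_mem (show z ∈ (univ ×ˢ Metric.closedBall 0 r : Set (ℝ × Plane)) from
      ⟨mem_univ _, by simpa using hz⟩), hsplit, map_add, map_add, map_smul, map_smul]
    refine (enorm_add_le _ _).trans (add_le_add ((enorm_add_le _ _).trans (add_le_add ?_ ?_)) hG)
    · rw [enorm_smul]
      refine mul_le_mul_right ?_ _
      rw [← ofReal_norm]
      exact ENNReal.ofReal_le_ofReal hv
    · rw [enorm_smul, mul_left_comm]
      refine mul_le_mul_right ?_ _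
      rw [h1]
      refine (ContinuousLinearMap.le_opENorm _ _).trans (mul_le_mul_left ?_ _)
      rw [← ofReal_norm]
      refine ENNReal.ofReal_le_ofReal ?_
      have := norm_fderiv_le_of_lipschitz ℝ hl (x₀ := z.2)
      rwa [Real.coe_toNNReal _ hc] at this

lemma measurable_eLpNorm_two_slice {E : Type*} [NormedAddCommGroup E] [MeasurableSpace E]
    [OpensMeasurableSpace E] {G : ℝ × Plane → E} (hG : Measurable G) :
    Measurable fun s => eLpNorm (fun x => G (s, x)) 2 volume := by
  have h : Measurable fun s => ∫⁻ x, ‖G (s, x)‖ₑ ^ (2 : ℝ) :=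
    (hG.enorm.pow_const 2).lintegral_prod_right'
  have h2 := h.pow_const (1 / 2 : ℝ)
  simp_rw [eLpNorm_eq_lintegral_rpow_enorm_toReal (p := 2) (by norm_num) (by norm_num)]
  simpa using h2

/-- **Duality estimate.** A solution of `η_t + u · ∇η + ∇ · G = 0` with zero initial data is
controlled in `H^{-1}` by the `L¹_t L²` norm of `G`. -/
theorem transport_estimate {T : ℝ} {η : ℝ × Plane → ℝ} {u G : ℝ × Plane → Plane}
    (hu : Measurable u) (hη : Measurable η) (hG : Measurable G) {A L : ℝ → ℝ≥0∞}
    (hA : Measurable A) (hL : Measurable L) (hA' : ∀ t, A t < ⊤) (hL' : ∀ t, L t < ⊤)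
    (huA : ∀ t x, ‖u (t, x)‖ₑ ≤ A t) (huL : ∀ t x y, ‖u (t, x) - u (t, y)‖ₑ ≤ L t * ‖x - y‖ₑ)
    (hAi : ∫⁻ t, A t < ⊤) (hLi : ∫⁻ t, L t < ⊤)
    (hη0 : ∀ z, z.1 ≤ 0 → η z = 0) (hG0 : ∀ z, z.1 ≤ 0 → G z = 0)
    (hηi : ∀ r, IntegrableOn η (univ ×ˢ Metric.closedBall 0 r))
    (hηu : ∀ K, IsCompact K → K ⊆ Iio T ×ˢ univ → IntegrableOn (fun z => η z • u z) K)
    (hGi : ∀ K, IsCompact K → K ⊆ Iio T ×ˢ univ → IntegrableOn G K)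
    (hw : ∀ ψ : ℝ × Plane → ℝ, ContDiff ℝ ∞ ψ → HasCompactSupport ψ → tsupport ψ ⊆ Iio T ×ˢ univ →
      ∫ z, fderiv ℝ ψ z (η z, η z • u z + G z) = 0)
    {V : Plane → ℝ} {C : NNReal} (hV : LipschitzWith C V) (hVc : HasCompactSupport V) :
    ∀ᵐ t, t ∈ Ioo 0 T → ‖∫ x, V x * η (t, x)‖ₑ
      ≤ ENNReal.ofReal (Real.exp (3 * (∫⁻ t, L t).toReal)) * eLpNorm (fderiv ℝ V) 2 volume
        * ∫⁻ s in Ioo 0 t, eLpNorm (fun x => G (s, x)) 2 volume := by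
  obtain ⟨ρ, hρ⟩ : ∃ ρ, ∀ x, ρ < ‖x‖ → V x = 0 := by
    obtain ⟨ρ, hρ⟩ := hVc.isCompact.isBounded.subset_closedBall 0
    refine ⟨ρ, fun x hx => image_eq_zero_of_notMem_tsupport fun h => ?_⟩
    exact absurd (by simpa using hρ h) (not_le.2 hx)
  -- All approximate solutions live in one ball: the support of V enlarged by the greatest distance
  -- a particle can travel.
  obtain ⟨r, hr⟩ : ∃ r, r = ρ + (∫⁻ t, A t).toReal := ⟨_, rfl⟩
  obtain ⟨Λ, hΛ⟩ : ∃ Λ, Λ = (∫⁻ t, L t).toReal := ⟨_, rfl⟩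
  rw [← hΛ]
  obtain ⟨c, hc⟩ : ∃ c, c = C * Real.exp Λ := ⟨_, rfl⟩
  have hc0 : 0 ≤ c := by rw [hc]; positivity
  have hVη : Integrable fun z : ℝ × Plane => V z.2 * η z := by
    obtain ⟨M, hM⟩ := hV.continuous.bounded_above_of_compact_support hVc
    refine integrable_of_norm_le_of_integrableOn (hηi ρ) (c := M)
      ((hV.continuous.comp continuous_snd).aestronglyMeasurable.mul hη.aestronglyMeasurable)
      (fun z hz => ?_) fun z => ?_
    · rw [hρ, zero_mul]; simpa using hz
    · rw [norm_mul]; exact mul_le_mul_of_nonneg_right (hM _) (norm_nonneg _)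
  have hy : LocallyIntegrable fun s => ∫ x, V x * η (s, x) := by
    rw [Measure.volume_eq_prod] at hVη
    exact hVη.integral_prod_left.locallyIntegrable
  -- The only times excluded are those where the primitive of s ↦ ∫ V η(s) is not differentiable
  -- with this derivative. This null set depends on V, but neither on the truncation nor on the step
  -- size.
  filter_upwards [LocallyIntegrable.ae_hasDerivAt_integral hy] with t htd ht
  specialize htd (t - 1)
  have hSm : ∀ n : ℕ, MeasurableSet {s | A s ≤ n ∧ L s ≤ n} := fun n =>
    (measurableSet_le hA measurable_const).inter (measurableSet_le hL measurable_const)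
  obtain ⟨v, hv⟩ : ∃ v : ℕ → ℝ × Plane → Plane,
      ∀ n, v n = {z : ℝ × Plane | A z.1 ≤ n ∧ L z.1 ≤ n}.indicator u := ⟨_, fun _ => rfl⟩
  have hvb := fun n => velocityBounds_truncate hu hA hL hA' hL' huA huL n
  simp_rw [← hv] at hvb
  obtain ⟨Q, hQ⟩ : ∃ Q : Set (ℝ × Plane), Q = Ioo 0 t ×ˢ Metric.closedBall 0 r := ⟨_, rfl⟩
  have hQm : MeasurableSet Q := hQ ▸ measurableSet_Ioo.prod Metric.isClosed_closedBall.measurableSet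
  obtain ⟨X, hX⟩ : ∃ X, X = ENNReal.ofReal (Real.exp (3 * Λ)) * eLpNorm (fderiv ℝ V) 2 volume
        * ∫⁻ s in Ioo 0 t, eLpNorm (fun x => G (s, x)) 2 volume := ⟨_, rfl⟩
  rw [← hX]
  -- N steps of length t / N reach exactly time 0; the smallness of t n / N keeps each displacement
  -- map invertible.
  have hmain : ∀ n N : ℕ, 1 ≤ N → t / N * n ≤ 1 / 2 → ‖∫ x, V x * η (t, x)‖ₑ
      ≤ (∫⁻ z in Q, ‖η z‖ₑ) * ENNReal.ofReal (c * (t / N * n * n))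
        + ENNReal.ofReal c * (∫⁻ z in Q, ‖η z‖ₑ * ‖u z - v n z‖ₑ) + X := by
    intro n N hN hNn
    have hNt : t - N * (t / N) = 0 := by
      rw [mul_div_cancel₀ _ (by positivity), sub_self]
    obtain ⟨ψ, ⟨D, hD⟩, h1, -, h3, h4, h5, h6⟩ := exists_approx_transport (hvb n) C.coe_nonneg
      (by simpa using hV) hρ t (div_nonneg ht.1.le N.cast_nonneg) hNn N
    rw [hNt] at h3 h4 h5 h6
    have hl := intervalIntegral_indicator_toReal_le hL hLi (hSm n) ht.1.le
    have ha := intervalIntegral_indicator_toReal_le hA hAi (hSm n) ht.1.le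
    rw [← hΛ] at hl
    have hψr : ∀ s x, r < ‖x‖ → ψ (s, x) = 0 := fun s x hx => h4 s x (by rw [hr] at hx; linarith)
    have hcl : C * Real.exp (∫ s in (0 : ℝ)..t, {s | A s ≤ n ∧ L s ≤ n}.indicator
        (fun s => (L s).toReal) s) ≤ c := by
      rw [hc]; exact mul_le_mul_of_nonneg_left (Real.exp_le_exp.2 hl) C.coe_nonneg
    have hψl : ∀ s, LipschitzWith c.toNNReal fun x => ψ (s, x) := fun s =>
      (h3 s).weaken (Real.toNNReal_le_toNNReal hcl)
    have hlim := tendsto_average_of_lipschitz hD hψr (h1 t · le_rfl) (hηi r) htd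
    have hbound : ∫⁻ z in Ioo 0 t ×ˢ univ, ‖fderiv ℝ ψ z (η z, η z • u z + G z)‖ₑ
        ≤ (∫⁻ z in Q, ‖η z‖ₑ) * ENNReal.ofReal (c * (t / N * n * n))
        + ENNReal.ofReal c * (∫⁻ z in Q, ‖η z‖ₑ * ‖u z - v n z‖ₑ) + X := by
      have hIm : MeasurableSet (Ioo 0 t ×ˢ (univ : Set Plane)) :=
        measurableSet_Ioo.prod MeasurableSet.univ
      have hBm : MeasurableSet (univ ×ˢ Metric.closedBall 0 r : Set (ℝ × Plane)) :=
        MeasurableSet.univ.prod Metric.isClosed_closedBall.measurableSet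
      have hle : ∀ᵐ z ∂(volume.restrict (Ioo 0 t ×ˢ (univ : Set Plane))),
          ‖fderiv ℝ ψ z (η z, η z • u z + G z)‖ₑ ≤
          (univ ×ˢ Metric.closedBall 0 r : Set (ℝ × Plane)).indicator
            (fun z => ‖η z‖ₑ * ENNReal.ofReal (c * (t / N * n * n))
              + ENNReal.ofReal c * (‖η z‖ₑ * ‖u z - v n z‖ₑ)) z
          + ‖fderiv ℝ (fun x => ψ (z.1, x)) z.2‖ₑ * ‖G z‖ₑ := by
        rw [ae_restrict_iff' hIm]
        filter_upwards [h6, hD.ae_differentiableAt] with z hz1 hz2 hz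
        refine enorm_fderiv_transport_le hz2 hc0 (hψl z.1) hψr (η z) ((hz1 hz.1).trans ?_)
        refine mul_le_mul_of_nonneg_right hcl ?_
        have := ht.1.le
        positivity
      refine (lintegral_mono_ae hle).trans ?_
      have hm1 : Measurable fun z : ℝ × Plane => ‖η z‖ₑ * ENNReal.ofReal (c * (t / N * n * n))
              + ENNReal.ofReal c * (‖η z‖ₑ * ‖u z - v n z‖ₑ) :=
        (hη.enorm.mul_const _).add
          ((hη.enorm.mul (hu.sub (hvb n).meas).enorm).const_mul _)
      rw [lintegral_add_left (hm1.indicator hBm)]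
      refine add_le_add (le_of_eq ?_) ?_
      · rw [lintegral_indicator hBm, Measure.restrict_restrict hBm, prod_inter_prod, univ_inter,
          inter_univ, ← hQ, lintegral_add_left (hη.enorm.mul_const _),
          lintegral_mul_const _ hη.enorm,
          lintegral_const_mul (f := fun z => ‖η z‖ₑ * ‖u z - v n z‖ₑ) _
            (hη.enorm.mul (hu.sub (hvb n).meas).enorm)]
      · rw [Measure.volume_eq_prod, ← Measure.prod_restrict, Measure.restrict_univ]
        refine (lintegral_prod_le _).trans ?_
        rw [hX]
        rw [← lintegral_const_mul _ (measurable_eLpNorm_two_slice hG)]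
        refine lintegral_mono fun s => ?_
        refine (lintegral_mul_le_eLpNorm_two
          (measurable_fderiv ℝ fun x => ψ (s, x)).enorm.aemeasurable
          (hG.comp measurable_prodMk_left).enorm.aemeasurable).trans ?_
        rw [eLpNorm_enorm', eLpNorm_enorm']
        refine mul_le_mul_left ((h5 s).trans ?_) _
        refine mul_le_mul_left (ENNReal.ofReal_le_ofReal (Real.exp_le_exp.2 ?_)) _
        linarith
    refine le_of_tendsto hlim.enorm ?_
    filter_upwards [Ioo_mem_nhdsGT ht.1] with δ hδ
    refine (enorm_average_le_of_weak (T := T) (a := fun z => (η z, η z • u z + G z)) ?_ ?_ hw hD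
      hψr hδ.1 hδ.2 ht.2).trans hbound
    · intro K hK hKT
      obtain ⟨q, hq⟩ := hK.isBounded.subset_closedBall 0
      have h7 : IntegrableOn η K := (hηi q).mono_set fun z hz => ⟨mem_univ _, by
        have := hq hz
        rw [mem_closedBall_zero_iff] at this ⊢
        exact (norm_snd_le z).trans this⟩
      exact Integrable.prodMk h7 ((hηu K hK hKT).add (hGi K hK hKT))
    · intro z hz
      simp [hη0 z hz, hG0 z hz]
  have hQc : Q ⊆ Icc 0 t ×ˢ Metric.closedBall 0 r := by
    rw [hQ]; exact prod_mono Ioo_subset_Icc_self Subset.rfl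
  have hcpt : IsCompact (Icc 0 t ×ˢ Metric.closedBall (0 : Plane) r) :=
    isCompact_Icc.prod (isCompact_closedBall _ _)
  have hI0 : ∫⁻ z in Q, ‖η z‖ₑ ≠ ⊤ :=
    ((hηi r).mono_set (by rw [hQ]; exact prod_mono (subset_univ _) Subset.rfl)).2.ne
  have hJ0 : ∫⁻ z in Q, ‖η z‖ₑ * ‖u z‖ₑ ≠ ⊤ := by
    have := ((hηu _ hcpt (prod_mono (fun s hs => hs.2.trans_lt ht.2) (subset_univ _))).mono_set
      hQc).2.ne
    simpa [enorm_smul] using this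
  have hstep : ∀ n : ℕ, ‖∫ x, V x * η (t, x)‖ₑ
      ≤ ENNReal.ofReal c * (∫⁻ z in Q, ‖η z‖ₑ * ‖u z - v n z‖ₑ) + X := by
    intro n
    -- The order of the limits matters: the step tends to zero at a fixed truncation level n,
    -- because the scheme error grows like n² / N.
    have hq : Tendsto (fun N : ℕ => t / N) atTop (𝓝 0) := tendsto_const_div_atTop_nhds_zero_nat t
    have h1 : Tendsto (fun N : ℕ => (∫⁻ z in Q, ‖η z‖ₑ) * ENNReal.ofReal (c * (t / N * n * n))
        + ENNReal.ofReal c * (∫⁻ z in Q, ‖η z‖ₑ * ‖u z - v n z‖ₑ) + X) atTop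
        (𝓝 ((∫⁻ z in Q, ‖η z‖ₑ) * ENNReal.ofReal (c * (0 * n * n))
        + ENNReal.ofReal c * (∫⁻ z in Q, ‖η z‖ₑ * ‖u z - v n z‖ₑ) + X)) := by
      refine Tendsto.add (Tendsto.add ?_ tendsto_const_nhds) tendsto_const_nhds
      refine ENNReal.Tendsto.const_mul (ENNReal.tendsto_ofReal ?_) (Or.inr hI0)
      exact ((hq.mul_const _).mul_const _).const_mul c
    refine (ge_of_tendsto h1 ?_).trans (by simp)
    have h2 : ∀ᶠ N : ℕ in atTop, t / N * n < 1 / 2 := by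
      have := hq.mul_const (n : ℝ)
      rw [zero_mul] at this
      exact this.eventually_lt_const (by norm_num)
    filter_upwards [h2, eventually_ge_atTop 1] with N h2 h3
    exact hmain n N h3 h2.le
  have hlim : Tendsto (fun n => ENNReal.ofReal c * (∫⁻ z in Q, ‖η z‖ₑ * ‖u z - v n z‖ₑ) + X) atTop
      (𝓝 (ENNReal.ofReal c * (∫⁻ _z in Q, 0) + X)) := by
    refine Tendsto.add (ENNReal.Tendsto.const_mul ?_ (Or.inr ENNReal.ofReal_ne_top))
      tendsto_const_nhds
    -- A and L are finite at every time, so the truncated velocity agrees with u at each point for n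
    -- large.
    refine tendsto_lintegral_of_dominated_convergence (fun z => ‖η z‖ₑ * ‖u z‖ₑ)
      (fun n => hη.enorm.mul (hu.sub (hvb n).meas).enorm) (fun n => Eventually.of_forall fun z => ?_)
      hJ0 (Eventually.of_forall fun z => ?_)
    · refine mul_le_mul_right ?_ _
      rw [hv]
      by_cases hz : z ∈ {z : ℝ × Plane | A z.1 ≤ n ∧ L z.1 ≤ n}
      · rw [indicator_of_mem hz]; simp
      · rw [indicator_of_notMem hz]; simp
    · have h1 : ∀ᶠ n : ℕ in atTop, A z.1 ≤ n ∧ L z.1 ≤ n := by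
        obtain ⟨p, hp⟩ := ENNReal.exists_nat_gt (hA' z.1).ne
        obtain ⟨q, hq⟩ := ENNReal.exists_nat_gt (hL' z.1).ne
        filter_upwards [eventually_ge_atTop p, eventually_ge_atTop q] with n hn hn'
        exact ⟨hp.le.trans (by exact_mod_cast hn), hq.le.trans (by exact_mod_cast hn')⟩
      refine tendsto_const_nhds.congr' ?_
      filter_upwards [h1] with n hn
      rw [hv, indicator_of_mem (show z ∈ {z : ℝ × Plane | A z.1 ≤ n ∧ L z.1 ≤ n} from hn)]
      simp
  refine (ge_of_tendsto' hlim hstep).trans (by simp)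

/-! ## Fourier multipliers on test functions -/

/-- The partial derivative of a Schwartz function. -/
def partialDeriv (j : Fin 2) : 𝓢(Plane, ℂ) →L[ℂ] 𝓢(Plane, ℂ) :=
  LineDeriv.lineDerivOpCLM ℂ 𝓢(Plane, ℂ) (EuclideanSpace.single j (1 : ℝ))

lemma partialDeriv_apply (j : Fin 2) (f : 𝓢(Plane, ℂ)) (x : Plane) :
    partialDeriv j f x = fderiv ℝ f x (EuclideanSpace.single j 1) :=
  SchwartzMap.lineDerivOp_apply_eq_fderiv _ f x

lemma fourier_partialDeriv_apply (j : Fin 2) (f : 𝓢(Plane, ℂ)) (ξ : Plane) :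
    𝓕 (partialDeriv j f) ξ = (2 * Real.pi * Complex.I * ξ j : ℂ) * 𝓕 f ξ := by
  have h : partialDeriv j f = LineDeriv.lineDerivOp (EuclideanSpace.single j (1 : ℝ)) f := rfl
  rw [h, SchwartzMap.fourier_lineDerivOp_eq, smul_apply,
    SchwartzMap.smulLeftCLM_apply_apply (by fun_prop)]
  simp [EuclideanSpace.inner_single_right, mul_assoc]

lemma eLpNorm_fourier (f : 𝓢(Plane, ℂ)) : eLpNorm (𝓕 f : 𝓢(Plane, ℂ)) 2 volume = eLpNorm f 2 volume := by
  have e : ∀ g : 𝓢(Plane, ℂ), ‖g.toLp 2 volume‖ = (eLpNorm g 2 volume).toReal :=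
    fun g => SchwartzMap.norm_toLp
  have h := SchwartzMap.norm_fourier_toL2_eq f
  rw [e, e] at h
  have hf : ∀ g : 𝓢(Plane, ℂ), eLpNorm g 2 volume ≠ ⊤ :=
    fun g => (SchwartzMap.memLp g 2 volume).2.ne
  exact (ENNReal.toReal_eq_toReal_iff' (hf _) (hf _)).1 h

lemma continuous_fourierInv {G : Plane → ℂ} (hG : Integrable G) : Continuous (𝓕⁻ G) := by
  rw [Real.fourierInv_eq_fourier_comp_neg]
  exact VectorFourier.fourierIntegral_continuous Real.continuous_fourierChar
    (by exact continuous_inner) hG.comp_neg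

lemma integral_fourierInv_mul {G H : Plane → ℂ} (hG : Integrable G) (hH : Integrable H) :
    ∫ x, 𝓕⁻ G x * H x = ∫ x, G x * 𝓕⁻ H x := by
  have h := VectorFourier.integral_bilin_fourierIntegral_eq_flip (ContinuousLinearMap.mul ℂ ℂ)
    (L := innerₗ Plane) (μ := volume) (ν := volume) Real.continuous_fourierChar
    (by exact continuous_inner) hG hH.comp_neg
  simp only [flip_innerₗ, ContinuousLinearMap.mul_apply'] at h
  have h' : ∫ ξ, 𝓕 G ξ * H (-ξ) = ∫ x, G x * 𝓕 (fun x => H (-x)) x := h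
  rw [← Real.fourierInv_eq_fourier_comp_neg] at h'
  rw [← h', ← integral_neg_eq_self]
  refine integral_congr_ae (Eventually.of_forall fun x => ?_)
  simp only
  rw [Real.fourierInv_eq_fourier_neg, neg_neg]

/-- Plancherel's inequality for integrable and square integrable functions. -/
lemma fourierInv_ae_eq_of_memLp {G : Plane → ℂ} (hG : Integrable G) (hG2 : MemLp G 2 volume) :
    (𝓕⁻ (hG2.toLp G) : Lp ℂ 2 volume) =ᵐ[volume] 𝓕⁻ G := by
  have hm : MemLp (𝓕⁻ (hG2.toLp G) : Lp ℂ 2 volume) 2 volume := Lp.memLp _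
  -- The L² transform and the integral transform represent the same tempered distribution.
  refine (represents_ofMemLp hm).ae_eq ⟨(continuous_fourierInv hG).locallyIntegrable, fun f _ => ?_⟩
  have h1 : ofMemLp hm = 𝓕⁻ (ofMemLp hG2) := by
    unfold ofMemLp
    rw [Lp.toLp_coeFn]
    exact (Lp.fourierInv_toTemperedDistribution_eq (hG2.toLp G)).symm
  rw [h1, TemperedDistribution.fourierInv_apply, ofMemLp_apply, SchwartzMap.fourierInv_coe,
    integral_fourierInv_mul f.integrable hG]

lemma eLpNorm_fourierInv_eq {G : Plane → ℂ} (hG : Integrable G) (hG2 : MemLp G 2 volume) :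
    eLpNorm (𝓕⁻ G) 2 volume = eLpNorm G 2 volume := by
  rw [← eLpNorm_congr_ae (fourierInv_ae_eq_of_memLp hG hG2)]
  have h : ‖(𝓕⁻ (hG2.toLp G) : Lp ℂ 2 (volume : Measure Plane))‖ = ‖hG2.toLp G‖ := by
    have := Lp.norm_fourier_eq (𝓕⁻ (hG2.toLp G) : Lp ℂ 2 (volume : Measure Plane))
    rwa [FourierTransform.fourier_fourierInv_eq, eq_comm] at this
  rw [Lp.norm_def, Lp.norm_toLp] at h
  exact (ENNReal.toReal_eq_toReal_iff' (Lp.memLp _).2.ne hG2.2.ne).1 h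

/-- The symbol of `Λ^β`. -/
def fracSymbol (β : ℝ) (ξ : Plane) : ℝ := (2 * Real.pi * ‖ξ‖) ^ β

lemma fracSymbol_nonneg (β : ℝ) (ξ : Plane) : 0 ≤ fracSymbol β ξ :=
  Real.rpow_nonneg (by positivity) _

lemma continuous_fracSymbol {β : ℝ} (hβ : 0 ≤ β) : Continuous (fracSymbol β) :=
  (by fun_prop : Continuous fun ξ : Plane => 2 * Real.pi * ‖ξ‖).rpow_const fun _ => Or.inr hβ

/-- Λ^β ρ need not be a Schwartz function, its symbol being singular at the origin. Domination by
the symbol of 1 - Δ still makes it continuous and square integrable, with the L² norm of `besselOp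
ρ` as a bound. -/
lemma fracSymbol_le {β : ℝ} (hβ : 0 ≤ β) (hβ2 : β ≤ 2) (ξ : Plane) :
    fracSymbol β ξ ≤ 1 + (2 * Real.pi * ‖ξ‖) ^ 2 := by
  unfold fracSymbol
  obtain ⟨q, hq, hq0⟩ : ∃ q, q = 2 * Real.pi * ‖ξ‖ ∧ 0 ≤ q := ⟨_, rfl, by positivity⟩
  rw [← hq]
  rcases le_total q 1 with h | h
  · have := Real.rpow_le_one hq0 h hβ
    nlinarith [sq_nonneg q]
  · have := Real.rpow_le_rpow_of_exponent_le h hβ2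
    rw [Real.rpow_two] at this
    linarith

/-- The complex-valued version of the fractional Laplacian of a test function. -/
def fracLap (β : ℝ) (ρ : 𝓢(Plane, ℂ)) : Plane → ℂ :=
  𝓕⁻ fun ξ : Plane => (fracSymbol β ξ : ℂ) * 𝓕 ρ ξ

/-- The Schwartz function `ρ - Δρ`. -/
def besselOp (ρ : 𝓢(Plane, ℂ)) : 𝓢(Plane, ℂ) :=
  ρ - (partialDeriv 0 (partialDeriv 0 ρ) + partialDeriv 1 (partialDeriv 1 ρ))

lemma fourier_besselOp_apply (ρ : 𝓢(Plane, ℂ)) (ξ : Plane) :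
    𝓕 (besselOp ρ) ξ = ((1 + (2 * Real.pi * ‖ξ‖) ^ 2 : ℝ) : ℂ) * 𝓕 ρ ξ := by
  have h : 𝓕 (besselOp ρ) = 𝓕 ρ - (𝓕 (partialDeriv 0 (partialDeriv 0 ρ))
      + 𝓕 (partialDeriv 1 (partialDeriv 1 ρ))) := by
    unfold besselOp
    rw [sub_eq_add_neg, FourierTransform.fourier_add, FourierTransform.fourier_neg,
      FourierTransform.fourier_add, sub_eq_add_neg]
  rw [h, sub_apply, add_apply, fourier_partialDeriv_apply,
    fourier_partialDeriv_apply, fourier_partialDeriv_apply, fourier_partialDeriv_apply]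
  have h2 : (‖ξ‖ : ℂ) ^ 2 = (ξ 0 : ℂ) ^ 2 + (ξ 1 : ℂ) ^ 2 := by
    rw [← Complex.ofReal_pow, EuclideanSpace.norm_sq_eq, Fin.sum_univ_two]
    simp
  push_cast
  rw [mul_pow, h2]
  linear_combination (- 4 * (Real.pi : ℂ) ^ 2 * ((ξ 0 : ℂ) ^ 2 + (ξ 1 : ℂ) ^ 2) * 𝓕 ρ ξ) *
    Complex.I_sq

section

variable {β : ℝ}

lemma norm_fracSymbol_mul_le (hβ : 0 ≤ β) (hβ2 : β ≤ 2) (ρ : 𝓢(Plane, ℂ)) (ξ : Plane) :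
    ‖(fracSymbol β ξ : ℂ) * 𝓕 ρ ξ‖ ≤ ‖𝓕 (besselOp ρ) ξ‖ := by
  rw [fourier_besselOp_apply, norm_mul, norm_mul, Complex.norm_real, Complex.norm_real,
    Real.norm_of_nonneg (fracSymbol_nonneg _ _), Real.norm_of_nonneg (by positivity)]
  exact mul_le_mul_of_nonneg_right (fracSymbol_le hβ hβ2 ξ) (norm_nonneg _)

lemma continuous_fracSymbol_mul (hβ : 0 ≤ β) (ρ : 𝓢(Plane, ℂ)) :
    Continuous fun ξ : Plane => (fracSymbol β ξ : ℂ) * 𝓕 ρ ξ :=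
  (Complex.continuous_ofReal.comp (continuous_fracSymbol hβ)).mul (𝓕 ρ).continuous

lemma integrable_fracSymbol_mul (hβ : 0 ≤ β) (hβ2 : β ≤ 2) (ρ : 𝓢(Plane, ℂ)) :
    Integrable fun ξ : Plane => (fracSymbol β ξ : ℂ) * 𝓕 ρ ξ :=
  (𝓕 (besselOp ρ)).integrable.mono (continuous_fracSymbol_mul hβ ρ).aestronglyMeasurable
    (Eventually.of_forall (norm_fracSymbol_mul_le hβ hβ2 ρ))

lemma memLp_fracSymbol_mul (hβ : 0 ≤ β) (hβ2 : β ≤ 2) (ρ : 𝓢(Plane, ℂ)) :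
    MemLp (fun ξ : Plane => (fracSymbol β ξ : ℂ) * 𝓕 ρ ξ) 2 volume :=
  ((𝓕 (besselOp ρ)).memLp 2).mono (continuous_fracSymbol_mul hβ ρ).aestronglyMeasurable
    (Eventually.of_forall (norm_fracSymbol_mul_le hβ hβ2 ρ))

lemma continuous_fracLap (hβ : 0 ≤ β) (hβ2 : β ≤ 2) (ρ : 𝓢(Plane, ℂ)) :
    Continuous (fracLap β ρ) :=
  continuous_fourierInv (integrable_fracSymbol_mul hβ hβ2 ρ)

lemma eLpNorm_fracLap_le (hβ : 0 ≤ β) (hβ2 : β ≤ 2) (ρ : 𝓢(Plane, ℂ)) :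
    eLpNorm (fracLap β ρ) 2 volume ≤ eLpNorm (besselOp ρ) 2 volume := by
  unfold fracLap
  rw [eLpNorm_fourierInv_eq (integrable_fracSymbol_mul hβ hβ2 ρ) (memLp_fracSymbol_mul hβ hβ2 ρ),
    ← eLpNorm_fourier]
  exact eLpNorm_mono (norm_fracSymbol_mul_le hβ hβ2 ρ)

lemma memLp_fracLap (hβ : 0 ≤ β) (hβ2 : β ≤ 2) (ρ : 𝓢(Plane, ℂ)) :
    MemLp (fracLap β ρ) 2 volume :=
  have h : eLpNorm (besselOp ρ) 2 volume < ⊤ := (SchwartzMap.memLp (besselOp ρ) 2 volume).2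
  ⟨(continuous_fracLap hβ hβ2 ρ).aestronglyMeasurable,
    lt_of_le_of_lt (eLpNorm_fracLap_le hβ hβ2 ρ) h⟩

lemma fourierInv_add_apply {G H : Plane → ℂ} (hG : Integrable G) (hH : Integrable H) (x : Plane) :
    𝓕⁻ (fun ξ => G ξ + H ξ) x = 𝓕⁻ G x + 𝓕⁻ H x := by
  simp only [Real.fourierInv_eq, smul_add]
  have h : ∀ {G : Plane → ℂ}, Integrable G →
      Integrable fun v => Real.fourierChar (inner ℝ v x) • G v := by
    intro G hG
    have := (Real.fourierIntegral_convergent_iff (f := G) (-x)).2 hG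
    simpa using this
  exact integral_add (h hG) (h hH)

lemma fourierInv_const_mul_apply (c : ℂ) (G : Plane → ℂ) (x : Plane) :
    𝓕⁻ (fun ξ => c * G ξ) x = c * 𝓕⁻ G x := by
  simp only [Real.fourierInv_eq]
  rw [← integral_const_mul]
  refine integral_congr_ae (Eventually.of_forall fun v => ?_)
  simp only [Circle.smul_def, smul_eq_mul]
  ring

lemma fracLap_add (hβ : 0 ≤ β) (hβ2 : β ≤ 2) (ρ σ : 𝓢(Plane, ℂ)) (x : Plane) :
    fracLap β (ρ + σ) x = fracLap β ρ x + fracLap β σ x := by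
  unfold fracLap
  rw [← fourierInv_add_apply (integrable_fracSymbol_mul hβ hβ2 ρ)
    (integrable_fracSymbol_mul hβ hβ2 σ), FourierTransform.fourier_add]
  refine congrFun (congrArg (fun G : Plane → ℂ => 𝓕⁻ G) (funext fun ξ => ?_)) x
  rw [add_apply]; ring

lemma fracLap_smul (c : ℂ) (ρ : 𝓢(Plane, ℂ)) (x : Plane) :
    fracLap β (c • ρ) x = c * fracLap β ρ x := by
  unfold fracLap
  rw [← fourierInv_const_mul_apply, FourierTransform.fourier_smul]
  refine congrFun (congrArg (fun G : Plane → ℂ => 𝓕⁻ G) (funext fun ξ => ?_)) x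
  rw [smul_apply, smul_eq_mul]; ring

lemma fourierInv_conj_neg (G : Plane → ℂ) (x : Plane) :
    𝓕⁻ (fun ξ => starRingEnd ℂ (G (-ξ))) x = starRingEnd ℂ (𝓕⁻ G x) := by
  simp only [Real.fourierInv_eq]
  rw [← integral_conj, ← integral_neg_eq_self]
  refine integral_congr_ae (Eventually.of_forall fun v => ?_)
  simp only [Circle.smul_def, smul_eq_mul, map_mul, neg_neg, inner_neg_left]
  rw [← Circle.coe_inv_eq_conj, AddChar.map_neg_eq_inv]

lemma fourier_conj_apply (f : Plane → ℂ) (ξ : Plane) :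
    𝓕 (fun x => starRingEnd ℂ (f x)) ξ = starRingEnd ℂ (𝓕 f (-ξ)) := by
  simp only [Real.fourier_eq]
  rw [← integral_conj]
  refine integral_congr_ae (Eventually.of_forall fun v => ?_)
  simp only [Circle.smul_def, smul_eq_mul, map_mul, neg_neg, inner_neg_right]
  rw [← Circle.coe_inv_eq_conj, AddChar.map_neg_eq_inv]

/-- The symbol is real and even, so Λ^β commutes with conjugation and therefore with real parts.
This links the operator of the weak formulation to its complex version. -/
lemma fracLaplacian_re (hβ : 0 ≤ β) (hβ2 : β ≤ 2) (ρ : 𝓢(Plane, ℂ)) (x : Plane) :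
    fracLaplacian β (fun y => (ρ y).re) x = (fracLap β ρ x).re := by
  have hi := integrable_fracSymbol_mul hβ hβ2 ρ
  have h1 : ∀ ξ : Plane, (fracSymbol β ξ : ℂ) * 𝓕 (fun y => ((ρ y).re : ℂ)) ξ
      = (1 / 2 : ℂ) * ((fracSymbol β ξ : ℂ) * 𝓕 ρ ξ
        + starRingEnd ℂ ((fracSymbol β (-ξ) : ℂ) * 𝓕 ρ (-ξ))) := by
    intro ξ
    have h2 : (fun y => ((ρ y).re : ℂ)) = fun y => (1 / 2 : ℂ) * (ρ y + starRingEnd ℂ (ρ y)) := by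
      ext y
      rw [Complex.add_conj]; push_cast; ring
    have hc : Integrable fun y => starRingEnd ℂ (ρ y) :=
      Complex.conjLIE.toContinuousLinearEquiv.toContinuousLinearMap.integrable_comp ρ.integrable
    have h3 : 𝓕 (fun y => ((ρ y).re : ℂ)) ξ = (1 / 2 : ℂ) * (𝓕 ρ ξ + starRingEnd ℂ (𝓕 ρ (-ξ))) := by
      rw [h2, SchwartzMap.fourier_coe]
      have h4 := fourier_conj_apply ρ ξ
      have h5 := fourierInv_const_mul_apply (1 / 2) (fun y => ρ y + starRingEnd ℂ (ρ y)) (-ξ)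
      have h6 := fourierInv_add_apply ρ.integrable hc (-ξ)
      simp only [Real.fourierInv_eq_fourier_neg, neg_neg] at h5 h6
      rw [h5, h6, h4]
    rw [h3]
    have h7 : fracSymbol β (-ξ) = fracSymbol β ξ := by simp [fracSymbol]
    rw [h7, map_mul, Complex.conj_ofReal]
    ring
  have h8 : fracLaplacian β (fun y => (ρ y).re) x = (𝓕⁻ (fun ξ : Plane =>
      (fracSymbol β ξ : ℂ) * 𝓕 (fun y => ((ρ y).re : ℂ)) ξ) x).re := rfl
  have hj : Integrable fun ξ => starRingEnd ℂ ((fracSymbol β (-ξ) : ℂ) * 𝓕 ρ (-ξ)) :=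
    Complex.conjLIE.toContinuousLinearEquiv.toContinuousLinearMap.integrable_comp hi.comp_neg
  rw [h8]
  simp_rw [h1]
  rw [fourierInv_const_mul_apply, fourierInv_add_apply hi hj,
    fourierInv_conj_neg fun ξ => (fracSymbol β ξ : ℂ) * 𝓕 ρ ξ, Complex.add_conj]
  unfold fracLap
  push_cast
  rw [one_div, inv_mul_cancel_left₀ two_ne_zero, Complex.ofReal_re]

end

/-! ## The difference of two solutions -/

/-- The properties of the difference `(w, η)` of two solutions with velocities `u` and `v` that
enter the estimate of `w`. -/
structure IsPerturbation (α T : ℝ) (w u v : ℝ × Plane → Plane) (η : ℝ × Plane → ℝ)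
    (A E : ℝ → ℝ≥0∞) (M : ℝ≥0∞) : Prop where
  half_lt : 1 / 2 < α
  lt_one : α < 1
  meas_w : Measurable w
  meas_u : Measurable u
  meas_v : Measurable v
  meas_η : Measurable η
  meas_A : Measurable A
  meas_E : Measurable E
  M_lt : M < ⊤
  w_sq : ∀ s, eLpNorm (fun x => w (s, x)) 2 volume ≤ M
  u_le : ∀ s x, ‖u (s, x)‖ₑ ≤ A s
  v_le : ∀ s x, ‖v (s, x)‖ₑ ≤ A s
  A_int : ∫⁻ s, A s < ⊤
  E_int : ∫⁻ s in Ioo 0 T, E s < ⊤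
  η_int : ∀ r, IntegrableOn η (univ ×ˢ Metric.closedBall 0 r)
  transport : ∀ (V : Plane → ℝ) (C : NNReal), LipschitzWith C V → HasCompactSupport V →
    ∀ᵐ t, t ∈ Ioo 0 T → ‖∫ x, V x * η (t, x)‖ₑ ≤ E t * eLpNorm (fderiv ℝ V) 2 volume
  momentum : ∀ Φ : ℝ × Plane → Plane, IsTestOn (Iio T) Φ → IsDivFree Φ →
    ∫ z in slab T, (inner ℝ (w z) (timeDeriv Φ z) + (inner ℝ (w z) (spaceDeriv Φ z (u z))
      + inner ℝ (v z) (spaceDeriv Φ z (w z)))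
      - ∑ i : Fin 2, w z i * fracLaplacian (2 * α) (fun y => Φ (z.1, y) i) z.2
      + η z * Φ z 1) = 0
  divFree : ∀ ψ : ℝ × Plane → ℝ, IsTestOn (Ioo 0 T) ψ →
    ∫ z in slab T, spaceDeriv ψ z (w z) = 0

lemma partialDeriv_comm (i j : Fin 2) (f : 𝓢(Plane, ℂ)) :
    partialDeriv i (partialDeriv j f) = partialDeriv j (partialDeriv i f) := by
  have h : 𝓕 (partialDeriv i (partialDeriv j f)) = 𝓕 (partialDeriv j (partialDeriv i f)) := by
    ext ξ
    simp only [fourier_partialDeriv_apply]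
    ring
  have hinv : ∀ g : 𝓢(Plane, ℂ), 𝓕⁻ (𝓕 g : 𝓢(Plane, ℂ)) = g := fun g =>
    FourierTransform.fourierInv_fourier_eq g
  rw [← hinv (partialDeriv i (partialDeriv j f)), h, hinv]

lemma fderiv_apply_eq_sum (f : 𝓢(Plane, ℂ)) (x v : Plane) :
    fderiv ℝ f x v = ∑ j : Fin 2, (v j : ℂ) * partialDeriv j f x := by
  have h : v = ∑ j : Fin 2, v j • EuclideanSpace.single j (1 : ℝ) := by
    ext i
    fin_cases i <;> simp [Fin.sum_univ_two]
  conv_lhs => rw [h]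
  rw [map_sum]
  refine Finset.sum_congr rfl fun j _ => ?_
  rw [map_smul, partialDeriv_apply, Complex.real_smul]

/-- The real part of `∇^⊥ ρ`. -/
def perpGrad (ρ : 𝓢(Plane, ℂ)) (x : Plane) : Plane :=
  WithLp.toLp 2 ![-(partialDeriv 1 ρ x).re, (partialDeriv 0 ρ x).re]

@[simp] lemma perpGrad_zero (ρ : 𝓢(Plane, ℂ)) (x : Plane) :
    perpGrad ρ x 0 = -(partialDeriv 1 ρ x).re := rfl

@[simp] lemma perpGrad_one (ρ : 𝓢(Plane, ℂ)) (x : Plane) :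
    perpGrad ρ x 1 = (partialDeriv 0 ρ x).re := rfl

lemma contDiff_re (ρ : 𝓢(Plane, ℂ)) : ContDiff ℝ ∞ fun x => (ρ x).re :=
  Complex.reCLM.contDiff.comp (ρ.smooth ⊤)

lemma contDiff_perpGrad (ρ : 𝓢(Plane, ℂ)) : ContDiff ℝ ∞ (perpGrad ρ) := by
  rw [contDiff_euclidean]
  intro i
  fin_cases i
  · exact (contDiff_re (partialDeriv 1 ρ)).neg
  · exact contDiff_re (partialDeriv 0 ρ)

lemma hasCompactSupport_partialDeriv {ρ : 𝓢(Plane, ℂ)} (h : HasCompactSupport ρ) (j : Fin 2) :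
    HasCompactSupport (partialDeriv j ρ) :=
  h.isCompact.of_isClosed_subset (isClosed_tsupport _) (SchwartzMap.tsupport_lineDerivOp_subset _ ρ)

lemma fderiv_perpGrad (ρ : 𝓢(Plane, ℂ)) (x v : Plane) :
    fderiv ℝ (perpGrad ρ) x v = WithLp.toLp 2
      ![-(∑ j : Fin 2, (v j : ℂ) * partialDeriv j (partialDeriv 1 ρ) x).re,
        (∑ j : Fin 2, (v j : ℂ) * partialDeriv j (partialDeriv 0 ρ) x).re] := by
  have hd := (contDiff_perpGrad ρ).differentiable (by simp) x
  have hc : ∀ i, fderiv ℝ (perpGrad ρ) x v i = fderiv ℝ (fun y => perpGrad ρ y i) x v := by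
    intro i
    have h1 : HasFDerivAt (fun y => perpGrad ρ y i)
        ((EuclideanSpace.proj i : Plane →L[ℝ] ℝ).comp (fderiv ℝ (perpGrad ρ) x)) x :=
      (EuclideanSpace.proj i : Plane →L[ℝ] ℝ).hasFDerivAt.comp x hd.hasFDerivAt
    rw [h1.fderiv]; rfl
  have hre : ∀ f : 𝓢(Plane, ℂ), HasFDerivAt (fun y => (f y).re)
      (Complex.reCLM.comp (fderiv ℝ f x)) x := fun f =>
    Complex.reCLM.hasFDerivAt.comp x (f.hasFDerivAt x)
  ext i
  rw [hc]
  fin_cases i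
  · change fderiv ℝ (fun y => -(partialDeriv 1 ρ y).re) x v = _
    have h1 : HasFDerivAt (fun y => -(partialDeriv 1 ρ y).re) _ x := (hre _).neg
    rw [h1.fderiv]
    change -(fderiv ℝ (partialDeriv 1 ρ) x v).re = _
    rw [fderiv_apply_eq_sum]; rfl
  · change fderiv ℝ (fun y => (partialDeriv 0 ρ y).re) x v = _
    rw [(hre _).fderiv]
    change (fderiv ℝ (partialDeriv 0 ρ) x v).re = _
    rw [fderiv_apply_eq_sum]; rfl

lemma hasFDerivAt_smul_comp {F : Type*} [NormedAddCommGroup F] [NormedSpace ℝ F] {h : ℝ → ℝ}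
    (hh : ContDiff ℝ ∞ h) {g : Plane → F} (hg : ContDiff ℝ ∞ g) (z : ℝ × Plane) (a : ℝ)
    (v : Plane) :
    fderiv ℝ (fun z : ℝ × Plane => h z.1 • g z.2) z (a, v)
      = (a * deriv h z.1) • g z.2 + h z.1 • fderiv ℝ g z.2 v := by
  have h1 : HasFDerivAt (fun z : ℝ × Plane => h z.1)
      ((ContinuousLinearMap.toSpanSingleton ℝ (deriv h z.1)).comp
        (ContinuousLinearMap.fst ℝ ℝ Plane)) z :=
    ((hh.differentiable (by simp) z.1).hasDerivAt.hasFDerivAt).comp z hasFDerivAt_fst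
  have h2 : HasFDerivAt (fun z : ℝ × Plane => g z.2)
      ((fderiv ℝ g z.2).comp (ContinuousLinearMap.snd ℝ ℝ Plane)) z :=
    (hg.differentiable (by simp) z.2).hasFDerivAt.comp z hasFDerivAt_snd
  have h3 : HasFDerivAt (fun z : ℝ × Plane => h z.1 • g z.2) _ z := h1.smul h2
  rw [h3.fderiv]
  simp [add_comm]

lemma isTestOn_smul_comp {F : Type*} [NormedAddCommGroup F] [NormedSpace ℝ F] {I : Set ℝ}
    {h : ℝ → ℝ}
    (hh : ContDiff ℝ ∞ h) (hc : HasCompactSupport h) (hI : tsupport h ⊆ I) {g : Plane → F}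
    (hg : ContDiff ℝ ∞ g) (hgc : HasCompactSupport g) :
    IsTestOn I fun z : ℝ × Plane => h z.1 • g z.2 := by
  have hcl : IsClosed (tsupport h ×ˢ tsupport g) :=
    (isClosed_tsupport h).prod (isClosed_tsupport g)
  have hs : tsupport (fun z : ℝ × Plane => h z.1 • g z.2) ⊆ tsupport h ×ˢ tsupport g := by
    refine closure_minimal (fun z hz => ⟨subset_tsupport _ fun h0 => hz ?_,
      subset_tsupport _ fun h0 => hz ?_⟩) hcl
    · simp [h0]
    · simp [h0]
  exact ⟨(hh.comp contDiff_fst).smul (hg.comp contDiff_snd),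
    (hc.isCompact.prod hgc.isCompact).of_isClosed_subset (isClosed_tsupport _) hs,
    hs.trans (prod_mono hI (subset_univ _))⟩

/-- The pairing of a vector field with `(-G, F)`. -/
def perpInner (a : Plane) (F G : ℂ) : ℂ := (a 1 : ℂ) * F - (a 0 : ℂ) * G

/-- The integrand of the nonlinear and buoyancy terms tested with `∇^⊥ ρ`. -/
def forcing (w u v : ℝ × Plane → Plane) (η : ℝ × Plane → ℝ) (ρ : 𝓢(Plane, ℂ))
    (z : ℝ × Plane) : ℂ :=
  ∑ j : Fin 2, ((u z j : ℂ) * perpInner (w z) (partialDeriv j (partialDeriv 0 ρ) z.2)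
      (partialDeriv j (partialDeriv 1 ρ) z.2)
    + (w z j : ℂ) * perpInner (v z) (partialDeriv j (partialDeriv 0 ρ) z.2)
      (partialDeriv j (partialDeriv 1 ρ) z.2)) + (η z : ℂ) * partialDeriv 0 ρ z.2

/-- The weak momentum balance for the test function `h(t) ∇^⊥ ρ(x)`. -/
def balance (β : ℝ) (w u v : ℝ × Plane → Plane) (η : ℝ × Plane → ℝ) (h : ℝ → ℝ)
    (ρ : 𝓢(Plane, ℂ)) (z : ℝ × Plane) : ℂ :=
  ((deriv h z.1 : ℝ) : ℂ) * perpInner (w z) (partialDeriv 0 ρ z.2) (partialDeriv 1 ρ z.2)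
    - (h z.1 : ℂ) * perpInner (w z) (fracLap β (partialDeriv 0 ρ) z.2)
      (fracLap β (partialDeriv 1 ρ) z.2)
    + (h z.1 : ℂ) * forcing w u v η ρ z

section

variable {α T : ℝ} {w u v : ℝ × Plane → Plane} {η : ℝ × Plane → ℝ} {A E : ℝ → ℝ≥0∞}
  {M : ℝ≥0∞}

/-- ∇^⊥ of the real part of ρ is divergence free because mixed derivatives commute, so its product
with h(t) is an admissible test function. -/
lemma IsPerturbation.integral_re_balance (hp : IsPerturbation α T w u v η A E M) {h : ℝ → ℝ}
    (hh : ContDiff ℝ ∞ h) (hc : HasCompactSupport h) (hI : tsupport h ⊆ Iio T)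
    {ρ : 𝓢(Plane, ℂ)} (hρ : HasCompactSupport ρ) :
    ∫ z in slab T, (balance (2 * α) w u v η h ρ z).re = 0 := by
  have hgc : HasCompactSupport (perpGrad ρ) := by
    refine HasCompactSupport.intro
      (((hasCompactSupport_partialDeriv hρ 0).isCompact.union
        (hasCompactSupport_partialDeriv hρ 1).isCompact)) fun x hx => ?_
    rw [mem_union, not_or] at hx
    ext i
    fin_cases i
    · change -(partialDeriv 1 ρ x).re = 0
      rw [image_eq_zero_of_notMem_tsupport hx.2]; simp
    · change (partialDeriv 0 ρ x).re = 0
      rw [image_eq_zero_of_notMem_tsupport hx.1]; simp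
  have htest := isTestOn_smul_comp hh hc hI (contDiff_perpGrad ρ) hgc
  have hβ : 0 ≤ 2 * α := by linarith [hp.half_lt]
  have hβ2 : 2 * α ≤ 2 := by linarith [hp.lt_one]
  have hfrac : ∀ (s : ℝ) (f : 𝓢(Plane, ℂ)) (x : Plane),
      fracLaplacian (2 * α) (fun y => s * (f y).re) x = s * (fracLap (2 * α) f x).re := by
    intro s f x
    have h1 := fracLaplacian_re hβ hβ2 ((s : ℂ) • f) x
    rw [fracLap_smul, Complex.re_ofReal_mul] at h1
    rw [← h1]
    congr 1
    funext y
    rw [smul_apply, smul_eq_mul, Complex.re_ofReal_mul]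
  rw [← hp.momentum _ htest ?_]
  · refine integral_congr_ae (Eventually.of_forall fun z => ?_)
    simp only [timeDeriv, spaceDeriv]
    rw [hasFDerivAt_smul_comp hh (contDiff_perpGrad ρ),
      hasFDerivAt_smul_comp hh (contDiff_perpGrad ρ), hasFDerivAt_smul_comp hh (contDiff_perpGrad ρ),
      fderiv_perpGrad, fderiv_perpGrad, fderiv_perpGrad]
    simp only [Fin.sum_univ_two]
    have h0 : (fun y => (h z.1 • perpGrad ρ y) 0) = fun y => (-h z.1) * (partialDeriv 1 ρ y).re := by
      funext y; simp
    have h1 : (fun y => (h z.1 • perpGrad ρ y) 1) = fun y => (h z.1) * (partialDeriv 0 ρ y).re := by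
      funext y; simp
    rw [h0, h1, hfrac, hfrac]
    simp only [balance, forcing, perpInner, PiLp.inner_apply, Fin.sum_univ_two]
    simp [Complex.add_re, Complex.mul_re]
    ring
  · intro z
    rw [Fin.sum_univ_two]
    simp only [spaceDeriv]
    rw [hasFDerivAt_smul_comp hh (contDiff_perpGrad ρ),
      hasFDerivAt_smul_comp hh (contDiff_perpGrad ρ), fderiv_perpGrad, fderiv_perpGrad]
    simp [partialDeriv_comm 1 0]

lemma forcing_smul (c : ℂ) (ρ : 𝓢(Plane, ℂ)) (z : ℝ × Plane) :
    forcing w u v η (c • ρ) z = c * forcing w u v η ρ z := by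
  simp only [forcing, map_smul, smul_apply, smul_eq_mul, perpInner, Fin.sum_univ_two]
  ring

lemma balance_smul (β : ℝ) (h : ℝ → ℝ) (c : ℂ) (ρ : 𝓢(Plane, ℂ)) (z : ℝ × Plane) :
    balance β w u v η h (c • ρ) z = c * balance β w u v η h ρ z := by
  simp only [balance, forcing_smul, map_smul, fracLap_smul, smul_apply, smul_eq_mul, perpInner]
  ring

/-- The balance is complex linear in ρ, so its imaginary part is the real part of the balance for
-iρ. -/
theorem IsPerturbation.integral_balance (hp : IsPerturbation α T w u v η A E M) {h : ℝ → ℝ}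
    (hh : ContDiff ℝ ∞ h) (hc : HasCompactSupport h) (hI : tsupport h ⊆ Iio T)
    {ρ : 𝓢(Plane, ℂ)} (hρ : HasCompactSupport ρ)
    (hi : IntegrableOn (balance (2 * α) w u v η h ρ) (slab T)) :
    ∫ z in slab T, balance (2 * α) w u v η h ρ z = 0 := by
  have h1 := hp.integral_re_balance hh hc hI hρ
  have h2 := hp.integral_re_balance hh hc hI (ρ := (-Complex.I) • ρ)
    (HasCompactSupport.smul_left (f := fun _ => -Complex.I) hρ)
  have hre : (∫ z in slab T, balance (2 * α) w u v η h ρ z).re = 0 := by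
    rw [← h1]; exact (integral_re hi).symm
  have him : (∫ z in slab T, balance (2 * α) w u v η h ρ z).im = 0 := by
    rw [← h2]
    refine (integral_im hi).symm.trans (integral_congr_ae (Eventually.of_forall fun z => ?_))
    simp only [balance_smul]
    simp
  exact Complex.ext hre him

end

/-! ## The momentum balance in time -/

/-- The pairing of a velocity field at time `s` with `(-G, F)`. -/
def velPair (w : ℝ × Plane → Plane) (s : ℝ) (F G : Plane → ℂ) : ℂ :=
  ∫ x, perpInner (w (s, x)) (F x) (G x)

/-- The linear part of the momentum balance tested with `h(t) ∇^⊥ ρ`. -/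
def linearPart (β : ℝ) (w : ℝ × Plane → Plane) (h : ℝ → ℝ) (ρ : 𝓢(Plane, ℂ)) (s : ℝ) : ℂ :=
  ((deriv h s : ℝ) : ℂ) * velPair w s (partialDeriv 0 ρ) (partialDeriv 1 ρ)
    - (h s : ℂ) * velPair w s (fracLap β (partialDeriv 0 ρ)) (fracLap β (partialDeriv 1 ρ))

/-- The sum of the `L²` norms of the second derivatives. -/
def hessNorm (ρ : 𝓢(Plane, ℂ)) : ℝ :=
  ∑ j : Fin 2, (‖(partialDeriv j (partialDeriv 0 ρ)).toLp 2 volume‖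
    + ‖(partialDeriv j (partialDeriv 1 ρ)).toLp 2 volume‖)

/-- The norm that controls the linear part of the momentum balance. -/
def linearNorm (ρ : 𝓢(Plane, ℂ)) : ℝ :=
  (‖(partialDeriv 0 ρ).toLp 2 volume‖ + ‖(partialDeriv 1 ρ).toLp 2 volume‖)
    + (‖(besselOp (partialDeriv 0 ρ)).toLp 2 volume‖
      + ‖(besselOp (partialDeriv 1 ρ)).toLp 2 volume‖)

lemma ofReal_norm_toLp (g : 𝓢(Plane, ℂ)) :
    ENNReal.ofReal ‖g.toLp 2 volume‖ = eLpNorm g 2 volume := by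
  have e : ‖g.toLp 2 volume‖ = (eLpNorm g 2 volume).toReal := SchwartzMap.norm_toLp
  have h : eLpNorm g 2 volume ≠ ⊤ := (SchwartzMap.memLp g 2 volume).2.ne
  rw [e, ENNReal.ofReal_toReal h]

lemma continuous_norm_toLp :
    Continuous fun g : 𝓢(Plane, ℂ) => ‖g.toLp 2 (volume : Measure Plane)‖ :=
  (SchwartzMap.continuous_toLp (p := 2)).norm

lemma continuous_besselOp : Continuous besselOp := by
  unfold besselOp
  fun_prop

lemma continuous_hessNorm : Continuous hessNorm := by
  unfold hessNorm
  refine continuous_finsetSum _ fun j _ => ?_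
  exact (continuous_norm_toLp.comp (by fun_prop)).add (continuous_norm_toLp.comp (by fun_prop))

lemma continuous_linearNorm : Continuous linearNorm := by
  have h := continuous_besselOp
  unfold linearNorm
  exact ((continuous_norm_toLp.comp (by fun_prop)).add (continuous_norm_toLp.comp (by fun_prop))).add
    ((continuous_norm_toLp.comp (by fun_prop)).add (continuous_norm_toLp.comp (by fun_prop)))

lemma toLp_add (f g : 𝓢(Plane, ℂ)) :
    (f + g).toLp 2 (volume : Measure Plane) = f.toLp 2 volume + g.toLp 2 volume :=
  map_add (SchwartzMap.toLpCLM ℝ ℂ 2 (volume : Measure Plane)) f g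

lemma toLp_smul (c : ℂ) (f : 𝓢(Plane, ℂ)) :
    (c • f).toLp 2 (volume : Measure Plane) = c • f.toLp 2 volume :=
  map_smul (SchwartzMap.toLpCLM ℂ ℂ 2 (volume : Measure Plane)) c f

lemma hessNorm_nonneg (ρ : 𝓢(Plane, ℂ)) : 0 ≤ hessNorm ρ := by
  unfold hessNorm; positivity

lemma hessNorm_zero : hessNorm 0 = 0 := by
  have h : (0 : 𝓢(Plane, ℂ)).toLp 2 (volume : Measure Plane) = 0 :=
    map_zero (SchwartzMap.toLpCLM ℝ ℂ 2 (volume : Measure Plane))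
  simp [hessNorm, h]

lemma linearNorm_zero : linearNorm 0 = 0 := by
  have h : (0 : 𝓢(Plane, ℂ)).toLp 2 (volume : Measure Plane) = 0 :=
    map_zero (SchwartzMap.toLpCLM ℝ ℂ 2 (volume : Measure Plane))
  simp [linearNorm, besselOp, h]

lemma hessNorm_add_le (ρ σ : 𝓢(Plane, ℂ)) : hessNorm (ρ + σ) ≤ hessNorm ρ + hessNorm σ := by
  unfold hessNorm
  rw [← Finset.sum_add_distrib]
  refine Finset.sum_le_sum fun j _ => ?_
  simp only [map_add, toLp_add]
  have h1 := norm_add_le ((partialDeriv j (partialDeriv 0 ρ)).toLp 2 (volume : Measure Plane))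
    ((partialDeriv j (partialDeriv 0 σ)).toLp 2 volume)
  have h2 := norm_add_le ((partialDeriv j (partialDeriv 1 ρ)).toLp 2 (volume : Measure Plane))
    ((partialDeriv j (partialDeriv 1 σ)).toLp 2 volume)
  linarith

lemma hessNorm_smul (c : ℂ) (ρ : 𝓢(Plane, ℂ)) : hessNorm (c • ρ) = ‖c‖ * hessNorm ρ := by
  simp only [hessNorm, map_smul, toLp_smul, norm_smul, Finset.mul_sum, mul_add]

lemma hessNorm_sum_le {ι : Type*} (s : Finset ι) (ρ : ι → 𝓢(Plane, ℂ)) :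
    hessNorm (∑ n ∈ s, ρ n) ≤ ∑ n ∈ s, hessNorm (ρ n) :=
  Finset.le_sum_of_subadditive hessNorm hessNorm_zero.le hessNorm_add_le s ρ

lemma norm_perpInner_le (a : Plane) (F G : ℂ) : ‖perpInner a F G‖ ≤ ‖a‖ * (‖F‖ + ‖G‖) := by
  unfold perpInner
  refine (norm_sub_le _ _).trans ?_
  rw [norm_mul, norm_mul, Complex.norm_real, Complex.norm_real, mul_add]
  exact add_le_add (mul_le_mul_of_nonneg_right (PiLp.norm_apply_le a 1) (norm_nonneg _))
    (mul_le_mul_of_nonneg_right (PiLp.norm_apply_le a 0) (norm_nonneg _))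

lemma enorm_perpInner_le (a : Plane) (F G : ℂ) :
    ‖perpInner a F G‖ₑ ≤ ‖a‖ₑ * (‖F‖ₑ + ‖G‖ₑ) := by
  have h := ENNReal.ofReal_le_ofReal (norm_perpInner_le a F G)
  rwa [ENNReal.ofReal_mul (norm_nonneg _), ENNReal.ofReal_add (norm_nonneg _) (norm_nonneg _),
    ofReal_norm, ofReal_norm, ofReal_norm, ofReal_norm] at h

lemma measurable_perpInner {X : Type*} [MeasurableSpace X] {a : X → Plane} {F G : X → ℂ}
    (ha : Measurable a) (hF : Measurable F) (hG : Measurable G) :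
    Measurable fun x => perpInner (a x) (F x) (G x) := by
  have h : ∀ i, Measurable fun x => a x i := fun i =>
    (EuclideanSpace.proj i : Plane →L[ℝ] ℝ).continuous.measurable.comp ha
  exact ((Complex.measurable_ofReal.comp (h 1)).mul hF).sub
    ((Complex.measurable_ofReal.comp (h 0)).mul hG)

lemma lintegral_enorm_le_of_slice {f : Plane → ℂ} {B : ℝ≥0∞} {a : Plane → Plane}
    (ha : Measurable a) {H : Plane → ℝ≥0∞} (hH : Measurable H)
    (h : ∀ x, ‖f x‖ₑ ≤ B * (‖a x‖ₑ * H x)) :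
    ∫⁻ x, ‖f x‖ₑ ≤ B * (eLpNorm a 2 volume * eLpNorm H 2 volume) := by
  refine (lintegral_mono h).trans ?_
  rw [lintegral_const_mul (f := fun x => ‖a x‖ₑ * H x) _ (ha.enorm.mul hH)]
  refine mul_le_mul_right ((lintegral_mul_le_eLpNorm_two ha.enorm.aemeasurable hH.aemeasurable).trans
    ?_) _
  rw [eLpNorm_enorm']

lemma eLpNorm_enorm_add_le {F G : Plane → ℂ} (hF : Measurable F) (hG : Measurable G) :
    eLpNorm (fun x => ‖F x‖ₑ + ‖G x‖ₑ) 2 volume ≤ eLpNorm F 2 volume + eLpNorm G 2 volume := by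
  refine (eLpNorm_add_le hF.enorm.aestronglyMeasurable hG.enorm.aestronglyMeasurable
    one_le_two).trans ?_
  rw [eLpNorm_enorm', eLpNorm_enorm']

/-- A function on the slab dominated by the product of a time function, a velocity field that is
bounded in `L²`, and a square integrable function of space, is integrable. -/
lemma integrableOn_slab_of_le {T : ℝ} {f : ℝ × Plane → ℂ} (hf : Measurable f) {B : ℝ → ℝ≥0∞}
    (hBi : ∫⁻ s in Ioo 0 T, B s ≠ ⊤) {w : ℝ × Plane → Plane} (hw : Measurable w)
    {M : ℝ≥0∞} (hM : M ≠ ⊤) (hwM : ∀ s, eLpNorm (fun x => w (s, x)) 2 volume ≤ M)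
    {H : Plane → ℝ≥0∞} (hH : Measurable H) (hH2 : eLpNorm H 2 volume ≠ ⊤)
    (h : ∀ s x, ‖f (s, x)‖ₑ ≤ B s * (‖w (s, x)‖ₑ * H x)) : IntegrableOn f (slab T) := by
  refine ⟨hf.aestronglyMeasurable, ?_⟩
  rw [HasFiniteIntegral, volume_restrict_slab]
  refine (lintegral_prod_le _).trans_lt ?_
  have h1 : ∀ s, ∫⁻ x, ‖f (s, x)‖ₑ ≤ B s * (M * eLpNorm H 2 volume) := fun s =>
    (lintegral_enorm_le_of_slice (hw.comp measurable_prodMk_left) hH (h s)).trans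
      (mul_le_mul_right (mul_le_mul_left (hwM s) _) _)
  refine (lintegral_mono h1).trans_lt ?_
  rw [lintegral_mul_const' _ _ (ENNReal.mul_ne_top hM hH2)]
  exact (ENNReal.mul_ne_top hBi (ENNReal.mul_ne_top hM hH2)).lt_top

section

variable {α T : ℝ} {w u v : ℝ × Plane → Plane} {η : ℝ × Plane → ℝ} {A E : ℝ → ℝ≥0∞}
  {M : ℝ≥0∞}

/-- The second derivatives of a test function that enter the nonlinear term. -/
def hessSum (ρ : 𝓢(Plane, ℂ)) (x : Plane) : ℝ≥0∞ :=
  ∑ j : Fin 2, (‖partialDeriv j (partialDeriv 0 ρ) x‖ₑ + ‖partialDeriv j (partialDeriv 1 ρ) x‖ₑ)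

lemma measurable_hessSum (ρ : 𝓢(Plane, ℂ)) : Measurable (hessSum ρ) := by
  unfold hessSum
  refine Finset.measurable_sum _ fun j _ => ?_
  exact (partialDeriv j (partialDeriv 0 ρ)).continuous.measurable.enorm.add
    (partialDeriv j (partialDeriv 1 ρ)).continuous.measurable.enorm

lemma eLpNorm_hessSum_le (ρ : 𝓢(Plane, ℂ)) :
    eLpNorm (hessSum ρ) 2 volume ≤ ENNReal.ofReal (hessNorm ρ) := by
  have h1 : ∀ f g : 𝓢(Plane, ℂ), eLpNorm (fun x => ‖f x‖ₑ + ‖g x‖ₑ) 2 volume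
      ≤ ENNReal.ofReal (‖f.toLp 2 volume‖ + ‖g.toLp 2 volume‖) := by
    intro f g
    rw [ENNReal.ofReal_add (norm_nonneg _) (norm_nonneg _), ofReal_norm_toLp, ofReal_norm_toLp]
    exact eLpNorm_enorm_add_le f.continuous.measurable g.continuous.measurable
  obtain ⟨G, hG⟩ : ∃ G : Fin 2 → Plane → ℝ≥0∞, ∀ j, G j = fun x =>
      ‖partialDeriv j (partialDeriv 0 ρ) x‖ₑ + ‖partialDeriv j (partialDeriv 1 ρ) x‖ₑ :=
    ⟨_, fun _ => rfl⟩
  have hGm : ∀ j, AEStronglyMeasurable (G j) volume := fun j => by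
    rw [hG]
    exact ((partialDeriv j (partialDeriv 0 ρ)).continuous.measurable.enorm.add
      (partialDeriv j (partialDeriv 1 ρ)).continuous.measurable.enorm).aestronglyMeasurable
  have hs : hessSum ρ = G 0 + G 1 := by
    funext x
    rw [Pi.add_apply, hG, hG, hessSum, Fin.sum_univ_two]
  rw [hs]
  refine (eLpNorm_add_le (hGm 0) (hGm 1) one_le_two).trans ?_
  rw [hessNorm, Fin.sum_univ_two, ENNReal.ofReal_add (add_nonneg (norm_nonneg _) (norm_nonneg _))
    (add_nonneg (norm_nonneg _) (norm_nonneg _)), hG, hG]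
  exact add_le_add (h1 _ _) (h1 _ _)

/-- The nonlinear part of the forcing. -/
def advection (w u v : ℝ × Plane → Plane) (ρ : 𝓢(Plane, ℂ)) (z : ℝ × Plane) : ℂ :=
  ∑ j : Fin 2, ((u z j : ℂ) * perpInner (w z) (partialDeriv j (partialDeriv 0 ρ) z.2)
      (partialDeriv j (partialDeriv 1 ρ) z.2)
    + (w z j : ℂ) * perpInner (v z) (partialDeriv j (partialDeriv 0 ρ) z.2)
      (partialDeriv j (partialDeriv 1 ρ) z.2))

lemma forcing_eq (ρ : 𝓢(Plane, ℂ)) (z : ℝ × Plane) :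
    forcing w u v η ρ z = advection w u v ρ z + (η z : ℂ) * partialDeriv 0 ρ z.2 := rfl

lemma enorm_coord_le (a : Plane) (j : Fin 2) : ‖(a j : ℂ)‖ₑ ≤ ‖a‖ₑ := by
  rw [← ofReal_norm, ← ofReal_norm, Complex.norm_real]
  exact ENNReal.ofReal_le_ofReal (PiLp.norm_apply_le a j)

/-- In both parts of the quadratic term one factor is w and the other is a velocity bounded by B;
hence 2 B. -/
lemma enorm_advection_le (ρ : 𝓢(Plane, ℂ)) {z : ℝ × Plane} {B : ℝ≥0∞} (hu : ‖u z‖ₑ ≤ B)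
    (hv : ‖v z‖ₑ ≤ B) :
    ‖advection w u v ρ z‖ₑ ≤ 2 * B * (‖w z‖ₑ * hessSum ρ z.2) := by
  unfold advection hessSum
  refine (enorm_sum_le _ _).trans ?_
  rw [Finset.mul_sum, Finset.mul_sum]
  refine Finset.sum_le_sum fun j _ => ?_
  refine (enorm_add_le _ _).trans ?_
  rw [enorm_mul, enorm_mul]
  have h1 : ‖(u z j : ℂ)‖ₑ * ‖perpInner (w z) (partialDeriv j (partialDeriv 0 ρ) z.2)
      (partialDeriv j (partialDeriv 1 ρ) z.2)‖ₑ ≤ B * (‖w z‖ₑ *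
      (‖partialDeriv j (partialDeriv 0 ρ) z.2‖ₑ + ‖partialDeriv j (partialDeriv 1 ρ) z.2‖ₑ)) :=
    mul_le_mul' ((enorm_coord_le _ _).trans hu) (enorm_perpInner_le _ _ _)
  have h2 : ‖(w z j : ℂ)‖ₑ * ‖perpInner (v z) (partialDeriv j (partialDeriv 0 ρ) z.2)
      (partialDeriv j (partialDeriv 1 ρ) z.2)‖ₑ ≤ B * (‖w z‖ₑ *
      (‖partialDeriv j (partialDeriv 0 ρ) z.2‖ₑ + ‖partialDeriv j (partialDeriv 1 ρ) z.2‖ₑ)) := by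
    refine (mul_le_mul' (enorm_coord_le _ _) ((enorm_perpInner_le _ _ _).trans
      (mul_le_mul_left hv _))).trans_eq ?_
    ring
  refine (add_le_add h1 h2).trans_eq ?_
  ring

lemma measurable_coord {X : Type*} [MeasurableSpace X] {a : X → Plane} (ha : Measurable a)
    (j : Fin 2) : Measurable fun x => (a x j : ℂ) :=
  Complex.measurable_ofReal.comp
    ((EuclideanSpace.proj j : Plane →L[ℝ] ℝ).continuous.measurable.comp ha)

lemma measurable_schwartz_snd (g : 𝓢(Plane, ℂ)) : Measurable fun z : ℝ × Plane => g z.2 :=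
  g.continuous.measurable.comp measurable_snd

lemma measurable_advection (hw : Measurable w) (hu : Measurable u) (hv : Measurable v)
    (ρ : 𝓢(Plane, ℂ)) : Measurable (advection w u v ρ) := by
  unfold advection
  refine Finset.measurable_sum _ fun j _ => ?_
  exact ((measurable_coord hu j).mul (measurable_perpInner hw (measurable_schwartz_snd _)
    (measurable_schwartz_snd _))).add ((measurable_coord hw j).mul
    (measurable_perpInner hv (measurable_schwartz_snd _) (measurable_schwartz_snd _)))

lemma advection_sum {ι : Type*} (s : Finset ι) (c : ι → ℂ) (ρ : ι → 𝓢(Plane, ℂ))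
    (z : ℝ × Plane) :
    advection w u v (∑ n ∈ s, c n • ρ n) z = ∑ n ∈ s, c n * advection w u v (ρ n) z := by
  simp only [advection, map_sum, map_smul, perpInner, schwartzMap_sum_apply, smul_apply,
    smul_eq_mul, Fin.sum_univ_two, Finset.mul_sum, ← Finset.sum_add_distrib,
    ← Finset.sum_sub_distrib]
  refine Finset.sum_congr rfl fun n _ => ?_
  ring

namespace IsPerturbation

lemma A_int' (hp : IsPerturbation α T w u v η A E M) : ∫⁻ s in Ioo 0 T, 2 * A s ≠ ⊤ := by
  rw [lintegral_const_mul' _ _ (by norm_num)]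
  exact ENNReal.mul_ne_top (by norm_num)
    ((setLIntegral_le_lintegral _ _).trans_lt hp.A_int).ne

lemma integrableOn_advection (hp : IsPerturbation α T w u v η A E M) (ρ : 𝓢(Plane, ℂ)) :
    IntegrableOn (advection w u v ρ) (slab T) :=
  integrableOn_slab_of_le (measurable_advection hp.meas_w hp.meas_u hp.meas_v ρ) hp.A_int'
    hp.meas_w hp.M_lt.ne hp.w_sq (measurable_hessSum ρ)
    ((eLpNorm_hessSum_le ρ).trans_lt ENNReal.ofReal_lt_top).ne
    fun s x => enorm_advection_le ρ (hp.u_le s x) (hp.v_le s x)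

lemma enorm_integral_advection_le (hp : IsPerturbation α T w u v η A E M) (ρ : 𝓢(Plane, ℂ))
    (s : ℝ) : ‖∫ x, advection w u v ρ (s, x)‖ₑ
      ≤ 2 * A s * eLpNorm (fun x => w (s, x)) 2 volume * ENNReal.ofReal (hessNorm ρ) := by
  refine (enorm_integral_le_lintegral_enorm _).trans ?_
  refine (lintegral_enorm_le_of_slice (hp.meas_w.comp measurable_prodMk_left)
    (measurable_hessSum ρ) fun x => enorm_advection_le ρ (hp.u_le s x) (hp.v_le s x)).trans ?_
  rw [mul_assoc (2 * A s)]
  exact mul_le_mul_right (mul_le_mul_right (eLpNorm_hessSum_le ρ) _) _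

lemma ae_integrable_advection (hp : IsPerturbation α T w u v η A E M) (ρ : 𝓢(Plane, ℂ)) :
    ∀ᵐ s, s ∈ Ioo 0 T → Integrable fun x => advection w u v ρ (s, x) := by
  have h := hp.integrableOn_advection ρ
  rw [IntegrableOn, volume_restrict_slab] at h
  exact (ae_restrict_iff' measurableSet_Ioo).1 h.prod_right_ae

/-- η is integrable only over sets bounded in x, so V must have compact support. This is the
obstacle to testing directly with Schwartz functions. -/
lemma integrable_buoyancy (hp : IsPerturbation α T w u v η A E M) {V : Plane → ℂ}
    (hV : Continuous V) (hc : HasCompactSupport V) :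
    Integrable fun z : ℝ × Plane => (η z : ℂ) * V z.2 := by
  obtain ⟨r, hr⟩ := hc.isCompact.isBounded.subset_closedBall 0
  obtain ⟨C, hC⟩ := hV.bounded_above_of_compact_support hc
  refine integrable_of_norm_le_of_integrableOn (hp.η_int r) (c := C)
    ((Complex.measurable_ofReal.comp hp.meas_η).aestronglyMeasurable.mul
      (hV.comp continuous_snd).aestronglyMeasurable) (fun z hz => ?_) fun z => ?_
  · rw [image_eq_zero_of_notMem_tsupport fun h => hz ⟨mem_univ _, hr h⟩, mul_zero]
  · rw [norm_mul, Complex.norm_real, mul_comm]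
    exact mul_le_mul_of_nonneg_right (hC _) (norm_nonneg _)

lemma integrable_velPair (hp : IsPerturbation α T w u v η A E M) {F G : Plane → ℂ}
    (hF : Continuous F) (hG : Continuous G) (hF2 : MemLp F 2 volume) (hG2 : MemLp G 2 volume)
    (s : ℝ) : Integrable fun x => perpInner (w (s, x)) (F x) (G x) := by
  have hws : Measurable fun x => w (s, x) := hp.meas_w.comp measurable_prodMk_left
  refine ⟨(measurable_perpInner hws hF.measurable hG.measurable).aestronglyMeasurable, ?_⟩
  refine (lintegral_enorm_le_of_slice (B := 1) hws (H := fun x => ‖F x‖ₑ + ‖G x‖ₑ)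
    (hF.measurable.enorm.add hG.measurable.enorm) fun x => ?_).trans_lt ?_
  · rw [one_mul]; exact enorm_perpInner_le _ _ _
  · rw [one_mul]
    refine ENNReal.mul_lt_top ((hp.w_sq s).trans_lt hp.M_lt) ?_
    exact (eLpNorm_enorm_add_le hF.measurable hG.measurable).trans_lt
      (ENNReal.add_lt_top.2 ⟨hF2.2, hG2.2⟩)

lemma enorm_velPair_le (hp : IsPerturbation α T w u v η A E M) {F G : Plane → ℂ}
    (hF : Continuous F) (hG : Continuous G) (s : ℝ) :
    ‖velPair w s F G‖ₑ ≤ M * (eLpNorm F 2 volume + eLpNorm G 2 volume) := by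
  have hws : Measurable fun x => w (s, x) := hp.meas_w.comp measurable_prodMk_left
  refine (enorm_integral_le_lintegral_enorm _).trans ?_
  refine (lintegral_enorm_le_of_slice (B := 1) hws (H := fun x => ‖F x‖ₑ + ‖G x‖ₑ)
    (hF.measurable.enorm.add hG.measurable.enorm) fun x => ?_).trans ?_
  · rw [one_mul]; exact enorm_perpInner_le _ _ _
  · rw [one_mul]
    exact mul_le_mul' (hp.w_sq s) (eLpNorm_enorm_add_le hF.measurable hG.measurable)

lemma measurable_velPair (hp : IsPerturbation α T w u v η A E M) {F G : Plane → ℂ}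
    (hF : Continuous F) (hG : Continuous G) : Measurable fun s => velPair w s F G := by
  have h := (measurable_perpInner hp.meas_w (hF.measurable.comp measurable_snd)
    (hG.measurable.comp measurable_snd)).stronglyMeasurable
  exact (StronglyMeasurable.integral_prod_right' (ν := (volume : Measure Plane)) h).measurable

lemma integrableOn_velPair (hp : IsPerturbation α T w u v η A E M) {F G : Plane → ℂ}
    (hF : Continuous F) (hG : Continuous G) (hF2 : MemLp F 2 volume) (hG2 : MemLp G 2 volume)
    {k : ℝ → ℝ} (hk : Continuous k) :
    IntegrableOn (fun z : ℝ × Plane => (k z.1 : ℂ) * perpInner (w z) (F z.2) (G z.2)) (slab T) := by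
  obtain ⟨C, hC⟩ := (isCompact_Icc (a := (0 : ℝ)) (b := T)).exists_bound_of_continuousOn
    hk.continuousOn
  refine integrableOn_slab_of_le (B := fun s => ‖k s‖ₑ) (H := fun x => ‖F x‖ₑ + ‖G x‖ₑ) ?_ ?_
    hp.meas_w hp.M_lt.ne hp.w_sq (hF.measurable.enorm.add hG.measurable.enorm) ?_ fun s x => ?_
  · exact (Complex.measurable_ofReal.comp (hk.measurable.comp measurable_fst)).mul
      (measurable_perpInner hp.meas_w (hF.measurable.comp measurable_snd)
        (hG.measurable.comp measurable_snd))
  · exact ((hk.continuousOn.integrableOn_compact isCompact_Icc).mono_set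
      (Ioo_subset_Icc_self (a := (0 : ℝ)) (b := T))).2.ne
  · exact ((eLpNorm_enorm_add_le hF.measurable hG.measurable).trans_lt
      (ENNReal.add_lt_top.2 ⟨hF2.2, hG2.2⟩)).ne
  · rw [enorm_mul]
    refine mul_le_mul' (le_of_eq ?_) (enorm_perpInner_le _ _ _)
    rw [← ofReal_norm, Complex.norm_real, ofReal_norm]

/-- The momentum balance tested with a product, as an identity in time. -/
theorem integral_linearPart_add (hp : IsPerturbation α T w u v η A E M) {h : ℝ → ℝ}
    (hh : ContDiff ℝ ∞ h) (hc : HasCompactSupport h) (hI : tsupport h ⊆ Iio T)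
    {ρ : 𝓢(Plane, ℂ)} (hρ : HasCompactSupport ρ) :
    IntegrableOn (fun s => linearPart (2 * α) w h ρ s) (Ioo 0 T) ∧
    IntegrableOn (fun s => (h s : ℂ) * ∫ x, forcing w u v η ρ (s, x)) (Ioo 0 T) ∧
    ∫ s in Ioo 0 T, linearPart (2 * α) w h ρ s
      = - ∫ s in Ioo 0 T, (h s : ℂ) * ∫ x, forcing w u v η ρ (s, x) := by
  have hβ : 0 ≤ 2 * α := by linarith [hp.half_lt]
  have hβ2 : 2 * α ≤ 2 := by linarith [hp.lt_one]
  have hm : ∀ g : 𝓢(Plane, ℂ), MemLp g 2 volume := fun g => SchwartzMap.memLp g 2 volume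
  have hcl : ∀ g, Continuous (fracLap (2 * α) g) := continuous_fracLap hβ hβ2
  have hml : ∀ g, MemLp (fracLap (2 * α) g) 2 volume := memLp_fracLap hβ hβ2
  have hh' : Continuous (deriv h) := hh.continuous_deriv (by simp)
  have i1 := hp.integrableOn_velPair (partialDeriv 0 ρ).continuous (partialDeriv 1 ρ).continuous
    (hm _) (hm _) hh'
  have i2 := hp.integrableOn_velPair (hcl (partialDeriv 0 ρ)) (hcl (partialDeriv 1 ρ))
    (hml _) (hml _) hh.continuous
  have i3 : IntegrableOn (forcing w u v η ρ) (slab T) := by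
    have h3 : IntegrableOn (fun z : ℝ × Plane => (η z : ℂ) * partialDeriv 0 ρ z.2) (slab T) :=
      (hp.integrable_buoyancy (partialDeriv 0 ρ).continuous
        (hasCompactSupport_partialDeriv hρ 0)).integrableOn
    exact (hp.integrableOn_advection ρ).add h3
  have i4 : IntegrableOn (fun z : ℝ × Plane => (h z.1 : ℂ) * forcing w u v η ρ z) (slab T) := by
    obtain ⟨C, hC⟩ := hh.continuous.bounded_above_of_compact_support hc
    refine Integrable.bdd_mul (c := C) i3 ?_ (Eventually.of_forall fun z => ?_)
    · exact (Complex.continuous_ofReal.comp (hh.continuous.comp continuous_fst)).aestronglyMeasurable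
    · rw [Complex.norm_real]; exact hC _
  have key := hp.integral_balance hh hc hI hρ ((i1.sub i2).add i4)
  have e1 : ∀ s, ∫ x, (((deriv h s : ℝ) : ℂ) * perpInner (w (s, x)) (partialDeriv 0 ρ x)
      (partialDeriv 1 ρ x) - (h s : ℂ) * perpInner (w (s, x)) (fracLap (2 * α) (partialDeriv 0 ρ) x)
        (fracLap (2 * α) (partialDeriv 1 ρ) x)) = linearPart (2 * α) w h ρ s := by
    intro s
    rw [integral_sub ((hp.integrable_velPair (partialDeriv 0 ρ).continuous
      (partialDeriv 1 ρ).continuous (hm _) (hm _) s).const_mul _) ((hp.integrable_velPair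
      (hcl (partialDeriv 0 ρ)) (hcl (partialDeriv 1 ρ)) (hml _) (hml _) s).const_mul _),
      integral_const_mul, integral_const_mul]
    rfl
  have e2 : ∀ s, ∫ x, (h s : ℂ) * forcing w u v η ρ (s, x)
      = (h s : ℂ) * ∫ x, forcing w u v η ρ (s, x) := fun s => integral_const_mul _ _
  have i12 : IntegrableOn (fun z : ℝ × Plane => ((deriv h z.1 : ℝ) : ℂ) * perpInner (w z)
      (partialDeriv 0 ρ z.2) (partialDeriv 1 ρ z.2) - (h z.1 : ℂ) * perpInner (w z)
      (fracLap (2 * α) (partialDeriv 0 ρ) z.2) (fracLap (2 * α) (partialDeriv 1 ρ) z.2)) (slab T) :=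
    i1.sub i2
  rw [IntegrableOn, volume_restrict_slab] at i12 i4
  have key' : ∫ z in slab T, ((((deriv h z.1 : ℝ) : ℂ) * perpInner (w z) (partialDeriv 0 ρ z.2)
      (partialDeriv 1 ρ z.2) - (h z.1 : ℂ) * perpInner (w z) (fracLap (2 * α) (partialDeriv 0 ρ) z.2)
        (fracLap (2 * α) (partialDeriv 1 ρ) z.2)) + (h z.1 : ℂ) * forcing w u v η ρ z) = 0 := key
  rw [volume_restrict_slab, integral_add i12 i4, integral_prod _ i12, integral_prod _ i4] at key'
  simp only [e1, e2] at key'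
  refine ⟨?_, ?_, eq_neg_of_add_eq_zero_left key'⟩
  · refine i12.integral_prod_left.congr (Eventually.of_forall fun s => ?_)
    exact e1 s
  · refine i4.integral_prod_left.congr (Eventually.of_forall fun s => ?_)
    exact e2 s

end IsPerturbation

end

/-! ### Bounds for the forcing by second derivatives of the test function -/

section

variable {α T : ℝ} {w u v : ℝ × Plane → Plane} {η : ℝ × Plane → ℝ} {A E : ℝ → ℝ≥0∞}
  {M : ℝ≥0∞}

lemma enorm_fderiv_le_sum (f : 𝓢(Plane, ℂ)) (x : Plane) :
    ‖fderiv ℝ f x‖ ≤ ∑ j : Fin 2, ‖partialDeriv j f x‖ := by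
  refine ContinuousLinearMap.opNorm_le_bound _ (by positivity) fun y => ?_
  rw [fderiv_apply_eq_sum, Finset.sum_mul]
  refine (norm_sum_le _ _).trans (Finset.sum_le_sum fun j _ => ?_)
  rw [norm_mul, Complex.norm_real, mul_comm]
  exact mul_le_mul_of_nonneg_left (PiLp.norm_apply_le y j) (norm_nonneg _)

/-- P will be the real or the imaginary part, since the transport bound is stated for real test
functions. -/
lemma eLpNorm_fderiv_clm_partialDeriv_le (ρ : 𝓢(Plane, ℂ)) (P : ℂ →L[ℝ] ℝ) (hP : ‖P‖ ≤ 1) :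
    eLpNorm (fderiv ℝ fun x => P (partialDeriv 0 ρ x)) 2 volume ≤ ENNReal.ofReal (hessNorm ρ) := by
  refine le_trans ?_ (eLpNorm_hessSum_le ρ)
  refine eLpNorm_mono_enorm fun x => ?_
  have hd : DifferentiableAt ℝ (partialDeriv 0 ρ) x := (partialDeriv 0 ρ).differentiableAt
  have e : fderiv ℝ (fun x => P (partialDeriv 0 ρ x)) x = P.comp (fderiv ℝ (partialDeriv 0 ρ) x) :=
    (P.hasFDerivAt.comp x hd.hasFDerivAt).fderiv
  rw [e, enorm_eq_self, hessSum]
  have h1 : ‖P.comp (fderiv ℝ (partialDeriv 0 ρ) x)‖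
      ≤ ∑ j : Fin 2, ‖partialDeriv j (partialDeriv 0 ρ) x‖ :=
    (ContinuousLinearMap.opNorm_comp_le _ _).trans
      ((mul_le_of_le_one_left (norm_nonneg _) hP).trans (enorm_fderiv_le_sum _ x))
  rw [← ofReal_norm]
  refine (ENNReal.ofReal_le_ofReal h1).trans ?_
  rw [ENNReal.ofReal_sum_of_nonneg fun _ _ => norm_nonneg _]
  refine Finset.sum_le_sum fun j _ => ?_
  rw [ofReal_norm]
  exact le_self_add

/-- The size of the forcing at time `s`. -/
def forceBound (w : ℝ × Plane → Plane) (A E : ℝ → ℝ≥0∞) (s : ℝ) : ℝ≥0∞ :=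
  2 * A s * eLpNorm (fun x => w (s, x)) 2 volume + 2 * E s

lemma forcing_sum {ι : Type*} (s : Finset ι) (c : ι → ℂ) (ρ : ι → 𝓢(Plane, ℂ))
    (z : ℝ × Plane) :
    forcing w u v η (∑ n ∈ s, c n • ρ n) z = ∑ n ∈ s, c n * forcing w u v η (ρ n) z := by
  simp only [forcing_eq, advection_sum, map_sum, map_smul, schwartzMap_sum_apply, smul_apply,
    smul_eq_mul, Finset.mul_sum, ← Finset.sum_add_distrib]
  refine Finset.sum_congr rfl fun n _ => ?_
  ring

namespace IsPerturbation

lemma measurable_forceBound (hp : IsPerturbation α T w u v η A E M) :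
    Measurable (forceBound w A E) :=
  ((hp.meas_A.const_mul 2).mul (measurable_eLpNorm_two_slice hp.meas_w)).add
    (hp.meas_E.const_mul 2)

lemma lintegral_forceBound_lt (hp : IsPerturbation α T w u v η A E M) :
    ∫⁻ s in Ioo 0 T, forceBound w A E s < ⊤ := by
  have h1 : ∫⁻ s in Ioo 0 T, forceBound w A E s ≤ ∫⁻ s in Ioo 0 T, (2 * A s * M + 2 * E s) :=
    lintegral_mono fun s => add_le_add_left (mul_le_mul_right (hp.w_sq s) _) _
  refine h1.trans_lt ?_
  have h2 : (2 : ℝ≥0∞) ≠ ⊤ := by norm_num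
  rw [lintegral_add_right _ (hp.meas_E.const_mul 2), lintegral_mul_const' _ _ hp.M_lt.ne,
    lintegral_const_mul' 2 E h2]
  exact ENNReal.add_lt_top.2 ⟨ENNReal.mul_lt_top hp.A_int'.lt_top hp.M_lt,
    ENNReal.mul_lt_top h2.lt_top hp.E_int⟩

/-- The transport bound is applied with V equal to the real and to the imaginary part of ∂₀ρ, whence
the factor 2. The gradient of V consists of second derivatives of ρ, so buoyancy costs as much as
advection. -/
lemma ae_enorm_buoyancy_le (hp : IsPerturbation α T w u v η A E M) {ρ : 𝓢(Plane, ℂ)}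
    (hρ : HasCompactSupport ρ) : ∀ᵐ s, s ∈ Ioo 0 T →
      (Integrable fun x => (η (s, x) : ℂ) * partialDeriv 0 ρ x) ∧
      ‖∫ x, (η (s, x) : ℂ) * partialDeriv 0 ρ x‖ₑ ≤ 2 * E s * ENNReal.ofReal (hessNorm ρ) := by
  have hc := hasCompactSupport_partialDeriv hρ 0
  have h1 : ∀ P : ℂ →L[ℝ] ℝ, ‖P‖ ≤ 1 → ∀ᵐ s, s ∈ Ioo 0 T →
      ‖∫ x, P (partialDeriv 0 ρ x) * η (s, x)‖ₑ ≤ E s * ENNReal.ofReal (hessNorm ρ) := by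
    intro P hP
    have hsm : ContDiff ℝ 1 fun x => P (partialDeriv 0 ρ x) :=
      P.contDiff.comp ((partialDeriv 0 ρ).smooth 1)
    have hcP : HasCompactSupport fun x => P (partialDeriv 0 ρ x) :=
      hc.comp_left (g := P) (map_zero P)
    obtain ⟨C, hC⟩ := hsm.lipschitzWith_of_hasCompactSupport hcP one_ne_zero
    filter_upwards [hp.transport _ C hC hcP] with s hs hsT
    exact (hs hsT).trans (mul_le_mul_right (eLpNorm_fderiv_clm_partialDeriv_le ρ P hP) _)
  filter_upwards [h1 Complex.reCLM Complex.reCLM_norm.le, h1 Complex.imCLM Complex.imCLM_norm.le,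
    (hp.integrable_buoyancy (partialDeriv 0 ρ).continuous hc).prod_right_ae] with s hre him hi hs
  refine ⟨hi, ?_⟩
  have e : ∫ x, (η (s, x) : ℂ) * partialDeriv 0 ρ x
      = ((∫ x, Complex.reCLM (partialDeriv 0 ρ x) * η (s, x) : ℝ) : ℂ)
        + ((∫ x, Complex.imCLM (partialDeriv 0 ρ x) * η (s, x) : ℝ) : ℂ) * Complex.I := by
    rw [← integral_re_add_im hi]
    simp [mul_comm]
  have hofReal : ∀ r : ℝ, ‖(r : ℂ)‖ₑ = ‖r‖ₑ := fun r => by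
    rw [← ofReal_norm, Complex.norm_real, ofReal_norm]
  have hI : ‖Complex.I‖ₑ = 1 := by rw [← ofReal_norm, Complex.norm_I, ENNReal.ofReal_one]
  rw [e]
  refine (enorm_add_le _ _).trans ?_
  rw [enorm_mul, hI, mul_one, hofReal, hofReal, mul_assoc, two_mul]
  exact add_le_add (hre hs) (him hs)

lemma ae_enorm_forcing_le (hp : IsPerturbation α T w u v η A E M) {ρ : 𝓢(Plane, ℂ)}
    (hρ : HasCompactSupport ρ) : ∀ᵐ s, s ∈ Ioo 0 T →
      (Integrable fun x => forcing w u v η ρ (s, x)) ∧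
      ‖∫ x, forcing w u v η ρ (s, x)‖ₑ ≤ forceBound w A E s * ENNReal.ofReal (hessNorm ρ) := by
  filter_upwards [hp.ae_enorm_buoyancy_le hρ, hp.ae_integrable_advection ρ] with s h1 h2 hs
  refine ⟨(h2 hs).add (h1 hs).1, ?_⟩
  simp only [forcing_eq]
  rw [integral_add (h2 hs) (h1 hs).1, forceBound, add_mul]
  exact (enorm_add_le _ _).trans (add_le_add (hp.enorm_integral_advection_le ρ s) (h1 hs).2)

/-- The forcing is bounded simultaneously on a finite dimensional space of test functions. -/
lemma ae_enorm_sum_forcing_le (hp : IsPerturbation α T w u v η A E M) {ι : Type*} [Fintype ι]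
    {ρ : ι → 𝓢(Plane, ℂ)} (hρ : ∀ n, HasCompactSupport (ρ n)) : ∀ᵐ s, s ∈ Ioo 0 T →
      ∀ c : ι → ℝ, ‖∑ n, (c n : ℂ) * ∫ x, forcing w u v η (ρ n) (s, x)‖ₑ
        ≤ forceBound w A E s * ENNReal.ofReal (hessNorm (∑ n, (c n : ℂ) • ρ n)) := by
  have hsum : ∀ c : ι → ℂ, HasCompactSupport (∑ n, c n • ρ n : 𝓢(Plane, ℂ)) := by
    intro c
    refine HasCompactSupport.intro (isCompact_iUnion fun n => (hρ n).isCompact) fun x hx => ?_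
    rw [mem_iUnion, not_exists] at hx
    rw [schwartzMap_sum_apply]
    refine Finset.sum_eq_zero fun n _ => ?_
    rw [smul_apply, image_eq_zero_of_notMem_tsupport (hx n), smul_zero]
  -- The exceptional times depend on the test function. Countably many rational combinations share
  -- one null set, and at a fixed time the inequality is closed in the coefficients, so density
  -- gives all real ones.
  have hq := ae_all_iff.2 fun c : ι → ℚ => hp.ae_enorm_forcing_le (hsum fun n => ((c n : ℝ) : ℂ))
  have hall := ae_all_iff.2 fun n => hp.ae_enorm_forcing_le (hρ n)
  have hfin : ∀ᵐ s, s ∈ Ioo 0 T → forceBound w A E s < ⊤ :=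
    (ae_restrict_iff' measurableSet_Ioo).1
      (ae_lt_top hp.measurable_forceBound hp.lintegral_forceBound_lt.ne)
  filter_upwards [hq, hall, hfin] with s hs hn hf hsT
  have hclosed : IsClosed {c : ι → ℝ | ‖∑ n, (c n : ℂ) * ∫ x, forcing w u v η (ρ n) (s, x)‖ₑ
        ≤ forceBound w A E s * ENNReal.ofReal (hessNorm (∑ n, (c n : ℂ) • ρ n))} := by
    refine isClosed_le ?_ ?_
    · fun_prop
    · refine ENNReal.continuous_const_mul (hf hsT).ne |>.comp (ENNReal.continuous_ofReal.comp
        (continuous_hessNorm.comp ?_))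
      fun_prop
  have hdense : DenseRange fun (c : ι → ℚ) (n : ι) => ((c n : ℚ) : ℝ) :=
    DenseRange.piMap fun _ => Rat.denseRange_cast
  intro c
  refine hdense.induction_on (p := fun c : ι → ℝ => ‖∑ n, (c n : ℂ) *
    ∫ x, forcing w u v η (ρ n) (s, x)‖ₑ ≤ forceBound w A E s *
      ENNReal.ofReal (hessNorm (∑ n, (c n : ℂ) • ρ n))) c hclosed fun c => ?_
  have h := (hs c hsT).2
  simp only [forcing_sum] at h
  rw [integral_finsetSum _ fun n _ => (hn n hsT).1.const_mul _] at h
  simpa only [integral_const_mul] using h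

end IsPerturbation

end

/-! ### Extension of the momentum inequality to Schwartz test functions -/

section

variable {α T : ℝ} {w u v : ℝ × Plane → Plane} {η : ℝ × Plane → ℝ} {A E : ℝ → ℝ≥0∞}
  {M : ℝ≥0∞}

lemma perpInner_sub (a : Plane) (F G F' G' : ℂ) :
    perpInner a (F - F') (G - G') = perpInner a F G - perpInner a F' G' := by
  unfold perpInner; ring

lemma fracLap_sub {β : ℝ} (hβ : 0 ≤ β) (hβ2 : β ≤ 2) (ρ σ : 𝓢(Plane, ℂ)) (x : Plane) :
    fracLap β (ρ - σ) x = fracLap β ρ x - fracLap β σ x := by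
  have h := fracLap_add hβ hβ2 (ρ - σ) σ x
  rw [sub_add_cancel] at h
  rw [h, add_sub_cancel_right]

namespace IsPerturbation

lemma velPair_sub (hp : IsPerturbation α T w u v η A E M) {F G F' G' : Plane → ℂ}
    (hF : Continuous F) (hG : Continuous G) (hF2 : MemLp F 2 volume) (hG2 : MemLp G 2 volume)
    (hF' : Continuous F') (hG' : Continuous G') (hF2' : MemLp F' 2 volume)
    (hG2' : MemLp G' 2 volume) (s : ℝ) :
    velPair w s (fun x => F x - F' x) (fun x => G x - G' x)
      = velPair w s F G - velPair w s F' G' := by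
  unfold velPair
  simp only [perpInner_sub]
  exact integral_sub (hp.integrable_velPair hF hG hF2 hG2 s)
    (hp.integrable_velPair hF' hG' hF2' hG2' s)

lemma linearPart_sub (hp : IsPerturbation α T w u v η A E M) (h : ℝ → ℝ) (ρ σ : 𝓢(Plane, ℂ))
    (s : ℝ) : linearPart (2 * α) w h (ρ - σ) s
      = linearPart (2 * α) w h ρ s - linearPart (2 * α) w h σ s := by
  have hβ : 0 ≤ 2 * α := by linarith [hp.half_lt]
  have hβ2 : 2 * α ≤ 2 := by linarith [hp.lt_one]
  have hm : ∀ g : 𝓢(Plane, ℂ), MemLp g 2 volume := fun g => SchwartzMap.memLp g 2 volume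
  have hcl : ∀ g, Continuous (fracLap (2 * α) g) := continuous_fracLap hβ hβ2
  have hml : ∀ g, MemLp (fracLap (2 * α) g) 2 volume := memLp_fracLap hβ hβ2
  have e1 := hp.velPair_sub (partialDeriv 0 ρ).continuous (partialDeriv 1 ρ).continuous
    (hm _) (hm _) (partialDeriv 0 σ).continuous (partialDeriv 1 σ).continuous (hm _) (hm _) s
  have e2 := hp.velPair_sub (hcl (partialDeriv 0 ρ)) (hcl (partialDeriv 1 ρ)) (hml _) (hml _)
    (hcl (partialDeriv 0 σ)) (hcl (partialDeriv 1 σ)) (hml _) (hml _) s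
  have f1 : ∀ j, (partialDeriv j (ρ - σ) : Plane → ℂ)
      = fun x => partialDeriv j ρ x - partialDeriv j σ x := fun j => by
    rw [map_sub]; rfl
  have f2 : ∀ j, fracLap (2 * α) (partialDeriv j (ρ - σ))
      = fun x => fracLap (2 * α) (partialDeriv j ρ) x - fracLap (2 * α) (partialDeriv j σ) x :=
    fun j => by
      funext x
      rw [map_sub, fracLap_sub hβ hβ2]
  unfold linearPart
  rw [f1, f1, f2, f2, e1, e2]
  ring

/-- The first half of `linearNorm` bounds the term with the time derivative, the second half,
through `besselOp`, the dissipative term. -/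
lemma enorm_linearPart_le (hp : IsPerturbation α T w u v η A E M) (h : ℝ → ℝ) (ρ : 𝓢(Plane, ℂ))
    (s : ℝ) : ‖linearPart (2 * α) w h ρ s‖ₑ
      ≤ (‖deriv h s‖ₑ + ‖h s‖ₑ) * (M * ENNReal.ofReal (linearNorm ρ)) := by
  have hβ : 0 ≤ 2 * α := by linarith [hp.half_lt]
  have hβ2 : 2 * α ≤ 2 := by linarith [hp.lt_one]
  have hofReal : ∀ r : ℝ, ‖(r : ℂ)‖ₑ = ‖r‖ₑ := fun r => by
    rw [← ofReal_norm, Complex.norm_real, ofReal_norm]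
  have hL : ENNReal.ofReal (linearNorm ρ)
      = (eLpNorm (partialDeriv 0 ρ) 2 volume + eLpNorm (partialDeriv 1 ρ) 2 volume)
        + (eLpNorm (besselOp (partialDeriv 0 ρ)) 2 volume
          + eLpNorm (besselOp (partialDeriv 1 ρ)) 2 volume) := by
    rw [linearNorm, ENNReal.ofReal_add (by positivity) (by positivity),
      ENNReal.ofReal_add (by positivity) (by positivity),
      ENNReal.ofReal_add (by positivity) (by positivity), ofReal_norm_toLp, ofReal_norm_toLp,
      ofReal_norm_toLp, ofReal_norm_toLp]
  have h1 := hp.enorm_velPair_le (partialDeriv 0 ρ).continuous (partialDeriv 1 ρ).continuous s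
  have h2 := hp.enorm_velPair_le (continuous_fracLap hβ hβ2 (partialDeriv 0 ρ))
    (continuous_fracLap hβ hβ2 (partialDeriv 1 ρ)) s
  unfold linearPart
  refine enorm_sub_le.trans ?_
  rw [enorm_mul, enorm_mul, hofReal, hofReal, add_mul, hL]
  refine add_le_add (mul_le_mul_right (h1.trans (mul_le_mul_right le_self_add _)) _)
    (mul_le_mul_right (h2.trans (mul_le_mul_right (le_add_left ?_) _)) _)
  exact add_le_add (eLpNorm_fracLap_le hβ hβ2 _) (eLpNorm_fracLap_le hβ hβ2 _)

lemma tendsto_linearPart (hp : IsPerturbation α T w u v η A E M) (h : ℝ → ℝ)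
    {g : ℕ → 𝓢(Plane, ℂ)} {ρ : 𝓢(Plane, ℂ)} (hg : Tendsto g atTop (𝓝 ρ)) (s : ℝ) :
    Tendsto (fun k => linearPart (2 * α) w h (g k) s) atTop
      (𝓝 (linearPart (2 * α) w h ρ s)) := by
  rw [tendsto_iff_edist_tendsto_0]
  have h0 : Tendsto (fun k => (‖deriv h s‖ₑ + ‖h s‖ₑ) *
      (M * ENNReal.ofReal (linearNorm (g k - ρ)))) atTop (𝓝 0) := by
    have h1 : Tendsto (fun k => linearNorm (g k - ρ)) atTop (𝓝 0) := by
      have := (continuous_linearNorm.tendsto _).comp (hg.sub_const ρ)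
      rwa [sub_self, linearNorm_zero] at this
    have h2 : Tendsto (fun k => ENNReal.ofReal (linearNorm (g k - ρ))) atTop (𝓝 0) := by
      simpa using ENNReal.tendsto_ofReal h1
    have h3 := ENNReal.Tendsto.const_mul (a := M) h2 (Or.inr hp.M_lt.ne)
    rw [mul_zero] at h3
    have h4 := ENNReal.Tendsto.const_mul (a := ‖deriv h s‖ₑ + ‖h s‖ₑ) h3
      (Or.inr (by simp))
    rwa [mul_zero] at h4
  refine tendsto_of_tendsto_of_tendsto_of_le_of_le tendsto_const_nhds h0 (fun _ => bot_le)
    fun k => ?_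
  dsimp only
  rw [edist_eq_enorm_sub, ← hp.linearPart_sub]
  exact hp.enorm_linearPart_le h _ s

lemma measurable_linearPart (hp : IsPerturbation α T w u v η A E M) {h : ℝ → ℝ}
    (hh : Continuous h) (ρ : 𝓢(Plane, ℂ)) :
    Measurable fun s => linearPart (2 * α) w h ρ s := by
  have hβ : 0 ≤ 2 * α := by linarith [hp.half_lt]
  have hβ2 : 2 * α ≤ 2 := by linarith [hp.lt_one]
  exact ((Complex.measurable_ofReal.comp (measurable_deriv h)).mul (hp.measurable_velPair
    (partialDeriv 0 ρ).continuous (partialDeriv 1 ρ).continuous)).sub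
    ((Complex.measurable_ofReal.comp hh.measurable).mul (hp.measurable_velPair
      (continuous_fracLap hβ hβ2 (partialDeriv 0 ρ)) (continuous_fracLap hβ hβ2 (partialDeriv 1 ρ))))

/-- The momentum balance as an inequality, for compactly supported test functions. -/
lemma enorm_integral_sum_linearPart_le_of_hasCompactSupport
    (hp : IsPerturbation α T w u v η A E M) {ι : Type*} [Fintype ι] {h : ι → ℝ → ℝ}
    (hh : ∀ n, ContDiff ℝ ∞ (h n)) (hc : ∀ n, HasCompactSupport (h n))
    (hI : ∀ n, tsupport (h n) ⊆ Iio T) {ρ : ι → 𝓢(Plane, ℂ)}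
    (hρ : ∀ n, HasCompactSupport (ρ n)) :
    ‖∫ s in Ioo 0 T, ∑ n, linearPart (2 * α) w (h n) (ρ n) s‖ₑ
      ≤ ∫⁻ s in Ioo 0 T, forceBound w A E s *
        ENNReal.ofReal (hessNorm (∑ n, (h n s : ℂ) • ρ n)) := by
  have key := fun n => hp.integral_linearPart_add (hh n) (hc n) (hI n) (hρ n)
  rw [integral_finsetSum _ fun n _ => (key n).1, Finset.sum_congr rfl fun n _ => (key n).2.2,
    Finset.sum_neg_distrib, enorm_neg, ← integral_finsetSum _ fun n _ => (key n).2.1]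
  refine (enorm_integral_le_lintegral_enorm _).trans (lintegral_mono_ae ?_)
  rw [ae_restrict_iff' measurableSet_Ioo]
  -- The bound holds for all coefficients at once off a single null set, so the coefficients may be
  -- the values h n s, which vary with s.
  filter_upwards [hp.ae_enorm_sum_forcing_le hρ] with s hs hsT
  exact hs hsT fun n => h n s

/-- The momentum balance as an inequality, for a finite family of Schwartz test functions. -/
theorem enorm_integral_sum_linearPart_le
    (hp : IsPerturbation α T w u v η A E M) {ι : Type*} [Fintype ι] {h : ι → ℝ → ℝ}
    (hh : ∀ n, ContDiff ℝ ∞ (h n)) (hc : ∀ n, HasCompactSupport (h n))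
    (hI : ∀ n, tsupport (h n) ⊆ Iio T) (ρ : ι → 𝓢(Plane, ℂ)) :
    ‖∫ s in Ioo 0 T, ∑ n, linearPart (2 * α) w (h n) (ρ n) s‖ₑ
      ≤ ∫⁻ s in Ioo 0 T, forceBound w A E s *
        ENNReal.ofReal (hessNorm (∑ n, (h n s : ℂ) • ρ n)) := by
  -- Each ρ n is approximated by compactly supported functions. The left side converges by
  -- continuity of `linearNorm`, the right side by continuity of `hessNorm`; the forcing never has
  -- to be evaluated on ρ n itself.
  choose g hg hgt using fun n => exists_seq_hasCompactSupport_tendsto (ρ n)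
  choose C hC using fun n => (hh n).continuous.bounded_above_of_compact_support (hc n)
  choose D hD using fun n => ((hh n).continuous_deriv (by simp)).bounded_above_of_compact_support
    (hc n).deriv
  have hbd : ∀ n (N : 𝓢(Plane, ℂ) → ℝ), Continuous N → ∃ B : ℝ, 0 ≤ B ∧ ∀ k, N (g n k) ≤ B := by
    intro n N hN
    obtain ⟨B, hB⟩ := ((hN.tendsto _).comp (hgt n)).bddAbove_range
    exact ⟨max B 0, le_max_right _ _, fun k => (hB ⟨k, rfl⟩).trans (le_max_left _ _)⟩
  choose P hP0 hP using fun n => hbd n linearNorm continuous_linearNorm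
  choose Q hQ0 hQ using fun n => hbd n hessNorm continuous_hessNorm
  have hC0 : ∀ n, 0 ≤ C n := fun n => (norm_nonneg _).trans (hC n 0)
  have hD0 : ∀ n, 0 ≤ D n := fun n => (norm_nonneg _).trans (hD n 0)
  have hM := hp.M_lt.ne
  have hl : Tendsto (fun k => ∫ s in Ioo 0 T, ∑ n, linearPart (2 * α) w (h n) (g n k) s) atTop
      (𝓝 (∫ s in Ioo 0 T, ∑ n, linearPart (2 * α) w (h n) (ρ n) s)) := by
    refine tendsto_integral_of_dominated_convergence
      (fun _ => ∑ n, (D n + C n) * (M.toReal * P n)) (fun k => ?_) (integrable_const _)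
      (fun k => Eventually.of_forall fun s => ?_) (Eventually.of_forall fun s => ?_)
    · exact (Finset.measurable_fun_sum _ fun n _ =>
        hp.measurable_linearPart (hh n).continuous (g n k)).aestronglyMeasurable
    · refine (norm_sum_le _ _).trans (Finset.sum_le_sum fun n _ => ?_)
      have h1 := hp.enorm_linearPart_le (h n) (g n k) s
      have h2 : (‖deriv (h n) s‖ₑ + ‖h n s‖ₑ) * (M * ENNReal.ofReal (linearNorm (g n k)))
          ≤ ENNReal.ofReal ((D n + C n) * (M.toReal * P n)) := by
        rw [ENNReal.ofReal_mul (add_nonneg (hD0 n) (hC0 n)), ENNReal.ofReal_mul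
          ENNReal.toReal_nonneg, ENNReal.ofReal_toReal hM, ENNReal.ofReal_add (hD0 n) (hC0 n),
          ← ofReal_norm, ← ofReal_norm]
        exact mul_le_mul' (add_le_add (ENNReal.ofReal_le_ofReal (hD n s))
          (ENNReal.ofReal_le_ofReal (hC n s))) (mul_le_mul_right
          (ENNReal.ofReal_le_ofReal (hP n k)) _)
      have h3 := h1.trans h2
      rw [← ofReal_norm] at h3
      exact (ENNReal.ofReal_le_ofReal_iff (mul_nonneg (add_nonneg (hD0 n) (hC0 n))
        (mul_nonneg ENNReal.toReal_nonneg (hP0 n)))).1 h3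
    · exact tendsto_finsetSum _ fun n _ => hp.tendsto_linearPart (h n) (hgt n) s
  have hle : ∀ {k : ℕ} {s : ℝ}, hessNorm (∑ n, (h n s : ℂ) • g n k) ≤ ∑ n, C n * Q n := by
    intro k s
    refine (hessNorm_sum_le _ _).trans (Finset.sum_le_sum fun n _ => ?_)
    rw [hessNorm_smul, Complex.norm_real]
    exact mul_le_mul (hC n s) (hQ n k) (hessNorm_nonneg _) (hC0 n)
  have hr : Tendsto (fun k => ∫⁻ s in Ioo 0 T, forceBound w A E s *
      ENNReal.ofReal (hessNorm (∑ n, (h n s : ℂ) • g n k))) atTop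
      (𝓝 (∫⁻ s in Ioo 0 T, forceBound w A E s *
        ENNReal.ofReal (hessNorm (∑ n, (h n s : ℂ) • ρ n)))) := by
    refine tendsto_lintegral_of_dominated_convergence
      (fun s => forceBound w A E s * ENNReal.ofReal (∑ n, C n * Q n)) (fun k => ?_)
      (fun k => Eventually.of_forall fun s => ?_) ?_ ?_
    · refine hp.measurable_forceBound.mul (ENNReal.measurable_ofReal.comp
        (continuous_hessNorm.comp (continuous_finsetSum _ fun n _ => ?_)).measurable)
      exact (Complex.continuous_ofReal.comp (hh n).continuous).smul continuous_const
    · exact mul_le_mul_right (ENNReal.ofReal_le_ofReal hle) _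
    · rw [lintegral_mul_const' _ _ ENNReal.ofReal_ne_top]
      exact ENNReal.mul_ne_top hp.lintegral_forceBound_lt.ne ENNReal.ofReal_ne_top
    · filter_upwards [ae_lt_top hp.measurable_forceBound hp.lintegral_forceBound_lt.ne] with s hs
      refine ENNReal.Tendsto.const_mul (ENNReal.tendsto_ofReal
        ((continuous_hessNorm.tendsto _).comp (tendsto_finsetSum _ fun n _ => ?_)))
        (Or.inr hs.ne)
      exact (hgt n).const_smul _
  exact le_of_tendsto_of_tendsto hl.enorm hr (Eventually.of_forall fun k =>
    hp.enorm_integral_sum_linearPart_le_of_hasCompactSupport hh hc hI fun n => hg n k)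

end IsPerturbation

end

/-! ### Smooth cutoffs in time and Lebesgue points -/

open scoped Convolution

/-- The smooth decreasing step from `1` to `0` with derivative minus the given bump. -/
def smoothStep (f : ContDiffBump (0 : ℝ)) (s : ℝ) : ℝ :=
  ∫ r in s..f.rOut, f.normed volume r

lemma normed_eq_zero_of_le (f : ContDiffBump (0 : ℝ)) {r : ℝ} (h : f.rOut ≤ |r|) :
    f.normed volume r = 0 := by
  have : r ∉ Function.support (f.normed volume) := by
    rw [f.support_normed_eq, Metric.mem_ball, Real.dist_eq, sub_zero]
    exact not_lt.2 h
  simpa using this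

lemma hasDerivAt_smoothStep (f : ContDiffBump (0 : ℝ)) (s : ℝ) :
    HasDerivAt (smoothStep f) (-f.normed volume s) s :=
  intervalIntegral.integral_hasDerivAt_left (f.continuous_normed.intervalIntegrable _ _)
    f.continuous_normed.stronglyMeasurable.stronglyMeasurableAtFilter
    f.continuous_normed.continuousAt

lemma contDiff_smoothStep (f : ContDiffBump (0 : ℝ)) : ContDiff ℝ ∞ (smoothStep f) := by
  rw [contDiff_infty_iff_deriv]
  refine ⟨fun s => (hasDerivAt_smoothStep f s).differentiableAt, ?_⟩
  rw [funext fun s => (hasDerivAt_smoothStep f s).deriv]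
  exact f.contDiff_normed.neg

lemma smoothStep_of_le (f : ContDiffBump (0 : ℝ)) {s : ℝ} (h : f.rOut ≤ s) :
    smoothStep f s = 0 := by
  unfold smoothStep
  rw [intervalIntegral.integral_symm, intervalIntegral.integral_of_le h, neg_eq_zero]
  refine setIntegral_eq_zero_of_forall_eq_zero fun r hr => normed_eq_zero_of_le f ?_
  exact hr.1.le.trans (le_abs_self r)

lemma smoothStep_of_le_neg (f : ContDiffBump (0 : ℝ)) {s : ℝ} (h : s ≤ -f.rOut) :
    smoothStep f s = 1 := by
  have h0 := f.rOut_pos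
  unfold smoothStep
  rw [intervalIntegral.integral_of_le (by linarith), setIntegral_eq_integral_of_forall_compl_eq_zero,
    f.integral_normed]
  intro r hr
  refine normed_eq_zero_of_le f ?_
  rw [mem_Ioc, not_and_or, not_lt, not_le] at hr
  rcases hr with hr | hr
  · exact le_trans (by linarith) (neg_le_abs r)
  · exact hr.le.trans (le_abs_self r)

lemma smoothStep_mem (f : ContDiffBump (0 : ℝ)) (s : ℝ) :
    0 ≤ smoothStep f s ∧ smoothStep f s ≤ 1 := by
  rcases le_total f.rOut s with h | h
  · rw [smoothStep_of_le f h]; exact ⟨le_rfl, zero_le_one⟩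
  · unfold smoothStep
    refine ⟨intervalIntegral.integral_nonneg h fun r _ => f.nonneg_normed r, ?_⟩
    rw [intervalIntegral.integral_of_le h, ← f.integral_normed (μ := volume)]
    exact setIntegral_le_integral f.integrable_normed
      (Eventually.of_forall fun r => f.nonneg_normed r)

/-- A sequence of bumps shrinking to the origin. -/
def bumpSeq (k : ℕ) : ContDiffBump (0 : ℝ) where
  rIn := 1 / (2 * (k + 1))
  rOut := 1 / (k + 1)
  rIn_pos := by positivity
  rIn_lt_rOut := by
    apply one_div_lt_one_div_of_lt <;> linarith [(k.cast_nonneg : (0 : ℝ) ≤ k)]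

lemma tendsto_bumpSeq : Tendsto (fun k => (bumpSeq k).rOut) atTop (𝓝 0) :=
  tendsto_one_div_add_atTop_nhds_zero_nat

lemma ae_tendsto_bumpSeq {Y : ℝ → ℂ} (hY : Integrable Y) :
    ∀ᵐ t, Tendsto (fun k => ∫ s, (bumpSeq k).normed volume (s - t) • Y s) atTop (𝓝 (Y t)) := by
  have h := ContDiffBump.ae_convolution_tendsto_right_of_locallyIntegrable (μ := volume)
    (φ := bumpSeq) (K := 2) tendsto_bumpSeq (Eventually.of_forall fun k => ?_)
    hY.locallyIntegrable
  · filter_upwards [h] with t ht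
    refine ht.congr fun k => ?_
    rw [convolution_eq_swap]
    refine integral_congr_ae (Eventually.of_forall fun s => ?_)
    simp only [ContinuousLinearMap.lsmul_apply]
    rw [← neg_sub s t, (bumpSeq k).normed_neg]
  · simp only [bumpSeq]
    rw [one_div, one_div, mul_inv]
    linarith

/-- Integration against the derivative of a sharpening cutoff at a Lebesgue point. -/
lemma tendsto_integral_deriv_smoothStep {T t C : ℝ} {Y Z : ℝ → ℂ}
    (hY : IntegrableOn Y (Ioo 0 T)) (hZ : IntegrableOn Z (Ioo 0 T))
    (hC : ∀ s ∈ Ioo 0 T, ‖Z s - Y s‖ ≤ C * |s - t|) {y : ℂ}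
    (ht : Tendsto (fun k => ∫ s, (bumpSeq k).normed volume (s - t) • (Ioo 0 T).indicator Y s) atTop
      (𝓝 y)) :
    Tendsto (fun k => ∫ s in Ioo 0 T,
      ((-(bumpSeq k).normed volume (s - t) : ℝ) : ℂ) * Z s) atTop (𝓝 (-y)) := by
  have hcont : ∀ k, Continuous fun s => (bumpSeq k).normed volume (s - t) := fun k =>
    (bumpSeq k).continuous_normed.comp (by fun_prop)
  have hbd : ∀ k, ∃ B, ∀ s, ‖((-(bumpSeq k).normed volume (s - t) : ℝ) : ℂ)‖ ≤ B := fun k => by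
    obtain ⟨B, hB⟩ := (bumpSeq k).continuous_normed.bounded_above_of_compact_support
      ((bumpSeq k).hasCompactSupport_normed (μ := volume))
    exact ⟨B, fun s => by rw [Complex.norm_real, norm_neg]; exact hB _⟩
  have hint : ∀ k {Y : ℝ → ℂ}, IntegrableOn Y (Ioo 0 T) → IntegrableOn (fun s =>
      ((-(bumpSeq k).normed volume (s - t) : ℝ) : ℂ) * Y s) (Ioo 0 T) := by
    intro k Y hY
    obtain ⟨B, hB⟩ := hbd k
    exact Integrable.bdd_mul (c := B) hY (Complex.continuous_ofReal.comp
      (hcont k).neg).aestronglyMeasurable (Eventually.of_forall hB)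
  have h1 : Tendsto (fun k => ∫ s in Ioo 0 T,
      ((-(bumpSeq k).normed volume (s - t) : ℝ) : ℂ) * Y s) atTop (𝓝 (-y)) := by
    refine ht.neg.congr fun k => ?_
    rw [← integral_indicator measurableSet_Ioo, ← integral_neg]
    refine integral_congr_ae (Eventually.of_forall fun s => ?_)
    by_cases hs : s ∈ Ioo 0 T <;> simp [hs]
  -- Z - Y is of order |s - t|, while the bump has mass 1 and is supported where |s - t| is at most
  -- its radius, which tends to 0.
  have h2 : Tendsto (fun k => ∫ s in Ioo 0 T,
      ((-(bumpSeq k).normed volume (s - t) : ℝ) : ℂ) * (Z s - Y s)) atTop (𝓝 0) := by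
    have h0 : Tendsto (fun k => |C| * (bumpSeq k).rOut) atTop (𝓝 0) := by
      have := tendsto_bumpSeq.const_mul |C|
      rwa [mul_zero] at this
    refine squeeze_zero_norm (fun k => ?_) h0
    have hle : ∀ s ∈ Ioo 0 T, ‖((-(bumpSeq k).normed volume (s - t) : ℝ) : ℂ) * (Z s - Y s)‖
        ≤ (|C| * (bumpSeq k).rOut) * (bumpSeq k).normed volume (s - t) := by
      intro s hs
      have hn := (bumpSeq k).nonneg_normed (μ := volume) (s - t)
      rw [norm_mul, Complex.norm_real, norm_neg, Real.norm_of_nonneg hn, mul_comm]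
      rcases le_total (bumpSeq k).rOut |s - t| with h | h
      · rw [normed_eq_zero_of_le _ h, mul_zero, mul_zero]
      · refine mul_le_mul_of_nonneg_right ((hC s hs).trans ?_) hn
        exact mul_le_mul (le_abs_self C) h (abs_nonneg _) (abs_nonneg _)
    have hi : Integrable fun s => (|C| * (bumpSeq k).rOut) * (bumpSeq k).normed volume (s - t) :=
      ((bumpSeq k).integrable_normed.comp_sub_right t).const_mul _
    refine (norm_integral_le_integral_norm _).trans ?_
    refine (setIntegral_mono_on (hint k (hZ.sub hY)).norm hi.integrableOn measurableSet_Ioo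
      hle).trans ?_
    refine (setIntegral_le_integral hi (Eventually.of_forall fun s => ?_)).trans ?_
    · exact mul_nonneg (mul_nonneg (abs_nonneg _) (bumpSeq k).rOut_pos.le)
        ((bumpSeq k).nonneg_normed _)
    · rw [integral_const_mul, integral_sub_right_eq_self (fun s => (bumpSeq k).normed volume s) t,
        (bumpSeq k).integral_normed, mul_one]
  have h3 := h1.add h2
  rw [add_zero] at h3
  refine h3.congr fun k => ?_
  have hi2 : IntegrableOn (fun s => ((-(bumpSeq k).normed volume (s - t) : ℝ) : ℂ) * (Z s - Y s))
      (Ioo 0 T) := hint k (hZ.sub hY)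
  rw [← integral_add (hint k hY) hi2]
  refine integral_congr_ae (Eventually.of_forall fun s => ?_)
  dsimp only
  ring

/-- Integrals against a sharpening cutoff. -/
lemma tendsto_lintegral_smoothStep {T t : ℝ} (ht : t ∈ Ioo 0 T) {g : ℝ → ℝ≥0∞} (hg : Measurable g)
    (hi : ∫⁻ s in Ioo 0 T, g s ≠ ⊤) :
    Tendsto (fun k => ∫⁻ s in Ioo 0 T, ENNReal.ofReal (smoothStep (bumpSeq k) (s - t)) * g s) atTop
      (𝓝 (∫⁻ s in Ioo 0 t, g s)) := by
  have e : ∫⁻ s in Ioo 0 t, g s = ∫⁻ s in Ioo 0 T, (Iio t).indicator g s := by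
    rw [setLIntegral_indicator measurableSet_Iio]
    congr 2
    ext s
    simp only [mem_Ioo, mem_inter_iff, mem_Iio]
    constructor
    · rintro ⟨h1, h2⟩; exact ⟨h2, h1, h2.trans ht.2⟩
    · rintro ⟨h1, h2, _⟩; exact ⟨h2, h1⟩
  rw [e]
  refine tendsto_lintegral_of_dominated_convergence g (fun k => ?_)
    (fun k => Eventually.of_forall fun s => ?_) hi ?_
  · exact (ENNReal.measurable_ofReal.comp ((contDiff_smoothStep (bumpSeq k)).continuous.comp
      (by fun_prop : Continuous fun s => s - t)).measurable).mul hg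
  · refine mul_le_of_le_one_left bot_le ?_
    exact ENNReal.ofReal_le_one.2 (smoothStep_mem _ _).2
  · filter_upwards [ae_restrict_of_ae (compl_mem_ae_iff.2 (measure_singleton t))] with s hs
    refine tendsto_const_nhds.congr' ?_
    have hpos : 0 < |s - t| := abs_pos.2 (sub_ne_zero.2 hs)
    filter_upwards [(tendsto_order.1 tendsto_bumpSeq).2 _ hpos] with k hk
    rcases lt_or_gt_of_ne (hs : s ≠ t) with h | h
    · rw [abs_of_neg (by linarith)] at hk
      rw [smoothStep_of_le_neg _ (by linarith), ENNReal.ofReal_one, one_mul,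
        indicator_of_mem (show s ∈ Iio t from h)]
    · rw [abs_of_pos (by linarith)] at hk
      rw [smoothStep_of_le _ hk.le, ENNReal.ofReal_zero, zero_mul,
        indicator_of_notMem (show s ∉ Iio t from not_lt.2 h.le)]

/-! ### Duhamel's formula with a truncated exponential series -/

section

variable {α T : ℝ} {w u v : ℝ × Plane → Plane} {η : ℝ × Plane → ℝ} {A E : ℝ → ℝ≥0∞}
  {M : ℝ≥0∞}

/-- The normalized powers `(s - t) ^ n / n!`. -/
def taylorPow (t : ℝ) (n : ℕ) (s : ℝ) : ℝ := (s - t) ^ n / n.factorial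

lemma taylorPow_zero (t s : ℝ) : taylorPow t 0 s = 1 := by simp [taylorPow]

lemma contDiff_taylorPow (t : ℝ) (n : ℕ) : ContDiff ℝ ∞ (taylorPow t n) := by
  unfold taylorPow; fun_prop

lemma hasDerivAt_taylorPow_succ (t s : ℝ) (n : ℕ) :
    HasDerivAt (taylorPow t (n + 1)) (taylorPow t n s) s := by
  unfold taylorPow
  have h := (((hasDerivAt_id s).sub_const t).pow (n + 1)).div_const ((n + 1).factorial : ℝ)
  refine h.congr_deriv ?_
  have h1 : ((n : ℝ) + 1) ≠ 0 := by positivity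
  have h2 : (n.factorial : ℝ) ≠ 0 := by positivity
  rw [Nat.factorial_succ, Nat.add_sub_cancel, id_eq]
  push_cast
  field_simp

lemma deriv_taylorPow_zero (t s : ℝ) : deriv (taylorPow t 0) s = 0 := by
  have : taylorPow t 0 = fun _ => 1 := funext fun s => taylorPow_zero t s
  rw [this, deriv_const]

/-- A chain of test functions generated by the fractional Laplacian. -/
def IsFracChain (β : ℝ) (ρ : ℕ → 𝓢(Plane, ℂ)) : Prop :=
  ∀ n j x, fracLap β (partialDeriv j (ρ n)) x = partialDeriv j (ρ (n + 1)) x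

/-- The pairing of the velocity at time `s` with `∇^⊥ ρ`. -/
def gradPair (w : ℝ × Plane → Plane) (ρ : 𝓢(Plane, ℂ)) (s : ℝ) : ℂ :=
  velPair w s (partialDeriv 0 ρ) (partialDeriv 1 ρ)

lemma linearPart_of_isFracChain {β : ℝ} {ρ : ℕ → 𝓢(Plane, ℂ)} (hρ : IsFracChain β ρ) (h : ℝ → ℝ)
    (n : ℕ) (s : ℝ) : linearPart β w h (ρ n) s
      = ((deriv h s : ℝ) : ℂ) * gradPair w (ρ n) s - (h s : ℂ) * gradPair w (ρ (n + 1)) s := by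
  have e : ∀ j, fracLap β (partialDeriv j (ρ n)) = partialDeriv j (ρ (n + 1)) := fun j =>
    funext fun x => hρ n j x
  simp only [linearPart, gradPair, e]

/-- The sum telescopes: the derivative of (s - t)^{n+1} / (n+1)! is the preceding power, and it
cancels the dissipation of the term number n. What survives is the derivative of the cutoff and the
last dissipation term. -/
lemma sum_linearPart_eq {β : ℝ} {ρ : ℕ → 𝓢(Plane, ℂ)} (hρ : IsFracChain β ρ) {h : ℕ → ℝ → ℝ}
    {κ : ℝ → ℝ} {κ' s t : ℝ} (hκ : HasDerivAt κ κ' s)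
    (hh : ∀ n, h n =ᶠ[𝓝 s] fun r => κ r * taylorPow t n r) (N : ℕ) :
    ∑ n ∈ Finset.range (N + 1), linearPart β w (h n) (ρ n) s
      = (κ' : ℂ) * ∑ n ∈ Finset.range (N + 1), (taylorPow t n s : ℂ) * gradPair w (ρ n) s
        - (κ s : ℂ) * ((taylorPow t N s : ℂ) * gradPair w (ρ (N + 1)) s) := by
  have hd : ∀ n, deriv (h n) s = κ' * taylorPow t n s + κ s * deriv (taylorPow t n) s := by
    intro n
    rw [(hh n).deriv_eq]
    exact (hκ.mul ((contDiff_taylorPow t n).differentiable (by simp) s).hasDerivAt).deriv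
  induction N with
  | zero =>
    simp only [zero_add, Finset.sum_range_one]
    rw [linearPart_of_isFracChain hρ, hd, (hh 0).eq_of_nhds, deriv_taylorPow_zero, taylorPow_zero]
    simp
  | succ N ih =>
    rw [Finset.sum_range_succ, ih, Finset.sum_range_succ _ (N + 1), linearPart_of_isFracChain hρ,
      hd, (hh (N + 1)).eq_of_nhds, (hasDerivAt_taylorPow_succ t s N).deriv]
    push_cast
    ring

lemma abs_taylorPow_succ_le {t s T : ℝ} (ht : t ∈ Ioo 0 T) (hs : s ∈ Ioo 0 T) (n : ℕ) :
    |taylorPow t (n + 1) s| ≤ T ^ n * |s - t| := by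
  have h1 : |s - t| ≤ T := by
    rw [abs_le]; constructor <;> linarith [ht.1, ht.2, hs.1, hs.2]
  rw [taylorPow, abs_div, abs_pow, pow_succ, Nat.abs_cast]
  refine (div_le_self (by positivity) (mod_cast (n + 1).factorial_pos)).trans ?_
  exact mul_le_mul_of_nonneg_right (pow_le_pow_left₀ (abs_nonneg _) h1 n) (abs_nonneg _)

namespace IsPerturbation

lemma enorm_gradPair_le (hp : IsPerturbation α T w u v η A E M) (ρ : 𝓢(Plane, ℂ)) (s : ℝ) :
    ‖gradPair w ρ s‖ₑ ≤ M * (eLpNorm (partialDeriv 0 ρ) 2 volume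
      + eLpNorm (partialDeriv 1 ρ) 2 volume) :=
  hp.enorm_velPair_le (partialDeriv 0 ρ).continuous (partialDeriv 1 ρ).continuous s

lemma exists_norm_gradPair_le (hp : IsPerturbation α T w u v η A E M) (ρ : 𝓢(Plane, ℂ)) :
    ∃ C : ℝ, 0 ≤ C ∧ ∀ s, ‖gradPair w ρ s‖ ≤ C := by
  have hm : ∀ g : 𝓢(Plane, ℂ), eLpNorm g 2 volume < ⊤ := fun g => (SchwartzMap.memLp g 2 volume).2
  have hfin : M * (eLpNorm (partialDeriv 0 ρ) 2 volume
      + eLpNorm (partialDeriv 1 ρ) 2 volume) ≠ ⊤ :=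
    (ENNReal.mul_lt_top hp.M_lt (ENNReal.add_lt_top.2 ⟨hm _, hm _⟩)).ne
  refine ⟨(M * (eLpNorm (partialDeriv 0 ρ) 2 volume
    + eLpNorm (partialDeriv 1 ρ) 2 volume)).toReal, ENNReal.toReal_nonneg, fun s => ?_⟩
  have h := ENNReal.toReal_mono hfin (hp.enorm_gradPair_le ρ s)
  rwa [toReal_enorm] at h

lemma measurable_gradPair (hp : IsPerturbation α T w u v η A E M) (ρ : 𝓢(Plane, ℂ)) :
    Measurable (gradPair w ρ) :=
  hp.measurable_velPair (partialDeriv 0 ρ).continuous (partialDeriv 1 ρ).continuous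

lemma integrableOn_gradPair (hp : IsPerturbation α T w u v η A E M) (ρ : 𝓢(Plane, ℂ)) :
    IntegrableOn (gradPair w ρ) (Ioo 0 T) := by
  obtain ⟨C, _, hC⟩ := hp.exists_norm_gradPair_le ρ
  exact Integrable.of_bound (hp.measurable_gradPair ρ).aestronglyMeasurable C
    (Eventually.of_forall hC)

/-- The truncated Duhamel inequality. -/
theorem ae_enorm_gradPair_le (hp : IsPerturbation α T w u v η A E M) {ρ : ℕ → 𝓢(Plane, ℂ)}
    (hρ : IsFracChain (2 * α) ρ) : ∀ᵐ t, t ∈ Ioo 0 T → ∀ N : ℕ,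
      ‖gradPair w (ρ 0) t‖ₑ ≤ ∫⁻ s in Ioo 0 t, (forceBound w A E s * ENNReal.ofReal
        (hessNorm (∑ n ∈ Finset.range (N + 1), (taylorPow t n s : ℂ) • ρ n))
        + ‖(taylorPow t N s : ℂ) * gradPair w (ρ (N + 1)) s‖ₑ) := by
  have hY := hp.integrableOn_gradPair (ρ 0)
  -- The null set is that of the points where averages of the pairing with ρ 0 fail to converge; it
  -- is independent of the degree N.
  filter_upwards [ae_tendsto_bumpSeq ((integrable_indicator_iff measurableSet_Ioo).2 hY)]
    with t ht htT N
  obtain ⟨C, hC0, hC⟩ : ∃ C : ℕ → ℝ, (∀ n, 0 ≤ C n) ∧ ∀ n s, ‖gradPair w (ρ n) s‖ ≤ C n := by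
    choose C h0 hC using fun n => hp.exists_norm_gradPair_le (ρ n)
    exact ⟨C, h0, hC⟩
  rw [indicator_of_mem htT] at ht
  obtain ⟨Z, hZ⟩ : ∃ Z : ℝ → ℂ, ∀ s, Z s = ∑ n ∈ Finset.range (N + 1),
      (taylorPow t n s : ℂ) * gradPair w (ρ n) s := ⟨_, fun _ => rfl⟩
  have hZm : Measurable Z := by
    rw [funext hZ]
    exact Finset.measurable_fun_sum _ fun n _ => (Complex.measurable_ofReal.comp
      (contDiff_taylorPow t n).continuous.measurable).mul (hp.measurable_gradPair _)
  -- All terms of positive degree vanish at s = t, so only the pairing with ρ 0 is seen in the limit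
  -- of sharp cutoffs.
  have hZY : ∀ s ∈ Ioo 0 T, ‖Z s - gradPair w (ρ 0) s‖
      ≤ (∑ n ∈ Finset.range N, T ^ n * C (n + 1)) * |s - t| := by
    intro s hs
    rw [hZ, Finset.sum_range_succ', taylorPow_zero, Complex.ofReal_one, one_mul,
      add_sub_cancel_right, Finset.sum_mul]
    refine (norm_sum_le _ _).trans (Finset.sum_le_sum fun n _ => ?_)
    rw [norm_mul, Complex.norm_real, mul_right_comm]
    exact mul_le_mul (abs_taylorPow_succ_le htT hs n) (hC _ _) (norm_nonneg _)
      (mul_nonneg (pow_nonneg (htT.1.trans htT.2).le _) (abs_nonneg _))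
  have hZi : IntegrableOn Z (Ioo 0 T) := by
    have h1 : IntegrableOn (fun s => Z s - gradPair w (ρ 0) s) (Ioo 0 T) := by
      refine Measure.integrableOn_of_bounded (M := (∑ n ∈ Finset.range N, T ^ n * C (n + 1)) * T)
        (by simp) (hZm.sub (hp.measurable_gradPair _)).aestronglyMeasurable ?_
      refine (ae_restrict_iff' measurableSet_Ioo).2 (Eventually.of_forall fun s hs => ?_)
      refine (hZY s hs).trans (mul_le_mul_of_nonneg_left ?_ (Finset.sum_nonneg fun n _ =>
        mul_nonneg (pow_nonneg (htT.1.trans htT.2).le _) (hC0 _)))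
      rw [abs_le]; constructor <;> linarith [htT.1, htT.2, hs.1, hs.2]
    have h2 := h1.add hY
    refine h2.congr (Eventually.of_forall fun s => ?_)
    simp
  have lim := tendsto_integral_deriv_smoothStep hY hZi hZY ht
  obtain ⟨g, hg⟩ : ∃ g : ℝ → ℝ≥0∞, ∀ s, g s = forceBound w A E s * ENNReal.ofReal
        (hessNorm (∑ n ∈ Finset.range (N + 1), (taylorPow t n s : ℂ) • ρ n))
        + ‖(taylorPow t N s : ℂ) * gradPair w (ρ (N + 1)) s‖ₑ := ⟨_, fun _ => rfl⟩
  have hsumc : Continuous fun s => ∑ n ∈ Finset.range (N + 1), (taylorPow t n s : ℂ) • ρ n :=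
    continuous_finsetSum _ fun n _ =>
      (Complex.continuous_ofReal.comp (contDiff_taylorPow t n).continuous).smul continuous_const
  have hgm2 : Measurable fun s => (taylorPow t N s : ℂ) * gradPair w (ρ (N + 1)) s :=
    (Complex.measurable_ofReal.comp
      (contDiff_taylorPow t N).continuous.measurable).mul (hp.measurable_gradPair _)
  have hgm1 : Measurable fun s => forceBound w A E s * ENNReal.ofReal
        (hessNorm (∑ n ∈ Finset.range (N + 1), (taylorPow t n s : ℂ) • ρ n)) :=
    hp.measurable_forceBound.mul (ENNReal.measurable_ofReal.comp
      (continuous_hessNorm.comp hsumc).measurable)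
  have hgm : Measurable g := by
    rw [funext hg]
    exact hgm1.add hgm2.enorm
  have hr : IntegrableOn (fun s => (taylorPow t N s : ℂ) * gradPair w (ρ (N + 1)) s) (Ioo 0 T) := by
    obtain ⟨B, hB⟩ := (isCompact_Icc (a := (0 : ℝ)) (b := T)).exists_bound_of_continuousOn
      (contDiff_taylorPow t N).continuous.continuousOn
    refine Measure.integrableOn_of_bounded (M := B * C (N + 1))
      (by simp) hgm2.aestronglyMeasurable ?_
    refine (ae_restrict_iff' measurableSet_Ioo).2 (Eventually.of_forall fun s hs => ?_)
    rw [norm_mul, Complex.norm_real]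
    have h1 := hB s (Ioo_subset_Icc_self hs)
    exact mul_le_mul h1 (hC _ _) (norm_nonneg _) ((norm_nonneg _).trans h1)
  have hgi : ∫⁻ s in Ioo 0 T, g s ≠ ⊤ := by
    obtain ⟨B, hB⟩ := (isCompact_Icc (a := (0 : ℝ)) (b := T)).exists_bound_of_continuousOn
      (continuous_hessNorm.comp hsumc).continuousOn
    rw [funext hg, lintegral_add_left hgm1]
    refine ENNReal.add_ne_top.2 ⟨?_, hr.2.ne⟩
    refine ((setLIntegral_mono' (g := fun s => forceBound w A E s * ENNReal.ofReal B)
      measurableSet_Ioo fun s hs => ?_).trans_lt ?_).ne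
    · refine mul_le_mul_right (ENNReal.ofReal_le_ofReal ?_) _
      exact (le_abs_self _).trans (hB s (Ioo_subset_Icc_self hs))
    · rw [lintegral_mul_const' _ _ ENNReal.ofReal_ne_top]
      exact ENNReal.mul_lt_top hp.lintegral_forceBound_lt ENNReal.ofReal_lt_top
  have limr := tendsto_lintegral_smoothStep htT hgm hgi
  have e : ‖gradPair w (ρ 0) t‖ₑ = ‖-gradPair w (ρ 0) t‖ₑ := (enorm_neg _).symm
  rw [e]
  simp only [← hg]
  refine le_of_tendsto_of_tendsto lim.enorm limr ?_
  -- For such k the transition of the cutoff ends before T, as the weak formulation requires.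
  filter_upwards [(tendsto_order.1 tendsto_bumpSeq).2 (T - t) (by linarith [htT.2])] with k hk
  obtain ⟨κ, hκ⟩ : ∃ κ : ℝ → ℝ, ∀ s, κ s = smoothStep (bumpSeq k) (s - t) := ⟨_, fun _ => rfl⟩
  have hκs : ContDiff ℝ ∞ κ := by
    rw [funext hκ]; exact (contDiff_smoothStep _).comp (by fun_prop)
  have hκd : ∀ s, HasDerivAt κ (-(bumpSeq k).normed volume (s - t)) s := by
    intro s
    rw [funext hκ]
    have := (hasDerivAt_smoothStep (bumpSeq k) (s - t)).comp s ((hasDerivAt_id s).sub_const t)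
    rw [mul_one] at this
    exact this
  -- This bump is 1 on (0, T) and only provides compact support in time. The time factors need not
  -- vanish at 0, since the balance holds with zero initial term.
  obtain ⟨χ, hχ⟩ : ∃ χ : ContDiffBump (0 : ℝ), χ.rIn = T :=
    ⟨⟨T, T + 1, htT.1.trans htT.2, by linarith⟩, rfl⟩
  have hχ1 : ∀ s ∈ Ioo 0 T, (χ : ℝ → ℝ) =ᶠ[𝓝 s] fun _ => 1 := by
    intro s hs
    refine χ.eventuallyEq_one_of_mem_ball ?_
    rw [Metric.mem_ball, Real.dist_eq, sub_zero, hχ, abs_of_pos hs.1]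
    exact hs.2
  obtain ⟨h, hh⟩ : ∃ h : ℕ → ℝ → ℝ, ∀ n, h n = fun s => χ s * (κ s * taylorPow t n s) :=
    ⟨_, fun _ => rfl⟩
  have hhe : ∀ s ∈ Ioo 0 T, ∀ n, h n =ᶠ[𝓝 s] fun r => κ r * taylorPow t n r := by
    intro s hs n
    filter_upwards [hχ1 s hs] with r hr
    rw [hh]
    simp only [hr, one_mul]
  have hhs : ∀ n, ContDiff ℝ ∞ (h n) := fun n => by
    rw [hh]; exact χ.contDiff.mul (hκs.mul (contDiff_taylorPow t n))
  have hhc : ∀ n, HasCompactSupport (h n) := fun n => by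
    rw [hh]; exact χ.hasCompactSupport.mul_right
  have hhI : ∀ n, tsupport (h n) ⊆ Iio T := by
    intro n
    refine (closure_minimal (t := Iic (t + (bumpSeq k).rOut)) (fun s hs => ?_) isClosed_Iic).trans
      (Iic_subset_Iio.2 (by linarith))
    by_contra hcon
    rw [mem_Iic, not_le] at hcon
    refine hs ?_
    rw [hh]
    simp only
    rw [hκ, smoothStep_of_le _ (by linarith), zero_mul, mul_zero]
  have main := hp.enorm_integral_sum_linearPart_le (ι := Fin (N + 1)) (h := fun n => h n)
    (fun n => hhs n) (fun n => hhc n) (fun n => hhI n) (fun n => ρ n)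
  have e1 : ∫ s in Ioo 0 T, ∑ n : Fin (N + 1), linearPart (2 * α) w (h n) (ρ n) s
      = ∫ s in Ioo 0 T, (((-(bumpSeq k).normed volume (s - t) : ℝ) : ℂ) * Z s
        - (κ s : ℂ) * ((taylorPow t N s : ℂ) * gradPair w (ρ (N + 1)) s)) := by
    refine setIntegral_congr_fun measurableSet_Ioo fun s hs => ?_
    rw [Fin.sum_univ_eq_sum_range (fun n => linearPart (2 * α) w (h n) (ρ n) s) (N + 1), hZ]
    exact sum_linearPart_eq hρ (hκd s) (hhe s hs) N
  have hi1 : IntegrableOn (fun s => ((-(bumpSeq k).normed volume (s - t) : ℝ) : ℂ) * Z s)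
      (Ioo 0 T) := by
    obtain ⟨B, hB⟩ := (bumpSeq k).continuous_normed.bounded_above_of_compact_support
      ((bumpSeq k).hasCompactSupport_normed (μ := volume))
    refine Integrable.bdd_mul (c := B) hZi (Complex.continuous_ofReal.comp
      ((bumpSeq k).continuous_normed.comp (by fun_prop :
        Continuous fun s => s - t)).neg).aestronglyMeasurable (Eventually.of_forall fun s => ?_)
    rw [Complex.norm_real, norm_neg]; exact hB _
  have hi2 : IntegrableOn (fun s => (κ s : ℂ) * ((taylorPow t N s : ℂ) *
      gradPair w (ρ (N + 1)) s)) (Ioo 0 T) := by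
    refine Integrable.bdd_mul (c := 1) hr (Complex.continuous_ofReal.comp
      hκs.continuous).aestronglyMeasurable (Eventually.of_forall fun s => ?_)
    rw [Complex.norm_real, hκ, Real.norm_of_nonneg (smoothStep_mem _ _).1]
    exact (smoothStep_mem _ _).2
  rw [e1, integral_sub hi1 hi2] at main
  have tri : ∀ a b : ℂ, ‖a‖ₑ ≤ ‖a - b‖ₑ + ‖b‖ₑ := fun a b => by
    have := enorm_add_le (a - b) b
    rwa [sub_add_cancel] at this
  refine (tri _ (∫ s in Ioo 0 T, (κ s : ℂ) * ((taylorPow t N s : ℂ) *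
      gradPair w (ρ (N + 1)) s))).trans ((add_le_add main
        (enorm_integral_le_lintegral_enorm _)).trans ?_)
  have hκe : ∀ s, ‖(κ s : ℂ)‖ₑ = ENNReal.ofReal (smoothStep (bumpSeq k) (s - t)) := fun s => by
    rw [← ofReal_norm, Complex.norm_real, hκ, Real.norm_of_nonneg (smoothStep_mem _ _).1]
  rw [← lintegral_add_right' _ hi2.1.enorm]
  refine le_of_eq (setLIntegral_congr_fun measurableSet_Ioo fun s hs => ?_)
  rw [hg, ← hκe, mul_add, enorm_mul]
  congr 1
  have e2 : ∑ n : Fin (N + 1), (h n s : ℂ) • ρ n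
      = (κ s : ℂ) • ∑ n ∈ Finset.range (N + 1), (taylorPow t n s : ℂ) • ρ n := by
    rw [Fin.sum_univ_eq_sum_range (fun n => (h n s : ℂ) • ρ n) (N + 1), Finset.smul_sum]
    refine Finset.sum_congr rfl fun n _ => ?_
    rw [(hhe s hs n).eq_of_nhds, Complex.ofReal_mul, mul_smul]
  rw [e2, hessNorm_smul, ENNReal.ofReal_mul (norm_nonneg _), ofReal_norm]
  ring

end IsPerturbation

end

/-! ### Frequency localized test functions -/

/-- Smooth compactly supported functions of the frequency that vanish near the origin. -/
structure IsFreqTest (m : Plane → ℂ) : Prop where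
  smooth : ContDiff ℝ ∞ m
  compact : HasCompactSupport m
  zero_notMem : (0 : Plane) ∉ tsupport m

namespace IsFreqTest

variable {m : Plane → ℂ}

/-- Since m vanishes near the origin, a singularity of g there is invisible. -/
lemma mul (hm : IsFreqTest m) {g : Plane → ℂ} (hg : ∀ ξ, ξ ≠ 0 → ContDiffAt ℝ ∞ g ξ) :
    IsFreqTest fun ξ => g ξ * m ξ where
  smooth := by
    rw [contDiff_iff_contDiffAt]
    intro ξ
    rcases eq_or_ne ξ 0 with rfl | h
    · refine (contDiffAt_const (c := (0 : ℂ))).congr_of_eventuallyEq ?_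
      filter_upwards [notMem_tsupport_iff_eventuallyEq.1 hm.zero_notMem] with ξ hξ
      rw [hξ, Pi.zero_apply, mul_zero]
    · exact (hg ξ h).mul hm.smooth.contDiffAt
  compact := hm.compact.mul_left
  zero_notMem h := hm.zero_notMem (closure_mono (Function.support_mul_subset_right g m) h)

/-- The Schwartz function with the given Fourier transform. -/
def ofFreq (hm : IsFreqTest m) : 𝓢(Plane, ℂ) :=
  𝓕⁻ (hm.compact.toSchwartzMap hm.smooth)

lemma fourier_ofFreq (hm : IsFreqTest m) : 𝓕 hm.ofFreq = hm.compact.toSchwartzMap hm.smooth :=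
  FourierTransform.fourier_fourierInv_eq _

lemma fourier_ofFreq_apply (hm : IsFreqTest m) (ξ : Plane) : 𝓕 hm.ofFreq ξ = m ξ := by
  rw [hm.fourier_ofFreq]; rfl

lemma fracSymbol_pow (hm : IsFreqTest m) (β : ℝ) (n : ℕ) :
    IsFreqTest fun ξ => (fracSymbol β ξ : ℂ) ^ n * m ξ := by
  refine hm.mul fun ξ hξ => ContDiffAt.pow ?_ n
  refine Complex.ofRealCLM.contDiff.contDiffAt.comp ξ ?_
  refine ContDiffAt.rpow_const_of_ne (contDiffAt_const.mul (contDiffAt_norm ℝ hξ)) ?_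
  have := norm_pos_iff.2 hξ
  positivity

/-- Away from the origin all powers of |ξ|^β are smooth, so every power of Λ^β turns a frequency
localized function into a Schwartz function. This is what permits a Taylor expansion of the heat
flow within Schwartz test functions. -/
lemma isFracChain (hm : IsFreqTest m) (β : ℝ) :
    IsFracChain β fun n => (hm.fracSymbol_pow β n).ofFreq := by
  intro n j x
  have h : (fun ξ => (fracSymbol β ξ : ℂ) * 𝓕 (partialDeriv j (hm.fracSymbol_pow β n).ofFreq) ξ)
      = (𝓕 (partialDeriv j (hm.fracSymbol_pow β (n + 1)).ofFreq) : 𝓢(Plane, ℂ)) := by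
    funext ξ
    rw [fourier_partialDeriv_apply, fourier_partialDeriv_apply, fourier_ofFreq_apply,
      fourier_ofFreq_apply]
    ring
  unfold fracLap
  rw [h, ← SchwartzMap.fourierInv_coe, FourierTransform.fourierInv_fourier_eq]

lemma ofFreq_pow_zero (hm : IsFreqTest m) (β : ℝ) : (hm.fracSymbol_pow β 0).ofFreq = hm.ofFreq := by
  unfold ofFreq
  congr 1
  ext ξ
  change (fracSymbol β ξ : ℂ) ^ 0 * m ξ = m ξ
  rw [pow_zero, one_mul]

end IsFreqTest

/-- The remainder of the exponential series. -/
def expRemainder (N : ℕ) (X : ℝ) : ℝ := Real.exp X - ∑ n ∈ Finset.range N, X ^ n / n.factorial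

lemma hasSum_real_exp (x : ℝ) : HasSum (fun n : ℕ => x ^ n / n.factorial) (Real.exp x) := by
  rw [Real.exp_eq_exp_ℝ]
  exact NormedSpace.expSeries_div_hasSum_exp x

/-- The tail of the exponential series is compared term by term. -/
lemma abs_expRemainder_le {x X : ℝ} (h : |x| ≤ X) (N : ℕ) :
    |expRemainder N x| ≤ expRemainder N X := by
  have h1 := (hasSum_nat_add_iff' N).2 (hasSum_real_exp x)
  have h2 := (hasSum_nat_add_iff' N).2 (hasSum_real_exp X)
  refine h1.norm_le_of_bounded h2 fun n => ?_
  rw [Real.norm_eq_abs, abs_div, abs_pow, Nat.abs_cast]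
  exact div_le_div_of_nonneg_right (pow_le_pow_left₀ (abs_nonneg _) h _) (by positivity)

lemma tendsto_expRemainder (X : ℝ) : Tendsto (fun N => expRemainder N X) atTop (𝓝 0) := by
  have := (hasSum_real_exp X).tendsto_sum_nat.const_sub (Real.exp X)
  rwa [sub_self] at this

lemma rpow_le_exp {x γ : ℝ} (hx : 0 ≤ x) (hγ : 0 ≤ γ) (hγ1 : γ ≤ 1) : x ^ γ ≤ Real.exp x := by
  rcases le_total x 1 with h | h
  · exact (Real.rpow_le_one hx h hγ).trans (Real.one_le_exp hx)
  · have := Real.rpow_le_rpow_of_exponent_le h hγ1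
    rw [Real.rpow_one] at this
    linarith [Real.add_one_le_exp x]

/-- With x = τ q^β this is x^{1/β} ≤ e^x, which holds because 0 ≤ 1/β ≤ 1. It expresses that the
heat flow of Λ^β gains one derivative at the price τ^{-1/β}. -/
lemma mul_exp_neg_rpow_le {q τ β : ℝ} (hq : 0 ≤ q) (hτ : 0 < τ) (hβ : 1 ≤ β) :
    q * Real.exp (-(τ * q ^ β)) ≤ τ ^ (-(1 / β)) := by
  have hβ0 : 0 < β := by linarith
  have h1 : (τ * q ^ β) ^ (1 / β) = τ ^ (1 / β) * q := by
    rw [Real.mul_rpow hτ.le (Real.rpow_nonneg hq _), ← Real.rpow_mul hq, mul_one_div_cancel hβ0.ne',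
      Real.rpow_one]
  have h2 := rpow_le_exp (mul_nonneg hτ.le (Real.rpow_nonneg hq β)) (γ := 1 / β) (by positivity)
    ((div_le_one hβ0).2 hβ)
  rw [h1] at h2
  rw [Real.rpow_neg hτ.le, Real.exp_neg, ← div_eq_mul_inv, div_le_iff₀ (Real.exp_pos _),
    inv_mul_eq_div, le_div_iff₀ (Real.rpow_pos_of_pos hτ _), mul_comm]
  exact h2

lemma sum_taylorPow_mul_pow (t s μ : ℝ) (N : ℕ) :
    ∑ n ∈ Finset.range N, taylorPow t n s * μ ^ n
      = Real.exp (-((t - s) * μ)) - expRemainder N (-((t - s) * μ)) := by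
  rw [expRemainder, sub_sub_cancel]
  refine Finset.sum_congr rfl fun n _ => ?_
  rw [taylorPow, div_mul_eq_mul_div, ← mul_pow]
  congr 2
  ring

/-! ### The smoothing estimate -/

section

variable {α T : ℝ} {w u v : ℝ × Plane → Plane} {η : ℝ × Plane → ℝ} {A E : ℝ → ℝ≥0∞}
  {M : ℝ≥0∞} {m : Plane → ℂ}

/-- The `L²` norm of the gradient of a function with Fourier transform `m`. -/
def gradWeight (m : Plane → ℂ) : ℝ≥0∞ :=
  eLpNorm (fun ξ : Plane => ((2 * Real.pi * ‖ξ‖ : ℝ) : ℂ) * m ξ) 2 volume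

/-- The `L²` norm of the Laplacian of a function with Fourier transform `m`. -/
def lapWeight (m : Plane → ℂ) : ℝ≥0∞ :=
  eLpNorm (fun ξ : Plane => ((2 * Real.pi * ‖ξ‖ : ℝ) : ℂ) ^ 2 * m ξ) 2 volume

lemma IsFreqTest.gradWeight_lt (hm : IsFreqTest m) : gradWeight m < ⊤ := by
  refine (Continuous.memLp_of_hasCompactSupport (p := 2) ?_ hm.compact.mul_left).2
  have := hm.smooth.continuous
  fun_prop

lemma IsFreqTest.lapWeight_lt (hm : IsFreqTest m) : lapWeight m < ⊤ := by
  refine (Continuous.memLp_of_hasCompactSupport (p := 2) ?_ hm.compact.mul_left).2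
  have := hm.smooth.continuous
  fun_prop

lemma norm_fourier_partialDeriv_le (j : Fin 2) (f : 𝓢(Plane, ℂ)) (ξ : Plane) :
    ‖𝓕 (partialDeriv j f) ξ‖ ≤ (2 * Real.pi * ‖ξ‖) * ‖𝓕 f ξ‖ := by
  have hπ := Real.pi_pos
  rw [fourier_partialDeriv_apply, norm_mul]
  refine mul_le_mul_of_nonneg_right ?_ (norm_nonneg _)
  rw [norm_mul, norm_mul, norm_mul, Complex.norm_I, Complex.norm_real, Complex.norm_real,
    Real.norm_of_nonneg hπ.le, mul_one, Complex.norm_ofNat]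
  exact mul_le_mul_of_nonneg_left (PiLp.norm_apply_le ξ j) (by positivity)

lemma eLpNorm_partialDeriv_le (j : Fin 2) (f : 𝓢(Plane, ℂ)) :
    eLpNorm (partialDeriv j f) 2 volume ≤ gradWeight (𝓕 f : 𝓢(Plane, ℂ)) := by
  rw [← eLpNorm_fourier, gradWeight]
  refine eLpNorm_mono fun ξ => (norm_fourier_partialDeriv_le j f ξ).trans_eq ?_
  rw [norm_mul, Complex.norm_real, Real.norm_of_nonneg (by positivity)]

lemma ofReal_hessNorm_le (f : 𝓢(Plane, ℂ)) :
    ENNReal.ofReal (hessNorm f) ≤ 4 * lapWeight (𝓕 f : 𝓢(Plane, ℂ)) := by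
  have h : ∀ i j, eLpNorm (partialDeriv j (partialDeriv i f)) 2 volume
      ≤ lapWeight (𝓕 f : 𝓢(Plane, ℂ)) := by
    intro i j
    rw [← eLpNorm_fourier, lapWeight]
    refine eLpNorm_mono fun ξ => (norm_fourier_partialDeriv_le j _ ξ).trans ?_
    refine (mul_le_mul_of_nonneg_left (norm_fourier_partialDeriv_le i f ξ)
      (by positivity)).trans_eq ?_
    rw [norm_mul, norm_pow, Complex.norm_real, Real.norm_of_nonneg (by positivity)]
    ring
  rw [hessNorm, Fin.sum_univ_two, ENNReal.ofReal_add (by positivity) (by positivity),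
    ENNReal.ofReal_add (by positivity) (by positivity),
    ENNReal.ofReal_add (by positivity) (by positivity), ofReal_norm_toLp, ofReal_norm_toLp,
    ofReal_norm_toLp, ofReal_norm_toLp]
  refine (add_le_add (add_le_add (h _ _) (h _ _)) (add_le_add (h _ _) (h _ _))).trans_eq ?_
  ring

lemma IsFreqTest.exists_fracSymbol_le (hm : IsFreqTest m) {β : ℝ} (hβ : 0 ≤ β) :
    ∃ R, 0 ≤ R ∧ ∀ ξ, m ξ ≠ 0 → fracSymbol β ξ ≤ R := by
  obtain ⟨R, hR⟩ := hm.compact.isCompact.exists_bound_of_continuousOn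
    (continuous_fracSymbol hβ).continuousOn
  refine ⟨max R 0, le_max_right _ _, fun ξ hξ => ?_⟩
  exact (le_abs_self _).trans ((hR ξ (subset_tsupport m hξ)).trans (le_max_left _ _))

/-- The Fourier transform of the truncated heat flow. -/
lemma IsFreqTest.fourier_sum_taylorPow (hm : IsFreqTest m) (β t s : ℝ) (N : ℕ) (ξ : Plane) :
    𝓕 (∑ n ∈ Finset.range N, (taylorPow t n s : ℂ) • (hm.fracSymbol_pow β n).ofFreq) ξ
      = ((Real.exp (-((t - s) * fracSymbol β ξ))
        - expRemainder N (-((t - s) * fracSymbol β ξ)) : ℝ) : ℂ) * m ξ := by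
  have h1 : ∀ (S : Finset ℕ) (c : ℕ → ℂ) (ρ : ℕ → 𝓢(Plane, ℂ)),
      𝓕 (∑ n ∈ S, c n • ρ n) = ∑ n ∈ S, c n • (𝓕 (ρ n) : 𝓢(Plane, ℂ)) := by
    intro S c ρ
    have := map_sum (FourierTransform.fourierCLM ℂ 𝓢(Plane, ℂ)) (fun n => c n • ρ n) S
    simp only [map_smul] at this
    exact this
  rw [h1, schwartzMap_sum_apply, ← sum_taylorPow_mul_pow]
  push_cast
  rw [Finset.sum_mul]
  refine Finset.sum_congr rfl fun n _ => ?_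
  rw [Pi.smul_apply, IsFreqTest.fourier_ofFreq_apply, smul_eq_mul, mul_assoc]

/-- The truncated series is the exponential minus its remainder. The exponential absorbs one of the
two factors |2πξ| at the price (t - s)^{-1/β}. On the support of m the symbol is at most R, so the
remainder is at most that of the series at T R; the factor 4 counts the second derivatives. -/
lemma IsFreqTest.ofReal_hessNorm_sum_le (hm : IsFreqTest m) {β : ℝ} (hβ : 1 ≤ β) {R T t s : ℝ}
    (hR : ∀ ξ, m ξ ≠ 0 → fracSymbol β ξ ≤ R) (hR0 : 0 ≤ R) (ht : t ≤ T) (hs : s ∈ Ioo 0 t)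
    (N : ℕ) :
    ENNReal.ofReal (hessNorm (∑ n ∈ Finset.range N,
        (taylorPow t n s : ℂ) • (hm.fracSymbol_pow β n).ofFreq))
      ≤ 4 * (ENNReal.ofReal ((t - s) ^ (-(1 / β))) * gradWeight m
        + ENNReal.ofReal (expRemainder N (T * R)) * lapWeight m) := by
  have hts : 0 < t - s := by linarith [hs.2]
  have hT : 0 ≤ T := by linarith [hs.1, hs.2]
  have hrem : 0 ≤ expRemainder N (T * R) :=
    (abs_nonneg _).trans (abs_expRemainder_le (x := 0)
      (by rw [abs_zero]; exact mul_nonneg hT hR0) N)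
  refine (ofReal_hessNorm_le _).trans (mul_le_mul_right ?_ _)
  have hmc := hm.smooth.continuous
  have e : ∀ (c : ℝ) (_ : 0 ≤ c) (F : Plane → ℂ), ENNReal.ofReal c * eLpNorm F 2 volume
      = eLpNorm (fun ξ => (c : ℂ) * F ξ) 2 volume := by
    intro c hc F
    have h := eLpNorm_const_smul (c : ℂ) F 2 (volume : Measure Plane)
    rw [← ofReal_norm, Complex.norm_real, Real.norm_of_nonneg hc] at h
    exact h.symm
  rw [gradWeight, lapWeight, lapWeight, e _ (Real.rpow_nonneg hts.le _), e _ hrem]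
  refine (eLpNorm_mono_enorm (g := fun ξ : Plane => ‖((((t - s) ^ (-(1 / β)) : ℝ) : ℂ) *
    (((2 * Real.pi * ‖ξ‖ : ℝ) : ℂ) * m ξ))‖ + ‖((expRemainder N (T * R) : ℝ) : ℂ) *
      (((2 * Real.pi * ‖ξ‖ : ℝ) : ℂ) ^ 2 * m ξ)‖) fun ξ => ?_).trans ?_
  · rw [← ofReal_norm, ← ofReal_norm, Real.norm_of_nonneg (by positivity)]
    refine ENNReal.ofReal_le_ofReal ?_
    obtain ⟨q, hq, hq0⟩ : ∃ q, q = 2 * Real.pi * ‖ξ‖ ∧ 0 ≤ q := ⟨_, rfl, by positivity⟩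
    rw [hm.fourier_sum_taylorPow]
    rcases eq_or_ne (m ξ) 0 with h0 | h0
    · rw [h0]; simp
    have hμ : fracSymbol β ξ = q ^ β := by rw [hq, fracSymbol]
    rw [← hq]
    simp only [norm_mul, norm_pow, Complex.norm_real]
    rw [Real.norm_of_nonneg hq0, Real.norm_of_nonneg hrem,
      Real.norm_of_nonneg (Real.rpow_nonneg hts.le _), ← mul_assoc, ← mul_assoc, ← mul_assoc,
      ← add_mul]
    refine mul_le_mul_of_nonneg_right ?_ (norm_nonneg _)
    have h1 := mul_exp_neg_rpow_le hq0 hts hβ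
    have h2 : |expRemainder N (-((t - s) * fracSymbol β ξ))| ≤ expRemainder N (T * R) := by
      refine abs_expRemainder_le ?_ N
      rw [abs_neg, abs_of_nonneg (mul_nonneg hts.le (fracSymbol_nonneg _ _))]
      exact mul_le_mul (by linarith [hs.1]) (hR ξ h0) (fracSymbol_nonneg _ _) hT
    rw [Real.norm_eq_abs]
    have h3 := abs_sub (Real.exp (-((t - s) * fracSymbol β ξ)))
      (expRemainder N (-((t - s) * fracSymbol β ξ)))
    rw [abs_of_pos (Real.exp_pos _)] at h3
    calc q ^ 2 * |Real.exp (-((t - s) * fracSymbol β ξ))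
          - expRemainder N (-((t - s) * fracSymbol β ξ))|
        ≤ q ^ 2 * (Real.exp (-((t - s) * fracSymbol β ξ)) + expRemainder N (T * R)) := by
          refine mul_le_mul_of_nonneg_left ?_ (sq_nonneg q)
          linarith
      _ = q * Real.exp (-((t - s) * q ^ β)) * q + expRemainder N (T * R) * q ^ 2 := by
          rw [hμ]; ring
      _ ≤ (t - s) ^ (-(1 / β)) * q + expRemainder N (T * R) * q ^ 2 := by
          gcongr
  · refine (eLpNorm_add_le ?_ ?_ one_le_two).trans ?_
    · exact (by fun_prop : Continuous _).norm.aestronglyMeasurable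
    · exact (by fun_prop : Continuous _).norm.aestronglyMeasurable
    · rw [eLpNorm_norm, eLpNorm_norm]

namespace IsPerturbation

/-- The surviving dissipation term carries N + 1 powers of a symbol bounded by R and the factor T^N
/ N!, so it disappears as N grows. -/
lemma enorm_taylorPow_mul_gradPair_le (hp : IsPerturbation α T w u v η A E M) (hm : IsFreqTest m)
    {R t s : ℝ} (hR : ∀ ξ, m ξ ≠ 0 → fracSymbol (2 * α) ξ ≤ R) (hR0 : 0 ≤ R) (ht : t ≤ T)
    (hs : s ∈ Ioo 0 t) (N : ℕ) :
    ‖(taylorPow t N s : ℂ) * gradPair w (hm.fracSymbol_pow (2 * α) (N + 1)).ofFreq s‖ₑ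
      ≤ ENNReal.ofReal ((T * R) ^ N / N.factorial) *
        (ENNReal.ofReal R * (M * (2 * gradWeight m))) := by
  have hT : 0 ≤ T := by linarith [hs.1, hs.2]
  have h1 : ‖(taylorPow t N s : ℂ)‖ₑ ≤ ENNReal.ofReal (T ^ N / N.factorial) := by
    rw [← ofReal_norm, Complex.norm_real, taylorPow, Real.norm_eq_abs, abs_div, abs_pow,
      Nat.abs_cast]
    refine ENNReal.ofReal_le_ofReal (div_le_div_of_nonneg_right (pow_le_pow_left₀ (abs_nonneg _)
      ?_ N) (by positivity))
    rw [abs_le]; constructor <;> linarith [hs.1, hs.2]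
  have h2 : gradWeight (𝓕 (hm.fracSymbol_pow (2 * α) (N + 1)).ofFreq : 𝓢(Plane, ℂ))
      ≤ ENNReal.ofReal (R ^ (N + 1)) * gradWeight m := by
    have h := eLpNorm_const_smul ((R ^ (N + 1) : ℝ) : ℂ)
      (fun ξ : Plane => ((2 * Real.pi * ‖ξ‖ : ℝ) : ℂ) * m ξ) 2 (volume : Measure Plane)
    rw [← ofReal_norm, Complex.norm_real, Real.norm_of_nonneg (by positivity)] at h
    rw [gradWeight, gradWeight, ← h]
    refine eLpNorm_mono fun ξ => ?_
    rw [IsFreqTest.fourier_ofFreq_apply]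
    rcases eq_or_ne (m ξ) 0 with h0 | h0
    · rw [h0, mul_zero, mul_zero, norm_zero]; exact norm_nonneg _
    rw [Pi.smul_apply, smul_eq_mul]
    simp only [norm_mul, norm_pow, Complex.norm_real]
    rw [Real.norm_of_nonneg (fracSymbol_nonneg _ _), Real.norm_of_nonneg hR0]
    have := pow_le_pow_left₀ (fracSymbol_nonneg _ _) (hR ξ h0) (N + 1)
    rw [← mul_assoc, mul_comm _ (fracSymbol (2 * α) ξ ^ (N + 1)), mul_assoc]
    exact mul_le_mul_of_nonneg_right this (by positivity)
  rw [enorm_mul]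
  refine (mul_le_mul' h1 ((hp.enorm_gradPair_le _ s).trans (mul_le_mul_right (add_le_add
    ((eLpNorm_partialDeriv_le _ _).trans h2) ((eLpNorm_partialDeriv_le _ _).trans h2)) _))).trans_eq
    ?_
  rw [pow_succ, ENNReal.ofReal_mul (pow_nonneg hR0 N), mul_pow, mul_div_right_comm,
    ENNReal.ofReal_mul (by positivity)]
  ring

/-- The smoothing estimate for the velocity: Duhamel's formula tested with a frequency localized
function. -/
theorem ae_enorm_gradPair_ofFreq_le (hp : IsPerturbation α T w u v η A E M) (hm : IsFreqTest m) :
    ∀ᵐ t, t ∈ Ioo 0 T → ‖gradPair w hm.ofFreq t‖ₑ ≤ 4 * gradWeight m *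
      ∫⁻ s in Ioo 0 t, forceBound w A E s * ENNReal.ofReal ((t - s) ^ (-(1 / (2 * α)))) := by
  have hβ : 1 ≤ 2 * α := by linarith [hp.half_lt]
  obtain ⟨R, hR0, hR⟩ := hm.exists_fracSymbol_le (β := 2 * α) (by linarith)
  filter_upwards [hp.ae_enorm_gradPair_le (hm.isFracChain (2 * α))] with t ht htT
  have hf := hp.measurable_forceBound
  have hK := hm.gradWeight_lt
  have hL := hm.lapWeight_lt
  obtain ⟨I, hI⟩ : ∃ I, I = ∫⁻ s in Ioo 0 t, forceBound w A E s *
    ENNReal.ofReal ((t - s) ^ (-(1 / (2 * α)))) := ⟨_, rfl⟩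
  obtain ⟨J, hJ⟩ : ∃ J, J = ∫⁻ s in Ioo 0 t, forceBound w A E s := ⟨_, rfl⟩
  have hJt : J < ⊤ := by
    rw [hJ]
    exact (lintegral_mono_set (Ioo_subset_Ioo_right htT.2.le)).trans_lt hp.lintegral_forceBound_lt
  have hkm : Measurable fun s => ENNReal.ofReal ((t - s) ^ (-(1 / (2 * α)))) :=
    ENNReal.measurable_ofReal.comp ((by fun_prop : Measurable fun s : ℝ => t - s).pow_const _)
  -- The left side does not depend on N, while both error terms tend to 0: this is the passage from
  -- the Taylor polynomial to the heat flow.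
  have key : ∀ N : ℕ, ‖gradPair w hm.ofFreq t‖ₑ ≤ 4 * gradWeight m * I
      + ENNReal.ofReal (expRemainder (N + 1) (T * R)) * (4 * lapWeight m * J)
      + ENNReal.ofReal ((T * R) ^ N / N.factorial) *
        ((ENNReal.ofReal R * (M * (2 * gradWeight m))) * ENNReal.ofReal t) := by
    intro N
    have h1 := ht htT N
    simp only [hm.ofFreq_pow_zero] at h1
    refine h1.trans ((setLIntegral_mono' (g := fun s => (4 * gradWeight m *
      (forceBound w A E s * ENNReal.ofReal ((t - s) ^ (-(1 / (2 * α)))))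
        + (ENNReal.ofReal (expRemainder (N + 1) (T * R)) * (4 * lapWeight m)) *
          forceBound w A E s) + ENNReal.ofReal ((T * R) ^ N / N.factorial) *
            (ENNReal.ofReal R * (M * (2 * gradWeight m)))) measurableSet_Ioo fun s hs => ?_).trans
              ?_)
    · refine add_le_add ?_ (hp.enorm_taylorPow_mul_gradPair_le hm hR hR0 htT.2.le hs N)
      refine (mul_le_mul_right (hm.ofReal_hessNorm_sum_le hβ hR hR0 htT.2.le hs (N + 1))
        _).trans_eq ?_
      ring
    · rw [lintegral_add_right _ measurable_const, lintegral_add_right _ (hf.const_mul _),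
        lintegral_const_mul (f := fun s => forceBound w A E s *
          ENNReal.ofReal ((t - s) ^ (-(1 / (2 * α))))) _ (hf.mul hkm), lintegral_const_mul _ hf, lintegral_const, ← hI, ← hJ,
        Measure.restrict_apply_univ, Real.volume_Ioo, sub_zero]
      refine le_of_eq ?_
      ring
  have l1 : Tendsto (fun N => ENNReal.ofReal (expRemainder (N + 1) (T * R)) *
      (4 * lapWeight m * J)) atTop (𝓝 0) := by
    have h := ENNReal.tendsto_ofReal ((tendsto_expRemainder (T * R)).comp (tendsto_add_atTop_nat 1))
    have h' := ENNReal.Tendsto.mul_const (b := 4 * lapWeight m * J) h (Or.inr (by finiteness))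
    rwa [ENNReal.ofReal_zero, zero_mul] at h'
  have l2 : Tendsto (fun N : ℕ => ENNReal.ofReal ((T * R) ^ N / N.factorial) *
        ((ENNReal.ofReal R * (M * (2 * gradWeight m))) * ENNReal.ofReal t)) atTop (𝓝 0) := by
    have hM := hp.M_lt
    have h := ENNReal.tendsto_ofReal (FloorSemiring.tendsto_pow_div_factorial_atTop (T * R))
    have h' := ENNReal.Tendsto.mul_const (b := (ENNReal.ofReal R * (M * (2 * gradWeight m))) *
      ENNReal.ofReal t) h (Or.inr (by finiteness))
    rwa [ENNReal.ofReal_zero, zero_mul] at h'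
  have lim := ((tendsto_const_nhds (x := 4 * gradWeight m * I)).add l1).add l2
  rw [add_zero, add_zero] at lim
  rw [← hI]
  exact ge_of_tendsto' lim key

end IsPerturbation

end

/-! ### Vanishing divergence and reconstruction of the velocity components -/

section

variable {α T : ℝ} {w u v : ℝ × Plane → Plane} {η : ℝ × Plane → ℝ} {A E : ℝ → ℝ≥0∞}
  {M : ℝ≥0∞}

/-- The pairing of the velocity at time `s` with `∇ρ`. -/
def divPair (w : ℝ × Plane → Plane) (ρ : 𝓢(Plane, ℂ)) (s : ℝ) : ℂ :=
  velPair w s (partialDeriv 1 ρ) (-partialDeriv 0 ρ : 𝓢(Plane, ℂ))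

lemma perpInner_eq_fderiv (ρ : 𝓢(Plane, ℂ)) (x a : Plane) :
    perpInner a (partialDeriv 1 ρ x) ((-partialDeriv 0 ρ : 𝓢(Plane, ℂ)) x) = fderiv ℝ ρ x a := by
  rw [fderiv_apply_eq_sum, Fin.sum_univ_two, neg_apply, perpInner]
  ring

namespace IsPerturbation

lemma integral_clm_divPair (hp : IsPerturbation α T w u v η A E M) {ρ : 𝓢(Plane, ℂ)}
    (hρ : HasCompactSupport ρ) {h : ℝ → ℝ} (hh : ContDiff ℝ ∞ h) (hc : HasCompactSupport h)
    (hI : tsupport h ⊆ Ioo 0 T) (P : ℂ →L[ℝ] ℝ) :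
    ∫ z in slab T, P ((h z.1 : ℂ) * perpInner (w z) (partialDeriv 1 ρ z.2)
      ((-partialDeriv 0 ρ : 𝓢(Plane, ℂ)) z.2)) = 0 := by
  have hs : ContDiff ℝ ∞ fun x => P (ρ x) := P.contDiff.comp (ρ.smooth ⊤)
  have hcP : HasCompactSupport fun x => P (ρ x) := hρ.comp_left (g := P) (map_zero P)
  rw [← hp.divFree _ (isTestOn_smul_comp hh hc hI hs hcP)]
  refine integral_congr_ae (Eventually.of_forall fun z => ?_)
  have hd : DifferentiableAt ℝ ρ z.2 := ρ.differentiableAt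
  have e : fderiv ℝ (fun x => P (ρ x)) z.2 = P.comp (fderiv ℝ ρ z.2) :=
    (P.hasFDerivAt.comp z.2 hd.hasFDerivAt).fderiv
  simp only [spaceDeriv]
  rw [hasFDerivAt_smul_comp hh hs, e, perpInner_eq_fderiv, ← Complex.real_smul, map_smul]
  simp

lemma integral_smul_divPair (hp : IsPerturbation α T w u v η A E M) {ρ : 𝓢(Plane, ℂ)}
    (hρ : HasCompactSupport ρ) {h : ℝ → ℝ} (hh : ContDiff ℝ ∞ h) (hc : HasCompactSupport h)
    (hI : tsupport h ⊆ Ioo 0 T) : ∫ s in Ioo 0 T, (h s : ℂ) * divPair w ρ s = 0 := by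
  have hm : ∀ g : 𝓢(Plane, ℂ), MemLp g 2 volume := fun g => SchwartzMap.memLp g 2 volume
  have i1 := hp.integrableOn_velPair (partialDeriv 1 ρ).continuous
    (-partialDeriv 0 ρ : 𝓢(Plane, ℂ)).continuous (hm _) (hm _) hh.continuous
  have e : ∫ z in slab T, (h z.1 : ℂ) * perpInner (w z) (partialDeriv 1 ρ z.2)
      ((-partialDeriv 0 ρ : 𝓢(Plane, ℂ)) z.2) = 0 := by
    have h1 := hp.integral_clm_divPair hρ hh hc hI Complex.reCLM
    have h2 := hp.integral_clm_divPair hρ hh hc hI Complex.imCLM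
    rw [ContinuousLinearMap.integral_comp_comm _ i1] at h1 h2
    exact Complex.ext h1 h2
  rw [IntegrableOn, volume_restrict_slab] at i1
  rw [volume_restrict_slab, integral_prod _ i1] at e
  simp only [integral_const_mul] at e
  exact e

lemma enorm_divPair_le (hp : IsPerturbation α T w u v η A E M) (ρ : 𝓢(Plane, ℂ)) (s : ℝ) :
    ‖divPair w ρ s‖ₑ ≤ M * ENNReal.ofReal (linearNorm ρ) := by
  refine (hp.enorm_velPair_le (partialDeriv 1 ρ).continuous
    (-partialDeriv 0 ρ : 𝓢(Plane, ℂ)).continuous s).trans (mul_le_mul_right ?_ _)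
  have e : eLpNorm (-partialDeriv 0 ρ : 𝓢(Plane, ℂ)) 2 volume = eLpNorm (partialDeriv 0 ρ) 2 volume :=
    eLpNorm_neg _ _ _
  rw [e, linearNorm, ENNReal.ofReal_add (by positivity) (by positivity),
    ENNReal.ofReal_add (norm_nonneg _) (norm_nonneg _), ofReal_norm_toLp, ofReal_norm_toLp, add_comm]
  exact le_self_add

lemma ae_divPair_eq_zero_of_hasCompactSupport (hp : IsPerturbation α T w u v η A E M)
    {ρ : 𝓢(Plane, ℂ)} (hρ : HasCompactSupport ρ) : ∀ᵐ s, s ∈ Ioo 0 T → divPair w ρ s = 0 := by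
  have hm : Measurable (divPair w ρ) := hp.measurable_velPair (partialDeriv 1 ρ).continuous
    (-partialDeriv 0 ρ : 𝓢(Plane, ℂ)).continuous
  have hfin : M * ENNReal.ofReal (linearNorm ρ) ≠ ⊤ :=
    ENNReal.mul_ne_top hp.M_lt.ne ENNReal.ofReal_ne_top
  have hint : IntegrableOn (divPair w ρ) (Ioo 0 T) := by
    refine Integrable.of_bound hm.aestronglyMeasurable
      (M * ENNReal.ofReal (linearNorm ρ)).toReal (Eventually.of_forall fun s => ?_)
    have h := ENNReal.toReal_mono hfin (hp.enorm_divPair_le ρ s)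
    rwa [toReal_enorm] at h
  refine isOpen_Ioo.ae_eq_zero_of_integral_contDiff_smul_eq_zero hint.locallyIntegrableOn
    fun h hh hc hI => ?_
  rw [← setIntegral_eq_integral_of_forall_compl_eq_zero (s := Ioo 0 T)]
  · simpa only [Complex.real_smul] using hp.integral_smul_divPair hρ hh hc hI
  · intro s hs
    rw [image_eq_zero_of_notMem_tsupport fun h0 => hs (hI h0), zero_smul]

/-- The bound by `linearNorm` allows an approximation by compactly supported functions; countably
many of them share one null set of times. -/
lemma ae_divPair_eq_zero (hp : IsPerturbation α T w u v η A E M) (ρ : 𝓢(Plane, ℂ)) :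
    ∀ᵐ s, s ∈ Ioo 0 T → divPair w ρ s = 0 := by
  have hm : ∀ g : 𝓢(Plane, ℂ), MemLp g 2 volume := fun g => SchwartzMap.memLp g 2 volume
  obtain ⟨g, hg, hgt⟩ := exists_seq_hasCompactSupport_tendsto ρ
  filter_upwards [ae_all_iff.2 fun k => hp.ae_divPair_eq_zero_of_hasCompactSupport (hg k)]
    with s hs hsT
  have hle : ∀ k, ‖divPair w ρ s‖ₑ ≤ M * ENNReal.ofReal (linearNorm (ρ - g k)) := by
    intro k
    refine le_trans (le_of_eq ?_) (hp.enorm_divPair_le (ρ - g k) s)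
    congr 1
    have h1 := hp.velPair_sub (partialDeriv 1 ρ).continuous
      (-partialDeriv 0 ρ : 𝓢(Plane, ℂ)).continuous (hm _) (hm _) (partialDeriv 1 (g k)).continuous
      (-partialDeriv 0 (g k) : 𝓢(Plane, ℂ)).continuous (hm _) (hm _) s
    have h2 : velPair w s (partialDeriv 1 (g k)) (-partialDeriv 0 (g k) : 𝓢(Plane, ℂ)) = 0 :=
      hs k hsT
    rw [h2, sub_zero] at h1
    rw [divPair, divPair, ← h1]
    congr 1
    · rw [map_sub]; rfl
    · funext x
      rw [map_sub, neg_sub, sub_apply, neg_apply, neg_apply]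
      ring
  have l1 : Tendsto (fun k => linearNorm (ρ - g k)) atTop (𝓝 0) := by
    have := (continuous_linearNorm.tendsto _).comp (hgt.const_sub ρ)
    rwa [sub_self, linearNorm_zero] at this
  have l2 := ENNReal.Tendsto.const_mul (a := M) (ENNReal.tendsto_ofReal l1) (Or.inr hp.M_lt.ne)
  rw [ENNReal.ofReal_zero, mul_zero] at l2
  have := ge_of_tendsto' l2 hle
  exact enorm_eq_zero.1 (le_antisymm this bot_le)

end IsPerturbation

variable {m : Plane → ℂ}

namespace IsFreqTest

/-- The symbol of `∂_j Δ⁻¹`. -/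
lemma rieszSymbol (hm : IsFreqTest m) (j : Fin 2) :
    IsFreqTest fun ξ => (-(2 * Real.pi * Complex.I * ξ j) * ((fracSymbol 2 ξ : ℂ))⁻¹) * m ξ := by
  refine hm.mul fun ξ hξ => ?_
  have hpos : 0 < 2 * Real.pi * ‖ξ‖ := by
    have := norm_pos_iff.2 hξ
    positivity
  have h1 : ContDiffAt ℝ ∞ (fun ξ : Plane => (fracSymbol 2 ξ : ℂ)) ξ := by
    refine Complex.ofRealCLM.contDiff.contDiffAt.comp ξ ?_
    exact ContDiffAt.rpow_const_of_ne (contDiffAt_const.mul (contDiffAt_norm ℝ hξ)) hpos.ne'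
  have h2 : ContDiff ℝ ∞ fun ξ : Plane => (ξ j : ℂ) :=
    Complex.ofRealCLM.contDiff.comp (EuclideanSpace.proj j : Plane →L[ℝ] ℝ).contDiff
  refine ((contDiffAt_const.mul h2.contDiffAt).neg).mul (h1.inv ?_)
  have h3 : fracSymbol 2 ξ ≠ 0 := (Real.rpow_pos_of_pos hpos 2).ne'
  exact_mod_cast h3

/-- `∂_j Δ⁻¹ f` for a function `f` with frequencies away from the origin. -/
def riesz (hm : IsFreqTest m) (j : Fin 2) : 𝓢(Plane, ℂ) := (hm.rieszSymbol j).ofFreq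

lemma apply_zero (hm : IsFreqTest m) : m 0 = 0 := image_eq_zero_of_notMem_tsupport hm.zero_notMem

lemma fracSymbol_two (ξ : Plane) : fracSymbol 2 ξ = (2 * Real.pi * ‖ξ‖) ^ 2 := by
  rw [fracSymbol]; exact_mod_cast Real.rpow_natCast _ 2

/-- The gradient of ∂_j Δ⁻¹ is an operator of order zero: its symbol is at most 1 in modulus because
|ξ_j| ≤ |ξ|. -/
lemma gradWeight_riesz_le (hm : IsFreqTest m) (j : Fin 2) :
    gradWeight (fun ξ => (-(2 * Real.pi * Complex.I * ξ j) * ((fracSymbol 2 ξ : ℂ))⁻¹) * m ξ)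
      ≤ eLpNorm m 2 volume := by
  refine eLpNorm_mono fun ξ => ?_
  rcases eq_or_ne ξ 0 with rfl | h0
  · simp [hm.apply_zero]
  have hn := norm_pos_iff.2 h0
  have hπ := Real.pi_pos
  simp only [fracSymbol_two, norm_mul, norm_neg, norm_inv, Complex.norm_real, Complex.norm_I, norm_pow,
    Complex.norm_ofNat, mul_one]
  rw [Real.norm_of_nonneg hπ.le, Real.norm_of_nonneg (norm_nonneg ξ), Real.norm_ofNat, ← mul_assoc]
  refine mul_le_of_le_one_left (norm_nonneg _) ?_
  have h1 : ‖ξ j‖ ≤ ‖ξ‖ := PiLp.norm_apply_le ξ j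
  have hq : 0 < 2 * Real.pi * ‖ξ‖ := by positivity
  rw [← mul_assoc, ← div_eq_mul_inv, div_le_one (by positivity), sq]
  exact mul_le_mul_of_nonneg_left (mul_le_mul_of_nonneg_left h1 (by positivity)) hq.le

lemma ext_fourier {f g : 𝓢(Plane, ℂ)} (h : ∀ ξ, 𝓕 f ξ = 𝓕 g ξ) : f = g := by
  have hinv : ∀ g : 𝓢(Plane, ℂ), 𝓕⁻ (𝓕 g : 𝓢(Plane, ℂ)) = g := fun g =>
    FourierTransform.fourierInv_fourier_eq g
  have h1 : (𝓕 f : 𝓢(Plane, ℂ)) = 𝓕 g := by ext ξ; exact h ξ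
  rw [← hinv f, h1, hinv]

lemma fourier_add_apply (f g : 𝓢(Plane, ℂ)) (ξ : Plane) : 𝓕 (f + g) ξ = 𝓕 f ξ + 𝓕 g ξ := by
  rw [FourierTransform.fourier_add, add_apply]

lemma partialDeriv_riesz_comm (hm : IsFreqTest m) :
    partialDeriv 0 (hm.riesz 1) = partialDeriv 1 (hm.riesz 0) := by
  refine ext_fourier fun ξ => ?_
  simp only [riesz, fourier_partialDeriv_apply, fourier_ofFreq_apply]
  ring

lemma sum_partialDeriv_riesz (hm : IsFreqTest m) :
    partialDeriv 0 (hm.riesz 0) + partialDeriv 1 (hm.riesz 1) = hm.ofFreq := by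
  refine ext_fourier fun ξ => ?_
  simp only [fourier_add_apply, riesz, fourier_partialDeriv_apply, fourier_ofFreq_apply]
  rcases eq_or_ne ξ 0 with rfl | h0
  · simp [hm.apply_zero]
  have hn := norm_pos_iff.2 h0
  have hπ := Real.pi_pos
  have hne : (fracSymbol 2 ξ : ℂ) ≠ 0 := by
    rw [fracSymbol_two]
    exact_mod_cast (by positivity : (2 * Real.pi * ‖ξ‖) ^ 2 ≠ 0)
  have hsq : (fracSymbol 2 ξ : ℂ) = (2 * Real.pi) ^ 2 * ((ξ 0 : ℂ) ^ 2 + (ξ 1 : ℂ) ^ 2) := by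
    rw [fracSymbol_two, mul_pow, EuclideanSpace.norm_sq_eq, Fin.sum_univ_two, Real.norm_eq_abs,
      Real.norm_eq_abs, sq_abs, sq_abs]
    push_cast; ring
  field_simp
  rw [hsq]
  linear_combination (-(2 * (Real.pi : ℂ)) ^ 2 * ((ξ 0 : ℂ) ^ 2 + (ξ 1 : ℂ) ^ 2) * m ξ) *
    Complex.I_sq

end IsFreqTest

namespace IsPerturbation

/-- The Duhamel bound for the size of the velocity. -/
def smoothing (α : ℝ) (f : ℝ → ℝ≥0∞) (t : ℝ) : ℝ≥0∞ :=
  4 * ∫⁻ s in Ioo 0 t, f s * ENNReal.ofReal ((t - s) ^ (-(1 / (2 * α))))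

lemma velPair_add (hp : IsPerturbation α T w u v η A E M) (F G F' G' : 𝓢(Plane, ℂ)) (s : ℝ) :
    velPair w s F G + velPair w s F' G'
      = ∫ x, ((w (s, x) 1 : ℂ) * (F + F') x - (w (s, x) 0 : ℂ) * (G + G') x) := by
  have hm : ∀ g : 𝓢(Plane, ℂ), MemLp g 2 volume := fun g => SchwartzMap.memLp g 2 volume
  unfold velPair
  rw [← integral_add (hp.integrable_velPair F.continuous G.continuous (hm _) (hm _) s)
    (hp.integrable_velPair F'.continuous G'.continuous (hm _) (hm _) s)]
  refine integral_congr_ae (Eventually.of_forall fun x => ?_)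
  simp only [perpInner, add_apply]
  ring

/-- Let r_j = ∂_j Δ⁻¹ f, so that f = ∂₀ r₀ + ∂₁ r₁ and ∂₀ r₁ = ∂₁ r₀. Then w₀ f = -w·∇^⊥r₁ + w·∇r₀
and w₁ f = w·∇^⊥r₀ + w·∇r₁. The gradients pair to zero with w and the smoothing estimate bounds the
other two terms. -/
lemma ae_enorm_integral_coord_le (hp : IsPerturbation α T w u v η A E M) (hm : IsFreqTest m)
    (i : Fin 2) : ∀ᵐ t, t ∈ Ioo 0 T → ‖∫ x, (w (t, x) i : ℂ) * hm.ofFreq x‖ₑ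
      ≤ smoothing α (forceBound w A E) t * eLpNorm m 2 volume := by
  filter_upwards [hp.ae_enorm_gradPair_ofFreq_le (hm.rieszSymbol 0),
    hp.ae_enorm_gradPair_ofFreq_le (hm.rieszSymbol 1), hp.ae_divPair_eq_zero (hm.riesz 0),
    hp.ae_divPair_eq_zero (hm.riesz 1)] with t h0 h1 d0 d1 ht
  have hb : ∀ j, ‖gradPair w (hm.riesz j) t‖ₑ
      ≤ smoothing α (forceBound w A E) t * eLpNorm m 2 volume := by
    intro j
    have hj : ‖gradPair w (hm.riesz j) t‖ₑ ≤ 4 * gradWeight (fun ξ =>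
        (-(2 * Real.pi * Complex.I * ξ j) * ((fracSymbol 2 ξ : ℂ))⁻¹) * m ξ) *
        ∫⁻ s in Ioo 0 t, forceBound w A E s * ENNReal.ofReal ((t - s) ^ (-(1 / (2 * α)))) := by
      fin_cases j
      · exact h0 ht
      · exact h1 ht
    refine hj.trans ((mul_le_mul_left (mul_le_mul_right (hm.gradWeight_riesz_le j) _) _).trans_eq ?_)
    rw [smoothing]; ring
  fin_cases i
  · refine le_trans (le_of_eq ?_) (hb 1)
    have e : -gradPair w (hm.riesz 1) t + divPair w (hm.riesz 0) t
        = ∫ x, (w (t, x) 0 : ℂ) * hm.ofFreq x := by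
      have n1 : -gradPair w (hm.riesz 1) t = velPair w t (-partialDeriv 0 (hm.riesz 1) : 𝓢(Plane, ℂ))
          (-partialDeriv 1 (hm.riesz 1) : 𝓢(Plane, ℂ)) := by
        unfold gradPair velPair
        rw [← integral_neg]
        refine integral_congr_ae (Eventually.of_forall fun x => ?_)
        simp only [perpInner, neg_apply]
        ring
      rw [n1, divPair, hp.velPair_add, ← hm.sum_partialDeriv_riesz, hm.partialDeriv_riesz_comm]
      refine integral_congr_ae (Eventually.of_forall fun x => ?_)
      simp only [add_apply, neg_apply]
      ring
    have e' := e
    rw [d0 ht, add_zero] at e'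
    change ‖∫ x, (w (t, x) 0 : ℂ) * hm.ofFreq x‖ₑ = _
    rw [← e', enorm_neg]
  · refine le_trans (le_of_eq ?_) (hb 0)
    have e : gradPair w (hm.riesz 0) t + divPair w (hm.riesz 1) t
        = ∫ x, (w (t, x) 1 : ℂ) * hm.ofFreq x := by
      rw [gradPair, divPair, hp.velPair_add, hm.sum_partialDeriv_riesz, hm.partialDeriv_riesz_comm]
      refine integral_congr_ae (Eventually.of_forall fun x => ?_)
      simp only [add_apply, neg_apply]
      ring
    have e' := e
    rw [d1 ht, add_zero] at e'
    change ‖∫ x, (w (t, x) 1 : ℂ) * hm.ofFreq x‖ₑ = _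
    rw [← e']

end IsPerturbation

end

/-! ### The L² norm by duality with frequency localized functions -/

section

variable {α T : ℝ} {w u v : ℝ × Plane → Plane} {η : ℝ × Plane → ℝ} {A E : ℝ → ℝ≥0∞}
  {M : ℝ≥0∞} {m : Plane → ℂ}

lemma IsFreqTest.eventually_eq_zero (hm : IsFreqTest m) : ∀ᶠ ξ in 𝓝 0, m ξ = 0 :=
  notMem_tsupport_iff_eventuallyEq.1 hm.zero_notMem

lemma isFreqTest_zero : IsFreqTest fun _ => 0 :=
  ⟨contDiff_const, HasCompactSupport.zero, by simp [tsupport, Function.support]⟩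

lemma IsFreqTest.add {m' : Plane → ℂ} (hm : IsFreqTest m) (hm' : IsFreqTest m') :
    IsFreqTest fun ξ => m ξ + m' ξ :=
  ⟨hm.smooth.add hm'.smooth, hm.compact.add hm'.compact, notMem_tsupport_iff_eventuallyEq.2 (by
    filter_upwards [hm.eventually_eq_zero, hm'.eventually_eq_zero] with ξ h h'
    simp [h, h'])⟩

lemma IsFreqTest.const_mul (hm : IsFreqTest m) (c : ℂ) : IsFreqTest fun ξ => c * m ξ :=
  hm.mul fun _ _ => contDiffAt_const

/-- The space of square integrable functions with smooth, compactly supported Fourier transform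
vanishing near the origin. -/
def freqSpace : Submodule ℂ (Lp ℂ 2 (volume : Measure Plane)) where
  carrier := {g | ∃ (m : Plane → ℂ) (hm : IsFreqTest m), g = hm.ofFreq.toLp 2 volume}
  zero_mem' := by
    refine ⟨_, isFreqTest_zero, ?_⟩
    have h : isFreqTest_zero.ofFreq = 0 := by
      refine IsFreqTest.ext_fourier fun ξ => ?_
      rw [IsFreqTest.fourier_ofFreq_apply, FourierTransform.fourier_zero, zero_apply]
    rw [h]
    exact (map_zero (SchwartzMap.toLpCLM ℝ ℂ 2 (volume : Measure Plane))).symm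
  add_mem' := by
    rintro _ _ ⟨m, hm, rfl⟩ ⟨m', hm', rfl⟩
    refine ⟨_, hm.add hm', ?_⟩
    rw [← toLp_add]
    congr 1
    refine IsFreqTest.ext_fourier fun ξ => ?_
    simp only [IsFreqTest.fourier_add_apply, IsFreqTest.fourier_ofFreq_apply]
  smul_mem' := by
    rintro c _ ⟨m, hm, rfl⟩
    refine ⟨_, hm.const_mul c, ?_⟩
    rw [← toLp_smul]
    congr 1
    refine IsFreqTest.ext_fourier fun ξ => ?_
    rw [FourierTransform.fourier_smul, smul_apply, IsFreqTest.fourier_ofFreq_apply,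
      IsFreqTest.fourier_ofFreq_apply, smul_eq_mul]

lemma inner_ofFreq_toLp (hm : IsFreqTest m) (h : Lp ℂ 2 (volume : Measure Plane)) :
    inner ℂ (hm.ofFreq.toLp 2 volume) h
      = ∫ ξ, (𝓕 h : Lp ℂ 2 (volume : Measure Plane)) ξ * starRingEnd ℂ (m ξ) := by
  have h1 := Lp.inner_fourier_eq (hm.ofFreq.toLp 2 volume) h
  rw [← h1, SchwartzMap.toLp_fourier_eq, L2.inner_def]
  refine integral_congr_ae ?_
  filter_upwards [(𝓕 hm.ofFreq : 𝓢(Plane, ℂ)).coeFn_toLp 2 volume] with ξ hξ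
  rw [hξ, hm.fourier_ofFreq_apply]
  rfl

/-- The Fourier transform of a function orthogonal to the space annihilates all test functions on
the punctured plane, hence vanishes almost everywhere, the origin being a null set. -/
lemma dense_freqSpace : Dense (freqSpace : Set (Lp ℂ 2 (volume : Measure Plane))) := by
  rw [Submodule.dense_iff_topologicalClosure_eq_top, Submodule.topologicalClosure_eq_top_iff,
    Submodule.eq_bot_iff]
  intro h hh
  have hF : (𝓕 h : Lp ℂ 2 (volume : Measure Plane)) =ᵐ[volume] 0 := by
    have hloc : LocallyIntegrable (𝓕 h : Lp ℂ 2 (volume : Measure Plane)) volume :=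
      (Lp.memLp _).locallyIntegrable one_le_two
    have h0 := (isOpen_compl_singleton (x := (0 : Plane))).ae_eq_zero_of_integral_contDiff_smul_eq_zero
      (hloc.locallyIntegrableOn _) fun g hg hc hs => ?_
    · filter_upwards [h0, compl_mem_ae_iff.2 (measure_singleton (0 : Plane))] with ξ h1 h2
      exact h1 h2
    · have hm : IsFreqTest fun ξ => (g ξ : ℂ) := by
        refine ⟨Complex.ofRealCLM.contDiff.comp hg, hc.comp_left (g := ((↑) : ℝ → ℂ)) rfl,
          fun h0 => ?_⟩
        have : (0 : Plane) ∈ tsupport g :=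
          closure_mono (s := Function.support fun ξ => (g ξ : ℂ)) (t := Function.support g)
            (fun ξ hξ h1 => hξ (congrArg ((↑) : ℝ → ℂ) h1)) h0
        exact hs this rfl
      have h2 := (Submodule.mem_orthogonal _ _).1 hh _ ⟨_, hm, rfl⟩
      rw [inner_ofFreq_toLp] at h2
      rw [← h2]
      refine integral_congr_ae (Eventually.of_forall fun ξ => ?_)
      simp [mul_comm]
  have h1 : (𝓕 h : Lp ℂ 2 (volume : Measure Plane)) = 0 := (Lp.eq_zero_iff_ae_eq_zero).2 hF
  have h2 := Lp.norm_fourier_eq h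
  rw [h1, norm_zero] at h2
  exact norm_eq_zero.1 h2.symm

/-- A bound for the `L²` norm by duality with a sequence of frequency localized functions. -/
lemma exists_seq_eLpNorm_le : ∃ f : ℕ → {m : Plane → ℂ // IsFreqTest m},
    ∀ (a : Plane → ℝ) (C : ℝ≥0∞), MemLp a 2 volume →
      (∀ n, ‖∫ x, (a x : ℂ) * (f n).2.ofFreq x‖ₑ ≤ C * eLpNorm (f n).1 2 volume) →
      eLpNorm a 2 volume ≤ C := by
  have : Fact ((2 : ℝ≥0∞) ≠ ⊤) := ⟨by norm_num⟩
  -- A fixed countable family is essential: the pairing bounds hold off a null set of times for each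
  -- test function, and countably many such sets can be joined.
  obtain ⟨d, hd⟩ := TopologicalSpace.exists_dense_seq freqSpace
  choose m hm hmd using fun n => (d n).2
  refine ⟨fun n => ⟨m n, hm n⟩, fun a C ha hC => ?_⟩
  rcases eq_or_ne C ⊤ with rfl | hCt
  · exact le_top
  have hac : MemLp (fun x => (a x : ℂ)) 2 volume := ha.ofReal
  have hinner : ∀ n, inner ℂ (hac.toLp _) (d n : Lp ℂ 2 (volume : Measure Plane))
      = ∫ x, (a x : ℂ) * (hm n).ofFreq x := by
    intro n
    rw [hmd n, L2.inner_def]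
    refine integral_congr_ae ?_
    filter_upwards [hac.coeFn_toLp, (hm n).ofFreq.coeFn_toLp 2 volume] with x h1 h2
    rw [h1, h2, RCLike.inner_apply, mul_comm]
    simp
  have hnorm : ∀ n, ‖(d n : Lp ℂ 2 (volume : Measure Plane))‖ₑ = eLpNorm (m n) 2 volume := by
    intro n
    rw [← ofReal_norm, hmd n, ofReal_norm_toLp, ← eLpNorm_fourier, (hm n).fourier_ofFreq]
    rfl
  have hdr : DenseRange fun n => (d n : Lp ℂ 2 (volume : Measure Plane)) :=
    (dense_freqSpace.denseRange_val).comp hd continuous_subtype_val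
  have hall : ∀ g : Lp ℂ 2 (volume : Measure Plane),
      ‖(inner ℂ (hac.toLp _) g : ℂ)‖ₑ ≤ C * ‖g‖ₑ := by
    intro g
    refine hdr.induction_on (p := fun g => ‖(inner ℂ (hac.toLp _) g : ℂ)‖ₑ ≤ C * ‖g‖ₑ) g ?_
      fun n => ?_
    · refine isClosed_le (continuous_enorm.comp (by fun_prop)) ?_
      exact (ENNReal.continuous_const_mul hCt).comp continuous_enorm
    · rw [hinner, hnorm]; exact hC n
  -- By density the bound extends to all of L²; testing a with itself gives ‖a‖² ≤ C ‖a‖.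
  have h1 := hall (hac.toLp _)
  rw [inner_self_eq_norm_sq_to_K] at h1
  have h2 : ‖hac.toLp _‖ₑ = eLpNorm a 2 volume := by
    rw [Lp.enorm_toLp]
    exact eLpNorm_congr_norm_ae (Eventually.of_forall fun x => Complex.norm_real _)
  have h3 : ‖((‖hac.toLp _‖ : ℂ)) ^ 2‖ₑ = eLpNorm a 2 volume * eLpNorm a 2 volume := by
    rw [← ofReal_norm, norm_pow, Complex.norm_real, norm_norm, ENNReal.ofReal_pow (norm_nonneg _),
      ofReal_norm, h2, sq]
  have h4 : eLpNorm a 2 volume * eLpNorm a 2 volume ≤ C * eLpNorm a 2 volume := by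
    rw [← h3]
    exact h1.trans_eq (by rw [h2])
  rcases eq_or_ne (eLpNorm a 2 volume) 0 with h0 | h0
  · rw [h0]; exact bot_le
  · exact (ENNReal.mul_le_mul_iff_left h0 ha.2.ne).1 h4

lemma eLpNorm_plane_le {a : Plane → Plane} (ha : Measurable a) :
    eLpNorm a 2 volume ≤ eLpNorm (fun x => a x 0) 2 volume + eLpNorm (fun x => a x 1) 2 volume := by
  have h : ∀ i, Measurable fun x => a x i := fun i =>
    (EuclideanSpace.proj i : Plane →L[ℝ] ℝ).continuous.measurable.comp ha
  refine le_trans (eLpNorm_mono_real (g := fun x => ‖a x 0‖ + ‖a x 1‖) fun x => ?_)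
    ((eLpNorm_add_le (h 0).norm.aestronglyMeasurable (h 1).norm.aestronglyMeasurable
      one_le_two).trans (by rw [eLpNorm_norm, eLpNorm_norm]))
  rw [EuclideanSpace.norm_eq, Fin.sum_univ_two]
  refine Real.sqrt_le_iff.2 ⟨by positivity, ?_⟩
  nlinarith [norm_nonneg (a x 0), norm_nonneg (a x 1)]

/-- The velocity is controlled by the smoothed forcing. -/
theorem IsPerturbation.ae_eLpNorm_le (hp : IsPerturbation α T w u v η A E M) :
    ∀ᵐ t, t ∈ Ioo 0 T → eLpNorm (fun x => w (t, x)) 2 volume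
      ≤ 8 * ∫⁻ s in Ioo 0 t, forceBound w A E s * ENNReal.ofReal ((t - s) ^ (-(1 / (2 * α)))) := by
  obtain ⟨f, hf⟩ := exists_seq_eLpNorm_le
  filter_upwards [ae_all_iff.2 fun n => hp.ae_enorm_integral_coord_le (f n).2 0,
    ae_all_iff.2 fun n => hp.ae_enorm_integral_coord_le (f n).2 1] with t h0 h1 ht
  have hwt : Measurable fun x => w (t, x) := hp.meas_w.comp measurable_prodMk_left
  have hmem : ∀ i, MemLp (fun x => w (t, x) i) 2 volume := by
    intro i
    refine ⟨((EuclideanSpace.proj i : Plane →L[ℝ] ℝ).continuous.measurable.comp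
      hwt).aestronglyMeasurable, ?_⟩
    refine lt_of_le_of_lt (eLpNorm_mono fun x => PiLp.norm_apply_le (w (t, x)) i)
      ((hp.w_sq t).trans_lt hp.M_lt)
  -- The constant 8 is the constant 4 of `smoothing`, once for each component.
  refine (eLpNorm_plane_le hwt).trans ((add_le_add (hf _ _ (hmem 0) fun n => h0 n ht)
    (hf _ _ (hmem 1) fun n => h1 n ht)).trans_eq ?_)
  rw [smoothing]
  ring

end

/-! ### Gronwall's lemma with a singular kernel -/

/-- The singular kernel `e^{-lr} r^{-γ}` on `(0, T)`. -/
def singularKernel (T γ l : ℝ) : ℝ → ℝ≥0∞ :=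
  (Ioo 0 T).indicator fun r => ENNReal.ofReal (Real.exp (-(l * r))) * ENNReal.ofReal (r ^ (-γ))

lemma measurable_singularKernel (T γ l : ℝ) : Measurable (singularKernel T γ l) := by
  refine Measurable.indicator ?_ measurableSet_Ioo
  exact (ENNReal.measurable_ofReal.comp (by fun_prop)).mul
    (ENNReal.measurable_ofReal.comp (measurable_id.pow_const _))

lemma lintegral_singularKernel_lt {T γ q : ℝ} (hq : 0 < q) (hγ : γ * q < 1) :
    ∫⁻ r, singularKernel T γ 0 r ^ q < ⊤ := by
  have e : ∀ r, singularKernel T γ 0 r ^ q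
      = (Ioo 0 T).indicator (fun r => ENNReal.ofReal (r ^ (-(γ * q)))) r := by
    intro r
    by_cases hr : r ∈ Ioo 0 T
    · rw [singularKernel, indicator_of_mem hr, indicator_of_mem hr, zero_mul, neg_zero,
        Real.exp_zero, ENNReal.ofReal_one, one_mul,
        ENNReal.ofReal_rpow_of_pos (Real.rpow_pos_of_pos hr.1 _), ← Real.rpow_mul hr.1.le, neg_mul]
    · rw [singularKernel, indicator_of_notMem hr, indicator_of_notMem hr, ENNReal.zero_rpow_of_pos hq]
  simp only [e]
  rw [lintegral_indicator measurableSet_Ioo]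
  have h := (intervalIntegral.intervalIntegrable_rpow' (a := 0) (b := max T 0)
    (r := -(γ * q)) (by linarith)).1
  have h2 : IntegrableOn (fun r : ℝ => r ^ (-(γ * q))) (Ioo 0 T) :=
    h.mono_set fun r hr => ⟨hr.1, hr.2.le.trans (le_max_left _ _)⟩
  refine lt_of_le_of_lt (lintegral_mono fun r => ?_) h2.2
  rw [← ofReal_norm]
  exact ENNReal.ofReal_le_ofReal (le_abs_self _)

/-- The weight e^{-nr} tends to 0 for every r > 0, and the unweighted kernel dominates. Thus a large
weight, rather than a short time interval, provides the smallness for the Gronwall argument. -/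
lemma tendsto_lintegral_singularKernel {T γ q : ℝ} (hq : 0 < q) (hγ : γ * q < 1) :
    Tendsto (fun n : ℕ => ∫⁻ r, singularKernel T γ n r ^ q) atTop (𝓝 0) := by
  have h := tendsto_lintegral_of_dominated_convergence (μ := volume)
    (F := fun (n : ℕ) r => singularKernel T γ n r ^ q) (f := fun _ => 0)
    (fun r => singularKernel T γ 0 r ^ q)
    (fun n => (measurable_singularKernel T γ n).pow_const q) (fun n => Eventually.of_forall fun r => ?_)
    (lintegral_singularKernel_lt hq hγ).ne (Eventually.of_forall fun r => ?_)
  · rwa [lintegral_zero] at h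
  · refine ENNReal.rpow_le_rpow ?_ hq.le
    by_cases hr : r ∈ Ioo 0 T
    · rw [singularKernel, singularKernel, indicator_of_mem hr, indicator_of_mem hr]
      refine mul_le_mul_left (ENNReal.ofReal_le_ofReal (Real.exp_le_exp.2 ?_)) _
      rw [zero_mul, neg_zero, neg_nonpos]
      exact mul_nonneg n.cast_nonneg hr.1.le
    · rw [singularKernel, singularKernel, indicator_of_notMem hr, indicator_of_notMem hr]
  · by_cases hr : r ∈ Ioo 0 T
    · simp only [singularKernel, indicator_of_mem hr]
      have h1 : Tendsto (fun n : ℕ => Real.exp (-((n : ℝ) * r))) atTop (𝓝 0) :=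
        Real.tendsto_exp_neg_atTop_nhds_zero.comp
          (tendsto_natCast_atTop_atTop.atTop_mul_const hr.1)
      have h2 := ENNReal.Tendsto.mul_const (b := ENNReal.ofReal (r ^ (-γ)))
        (ENNReal.tendsto_ofReal h1) (Or.inr ENNReal.ofReal_ne_top)
      rw [ENNReal.ofReal_zero, zero_mul] at h2
      have h3 := (ENNReal.continuous_rpow_const (y := q)).tendsto 0 |>.comp h2
      rwa [ENNReal.zero_rpow_of_pos hq] at h3
    · simp only [singularKernel, indicator_of_notMem hr, ENNReal.zero_rpow_of_pos hq]
      exact tendsto_const_nhds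

/-- A Gronwall lemma with a singular kernel and a memory term. -/
theorem ae_eq_zero_of_singular_gronwall {T γ p q : ℝ} (hpq : p.HolderConjugate q)
    (hγ : γ * q < 1) {A b W : ℝ → ℝ≥0∞} (hAm : Measurable A) {M K : ℝ≥0∞}
    (hM : M < ⊤) (hK : K < ⊤) (hWM : ∀ s, W s ≤ M) (hA : ∫⁻ s, A s ^ p < ⊤)
    (hb : ∫⁻ s in Ioo 0 T, b s < ⊤)
    (h : ∀ᵐ t, t ∈ Ioo 0 T → W t ≤ 8 * ∫⁻ s in Ioo 0 t,
      (2 * A s * W s + 2 * (K * ∫⁻ r in Ioo 0 s, b r * W r)) *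
        ENNReal.ofReal ((t - s) ^ (-γ))) :
    ∀ᵐ t, t ∈ Ioo 0 T → W t = 0 := by
  obtain ⟨B, hB⟩ : ∃ B, B = ∫⁻ s in Ioo 0 T, b s := ⟨_, rfl⟩
  rw [← hB] at hb
  obtain ⟨D, hD⟩ : ∃ D, D = (∫⁻ s in Ioo 0 T, (A s + K * B) ^ p) ^ (1 / p) := ⟨_, rfl⟩
  have hp0 : 0 < p := hpq.pos
  have hq0 : 0 < q := hpq.symm.pos
  have hDt : D < ⊤ := by
    rw [hD]
    refine ENNReal.rpow_lt_top_of_nonneg (by positivity) ?_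
    have h1 := ENNReal.lintegral_rpow_add_lt_top_of_lintegral_rpow_lt_top
      (μ := volume.restrict (Ioo 0 T)) (p := p) (f := A) (g := fun _ => K * B) hAm.aemeasurable
      ((setLIntegral_le_lintegral _ _).trans_lt hA) ?_ hpq.lt.le
    · exact h1.ne
    · rw [lintegral_const, Measure.restrict_apply_univ, Real.volume_Ioo]
      exact ENNReal.mul_lt_top (ENNReal.rpow_lt_top_of_nonneg hp0.le
        (ENNReal.mul_lt_top hK hb).ne) ENNReal.ofReal_lt_top
  -- The weight is chosen so strong that the estimate below becomes a strict contraction; 16 is 8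
  -- times the factor 2 in front of both terms of the forcing.
  obtain ⟨n, hn⟩ : ∃ n : ℕ, 16 * (D * (∫⁻ r, singularKernel T γ n r ^ q) ^ (1 / q)) < 1 := by
    have l1 := (ENNReal.continuous_rpow_const (y := 1 / q)).tendsto 0 |>.comp
      (tendsto_lintegral_singularKernel (T := T) hq0 hγ)
    rw [ENNReal.zero_rpow_of_pos (by positivity)] at l1
    have l2 := ENNReal.Tendsto.const_mul (a := D) l1 (Or.inr hDt.ne)
    have l3 := ENNReal.Tendsto.const_mul (a := 16) l2 (Or.inr (by norm_num))
    rw [mul_zero, mul_zero] at l3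
    exact ((tendsto_order.1 l3).2 1 one_pos).exists
  obtain ⟨e, he⟩ : ∃ e : ℝ → ℝ≥0∞, ∀ s, e s = ENNReal.ofReal (Real.exp (-(n * s))) :=
    ⟨_, fun _ => rfl⟩
  have hemul : ∀ s r, e (s + r) = e s * e r := fun s r => by
    rw [he, he, he, ← ENNReal.ofReal_mul (Real.exp_pos _).le, ← Real.exp_add]
    congr 2; ring
  have heanti : ∀ {s r}, r ≤ s → e s ≤ e r := fun {s r} hrs => by
    rw [he, he]
    exact ENNReal.ofReal_le_ofReal (Real.exp_le_exp.2
      (neg_le_neg (mul_le_mul_of_nonneg_left hrs n.cast_nonneg)))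
  have he1 : ∀ {s}, 0 ≤ s → e s ≤ 1 := fun {s} hs => by
    refine (heanti hs).trans ?_
    rw [he, mul_zero, neg_zero, Real.exp_zero, ENNReal.ofReal_one]
  have he0 : ∀ s, e s ≠ 0 := fun s => by
    rw [he]; exact (ENNReal.ofReal_pos.2 (Real.exp_pos _)).ne'
  have het : ∀ s, e s ≠ ⊤ := fun s => by rw [he]; exact ENNReal.ofReal_ne_top
  -- The quantity to be shown zero is the weighted supremum of W. It is finite because W ≤ M, which
  -- is needed to cancel it at the end.
  obtain ⟨X, hX⟩ : ∃ X, X = essSup (fun t => e t * W t) (volume.restrict (Ioo 0 T)) := ⟨_, rfl⟩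
  have hle : ∀ᵐ t ∂volume.restrict (Ioo 0 T), e t * W t ≤ X := by
    rw [hX]; exact ENNReal.ae_le_essSup _
  have hXM : X ≤ M := by
    rw [hX]
    refine essSup_le_of_ae_le _ ((ae_restrict_iff' measurableSet_Ioo).2
      (Eventually.of_forall fun t ht => ?_))
    exact (mul_le_of_le_one_left bot_le (he1 ht.1.le)).trans (hWM t)
  -- The weight decreases in time, so it can be moved from s to the earlier time r inside the memory
  -- integral.
  have hmem : ∀ s ∈ Ioo 0 T, e s * ∫⁻ r in Ioo 0 s, b r * W r ≤ B * X := by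
    intro s hs
    rw [← lintegral_const_mul' _ _ (het s), hB, ← lintegral_mul_const' _ _ (hXM.trans_lt hM).ne]
    refine le_trans (lintegral_mono_ae (g := fun r => b r * X) ?_)
      (lintegral_mono_set (Ioo_subset_Ioo_right hs.2.le))
    have hsub : Ioo 0 s ⊆ Ioo 0 T := Ioo_subset_Ioo_right hs.2.le
    have hle' := ae_restrict_of_ae_restrict_of_subset hsub hle
    filter_upwards [hle', ae_restrict_mem measurableSet_Ioo] with r hr hrs
    calc e s * (b r * W r) ≤ e r * (b r * W r) := mul_le_mul_left (heanti hrs.2.le) _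
      _ = b r * (e r * W r) := by ring
      _ ≤ b r * X := mul_le_mul_right hr _
  have hbound : ∀ᵐ t ∂volume.restrict (Ioo 0 T), e t * W t
      ≤ 16 * (D * (∫⁻ r, singularKernel T γ n r ^ q) ^ (1 / q)) * X := by
    rw [ae_restrict_iff' measurableSet_Ioo]
    filter_upwards [h] with t ht htT
    have hsub : Ioo 0 t ⊆ Ioo 0 T := Ioo_subset_Ioo_right htT.2.le
    calc e t * W t ≤ e t * (8 * ∫⁻ s in Ioo 0 t,
          (2 * A s * W s + 2 * (K * ∫⁻ r in Ioo 0 s, b r * W r)) *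
            ENNReal.ofReal ((t - s) ^ (-γ))) := mul_le_mul_right (ht htT) _
      _ = 8 * ∫⁻ s in Ioo 0 t, e t * ((2 * A s * W s + 2 * (K * ∫⁻ r in Ioo 0 s, b r * W r)) *
            ENNReal.ofReal ((t - s) ^ (-γ))) := by
          rw [lintegral_const_mul' _ _ (het t)]; ring
      _ ≤ 8 * ∫⁻ s in Ioo 0 t, (2 * X) * ((A s + K * B) * singularKernel T γ n (t - s)) := by
          refine mul_le_mul_right (lintegral_mono_ae ?_) _
          have hle' := ae_restrict_of_ae_restrict_of_subset hsub hle
          filter_upwards [hle', ae_restrict_mem measurableSet_Ioo] with s hs hst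
          -- One factor of the weight accompanies the unknown at time s, the other is absorbed into
          -- the singular kernel.
          have e1 : e t = e s * e (t - s) := by rw [← hemul]; congr 1; ring
          have e2 : singularKernel T γ n (t - s)
              = e (t - s) * ENNReal.ofReal ((t - s) ^ (-γ)) := by
            have hm : t - s ∈ Ioo 0 T := ⟨by linarith [hst.2], by linarith [hst.1, htT.2]⟩
            rw [singularKernel, indicator_of_mem hm, he]
          rw [e1, e2]
          have h1 : e s * (2 * A s * W s + 2 * (K * ∫⁻ r in Ioo 0 s, b r * W r))
              ≤ 2 * X * (A s + K * B) := by
            calc e s * (2 * A s * W s + 2 * (K * ∫⁻ r in Ioo 0 s, b r * W r))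
                = 2 * A s * (e s * W s) + 2 * K * (e s * ∫⁻ r in Ioo 0 s, b r * W r) := by ring
              _ ≤ 2 * A s * X + 2 * K * (B * X) :=
                  add_le_add (mul_le_mul_right hs _) (mul_le_mul_right (hmem s (hsub hst)) _)
              _ = 2 * X * (A s + K * B) := by ring
          calc e s * e (t - s) * ((2 * A s * W s + 2 * (K * ∫⁻ r in Ioo 0 s, b r * W r)) *
                ENNReal.ofReal ((t - s) ^ (-γ)))
              = (e s * (2 * A s * W s + 2 * (K * ∫⁻ r in Ioo 0 s, b r * W r))) *
                (e (t - s) * ENNReal.ofReal ((t - s) ^ (-γ))) := by ring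
            _ ≤ (2 * X * (A s + K * B)) * (e (t - s) * ENNReal.ofReal ((t - s) ^ (-γ))) :=
                mul_le_mul_left h1 _
            _ = _ := by ring
      _ = 16 * (∫⁻ s in Ioo 0 t, (A s + K * B) * singularKernel T γ n (t - s)) * X := by
          rw [lintegral_const_mul' _ _ (ENNReal.mul_ne_top (by norm_num) (hXM.trans_lt hM).ne)]
          ring
      _ ≤ 16 * (D * (∫⁻ r, singularKernel T γ n r ^ q) ^ (1 / q)) * X := by
          refine mul_le_mul_left (mul_le_mul_right ?_ _) _
          have hkm : Measurable fun s => singularKernel T γ n (t - s) :=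
            (measurable_singularKernel T γ n).comp (by fun_prop)
          -- Hölder pairs A + K B in L^p with the weighted kernel in L^q.
          refine (ENNReal.lintegral_mul_le_Lp_mul_Lq (volume.restrict (Ioo 0 t)) hpq
            (f := fun s => A s + K * B) (g := fun s => singularKernel T γ n (t - s))
            (hAm.add_const _).aemeasurable hkm.aemeasurable).trans ?_
          rw [hD]
          refine mul_le_mul' (ENNReal.rpow_le_rpow (lintegral_mono_set hsub) (by positivity))
            (ENNReal.rpow_le_rpow ((setLIntegral_le_lintegral _ _).trans_eq ?_) (by positivity))
          exact lintegral_sub_left_eq_self (fun r => singularKernel T γ n r ^ q) t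
  -- A finite X with X ≤ c X and c < 1 must vanish.
  have hX0 : X = 0 := by
    by_contra hne
    have h1 : X ≤ 16 * (D * (∫⁻ r, singularKernel T γ n r ^ q) ^ (1 / q)) * X := by
      conv_lhs => rw [hX]
      exact essSup_le_of_ae_le _ hbound
    have h2 : 16 * (D * (∫⁻ r, singularKernel T γ n r ^ q) ^ (1 / q)) * X < 1 * X :=
      ENNReal.mul_lt_mul_left hne (hXM.trans_lt hM).ne hn
    rw [one_mul] at h2
    exact absurd h1 (not_le.2 h2)
  rw [hX0] at hle
  rw [ae_restrict_iff' measurableSet_Ioo] at hle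
  filter_upwards [hle] with t ht htT
  exact (mul_eq_zero.1 (le_antisymm (ht htT) bot_le)).resolve_left (he0 t)

/-! ### Regular representatives of the solutions -/

section

variable {χ φ : Plane → ℝ} {α T : ℝ} {u₀ : Plane → Plane} {θ₀ : Plane → ℝ}
  {u : ℝ × Plane → Plane} {θ : ℝ × Plane → ℝ}

lemma LocallySquareIntegrable.aestronglyMeasurable {F : Type*} [NormedAddCommGroup F]
    {f : ℝ × Plane → F} (hf : LocallySquareIntegrable T f) :
    AEStronglyMeasurable f (volume.restrict (slab T)) := by
  have hs : slab T ⊆ ⋃ n : ℕ, Icc 0 (T - 1 / (n + 1)) ×ˢ Metric.closedBall (0 : Plane) n := by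
    rintro ⟨t, x⟩ ⟨ht, -⟩
    obtain ⟨n, hn⟩ := exists_nat_one_div_lt (sub_pos.2 ht.2)
    obtain ⟨k, hk⟩ := exists_nat_ge ‖x‖
    refine mem_iUnion.2 ⟨max n k, ⟨ht.1.le, ?_⟩, ?_⟩
    · have : (1 : ℝ) / ((max n k : ℕ) + 1) ≤ 1 / (n + 1) := by
        apply one_div_le_one_div_of_le (by positivity)
        have : (n : ℝ) ≤ (max n k : ℕ) := by exact_mod_cast le_max_left n k
        linarith
      dsimp only at *
      linarith
    · rw [mem_closedBall_zero_iff]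
      exact hk.trans (by exact_mod_cast le_max_right n k)
  refine AEStronglyMeasurable.mono_measure (μ := volume.restrict
    (⋃ n : ℕ, Icc 0 (T - 1 / (n + 1)) ×ˢ Metric.closedBall (0 : Plane) n)) ?_
    (Measure.restrict_mono hs le_rfl)
  refine aestronglyMeasurable_iUnion_iff.2 fun n => (hf _ (isCompact_Icc.prod
    (isCompact_closedBall _ _)) ?_).1
  rintro ⟨t, x⟩ ⟨ht, -⟩
  have : (0 : ℝ) < 1 / (n + 1) := by positivity
  exact ⟨⟨ht.1, by linarith [ht.2]⟩, mem_univ _⟩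

/-- The compact sets may contain points at time 0, which form a null set. -/
lemma ae_restrict_of_ae_slab {P : ℝ × Plane → Prop} (h : ∀ᵐ z ∂volume.restrict (slab T), P z)
    {K : Set (ℝ × Plane)} (hK : K ⊆ Ico 0 T ×ˢ univ) : ∀ᵐ z ∂volume.restrict K, P z := by
  have h0 : slab T =ᵐ[volume] (Ico 0 T ×ˢ univ : Set (ℝ × Plane)) := by
    rw [slab, Measure.volume_eq_prod]
    exact Measure.set_prod_ae_eq Ioo_ae_eq_Ico (ae_eq_refl _)
  rw [Measure.restrict_congr_set h0] at h
  exact ae_restrict_of_ae_restrict_of_subset hK h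

lemma LocallySquareIntegrable.congr {F : Type*} [NormedAddCommGroup F] {f g : ℝ × Plane → F}
    (hf : LocallySquareIntegrable T f) (h : f =ᵐ[volume.restrict (slab T)] g) :
    LocallySquareIntegrable T g := fun K hK hKT =>
  (hf K hK hKT).ae_eq (ae_restrict_of_ae_slab h hKT)

lemma IsWeakSolution.congr (hs : IsWeakSolution α T u₀ θ₀ u θ) {u' : ℝ × Plane → Plane}
    {θ' : ℝ × Plane → ℝ} (hu : u =ᵐ[volume.restrict (slab T)] u')
    (hθ : θ =ᵐ[volume.restrict (slab T)] θ') : IsWeakSolution α T u₀ θ₀ u' θ' where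
  velocity_data := hs.velocity_data
  velocity_data_divFree := hs.velocity_data_divFree
  temperature_data := hs.temperature_data
  velocity_sq := hs.velocity_sq.congr hu
  temperature_sq := hs.temperature_sq.congr hθ
  divFree ψ hψ := by
    rw [← hs.divFree ψ hψ]
    refine integral_congr_ae ?_
    filter_upwards [hu] with z hz
    rw [hz]
  momentum Φ hΦ hd := by
    have e : momentumIntegrand α u θ Φ =ᵐ[volume.restrict (slab T)]
        momentumIntegrand α u' θ' Φ := by
      filter_upwards [hu, hθ] with z h1 h2
      simp only [momentumIntegrand, h1, h2]
    obtain ⟨h1, h2⟩ := hs.momentum Φ hΦ hd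
    exact ⟨h1.congr e, by rwa [← integral_congr_ae e]⟩
  temperature ψ hψ := by
    have e : temperatureIntegrand u θ ψ =ᵐ[volume.restrict (slab T)]
        temperatureIntegrand u' θ' ψ := by
      filter_upwards [hu, hθ] with z h1 h2
      simp only [temperatureIntegrand, h1, h2]
    obtain ⟨h1, h2⟩ := hs.temperature ψ hψ
    exact ⟨h1.congr e, by rwa [← integral_congr_ae e]⟩

/-- A velocity field on `(0, T)` that is bounded in `L²`, and whose sup norm and Lipschitz constant
are integrable in time. -/
structure IsRegularVelocity (T : ℝ) (u : ℝ × Plane → Plane) (L A : ℝ → ℝ≥0∞) (M : ℝ≥0∞) :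
    Prop where
  meas : Measurable u
  meas_L : Measurable L
  meas_A : Measurable A
  M_lt : M < ⊤
  lip : ∀ t x y, ‖u (t, x) - u (t, y)‖ₑ ≤ L t * ‖x - y‖ₑ
  bound : ∀ t x, ‖u (t, x)‖ₑ ≤ A t
  lt : ∀ t, L t < ⊤ ∧ A t < ⊤
  sq : ∀ t, eLpNorm (fun x => u (t, x)) 2 volume ≤ M
  L_int : ∫⁻ t, L t < ⊤
  A_int : ∀ p : ℝ, 1 ≤ p → ∫⁻ t, A t ^ p < ⊤

lemma enorm_plane_le (a : Plane) : ‖a‖ₑ ≤ ‖a 0‖ₑ + ‖a 1‖ₑ := by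
  rw [← ofReal_norm, ← ofReal_norm, ← ofReal_norm, ← ENNReal.ofReal_add (norm_nonneg _)
    (norm_nonneg _)]
  refine ENNReal.ofReal_le_ofReal ?_
  rw [EuclideanSpace.norm_eq, Fin.sum_univ_two]
  refine Real.sqrt_le_iff.2 ⟨by positivity, ?_⟩
  nlinarith [norm_nonneg (a 0), norm_nonneg (a 1)]

lemma exists_regular_velocity (h : IsDyadicPartition χ φ) (hs : IsWeakSolution α T u₀ θ₀ u θ)
    (hc : InUniquenessClass χ φ T u θ) : ∃ u' L A M, IsRegularVelocity T u' L A M ∧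
      u =ᵐ[volume.restrict (slab T)] u' := by
  have hm : ∀ i : Fin 2, AEStronglyMeasurable (fun z => u z i) (volume.restrict (slab T)) :=
    fun i => (EuclideanSpace.proj i : Plane →L[ℝ] ℝ).continuous.comp_aestronglyMeasurable
      hs.velocity_sq.aestronglyMeasurable
  choose g L A M hg hL hA hM hgu h0 hlip hbd hlt hsq hLi hAi using fun i =>
    exists_lipschitz_representative h (hm i) (hc.velocity_besov i) (hc.velocity_sobolev i)
  obtain ⟨u', hu'⟩ : ∃ u' : ℝ × Plane → Plane, ∀ z i, u' z i = g i z :=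
    ⟨fun z => WithLp.toLp 2 fun i => g i z, fun _ _ => rfl⟩
  have hu'm : Measurable u' := by
    have e : u' = fun z => (MeasurableEquiv.toLp 2 (Fin 2 → ℝ)) fun i => g i z := by
      funext z; ext i; exact hu' z i
    rw [e]
    exact (MeasurableEquiv.measurable _).comp (measurable_pi_lambda _ hg)
  refine ⟨u', fun t => L 0 t + L 1 t, fun t => A 0 t + A 1 t, M 0 + M 1, ⟨hu'm,
    (hL 0).add (hL 1), (hA 0).add (hA 1), ENNReal.add_lt_top.2 ⟨hM 0, hM 1⟩, fun t x y => ?_,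
    fun t x => ?_, fun t => ⟨ENNReal.add_lt_top.2 ⟨(hlt 0 t).1, (hlt 1 t).1⟩,
      ENNReal.add_lt_top.2 ⟨(hlt 0 t).2, (hlt 1 t).2⟩⟩, fun t => ?_, ?_, fun p hp => ?_⟩, ?_⟩
  · refine (enorm_plane_le _).trans ?_
    rw [PiLp.sub_apply, PiLp.sub_apply, hu', hu', hu', hu', add_mul]
    exact add_le_add (hlip 0 t x y) (hlip 1 t x y)
  · refine (enorm_plane_le _).trans ?_
    rw [hu', hu']
    exact add_le_add (hbd 0 t x) (hbd 1 t x)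
  · refine (eLpNorm_plane_le (hu'm.comp measurable_prodMk_left)).trans ?_
    simp only [Function.comp_apply, hu']
    exact add_le_add (hsq 0 t) (hsq 1 t)
  · rw [lintegral_add_left (hL 0)]
    exact ENNReal.add_lt_top.2 ⟨hLi 0, hLi 1⟩
  · exact ENNReal.lintegral_rpow_add_lt_top_of_lintegral_rpow_lt_top (hA 0).aemeasurable
      (hAi 0 p hp) (hAi 1 p hp) hp
  · filter_upwards [hgu 0, hgu 1] with z h1 h2
    ext i
    rw [hu']
    fin_cases i
    · exact h1.symm
    · exact h2.symm

/-- A temperature on `(0, T)` whose sup norm is integrable in time. -/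
structure IsRegularTemperature (T : ℝ) (θ : ℝ × Plane → ℝ) : Prop where
  meas : Measurable θ
  zero : ∀ z ∉ slab T, θ z = 0
  int : ∫⁻ t, eLpNorm (fun x => θ (t, x)) ⊤ volume < ⊤

lemma exists_regular_temperature (hs : IsWeakSolution α T u₀ θ₀ u θ)
    (hc : InUniquenessClass χ φ T u θ) : ∃ θ', IsRegularTemperature T θ' ∧
      θ =ᵐ[volume.restrict (slab T)] θ' := by
  have hm := hs.temperature_sq.aestronglyMeasurable
  have hsl : MeasurableSet (slab T) := measurableSet_Ioo.prod MeasurableSet.univ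
  have hae : θ =ᵐ[volume.restrict (slab T)] (slab T).indicator (hm.mk θ) :=
    hm.ae_eq_mk.trans (indicator_ae_eq_restrict hsl).symm
  refine ⟨(slab T).indicator (hm.mk θ), ⟨hm.stronglyMeasurable_mk.measurable.indicator hsl,
    fun z hz => indicator_of_notMem hz _, ?_⟩, hae⟩
  have h1 := hc.temperature_bounded
  rw [eLpNorm_one_eq_lintegral_enorm] at h1
  simp only [enorm_eq_self] at h1
  have h2 : ∫⁻ t in Ioo 0 T, eLpNorm (fun x => (slab T).indicator (hm.mk θ) (t, x)) ⊤ volume < ⊤ := by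
    refine lt_of_le_of_lt (le_of_eq (lintegral_congr_ae ?_)) h1
    filter_upwards [ae_slice_of_ae_slab hae] with t ht
    exact (eLpNorm_congr_ae ht).symm
  rwa [← lintegral_indicator measurableSet_Ioo, lintegral_congr fun t => ?_] at h2
  by_cases ht : t ∈ Ioo 0 T
  · rw [indicator_of_mem ht]
  · rw [indicator_of_notMem ht]
    have : (fun x => (slab T).indicator (hm.mk θ) (t, x)) = 0 :=
      funext fun x => indicator_of_notMem (fun h => ht h.1) _
    rw [this, eLpNorm_zero]

end

/-! ### Differences of temperatures -/

section

variable {α T : ℝ} {u₀ : Plane → Plane} {θ₀ : Plane → ℝ} {u₁ u₂ : ℝ × Plane → Plane}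
  {θ₁ θ₂ : ℝ × Plane → ℝ} {L₁ L₂ A₁ A₂ : ℝ → ℝ≥0∞} {M₁ M₂ : ℝ≥0∞}

lemma measurableSet_slab (T : ℝ) : MeasurableSet (slab T) :=
  measurableSet_Ioo.prod MeasurableSet.univ

lemma LocallySquareIntegrable.sub {F : Type*} [NormedAddCommGroup F] {f g : ℝ × Plane → F}
    (hf : LocallySquareIntegrable T f) (hg : LocallySquareIntegrable T g) :
    LocallySquareIntegrable T fun z => f z - g z := fun K hK hKT =>
  (hf K hK hKT).sub (hg K hK hKT)

/-- The product of locally square integrable functions that vanish off the slab is integrable on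
compact sets. -/
lemma integrableOn_smul_of_locallySquareIntegrable {f : ℝ × Plane → ℝ} {g : ℝ × Plane → Plane}
    (hf : LocallySquareIntegrable T f) (hg : LocallySquareIntegrable T g) (hfm : Measurable f)
    (hgm : Measurable g) (h0 : ∀ z ∉ slab T, f z = 0) {K : Set (ℝ × Plane)} (hK : IsCompact K)
    (hKT : K ⊆ Iio T ×ˢ univ) : IntegrableOn (fun z => f z • g z) K := by
  have hcl : IsClosed (Ici (0 : ℝ) ×ˢ (univ : Set Plane)) := isClosed_Ici.prod isClosed_univ
  obtain ⟨K', hK'⟩ : ∃ K', K' = K ∩ Ici (0 : ℝ) ×ˢ (univ : Set Plane) := ⟨_, rfl⟩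
  have hc : IsCompact K' := hK' ▸ hK.inter_right hcl
  have hT : K' ⊆ Ico 0 T ×ˢ univ := by
    rw [hK']
    rintro z ⟨h1, h2⟩
    exact ⟨⟨h2.1, (hKT h1).1⟩, mem_univ _⟩
  have hi : IntegrableOn (fun z => f z • g z) K' := by
    have h1 := MemLp.integrable_mul (p := 2) (q := 2) (hf K' hc hT).norm (hg K' hc hT).norm
    refine h1.mono (hfm.smul hgm).aestronglyMeasurable (Eventually.of_forall fun z => ?_)
    rw [Pi.mul_apply, norm_smul, norm_mul, norm_norm, norm_norm]
  have hsplit : K ⊆ K' ∪ (slab T)ᶜ := by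
    intro z hz
    by_cases h : z ∈ slab T
    · left; rw [hK']; exact ⟨hz, h.1.1.le, mem_univ _⟩
    · exact Or.inr h
  refine (hi.union ?_).mono_set hsplit
  refine (integrableOn_congr_fun (g := fun _ => (0 : Plane)) (fun z hz => ?_)
    (measurableSet_slab T).compl).2 integrableOn_zero
  simp only [h0 z hz, zero_smul]

lemma IsRegularTemperature.sub (h₁ : IsRegularTemperature T θ₁) (h₂ : IsRegularTemperature T θ₂) :
    IsRegularTemperature T fun z => θ₁ z - θ₂ z where
  meas := h₁.meas.sub h₂.meas
  zero z hz := by rw [h₁.zero z hz, h₂.zero z hz, sub_zero]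
  int := by
    have hs : ∀ t, eLpNorm (fun x => θ₁ (t, x) - θ₂ (t, x)) ⊤ volume
        ≤ eLpNorm (fun x => θ₁ (t, x)) ⊤ volume + eLpNorm (fun x => θ₂ (t, x)) ⊤ volume := fun t =>
      eLpNorm_sub_le (h₁.meas.comp measurable_prodMk_left).aestronglyMeasurable
        (h₂.meas.comp measurable_prodMk_left).aestronglyMeasurable le_top
    refine (lintegral_mono hs).trans_lt ?_
    rw [lintegral_add_left (measurable_eLpNorm_top_slice h₁.meas)]
    exact ENNReal.add_lt_top.2 ⟨h₁.int, h₂.int⟩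

lemma IsRegularTemperature.integrableOn (h : IsRegularTemperature T θ₁) (r : ℝ) :
    IntegrableOn θ₁ (univ ×ˢ Metric.closedBall 0 r) := by
  refine ⟨h.meas.aestronglyMeasurable, ?_⟩
  rw [HasFiniteIntegral, Measure.volume_eq_prod, ← Measure.prod_restrict, Measure.restrict_univ]
  refine (lintegral_prod_le _).trans_lt ?_
  have hs : ∀ t, ∫⁻ x in Metric.closedBall 0 r, ‖θ₁ (t, x)‖ₑ
      ≤ eLpNorm (fun x => θ₁ (t, x)) ⊤ volume * volume (Metric.closedBall (0 : Plane) r) := by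
    intro t
    rw [← setLIntegral_const]
    refine lintegral_mono_ae (ae_restrict_of_ae ?_)
    rw [eLpNorm_exponent_top]
    exact enorm_ae_le_eLpNormEssSup _ _
  refine (lintegral_mono hs).trans_lt ?_
  rw [lintegral_mul_const' _ _ measure_closedBall_lt_top.ne]
  exact ENNReal.mul_lt_top h.int measure_closedBall_lt_top

/-- A function whose integrals against all compactly supported Lipschitz functions vanish at almost
every time vanishes. -/
lemma IsRegularTemperature.ae_eq_zero (h : IsRegularTemperature T θ₁)
    (h0 : ∀ (V : Plane → ℝ) (C : NNReal), LipschitzWith C V → HasCompactSupport V →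
      ∀ᵐ t, t ∈ Ioo 0 T → ∫ x, V x * θ₁ (t, x) = 0) :
    θ₁ =ᵐ[volume.restrict (slab T)] 0 := by
  obtain ⟨φ, hφ, hφK⟩ : ∃ φ : ℕ → ContDiffBump (0 : Plane),
      Tendsto (fun i => (φ i).rOut) atTop (𝓝 0) ∧ ∀ i, (φ i).rOut ≤ 2 * (φ i).rIn := by
    refine ⟨fun k => ⟨1 / (2 * (k + 1)), 1 / (k + 1), by positivity, ?_⟩,
      tendsto_one_div_add_atTop_nhds_zero_nat, fun k => ?_⟩
    · apply one_div_lt_one_div_of_lt <;> linarith [(k.cast_nonneg : (0 : ℝ) ≤ k)]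
    · dsimp only
      rw [one_div, one_div, mul_inv]
      linarith
  obtain ⟨d, hd⟩ := TopologicalSpace.exists_dense_seq Plane
  have hV : ∀ k (c : Plane), ∀ᵐ t, t ∈ Ioo 0 T →
      ∫ x, (φ k).normed volume (c - x) * θ₁ (t, x) = 0 := by
    intro k c
    have hs : ContDiff ℝ 1 fun x => (φ k).normed volume (c - x) :=
      ((φ k).contDiff_normed (n := 1)).comp (contDiff_const.sub contDiff_id)
    have hc : HasCompactSupport fun x => (φ k).normed volume (c - x) :=
      ((φ k).hasCompactSupport_normed (μ := volume)).comp_homeomorph (Homeomorph.subLeft c)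
    obtain ⟨C, hC⟩ := hs.lipschitzWith_of_hasCompactSupport hc one_ne_zero
    exact h0 _ C hC hc
  have hfin : ∀ᵐ t, eLpNorm (fun x => θ₁ (t, x)) ⊤ volume < ⊤ :=
    ae_lt_top (measurable_eLpNorm_top_slice h.meas) h.int.ne
  have hslice : ∀ᵐ t, t ∈ Ioo 0 T → ∀ᵐ x, θ₁ (t, x) = 0 := by
    -- Testing with countably many mollifier scales and a dense sequence of centres leaves one null
    -- set of times. Mollifications are continuous, so they vanish everywhere, and they converge to
    -- the slice almost everywhere.
    filter_upwards [ae_all_iff.2 fun k => ae_all_iff.2 fun n => hV k (d n), hfin] with t ht hf htT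
    have hmem : MemLp (fun x => θ₁ (t, x)) ⊤ volume :=
      ⟨(h.meas.comp measurable_prodMk_left).aestronglyMeasurable, hf⟩
    have hloc : LocallyIntegrable (fun x => θ₁ (t, x)) volume := hmem.locallyIntegrable le_top
    have hz : ∀ k c, MeasureTheory.convolution ((φ k).normed volume) (fun x => θ₁ (t, x))
        (ContinuousLinearMap.lsmul ℝ ℝ) volume c = 0 := by
      intro k
      have hcont := ((φ k).hasCompactSupport_normed (μ := volume)).continuous_convolution_left
        (ContinuousLinearMap.lsmul ℝ ℝ) (μ := volume) (φ k).continuous_normed hloc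
      have he := hcont.ext_on hd (continuous_const (y := (0 : ℝ))) ?_
      · exact fun c => congrFun he c
      · rintro _ ⟨n, rfl⟩
        rw [convolution_eq_swap]
        simpa using ht k n htT
    filter_upwards [ContDiffBump.ae_convolution_tendsto_right_of_locallyIntegrable (μ := volume)
      (K := 2) hφ (Eventually.of_forall hφK) hloc] with x hx
    simp only [hz] at hx
    exact tendsto_nhds_unique hx tendsto_const_nhds |>.symm ▸ rfl
  have hms : MeasurableSet {z | θ₁ z = 0} := h.meas (measurableSet_singleton 0)
  rw [volume_restrict_slab]
  refine (Measure.ae_prod_iff_ae_ae hms).2 ((ae_restrict_iff' measurableSet_Ioo).2 ?_)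
  filter_upwards [hslice] with t ht htT
  exact ht htT

end

/-! ### The system for the difference and uniqueness -/

section

variable {α T : ℝ} {u₀ : Plane → Plane} {θ₀ : Plane → ℝ} {u₁ u₂ : ℝ × Plane → Plane}
  {θ₁ θ₂ : ℝ × Plane → ℝ} {L₁ L₂ A₁ A₂ : ℝ → ℝ≥0∞} {M₁ M₂ : ℝ≥0∞}

lemma fderiv_prod_apply (ψ : ℝ × Plane → ℝ) (z : ℝ × Plane) (a : ℝ) (b : Plane) :
    fderiv ℝ ψ z (a, b) = a * timeDeriv ψ z + spaceDeriv ψ z b := by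
  have e : ((a, b) : ℝ × Plane) = a • ((1, 0) : ℝ × Plane) + ((0, b) : ℝ × Plane) := by simp
  rw [e, map_add, map_smul, timeDeriv, spaceDeriv, smul_eq_mul]

/-- The equation for the difference of two temperatures. -/
lemma integral_fderiv_temperature_sub (hs₁ : IsWeakSolution α T u₀ θ₀ u₁ θ₁)
    (hs₂ : IsWeakSolution α T u₀ θ₀ u₂ θ₂) (hθ₁ : IsRegularTemperature T θ₁)
    (hθ₂ : IsRegularTemperature T θ₂) {ψ : ℝ × Plane → ℝ} (hψ : IsTestOn (Iio T) ψ) :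
    ∫ z, fderiv ℝ ψ z (θ₁ z - θ₂ z, (θ₁ z - θ₂ z) • u₁ z + θ₂ z • (u₁ z - u₂ z)) = 0 := by
  obtain ⟨i₁, e₁⟩ := hs₁.temperature ψ hψ
  obtain ⟨i₂, e₂⟩ := hs₂.temperature ψ hψ
  rw [← setIntegral_eq_integral_of_forall_compl_eq_zero (s := slab T)]
  · have h : ∫ z in slab T, (temperatureIntegrand u₁ θ₁ ψ z - temperatureIntegrand u₂ θ₂ ψ z) = 0 := by
      rw [integral_sub i₁ i₂]
      linarith
    rw [← h]
    refine integral_congr_ae (Eventually.of_forall fun z => ?_)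
    simp only [temperatureIntegrand]
    rw [fderiv_prod_apply]
    simp only [spaceDeriv]
    have e : ∀ v : Plane, ((0 : ℝ), v) = ContinuousLinearMap.inr ℝ ℝ Plane v := fun v => rfl
    simp only [e, map_add, map_smul, map_sub, smul_eq_mul]
    ring
  · intro z hz
    rw [hθ₁.zero z hz, hθ₂.zero z hz, sub_zero, zero_smul, zero_smul, add_zero]
    exact map_zero (fderiv ℝ ψ z)

/-- The size of the difference of the temperatures in the dual of the gradients. -/
def memoryTerm (L : ℝ → ℝ≥0∞) (G : ℝ × Plane → Plane) (t : ℝ) : ℝ≥0∞ :=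
  ENNReal.ofReal (Real.exp (3 * (∫⁻ t, L t).toReal)) *
    ∫⁻ s in Ioo 0 t, eLpNorm (fun x => G (s, x)) 2 volume

lemma measurable_memoryTerm (L : ℝ → ℝ≥0∞) (G : ℝ × Plane → Plane) :
    Measurable (memoryTerm L G) :=
  Monotone.measurable fun _ _ h => mul_le_mul_right
    (lintegral_mono_set (Ioo_subset_Ioo_right h)) _

lemma eLpNorm_smul_slice_le (θ₁ : ℝ × Plane → ℝ) {w : ℝ × Plane → Plane} (hw : Measurable w)
    (s : ℝ) : eLpNorm (fun x => θ₁ (s, x) • w (s, x)) 2 volume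
      ≤ eLpNorm (fun x => θ₁ (s, x)) ⊤ volume * eLpNorm (fun x => w (s, x)) 2 volume :=
  eLpNorm_smul_le_eLpNorm_top_mul_eLpNorm 2
    (hw.comp measurable_prodMk_left).aestronglyMeasurable
    fun x => θ₁ (s, x)

/-- The quadratic terms differ by w ⊗ u₁ + u₂ ⊗ w, so w always appears undifferentiated next to a
bounded velocity. -/
lemma momentumIntegrand_sub (Φ : ℝ × Plane → Plane) (z : ℝ × Plane) :
    momentumIntegrand α u₁ θ₁ Φ z - momentumIntegrand α u₂ θ₂ Φ z
      = inner ℝ (u₁ z - u₂ z) (timeDeriv Φ z) + (inner ℝ (u₁ z - u₂ z) (spaceDeriv Φ z (u₁ z))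
        + inner ℝ (u₂ z) (spaceDeriv Φ z (u₁ z - u₂ z)))
        - ∑ i : Fin 2, (u₁ z - u₂ z) i * fracLaplacian (2 * α) (fun y => Φ (z.1, y) i) z.2
        + (θ₁ z - θ₂ z) * Φ z 1 := by
  have e : ∀ v : Plane, ((0 : ℝ), v) = ContinuousLinearMap.inr ℝ ℝ Plane v := fun v => rfl
  simp only [momentumIntegrand, spaceDeriv, e, map_sub, inner_sub_left, inner_sub_right,
    Fin.sum_univ_two, PiLp.sub_apply]
  ring

lemma integrableOn_spaceDeriv (hu : Measurable u₁) (hs : LocallySquareIntegrable T u₁)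
    {ψ : ℝ × Plane → ℝ} (hψ : IsTestOn (Ioo 0 T) ψ) :
    IntegrableOn (fun z => spaceDeriv ψ z (u₁ z)) (slab T) := by
  have hT : tsupport ψ ⊆ Ico 0 T ×ˢ univ :=
    hψ.2.2.trans (prod_mono_left Ioo_subset_Ico_self)
  have hu1 : IntegrableOn u₁ (tsupport ψ) := by
    have : IsFiniteMeasure ((volume : Measure (ℝ × Plane)).restrict (tsupport ψ)) :=
      ⟨by rw [Measure.restrict_apply_univ]; exact hψ.2.1.isCompact.measure_lt_top⟩
    exact (hs _ hψ.2.1.isCompact hT).integrable one_le_two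
  have hc : Continuous (fderiv ℝ ψ) := hψ.1.continuous_fderiv (by simp)
  obtain ⟨C, hC⟩ := hc.bounded_above_of_compact_support (hψ.2.1.fderiv (𝕜 := ℝ))
  have h0 : Measurable fun z => ((0 : ℝ), u₁ z) := measurable_const.prodMk hu
  refine Integrable.integrableOn (integrable_of_norm_le_of_integrableOn hu1 (c := C)
    (isBoundedBilinearMap_apply.continuous.comp_aestronglyMeasurable
      (hc.aestronglyMeasurable.prodMk h0.aestronglyMeasurable)) (fun z hz => ?_) fun z => ?_)
  · have : fderiv ℝ ψ z = 0 := image_eq_zero_of_notMem_tsupport fun h =>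
      hz (tsupport_fderiv_subset ℝ h)
    rw [spaceDeriv, this]; rfl
  · refine ((fderiv ℝ ψ z).le_opNorm _).trans ?_
    have : ‖((0 : ℝ), u₁ z)‖ = ‖u₁ z‖ := by
      rw [Prod.norm_def, norm_zero]; exact max_eq_right (norm_nonneg _)
    rw [this]
    exact mul_le_mul_of_nonneg_right (hC z) (norm_nonneg _)

/-- The difference of two solutions is a perturbation. -/
theorem isPerturbation_sub (hα : 1 / 2 < α) (hα' : α < 1)
    (hs₁ : IsWeakSolution α T u₀ θ₀ u₁ θ₁)
    (hs₂ : IsWeakSolution α T u₀ θ₀ u₂ θ₂) (hθ₁ : IsRegularTemperature T θ₁)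
    (hθ₂ : IsRegularTemperature T θ₂) (hu₁ : IsRegularVelocity T u₁ L₁ A₁ M₁)
    (hu₂ : IsRegularVelocity T u₂ L₂ A₂ M₂) :
    IsPerturbation α T (fun z => u₁ z - u₂ z) u₁ u₂ (fun z => θ₁ z - θ₂ z)
      (fun t => A₁ t + A₂ t) (memoryTerm L₁ fun z => θ₂ z • (u₁ z - u₂ z)) (M₁ + M₂) := by
  have hw : Measurable fun z => u₁ z - u₂ z := hu₁.meas.sub hu₂.meas
  have hM : M₁ + M₂ < ⊤ := ENNReal.add_lt_top.2 ⟨hu₁.M_lt, hu₂.M_lt⟩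
  have hsq : ∀ s, eLpNorm (fun x => u₁ (s, x) - u₂ (s, x)) 2 volume ≤ M₁ + M₂ := fun s =>
    (eLpNorm_sub_le (hu₁.meas.comp measurable_prodMk_left).aestronglyMeasurable
      (hu₂.meas.comp measurable_prodMk_left).aestronglyMeasurable one_le_two).trans
      (add_le_add (hu₁.sq s) (hu₂.sq s))
  have hGM : ∫⁻ s, eLpNorm (fun x => θ₂ (s, x) • (u₁ (s, x) - u₂ (s, x))) 2 volume < ⊤ := by
    refine (lintegral_mono fun s => (eLpNorm_smul_slice_le θ₂ hw s).trans
      (mul_le_mul_right (hsq s) _)).trans_lt ?_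
    rw [lintegral_mul_const' _ _ hM.ne]
    exact ENNReal.mul_lt_top hθ₂.int hM
  have hEle : ∀ t, memoryTerm L₁ (fun z => θ₂ z • (u₁ z - u₂ z)) t
      ≤ ENNReal.ofReal (Real.exp (3 * (∫⁻ t, L₁ t).toReal)) *
        ∫⁻ s, eLpNorm (fun x => θ₂ (s, x) • (u₁ (s, x) - u₂ (s, x))) 2 volume := fun t =>
    mul_le_mul_right (setLIntegral_le_lintegral _ _) _
  have hEt := ENNReal.mul_lt_top (ENNReal.ofReal_lt_top
    (r := Real.exp (3 * (∫⁻ t, L₁ t).toReal))) hGM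
  have hA1 : ∀ {A : ℝ → ℝ≥0∞}, (∀ p : ℝ, 1 ≤ p → ∫⁻ t, A t ^ p < ⊤) → ∫⁻ t, A t < ⊤ := by
    intro A h
    simpa using h 1 le_rfl
  have hη := hθ₁.sub hθ₂
  refine
    { half_lt := hα
      lt_one := hα'
      meas_w := hw
      meas_u := hu₁.meas
      meas_v := hu₂.meas
      meas_η := hη.meas
      meas_A := hu₁.meas_A.add hu₂.meas_A
      meas_E := measurable_memoryTerm _ _
      M_lt := hM
      w_sq := hsq
      u_le := fun s x => (hu₁.bound s x).trans le_self_add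
      v_le := fun s x => (hu₂.bound s x).trans le_add_self
      A_int := ?_
      E_int := ?_
      η_int := hη.integrableOn
      transport := ?_
      momentum := ?_
      divFree := ?_ }
  · rw [lintegral_add_left hu₁.meas_A]
    exact ENNReal.add_lt_top.2 ⟨hA1 hu₁.A_int, hA1 hu₂.A_int⟩
  · refine (setLIntegral_mono' measurableSet_Ioo fun s _ => hEle s).trans_lt ?_
    rw [setLIntegral_const, Real.volume_Ioo]
    exact ENNReal.mul_lt_top hEt ENNReal.ofReal_lt_top
  · intro V C hV hVc
    have hslab : ∀ z : ℝ × Plane, z.1 ≤ 0 → z ∉ slab T := fun z hz h => absurd h.1.1 (not_lt.2 hz)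
    have key := transport_estimate (T := T) (η := fun z => θ₁ z - θ₂ z) (u := u₁)
      (G := fun z => θ₂ z • (u₁ z - u₂ z)) hu₁.meas hη.meas (hθ₂.meas.smul hw) hu₁.meas_A
      hu₁.meas_L (fun t => (hu₁.lt t).2) (fun t => (hu₁.lt t).1) hu₁.bound hu₁.lip
      (hA1 hu₁.A_int) hu₁.L_int (fun z hz => hη.zero z (hslab z hz))
      (fun z hz => by rw [hθ₂.zero z (hslab z hz), zero_smul]) hη.integrableOn
      (fun K hK hKT => integrableOn_smul_of_locallySquareIntegrable
        (hs₁.temperature_sq.sub hs₂.temperature_sq) hs₁.velocity_sq hη.meas hu₁.meas hη.zero hK hKT)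
      (fun K hK hKT => integrableOn_smul_of_locallySquareIntegrable hs₂.temperature_sq
        (hs₁.velocity_sq.sub hs₂.velocity_sq) hθ₂.meas hw hθ₂.zero hK hKT)
      (fun ψ h1 h2 h3 => integral_fderiv_temperature_sub hs₁ hs₂ hθ₁ hθ₂ ⟨h1, h2, h3⟩) hV hVc
    filter_upwards [key] with t ht htT
    refine (ht htT).trans_eq ?_
    rw [memoryTerm]
    ring
  · intro Φ hΦ hd
    obtain ⟨i₁, e₁⟩ := hs₁.momentum Φ hΦ hd
    obtain ⟨i₂, e₂⟩ := hs₂.momentum Φ hΦ hd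
    have h : ∫ z in slab T, (momentumIntegrand α u₁ θ₁ Φ z - momentumIntegrand α u₂ θ₂ Φ z) = 0 := by
      rw [integral_sub i₁ i₂]
      linarith
    rw [← h]
    exact integral_congr_ae (Eventually.of_forall fun z =>
      (momentumIntegrand_sub Φ z).symm)
  · intro ψ hψ
    have e : ∀ z, spaceDeriv ψ z (u₁ z - u₂ z) = spaceDeriv ψ z (u₁ z) - spaceDeriv ψ z (u₂ z) := by
      intro z
      have e : ∀ v : Plane, ((0 : ℝ), v) = ContinuousLinearMap.inr ℝ ℝ Plane v := fun v => rfl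
      simp only [spaceDeriv, e, map_sub]
    simp only [e]
    rw [integral_sub (integrableOn_spaceDeriv hu₁.meas hs₁.velocity_sq hψ)
      (integrableOn_spaceDeriv hu₂.meas hs₂.velocity_sq hψ), hs₁.divFree ψ hψ, hs₂.divFree ψ hψ,
      sub_zero]

/-- Uniqueness for regular representatives. -/
theorem ae_eq_of_regular (hα : 1 / 2 < α) (hα' : α < 1)
    (hs₁ : IsWeakSolution α T u₀ θ₀ u₁ θ₁)
    (hs₂ : IsWeakSolution α T u₀ θ₀ u₂ θ₂) (hθ₁ : IsRegularTemperature T θ₁)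
    (hθ₂ : IsRegularTemperature T θ₂) (hu₁ : IsRegularVelocity T u₁ L₁ A₁ M₁)
    (hu₂ : IsRegularVelocity T u₂ L₂ A₂ M₂) :
    u₁ =ᵐ[volume.restrict (slab T)] u₂ ∧ θ₁ =ᵐ[volume.restrict (slab T)] θ₂ := by
  have hp := isPerturbation_sub hα hα' hs₁ hs₂ hθ₁ hθ₂ hu₁ hu₂
  have hw : Measurable fun z => u₁ z - u₂ z := hp.meas_w
  -- The midpoint of 1 and 2α: larger than 1, so that its conjugate exponent is finite, and smaller
  -- than 2α, so that the kernel lies in L^q.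
  obtain ⟨q, hq⟩ : ∃ q, q = (1 + 2 * α) / 2 := ⟨_, rfl⟩
  have hq1 : 1 < q := by rw [hq]; linarith
  have hpq : q.conjExponent.HolderConjugate q := (Real.HolderConjugate.conjExponent hq1).symm
  have hγ : 1 / (2 * α) * q < 1 := by
    rw [one_div_mul_eq_div, div_lt_one (by linarith), hq]
    linarith
  have hW : ∀ᵐ t, t ∈ Ioo 0 T → eLpNorm (fun x => u₁ (t, x) - u₂ (t, x)) 2 volume = 0 := by
    refine ae_eq_zero_of_singular_gronwall (T := T) (γ := 1 / (2 * α)) hpq hγ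
      (A := fun t => A₁ t + A₂ t) (b := fun t => eLpNorm (fun x => θ₂ (t, x)) ⊤ volume)
      (W := fun t => eLpNorm (fun x => u₁ (t, x) - u₂ (t, x)) 2 volume) hp.meas_A hp.M_lt
      (K := ENNReal.ofReal (Real.exp (3 * (∫⁻ t, L₁ t).toReal))) ENNReal.ofReal_lt_top hp.w_sq
      ?_ ((setLIntegral_le_lintegral _ _).trans_lt hθ₂.int) ?_
    · exact ENNReal.lintegral_rpow_add_lt_top_of_lintegral_rpow_lt_top hu₁.meas_A.aemeasurable
        (hu₁.A_int _ hpq.lt.le) (hu₂.A_int _ hpq.lt.le) hpq.lt.le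
    · filter_upwards [hp.ae_eLpNorm_le] with t ht htT
      -- In the memory term ‖θ₂ w‖₂ ≤ ‖θ₂‖_∞ ‖w‖₂, which closes the inequality in the single unknown
      -- ‖w‖₂.
      refine (ht htT).trans (mul_le_mul_right (lintegral_mono fun s => mul_le_mul_left ?_ _) _)
      refine add_le_add_right (mul_le_mul_right (mul_le_mul_right (lintegral_mono fun r => ?_) _) _) _
      exact eLpNorm_smul_slice_le θ₂ hw r
  have hWx : ∀ᵐ t, t ∈ Ioo 0 T → ∀ᵐ x, u₁ (t, x) - u₂ (t, x) = 0 := by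
    filter_upwards [hW] with t ht htT
    exact (eLpNorm_eq_zero_iff (hw.comp measurable_prodMk_left).aestronglyMeasurable
      two_ne_zero).1 (ht htT)
  constructor
  · have hms : MeasurableSet {z | u₁ z = u₂ z} := measurableSet_eq_fun hu₁.meas hu₂.meas
    rw [volume_restrict_slab]
    refine (Measure.ae_prod_iff_ae_ae hms).2 ((ae_restrict_iff' measurableSet_Ioo).2 ?_)
    filter_upwards [hWx] with t ht htT
    filter_upwards [ht htT] with x hx
    exact sub_eq_zero.1 hx
  -- Once w vanishes the source θ₂ w does too, so the duality bound makes all pairings with η zero.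
  · have hE : ∀ t ∈ Ioo 0 T, memoryTerm L₁ (fun z => θ₂ z • (u₁ z - u₂ z)) t = 0 := by
      intro t ht
      have h0 : ∫⁻ s in Ioo 0 t, eLpNorm (fun x => θ₂ (s, x) • (u₁ (s, x) - u₂ (s, x))) 2 volume
          = 0 := by
        rw [← lintegral_zero (μ := volume.restrict (Ioo 0 t))]
        refine lintegral_congr_ae ((ae_restrict_iff' measurableSet_Ioo).2 ?_)
        filter_upwards [hW] with s hs hst
        refine le_antisymm ((eLpNorm_smul_slice_le θ₂ hw s).trans_eq ?_) bot_le
        rw [hs ⟨hst.1, hst.2.trans ht.2⟩, mul_zero]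
      rw [memoryTerm, h0, mul_zero]
    have hη := (hθ₁.sub hθ₂).ae_eq_zero fun V C hV hVc => by
      filter_upwards [hp.transport V C hV hVc] with t ht htT
      have h1 := ht htT
      rw [hE t htT, zero_mul] at h1
      exact enorm_eq_zero.1 (le_antisymm h1 bot_le)
    filter_upwards [hη] with z hz
    exact sub_eq_zero.1 hz

end

end Boussinesq

end

theorem theorem5
    (χ φ : Boussinesq.Plane → ℝ) (hχφ : Boussinesq.IsDyadicPartition χ φ)
    (α : ℝ) (hα : 1 / 2 < α) (hα' : α < 1) (T : ℝ) (hT : 0 < T)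
    (u₀ : Boussinesq.Plane → Boussinesq.Plane) (θ₀ : Boussinesq.Plane → ℝ)
    (u₁ u₂ : ℝ × Boussinesq.Plane → Boussinesq.Plane) (θ₁ θ₂ : ℝ × Boussinesq.Plane → ℝ)
    (hsol₁ : Boussinesq.IsWeakSolution α T u₀ θ₀ u₁ θ₁)
    (hsol₂ : Boussinesq.IsWeakSolution α T u₀ θ₀ u₂ θ₂)
    (hcls₁ : Boussinesq.InUniquenessClass χ φ T u₁ θ₁)
    (hcls₂ : Boussinesq.InUniquenessClass χ φ T u₂ θ₂) :
    u₁ =ᵐ[volume.restrict (Boussinesq.slab T)] u₂ ∧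
      θ₁ =ᵐ[volume.restrict (Boussinesq.slab T)] θ₂ := by
  obtain ⟨v₁, L₁, A₁, M₁, hv₁, hu₁⟩ := Boussinesq.exists_regular_velocity hχφ hsol₁ hcls₁
  obtain ⟨v₂, L₂, A₂, M₂, hv₂, hu₂⟩ := Boussinesq.exists_regular_velocity hχφ hsol₂ hcls₂
  obtain ⟨ϑ₁, hϑ₁, hθ₁⟩ := Boussinesq.exists_regular_temperature hsol₁ hcls₁
  obtain ⟨ϑ₂, hϑ₂, hθ₂⟩ := Boussinesq.exists_regular_temperature hsol₂ hcls₂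
  obtain ⟨hu, hθ⟩ := Boussinesq.ae_eq_of_regular hα hα' (hsol₁.congr hu₁ hθ₁)
    (hsol₂.congr hu₂ hθ₂) hϑ₁ hϑ₂ hv₁ hv₂
  exact ⟨hu₁.trans (hu.trans hu₂.symm), hθ₁.trans (hθ.trans hθ₂.symm)⟩
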